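/- **Conventions.** Let $\mathcal A,\mathcal B$ be $2$-categories. Let $(E\dashv R,\rho,\varepsilon,v,w)$ be a biadjunction: pseudofunctors $E:\mathcal B\to\mathcal A$, $R:\mathcal A\to\mathcal B$, pseudonatural transformations $\rho:\mathrm{Id}\to RE$, $\varepsilon:ER\to\mathrm{Id}$ and invertible modifications $v:\mathrm{id}_E\Rightarrow(\varepsilon E)(E\rho)$, $w:(R\varepsilon)(\rho R)\Rightarrow\mathrm{id}_R$ satisfying the two usual coherence (swallowtail) equations. Let $\mathcal T=(\mathcal T,m,\eta,\mu,\iota,\tau)$ be a pseudomonad on $\mathcal B$, with invertible modifications $\mu:m(\mathcal Tm)\Rightarrow m(m\mathcal T)$, $\iota:m(\eta\mathcal T)\Rightarrow\mathrm{id}$, $\tau:\mathrm{id}\Rightarrow m(\mathcal T\eta)$ satisfying the usual associativity and identity equations. A pseudonaturality cell of a transformation $\alpha:F\to G$ at $f:X\to Y$ is written $\alpha_f: G(f)\alpha_X\Rightarrow\alpha_YF(f)$. A *lax $\mathcal T$-algebra* is $\mathtt z=(Z,\mathrm{alg}_{\mathtt z}:\mathcal TZ\to Z,\ \overline{\mathtt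 z}:\mathrm{alg}_{\mathtt z}\mathcal T(\mathrm{alg}_{\mathtt z})\Rightarrow\mathrm{alg}_{\mathtt z}m_Z,\ \overline{\mathtt z}_0:\mathrm{id}_Z\Rightarrow\mathrm{alg}_{\mathtt z}\eta_Z)$ satisfying the usual associativity equation and the two unit equations. A *lax morphism* $\mathtt y\to\mathtt z$ is a $1$-cell $f:Y\to Z$ with a $2$-cell $\langle f\rangle:\mathrm{alg}_{\mathtt z}\mathcal T(f)\Rightarrow f\,\mathrm{alg}_{\mathtt y}$ compatible with multiplication and unit; it is a *pseudomorphism* if $\langle f\rangle$ is invertible; $2$-cells are the $2$-cells $f\Rightarrow g$ of $\mathcal B$ compatible with $\langle f\rangle,\langle g\rangle$. Let $\mathsf{Lax}\text{-}\mathcal T\text{-}\mathrm{Alg}_\ell$ and $\mathsf{Lax}\text{-}\mathcal T\text{-}\mathrm{Alg}$ be the $2$-categories of lax algebras with lax morphisms and with pseudomorphisms respectively, $\ell:\mathsf{Lax}\text{-}\mathcal T\text{-}\mathrm{Alg}\to\mathsf{Lax}\text{-}\mathcal T\text{-}\mathrm{Alg}_\ell$ the inclusion and $U:\mathsf{Lax}\text{-}\mathcal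 T\text{-}\mathrm{Alg}\to\mathcal B$ the forgetful $2$-functor. **Codescent objects.** Let $\Delta_\ell$ be the $2$-category freely generated by objects $\mathsf 1,\mathsf 2,\mathsf 3$, $1$-cells $d^0,d^1:\mathsf 1\to\mathsf 2$, $s^0:\mathsf 2\to\mathsf 1$, $\partial^0,\partial^1,\partial^2:\mathsf 2\to\mathsf 3$ and $2$-cells $$\sigma_{00}:\partial^0d^0\Rightarrow\partial^1d^0,\quad \sigma_{20}:\partial^2d^0\Rightarrow\partial^0d^1,\quad \sigma_{21}:\partial^2d^1\Rightarrow\partial^1d^1,\quad n_0:\mathrm{id}_{\mathsf 1}\Rightarrow s^0d^0,\quad n_1:\mathrm{id}_{\mathsf 1}\Rightarrow s^0d^1 .$$ Let $\dot\Delta_\ell$ be obtained from it by adding an object $\mathsf 0$, a $1$-cell $d:\mathsf 0\to\mathsf 1$ and a $2$-cell $\vartheta:d^1d\Rightarrow d^0d$ subject to $$(\sigma_{00}d)\cdot(\partial^0\vartheta)\cdot(\sigma_{20}d)\cdot(\partial^2\vartheta)=(\partial^1\vartheta)\cdot(\sigma_{21}d),\qquad (s^0\vartheta)\cdot(n_1d)=n_0d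 ,$$ and let $\dot\Delta$ be obtained from $\dot\Delta_\ell$ by making $\vartheta$ invertible; let $\mathrm t:\Delta_\ell\to\dot\Delta_\ell$ and $\mathrm j:\Delta_\ell\to\dot\Delta$ be the evident $2$-functors. For a pseudofunctor $D:\Delta_\ell^{\mathrm{op}}\to\mathcal A$ (only $1$-cells are reversed) and a pseudofunctor $W:\Delta_\ell\to\mathrm{Cat}$, the weighted bicolimit $W\ast_{\mathrm{bi}}D$ is an object of $\mathcal A$ with equivalences, pseudonatural in $X$, $\mathcal A(W\ast_{\mathrm{bi}}D,X)\simeq[\Delta_\ell,\mathrm{Cat}]_{PS}(W,\mathcal A(D-,X))$, where $[\ ,\ ]_{PS}$ denotes pseudofunctors, pseudonatural transformations and modifications. The *lax codescent object* of $D$ is $\dot\Delta_\ell(\mathsf 0,\mathrm t-)\ast_{\mathrm{bi}}D$ and its *codescent object* is $\dot\Delta(\mathsf 0,\mathrm j-)\ast_{\mathrm{bi}}D$. **The diagram.** Let $J:\mathcal A\to\mathsf{Lax}\text{-}\mathcal T\text{-}\mathrm{Alg}$ be a pseudofunctor with $UJ=R$. For $X$ in $\mathcal B$ put $k_X=\mathrm{alg}_{JEX}\,\mathcal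 T(\rho_X):\mathcal TX\to REX$ and $c_X=\varepsilon_{EX}E(k_X):E\mathcal TX\to EX$. For a lax $\mathcal T$-algebra $\mathtt y$ with carrier $Y$, let $\mathcal A_{\mathtt y}:\Delta_\ell^{\mathrm{op}}\to\mathcal A$ be the diagram with $\mathcal A_{\mathtt y}(\mathsf 1)=EY$, $\mathcal A_{\mathtt y}(\mathsf 2)=E\mathcal TY$, $\mathcal A_{\mathtt y}(\mathsf 3)=E\mathcal T^2Y$, $$d^0\mapsto E(\mathrm{alg}_{\mathtt y}),\quad d^1\mapsto c_Y,\quad s^0\mapsto E(\eta_Y),\quad \partial^0\mapsto E\mathcal T(\mathrm{alg}_{\mathtt y}),\quad \partial^1\mapsto E(m_Y),\quad \partial^2\mapsto c_{\mathcal TY},$$ and with the following $2$-cells, where the coherence isomorphisms of $E$ and $\mathcal T$ are left implicit: - $\sigma_{00}\mapsto E(\overline{\mathtt y})$ and $n_0\mapsto E(\overline{\mathtt y}_0)$; - $n_1\mapsto \big(\varepsilon_{EY}\ast E\big((\mathrm{alg}_{JEY}\ast\eta_{\rho_Y}^{-1})\cdot(\overline{JEY}_0\ast\rho_Y)\big)\big)\cdot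 v_Y$; - $\sigma_{20}\mapsto\gamma_{\mathrm{alg}_{\mathtt y}}^{-1}$, where for $f:X\to X'$ in $\mathcal B$ the invertible $2$-cell $\gamma_f:c_{X'}E\mathcal T(f)\Rightarrow E(f)c_X$ is $$\gamma_f=\big(\varepsilon_{E(f)}^{-1}\ast E(k_X)\big)\cdot\big(\varepsilon_{EX'}\ast E\big((\langle JE(f)\rangle\ast\mathcal T(\rho_X))\cdot(\mathrm{alg}_{JEX'}\ast\mathcal T(\rho_f^{-1}))\big)\big);$$ - $\sigma_{21}\mapsto(\varepsilon_{EY}\ast E(\kappa))\cdot(\delta\ast E\mathcal T(k_Y))\cdot(\varepsilon_{EY}\ast\gamma_{k_Y}^{-1})$, where $\kappa=(\mathrm{alg}_{JEY}\ast m_{\rho_Y}^{-1})\cdot(\overline{JEY}\ast\mathcal T^2(\rho_Y)):\mathrm{alg}_{JEY}\mathcal T(k_Y)\Rightarrow k_Ym_Y$ and $\delta:\varepsilon_{EY}c_{REY}\Rightarrow\varepsilon_{EY}E(\mathrm{alg}_{JEY})$ is $$\delta=\big(\varepsilon_{EY}\ast E\big((\mathrm{alg}_{JEY}\ast\mathcal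 T(w_{EY}))\cdot(\langle J(\varepsilon_{EY})\rangle^{-1}\ast\mathcal T(\rho_{REY}))\big)\big)\cdot\big(\varepsilon_{\varepsilon_{EY}}\ast E(k_{REY})\big).$$ **Theorem (Biadjoint Triangle Theorem).** Let $\mathcal A,\mathcal B$, $(E\dashv R,\rho,\varepsilon,v,w)$, $\mathcal T$ and $J$ with $UJ=R$ be as above. 1. The pseudofunctor $\ell\circ J$ is right biadjoint if and only if $\mathcal A$ has the lax codescent object of $\mathcal A_{\mathtt y}$ for every lax $\mathcal T$-algebra $\mathtt y$. In this case the left biadjoint $G$ is given by $G\mathtt y=\dot\Delta_\ell(\mathsf 0,\mathrm t-)\ast_{\mathrm{bi}}\mathcal A_{\mathtt y}$: for every left biadjoint $G$ of $\ell\circ J$ and every $\mathtt y$ the object $G\mathtt y$ is the lax codescent object of $\mathcal A_{\mathtt y}$, and every choice of lax codescent objects of all the $\mathcal A_{\mathtt y}$ is the object part of a left biadjoint of $\ell\circ J$. 2. The pseudofunctor $J$ is right biadjoint if and only if $\mathcal A$ has the codescent object of $\mathcal A_{\mathtt y}$ for every lax $\mathcal T$-algebra $\mathtt y$. In this case the left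 biadjoint $G'$ is given, in the same sense, by $G'\mathtt y=\dot\Delta(\mathsf 0,\mathrm j-)\ast_{\mathrm{bi}}\mathcal A_{\mathtt y}$. -/

import Mathlib

open CategoryTheory Bicategory
open scoped Pseudofunctor.StrongTrans

universe w v u w₁ v₁ u₁ w₂ v₂ u₂

namespace BiadjointTriangle

section Computads

/-- A small computad: a graph together with a set of 2-cells between parallel paths. -/
structure Computad where
  V : Type
  [quiver : Quiver.{0} V]
  Cell : {a b : V} → Quiver.Path a b → Quiver.Path a b → Type

attribute [instance] Computad.quiver

/-- Formal pastings of the 2-cells of a computad. -/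
inductive Computad.Pasting (c : Computad) :
    {a b : c.V} → Quiver.Path a b → Quiver.Path a b → Type
  | gen {a b : c.V} {p q : Quiver.Path a b} (γ : c.Cell p q) : Pasting c p q
  | refl {a b : c.V} (p : Quiver.Path a b) : Pasting c p p
  | vcomp {a b : c.V} {p q r : Quiver.Path a b} (η : Pasting c p q) (θ : Pasting c q r) :
      Pasting c p r
  | whiskerLeft {a b d : c.V} (p : Quiver.Path a b) {q r : Quiver.Path b d} (η : Pasting c q r) :
      Pasting c (p.comp q) (p.comp r)
  | whiskerRight {a b d : c.V} {p q : Quiver.Path a b} (η : Pasting c p q) (r : Quiver.Path b d) :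
      Pasting c (p.comp r) (q.comp r)

/-- The identity pasting between equal paths. -/
def Computad.Pasting.ofEq {c : Computad} {a b : c.V} {p q : Quiver.Path a b} (h : p = q) :
    c.Pasting p q :=
  h ▸ Computad.Pasting.refl p

/-- A presentation of a 2-category: a computad together with relations between pastings. -/
structure Presentation extends Computad where
  Eqn : {a b : V} → {p q : Quiver.Path a b} →
    toComputad.Pasting p q → toComputad.Pasting p q → Prop

/-- The presentation without relations. -/
def Computad.free (c : Computad) : Presentation where
  toComputad := c
  Eqn _ _ := False

namespace Presentation

variable (P : Presentation)

open Computad.Pasting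

/-- The congruence on pastings generated by the given relations and by the axioms
of a (strict) 2-category. -/
inductive Rel : {a b : P.V} → {p q : Quiver.Path a b} →
    P.Pasting p q → P.Pasting p q → Prop
  | eqn {a b : P.V} {p q : Quiver.Path a b} {η θ : P.Pasting p q} (h : P.Eqn η θ) : Rel η θ
  | vcomp_right {a b : P.V} {p q r : Quiver.Path a b} (η : P.Pasting p q) (θ₁ θ₂ : P.Pasting q r) :
      Rel θ₁ θ₂ → Rel (η.vcomp θ₁) (η.vcomp θ₂)
  | vcomp_left {a b : P.V} {p q r : Quiver.Path a b} (η₁ η₂ : P.Pasting p q) (θ : P.Pasting q r) :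
      Rel η₁ η₂ → Rel (η₁.vcomp θ) (η₂.vcomp θ)
  | whiskerLeft {a b d : P.V} (p : Quiver.Path a b) {q r : Quiver.Path b d}
      (η₁ η₂ : P.Pasting q r) : Rel η₁ η₂ → Rel (η₁.whiskerLeft p) (η₂.whiskerLeft p)
  | whiskerRight {a b d : P.V} {p q : Quiver.Path a b} (η₁ η₂ : P.Pasting p q)
      (r : Quiver.Path b d) : Rel η₁ η₂ → Rel (η₁.whiskerRight r) (η₂.whiskerRight r)
  | id_vcomp {a b : P.V} {p q : Quiver.Path a b} (η : P.Pasting p q) : Rel ((refl p).vcomp η) η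
  | vcomp_id {a b : P.V} {p q : Quiver.Path a b} (η : P.Pasting p q) : Rel (η.vcomp (refl q)) η
  | assoc {a b : P.V} {p q r s : Quiver.Path a b} (η : P.Pasting p q) (θ : P.Pasting q r)
      (ι : P.Pasting r s) : Rel ((η.vcomp θ).vcomp ι) (η.vcomp (θ.vcomp ι))
  | whiskerLeft_id {a b d : P.V} (p : Quiver.Path a b) (q : Quiver.Path b d) :
      Rel ((refl q).whiskerLeft p) (refl (p.comp q))
  | whiskerLeft_vcomp {a b d : P.V} (p : Quiver.Path a b) {q r s : Quiver.Path b d}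
      (η : P.Pasting q r) (θ : P.Pasting r s) :
      Rel ((η.vcomp θ).whiskerLeft p) ((η.whiskerLeft p).vcomp (θ.whiskerLeft p))
  | id_whiskerRight {a b d : P.V} (p : Quiver.Path a b) (q : Quiver.Path b d) :
      Rel ((refl p).whiskerRight q) (refl (p.comp q))
  | vcomp_whiskerRight {a b d : P.V} {p q r : Quiver.Path a b}
      (η : P.Pasting p q) (θ : P.Pasting q r) (s : Quiver.Path b d) :
      Rel ((η.vcomp θ).whiskerRight s) ((η.whiskerRight s).vcomp (θ.whiskerRight s))
  | nil_whiskerLeft {a b : P.V} {p q : Quiver.Path a b} (η : P.Pasting p q) :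
      Rel (η.whiskerLeft Quiver.Path.nil)
        ((ofEq (Quiver.Path.nil_comp p)).vcomp (η.vcomp (ofEq (Quiver.Path.nil_comp q).symm)))
  | comp_whiskerLeft {a b d e : P.V} (p : Quiver.Path a b) (q : Quiver.Path b d)
      {r s : Quiver.Path d e} (η : P.Pasting r s) :
      Rel (η.whiskerLeft (p.comp q)) ((ofEq (Quiver.Path.comp_assoc p q r)).vcomp
        (((η.whiskerLeft q).whiskerLeft p).vcomp (ofEq (Quiver.Path.comp_assoc p q s).symm)))
  | whiskerRight_nil {a b : P.V} {p q : Quiver.Path a b} (η : P.Pasting p q) :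
      Rel (η.whiskerRight Quiver.Path.nil) η
  | whiskerRight_comp {a b d e : P.V} {p q : Quiver.Path a b} (η : P.Pasting p q)
      (r : Quiver.Path b d) (s : Quiver.Path d e) :
      Rel (η.whiskerRight (r.comp s)) ((ofEq (Quiver.Path.comp_assoc p r s).symm).vcomp
        (((η.whiskerRight r).whiskerRight s).vcomp (ofEq (Quiver.Path.comp_assoc q r s))))
  | whisker_assoc {a b d e : P.V} (p : Quiver.Path a b) {q r : Quiver.Path b d}
      (η : P.Pasting q r) (s : Quiver.Path d e) :
      Rel ((η.whiskerLeft p).whiskerRight s) ((ofEq (Quiver.Path.comp_assoc p q s)).vcomp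
        (((η.whiskerRight s).whiskerLeft p).vcomp (ofEq (Quiver.Path.comp_assoc p r s).symm)))
  | whisker_exchange {a b d : P.V} {p q : Quiver.Path a b} {r s : Quiver.Path b d}
      (η : P.Pasting p q) (θ : P.Pasting r s) :
      Rel ((θ.whiskerLeft p).vcomp (η.whiskerRight s)) ((η.whiskerRight r).vcomp (θ.whiskerLeft q))

/-- The (strict) 2-category presented by `P`: the objects are the vertices, the 1-cells are
the paths and the 2-cells are the pastings modulo the congruence `P.Rel`. -/
def TwoCat : Type := P.V

instance : CategoryStruct P.TwoCat where
  Hom (a b : P.V) := Quiver.Path a b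
  id (a : P.V) := (Quiver.Path.nil : Quiver.Path a a)
  comp {a b d : P.V} (p : Quiver.Path a b) (q : Quiver.Path b d) := p.comp q

instance homCategory (a b : P.TwoCat) : Category (a ⟶ b) where
  Hom p q := Quot (@Rel P a b p q)
  id p := Quot.mk _ (Computad.Pasting.refl (c := P.toComputad) p)
  comp {p q r} := Quot.map₂ (Computad.Pasting.vcomp (c := P.toComputad) (p := p) (q := q) (r := r))
    Rel.vcomp_right Rel.vcomp_left
  id_comp := by rintro p q ⟨η⟩; exact Quot.sound (Rel.id_vcomp η)
  comp_id := by rintro p q ⟨η⟩; exact Quot.sound (Rel.vcomp_id η)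
  assoc := by rintro p q r s ⟨η⟩ ⟨θ⟩ ⟨ι⟩; exact Quot.sound (Rel.assoc η θ ι)

/-- The 2-cell represented by a pasting. -/
def cell {a b : P.TwoCat} {p q : a ⟶ b} (η : P.Pasting (a := a) (b := b) p q) : p ⟶ q :=
  Quot.mk _ η

theorem cell_ofEq {a b : P.TwoCat} {p q : a ⟶ b} (h : p = q) :
    P.cell (ofEq (c := P.toComputad) h) = eqToHom h := by
  subst h
  rfl

theorem cell_vcomp {a b : P.TwoCat} {p q r : a ⟶ b} (η : P.Pasting (a := a) (b := b) p q)
    (θ : P.Pasting (a := a) (b := b) q r) : P.cell (η.vcomp θ) = P.cell η ≫ P.cell θ := rfl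

theorem hom_comp_assoc {a b d e : P.TwoCat} (p : a ⟶ b) (q : b ⟶ d) (r : d ⟶ e) :
    (p ≫ q) ≫ r = p ≫ q ≫ r :=
  Quiver.Path.comp_assoc (V := P.V) p q r

theorem hom_id_comp {a b : P.TwoCat} (p : a ⟶ b) : 𝟙 a ≫ p = p :=
  Quiver.Path.nil_comp (V := P.V) p

/-- Left whiskering in the presented 2-category. -/
def wL {a b d : P.TwoCat} (p : a ⟶ b) {q r : b ⟶ d} (η : q ⟶ r) : p ≫ q ⟶ p ≫ r :=
  Quot.map (Computad.Pasting.whiskerLeft (c := P.toComputad) (a := a) (b := b) (d := d) p)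
    (Rel.whiskerLeft p) η

/-- Right whiskering in the presented 2-category. -/
def wR {a b d : P.TwoCat} {p q : a ⟶ b} (η : p ⟶ q) (r : b ⟶ d) : p ≫ r ⟶ q ≫ r :=
  Quot.map (fun η => Computad.Pasting.whiskerRight (c := P.toComputad) (a := a) (b := b) (d := d)
    η r) (fun _ _ h => Rel.whiskerRight _ _ r h) η

theorem wL_eqToHom {a b d : P.TwoCat} (p : a ⟶ b) {q r : b ⟶ d} (h : q = r) :
    P.wL p (eqToHom h) = eqToHom (by rw [h]) := by
  subst h
  exact Quot.sound (Rel.whiskerLeft_id p q)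

theorem wR_eqToHom {a b d : P.TwoCat} {p q : a ⟶ b} (h : p = q) (r : b ⟶ d) :
    P.wR (eqToHom h) r = eqToHom (by rw [h]) := by
  subst h
  exact Quot.sound (Rel.id_whiskerRight p r)

instance : Bicategory P.TwoCat where
  homCategory := P.homCategory
  whiskerLeft p _ _ η := P.wL p η
  whiskerRight η r := P.wR η r
  associator p q r := eqToIso (P.hom_comp_assoc p q r)
  leftUnitor p := eqToIso (P.hom_id_comp p)
  rightUnitor p := Iso.refl p
  whiskerLeft_id p q := Quot.sound (Rel.whiskerLeft_id p q)
  whiskerLeft_comp := by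
    rintro a b d p q r s ⟨η⟩ ⟨θ⟩
    exact Quot.sound (Rel.whiskerLeft_vcomp p η θ)
  id_whiskerRight p q := Quot.sound (Rel.id_whiskerRight p q)
  comp_whiskerRight := by
    rintro a b d p q r ⟨η⟩ ⟨θ⟩ s
    exact Quot.sound (Rel.vcomp_whiskerRight η θ s)
  id_whiskerLeft := by
    rintro a b p q ⟨η⟩
    refine (Quot.sound (Rel.nil_whiskerLeft η)).trans ?_
    rw [eqToIso.hom, eqToIso.inv, ← cell_ofEq, ← cell_ofEq]
    rfl
  comp_whiskerLeft := by
    rintro a b d e p q r s ⟨η⟩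
    refine (Quot.sound (Rel.comp_whiskerLeft p q η)).trans ?_
    rw [eqToIso.hom, eqToIso.inv, ← cell_ofEq, ← cell_ofEq]
    rfl
  whiskerRight_id := by
    rintro a b p q ⟨η⟩
    refine (Quot.sound (Rel.whiskerRight_nil η)).trans ?_
    exact ((Category.id_comp _).trans (Category.comp_id (P.cell η))).symm
  whiskerRight_comp := by
    rintro a b d e p q ⟨η⟩ r s
    refine (Quot.sound (Rel.whiskerRight_comp η r s)).trans ?_
    rw [eqToIso.hom, eqToIso.inv, ← cell_ofEq, ← cell_ofEq]
    rfl
  whisker_assoc := by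
    rintro a b d e p q r ⟨η⟩ s
    refine (Quot.sound (Rel.whisker_assoc p η s)).trans ?_
    rw [eqToIso.hom, eqToIso.inv, ← cell_ofEq, ← cell_ofEq]
    rfl
  whisker_exchange := by
    rintro a b d p q r s ⟨η⟩ ⟨θ⟩
    exact Quot.sound (Rel.whisker_exchange η θ)
  pentagon p q r s := by
    simp only [eqToIso.hom, wL_eqToHom, wR_eqToHom, eqToHom_trans]
  triangle p q := by
    simp only [eqToIso.hom, wL_eqToHom, eqToHom_trans]
    exact (Quot.sound (Rel.id_whiskerRight p q)).symm

instance : Bicategory.Strict P.TwoCat where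
  id_comp p := P.hom_id_comp p
  comp_id _ := rfl
  assoc p q r := P.hom_comp_assoc p q r

end Presentation
end Computads
end BiadjointTriangle
namespace BiadjointTriangle

section Lift

variable {B : Type u} [Bicategory.{w, v} B]

section

variable {V : Type} [Quiver.{0} V] (F : V ⥤q B)

/-- The composite in `B` of the image of a path. -/
def evalPath {a : V} : ∀ {b : V}, Quiver.Path a b → (F.obj a ⟶ F.obj b)
  | _, Quiver.Path.nil => 𝟙 (F.obj a)
  | _, Quiver.Path.cons p e => evalPath p ≫ F.map e

/-- The composite of a concatenation of paths. -/
def evalComp {a b : V} (p : Quiver.Path a b) : ∀ {d : V} (q : Quiver.Path b d),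
      evalPath F (p.comp q) ≅ evalPath F p ≫ evalPath F q
  | _, Quiver.Path.nil => (ρ_ (evalPath F p)).symm
  | _, Quiver.Path.cons q e => whiskerRightIso (evalComp p q) (F.map e) ≪≫ α_ _ _ _

theorem evalComp_assoc {a b d : V} (p : Quiver.Path a b) (q : Quiver.Path b d) {e : V}
    (r : Quiver.Path d e) :
    (evalComp F (p.comp q) r).hom ≫ (evalComp F p q).hom ▷ evalPath F r ≫ (α_ _ _ _).hom =
    eqToHom (congrArg (evalPath F) (Quiver.Path.comp_assoc p q r)) ≫
      (evalComp F p (q.comp r)).hom ≫ evalPath F p ◁ (evalComp F q r).hom := by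
  induction r with
  | nil =>
    change _ = 𝟙 _ ≫ _
    simp [evalComp, evalPath]
  | cons r e ih =>
    have e1 : eqToHom (congrArg (evalPath F) (Quiver.Path.comp_assoc p q (r.cons e))) =
        eqToHom (congrArg (evalPath F) (Quiver.Path.comp_assoc p q r)) ▷ F.map e := by
      rw [eqToHom_whiskerRight]
      rfl
    rw [e1]
    have h2 := congrArg (fun t => t ▷ F.map e) ih
    simp only [comp_whiskerRight] at h2
    change ((evalComp F (p.comp q) r).hom ▷ F.map e ≫ (α_ _ _ _).hom) ≫
      (evalComp F p q).hom ▷ (evalPath F r ≫ F.map e) ≫ (α_ _ _ _).hom =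
      _ ▷ _ ≫ ((evalComp F p (q.comp r)).hom ▷ F.map e ≫ (α_ _ _ _).hom) ≫
        evalPath F p ◁ ((evalComp F q r).hom ▷ F.map e ≫ (α_ _ _ _).hom)
    calc _ = ((evalComp F (p.comp q) r).hom ▷ F.map e ≫
          (evalComp F p q).hom ▷ evalPath F r ▷ F.map e ≫ (α_ _ _ _).hom ▷ F.map e) ≫
            (α_ _ _ _).hom ≫ _ ◁ (α_ _ _ _).hom := by simp
      _ = _ := by rw [h2]; simp

theorem evalComp_nil {a b : V} (p : Quiver.Path a b) :
    (evalComp F Quiver.Path.nil p).hom =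
      eqToHom (congrArg (evalPath F) (Quiver.Path.nil_comp p)) ≫ (λ_ _).inv := by
  induction p with
  | nil =>
    change _ = 𝟙 _ ≫ _
    simp [evalComp, evalPath]
  | cons p e ih =>
    have e1 : eqToHom (congrArg (evalPath F) (Quiver.Path.nil_comp (p.cons e))) =
        eqToHom (congrArg (evalPath F) (Quiver.Path.nil_comp p)) ▷ F.map e := by
      rw [eqToHom_whiskerRight]
      rfl
    rw [e1]
    change (evalComp F Quiver.Path.nil p).hom ▷ F.map e ≫ (α_ _ _ _).hom =
      _ ▷ _ ≫ (λ_ (evalPath F p ≫ F.map e)).inv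
    rw [ih]
    simp [evalPath]

end

/-- A morphism from the computad `c` to the bicategory `B`. -/
structure Computad.Interp (c : Computad) (B : Type u) [Bicategory.{w, v} B]
    extends c.V ⥤q B where
  cell : ∀ {a b : c.V} {p q : Quiver.Path a b}, c.Cell p q →
    (evalPath toPrefunctor p ⟶ evalPath toPrefunctor q)

namespace Computad.Interp

variable {c : Computad} (F : c.Interp B)

/-- The value of a pasting. -/
def eval : ∀ {a b : c.V} {p q : Quiver.Path a b}, c.Pasting p q →
    (evalPath F.toPrefunctor p ⟶ evalPath F.toPrefunctor q)
  | _, _, _, _, .gen γ => F.cell γ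
  | _, _, _, _, .refl _ => 𝟙 _
  | _, _, _, _, .vcomp η θ => eval η ≫ eval θ
  | _, _, _, _, .whiskerLeft p η => (evalComp F.toPrefunctor p _).hom ≫
      evalPath F.toPrefunctor p ◁ eval η ≫ (evalComp F.toPrefunctor p _).inv
  | _, _, _, _, .whiskerRight η r => (evalComp F.toPrefunctor _ r).hom ≫
      eval η ▷ evalPath F.toPrefunctor r ≫ (evalComp F.toPrefunctor _ r).inv

theorem eval_ofEq {a b : c.V} {p q : Quiver.Path a b} (h : p = q) :
    F.eval (Computad.Pasting.ofEq h) = eqToHom (congrArg (evalPath F.toPrefunctor) h) := by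
  subst h
  rfl

theorem evalComp_assoc_inv {V : Type} [Quiver.{0} V] (F : V ⥤q B) {a b d e : V}
    (p : Quiver.Path a b) (q : Quiver.Path b d) (r : Quiver.Path d e) :
    (α_ _ _ _).inv ≫ (evalComp F p q).inv ▷ evalPath F r ≫ (evalComp F (p.comp q) r).inv =
    evalPath F p ◁ (evalComp F q r).inv ≫ (evalComp F p (q.comp r)).inv ≫
    eqToHom (congrArg (evalPath F) (Quiver.Path.comp_assoc p q r).symm) := by
  have h := evalComp_assoc F p q r
  rw [← IsIso.inv_eq_inv] at h
  simpa using h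

/-- An interpretation of the computad of `P` is a model of `P` if it validates the relations. -/
def IsModel {P : Presentation} (F : P.toComputad.Interp B) : Prop :=
  ∀ {a b : P.V} {p q : Quiver.Path a b} {η θ : P.Pasting p q}, P.Eqn η θ → F.eval η = F.eval θ

theorem eval_congr {P : Presentation} {F : P.toComputad.Interp B} (hF : F.IsModel)
    {a b : P.V} {p q : Quiver.Path a b} {η θ : P.Pasting p q}
    (h : P.Rel η θ) : F.eval η = F.eval θ := by
  induction h with
  | eqn h => exact hF h
  | vcomp_right η θ₁ θ₂ _ ih => simp only [eval, ih]
  | vcomp_left η θ₁ θ₂ _ ih => simp only [eval, ih]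
  | whiskerLeft p η₁ η₂ _ ih => simp only [eval, ih]
  | whiskerRight η₁ η₂ r _ ih => simp only [eval, ih]
  | id_vcomp η => simp [eval]
  | vcomp_id η => simp [eval]
  | assoc η θ ι => simp [eval]
  | whiskerLeft_id p q => simp [eval]
  | whiskerLeft_vcomp p η θ => simp [eval]
  | id_whiskerRight p q => simp [eval]
  | vcomp_whiskerRight η θ s => simp [eval]
  | nil_whiskerLeft η =>
    rename_i a b p q
    have h1 : evalComp F.toPrefunctor Quiver.Path.nil p =
        eqToIso (congrArg (evalPath F.toPrefunctor) (Quiver.Path.nil_comp p)) ≪≫ (λ_ _).symm :=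
      Iso.ext (evalComp_nil F.toPrefunctor p)
    have h2 : evalComp F.toPrefunctor Quiver.Path.nil q =
        eqToIso (congrArg (evalPath F.toPrefunctor) (Quiver.Path.nil_comp q)) ≪≫ (λ_ _).symm :=
      Iso.ext (evalComp_nil F.toPrefunctor q)
    simp only [eval, eval_ofEq, h1, h2, evalPath]
    simp
  | comp_whiskerLeft p q η =>
    rename_i r s
    have h1 := evalComp_assoc F.toPrefunctor p q r
    have h2 := evalComp_assoc_inv F.toPrefunctor p q s
    simp only [eval, eval_ofEq, whiskerLeft_comp, Category.assoc]
    rw [← h2, ← reassoc_of% h1, ← comp_whiskerLeft_assoc, whisker_exchange_assoc]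
    simp
  | whiskerRight_nil η => simp [eval, evalComp, evalPath]
  | whiskerRight_comp η r s =>
    rename_i p q
    have h1 := evalComp_assoc F.toPrefunctor p r s
    have h2 := evalComp_assoc_inv F.toPrefunctor q r s
    have h1' : eqToHom (congrArg (evalPath F.toPrefunctor) (Quiver.Path.comp_assoc p r s).symm) ≫
        (evalComp F.toPrefunctor (p.comp r) s).hom ≫
          (evalComp F.toPrefunctor p r).hom ▷ evalPath F.toPrefunctor s =
        (evalComp F.toPrefunctor p (r.comp s)).hom ≫
          evalPath F.toPrefunctor p ◁ (evalComp F.toPrefunctor r s).hom ≫ (α_ _ _ _).inv := by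
      rw [← cancel_mono (α_ _ _ _).hom]
      simp only [Category.assoc, h1, Iso.inv_hom_id, Category.comp_id, eqToHom_trans_assoc,
        eqToHom_refl, Category.id_comp]
    have h2' : (evalComp F.toPrefunctor q r).inv ▷ evalPath F.toPrefunctor s ≫
        (evalComp F.toPrefunctor (q.comp r) s).inv ≫
        eqToHom (congrArg (evalPath F.toPrefunctor) (Quiver.Path.comp_assoc q r s)) =
        (α_ _ _ _).hom ≫ evalPath F.toPrefunctor q ◁ (evalComp F.toPrefunctor r s).inv ≫
        (evalComp F.toPrefunctor q (r.comp s)).inv := by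
      rw [← cancel_epi (α_ _ _ _).inv, reassoc_of% h2]
      simp
    simp only [eval, eval_ofEq, comp_whiskerRight, Category.assoc, h2', reassoc_of% h1']
    rw [← whiskerRight_comp_assoc, whisker_exchange_assoc]
    simp
  | whisker_assoc p η s =>
    rename_i q r
    have h1 := evalComp_assoc F.toPrefunctor p q s
    have h2 := evalComp_assoc_inv F.toPrefunctor p r s
    simp only [eval, eval_ofEq, comp_whiskerRight, whiskerLeft_comp, Category.assoc]
    rw [← h2, ← reassoc_of% h1]
    simp
  | whisker_exchange η θ => simp [eval, whisker_exchange_assoc]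

/-- The pseudofunctor out of the presented 2-category determined by a model. -/
def lift {P : Presentation} (F : P.toComputad.Interp B) (hF : F.IsModel) : P.TwoCat ⥤ᵖ B where
  obj (a : P.V) := F.obj a
  map {a b : P.V} p := evalPath (a := a) (b := b) F.toPrefunctor p
  map₂ {a b : P.V} {p q} η := Quot.lift (F.eval (a := a) (b := b) (p := p) (q := q))
    (fun _ _ h => eval_congr hF h) η
  map₂_id _ := rfl
  map₂_comp := by rintro a b p q r ⟨η⟩ ⟨θ⟩; rfl
  mapId a := Iso.refl _
  mapComp {a b d : P.V} p q := evalComp (a := a) (b := b) (d := d) F.toPrefunctor p q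
  map₂_whisker_left := by rintro a b d p q r ⟨η⟩; rfl
  map₂_whisker_right := by rintro a b d p q ⟨η⟩ r; rfl
  map₂_associator {a b d e} p q r := by
    have h := evalComp_assoc F.toPrefunctor (a := a) (b := b) (d := d) (e := e) p q r
    have h' : Quot.lift (F.eval (a := a) (b := e)) (fun _ _ h => eval_congr hF h)
        (α_ p q r).hom =
        eqToHom (congrArg (evalPath F.toPrefunctor) (Quiver.Path.comp_assoc p q r)) := by
      refine Eq.trans ?_ (F.eval_ofEq (Quiver.Path.comp_assoc p q r))
      exact congrArg (Quot.lift (F.eval (a := a) (b := e)) (fun _ _ h => eval_congr hF h))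
        (P.cell_ofEq (a := a) (b := e) (P.hom_comp_assoc p q r)).symm
    refine h'.trans ?_
    have h2 := congrArg (fun t => t ≫ evalPath F.toPrefunctor (a := a) p ◁
      (evalComp F.toPrefunctor (a := b) (b := d) q r).inv ≫
      (evalComp F.toPrefunctor (a := a) (b := b) p (Quiver.Path.comp q r)).inv) h
    simp only [Category.assoc, whiskerLeft_hom_inv_assoc, Iso.hom_inv_id, Category.comp_id] at h2
    exact h2.symm
  map₂_left_unitor {a b} p := by
    have h := evalComp_nil F.toPrefunctor (a := a) (b := b) p
    have h' : Quot.lift (F.eval (a := a) (b := b)) (fun _ _ h => eval_congr hF h)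
        (λ_ p).hom =
        eqToHom (congrArg (evalPath F.toPrefunctor) (Quiver.Path.nil_comp p)) := by
      refine Eq.trans ?_ (F.eval_ofEq (Quiver.Path.nil_comp p))
      exact congrArg (Quot.lift (F.eval (a := a) (b := b)) (fun _ _ h => eval_congr hF h))
        (P.cell_ofEq (a := a) (b := b) (P.hom_id_comp p)).symm
    refine h'.trans ?_
    have h2 := congrArg (fun t => t ≫ (λ_ (evalPath F.toPrefunctor (a := a) (b := b) p)).hom) h
    simp only [Category.assoc, Iso.inv_hom_id, Category.comp_id] at h2
    refine h2.symm.trans ?_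
    change _ = _ ≫ 𝟙 _ ▷ _ ≫ _
    rw [id_whiskerRight]
    exact congrArg (fun t => (evalComp F.toPrefunctor (a := a) (b := a) Quiver.Path.nil p).hom ≫ t)
      (Category.id_comp (λ_ (evalPath F.toPrefunctor (a := a) (b := b) p)).hom).symm
  map₂_right_unitor {a b} p := by
    change 𝟙 _ = (ρ_ _).inv ≫ _ ◁ 𝟙 _ ≫ (ρ_ _).hom
    rw [whiskerLeft_id, Category.id_comp, Iso.inv_hom_id]

end Computad.Interp
end Lift
end BiadjointTriangle
namespace BiadjointTriangle

section Delta

open Quiver.Path (nil)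

/-- The objects of `Δ_ℓ`. -/
inductive DeltaObj : Type
  | one
  | two
  | three

/-- The generating 1-cells of `Δ_ℓ`; here `e0`, `e1`, `e2` stand for `∂⁰`, `∂¹`, `∂²`. -/
inductive DeltaEdge : DeltaObj → DeltaObj → Type
  | d0 : DeltaEdge .one .two
  | d1 : DeltaEdge .one .two
  | s0 : DeltaEdge .two .one
  | e0 : DeltaEdge .two .three
  | e1 : DeltaEdge .two .three
  | e2 : DeltaEdge .two .three

instance : Quiver.{0} DeltaObj := ⟨DeltaEdge⟩

/-- The path of length one. -/
abbrev path1 {V : Type} [Quiver.{0} V] {a b : V} (f : a ⟶ b) : Quiver.Path a b := nil.cons f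

/-- The path of length two, in diagrammatic order. -/
abbrev path2 {V : Type} [Quiver.{0} V] {a b c : V} (f : a ⟶ b) (g : b ⟶ c) : Quiver.Path a c :=
  (nil.cons f).cons g

/-- The generating 2-cells of `Δ_ℓ`:
`σ₀₀ : ∂⁰d⁰ ⇒ ∂¹d⁰`, `σ₂₀ : ∂²d⁰ ⇒ ∂⁰d¹`, `σ₂₁ : ∂²d¹ ⇒ ∂¹d¹`,
`n₀ : 1 ⇒ s⁰d⁰`, `n₁ : 1 ⇒ s⁰d¹`. -/
inductive DeltaCell : {a b : DeltaObj} → Quiver.Path a b → Quiver.Path a b → Type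
  | sigma00 : DeltaCell (path2 DeltaEdge.d0 DeltaEdge.e0) (path2 DeltaEdge.d0 DeltaEdge.e1)
  | sigma20 : DeltaCell (path2 DeltaEdge.d0 DeltaEdge.e2) (path2 DeltaEdge.d1 DeltaEdge.e0)
  | sigma21 : DeltaCell (path2 DeltaEdge.d1 DeltaEdge.e2) (path2 DeltaEdge.d1 DeltaEdge.e1)
  | n0 : DeltaCell (nil (a := DeltaObj.one)) (path2 DeltaEdge.d0 DeltaEdge.s0)
  | n1 : DeltaCell (nil (a := DeltaObj.one)) (path2 DeltaEdge.d1 DeltaEdge.s0)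

/-- The computad generating `Δ_ℓ`. -/
def deltaComputad : Computad where
  V := DeltaObj
  Cell := DeltaCell

/-- The 2-category `Δ_ℓ`, freely generated by its computad. -/
abbrev DeltaL : Type := deltaComputad.free.TwoCat

/-- The objects of the 2-categories `Δ̇_ℓ` and `Δ̇`. -/
inductive DotObj : Type
  | zero
  | one
  | two
  | three

/-- The generating 1-cells of the 2-categories `Δ̇_ℓ` and `Δ̇`. -/
inductive DotEdge : DotObj → DotObj → Type
  | d : DotEdge .zero .one
  | d0 : DotEdge .one .two
  | d1 : DotEdge .one .two
  | s0 : DotEdge .two .one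
  | e0 : DotEdge .two .three
  | e1 : DotEdge .two .three
  | e2 : DotEdge .two .three

instance : Quiver.{0} DotObj := ⟨DotEdge⟩

/-- The generating 2-cells of `Δ̇_ℓ` (for `inv` false): those of `Δ_ℓ` and `ϑ : d¹d ⇒ d⁰d`.
The computad of `Δ̇` (for `inv` true) has one more generator `d⁰d ⇒ d¹d`. -/
inductive DotCell (inv : Prop) : {a b : DotObj} → Quiver.Path a b → Quiver.Path a b → Type
  | sigma00 : DotCell inv (path2 DotEdge.d0 DotEdge.e0) (path2 DotEdge.d0 DotEdge.e1)
  | sigma20 : DotCell inv (path2 DotEdge.d0 DotEdge.e2) (path2 DotEdge.d1 DotEdge.e0)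
  | sigma21 : DotCell inv (path2 DotEdge.d1 DotEdge.e2) (path2 DotEdge.d1 DotEdge.e1)
  | n0 : DotCell inv (nil (a := DotObj.one)) (path2 DotEdge.d0 DotEdge.s0)
  | n1 : DotCell inv (nil (a := DotObj.one)) (path2 DotEdge.d1 DotEdge.s0)
  | theta : DotCell inv (path2 DotEdge.d DotEdge.d1) (path2 DotEdge.d DotEdge.d0)
  | thetaInv (h : inv) : DotCell inv (path2 DotEdge.d DotEdge.d0) (path2 DotEdge.d DotEdge.d1)

/-- The computad generating `Δ̇_ℓ` (for `inv` false) and `Δ̇` (for `inv` true). -/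
def dotComputad (inv : Prop) : Computad where
  V := DotObj
  Cell := DotCell inv

/-- The pasting in the computad of `Δ̇_ℓ` or `Δ̇` given by one generating 2-cell. -/
def dotGen {inv : Prop} {a b : DotObj} {p q : Quiver.Path a b} (γ : DotCell inv p q) :
    (dotComputad inv).Pasting (a := a) (b := b) p q :=
  .gen γ

/-- The pasting `γ` preceded by `d`. -/
def dotAfterD {inv : Prop} {b : DotObj} {p q : Quiver.Path DotObj.one b} (γ : DotCell inv p q) :
    (dotComputad inv).Pasting (a := DotObj.zero) (b := b)
      ((path1 DotEdge.d).comp p) ((path1 DotEdge.d).comp q) :=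
  .whiskerLeft (c := dotComputad inv) (path1 DotEdge.d) (dotGen γ)

/-- The pasting `ϑ` followed by the generating 1-cell `f`. -/
def dotTheta (inv : Prop) {b : DotObj} (f : DotEdge DotObj.two b) :
    (dotComputad inv).Pasting (a := DotObj.zero) (b := b)
      ((path2 DotEdge.d DotEdge.d1).cons f) ((path2 DotEdge.d DotEdge.d0).cons f) :=
  .whiskerRight (c := dotComputad inv) (dotGen DotCell.theta) (path1 f)

/-- The equations imposed on `Δ̇_ℓ` and `Δ̇`: associativity, identity and, in `Δ̇`,
the invertibility of `ϑ`. -/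
inductive DotEqn (inv : Prop) : {a b : DotObj} → {p q : Quiver.Path a b} →
    (dotComputad inv).Pasting (a := a) (b := b) p q →
    (dotComputad inv).Pasting (a := a) (b := b) p q → Prop
  | associativity : DotEqn inv
      ((dotTheta inv DotEdge.e2).vcomp ((dotAfterD DotCell.sigma20).vcomp
        ((dotTheta inv DotEdge.e0).vcomp (dotAfterD DotCell.sigma00))))
      ((dotAfterD DotCell.sigma21).vcomp (dotTheta inv DotEdge.e1))
  | identity : DotEqn inv
      ((dotAfterD DotCell.n1).vcomp (dotTheta inv DotEdge.s0)) (dotAfterD DotCell.n0)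
  | theta_thetaInv (h : inv) : DotEqn inv
      ((dotGen DotCell.theta).vcomp (dotGen (DotCell.thetaInv h))) (.refl _)
  | thetaInv_theta (h : inv) : DotEqn inv
      ((dotGen (DotCell.thetaInv h)).vcomp (dotGen DotCell.theta)) (.refl _)

/-- The presentation of `Δ̇_ℓ` (for `inv` false) and of `Δ̇` (for `inv` true). -/
def dotPresentation (inv : Prop) : Presentation where
  toComputad := dotComputad inv
  Eqn := DotEqn inv

/-- The 2-category `Δ̇_ℓ` (for `inv` false), respectively `Δ̇` (for `inv` true). -/
abbrev DotDelta (inv : Prop) : Type := (dotPresentation inv).TwoCat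

/-- The inclusion on the generating graphs. -/
def inclusionPrefunctor (inv : Prop) : DeltaObj ⥤q DotDelta inv where
  obj
    | .one => DotObj.one
    | .two => DotObj.two
    | .three => DotObj.three
  map
    | .d0 => path1 DotEdge.d0
    | .d1 => path1 DotEdge.d1
    | .s0 => path1 DotEdge.s0
    | .e0 => path1 DotEdge.e0
    | .e1 => path1 DotEdge.e1
    | .e2 => path1 DotEdge.e2

/-- The inclusion of computads of `Δ_ℓ` in `Δ̇_ℓ`, respectively in `Δ̇`. -/
def inclusionInterp (inv : Prop) : deltaComputad.Interp (DotDelta inv) where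
  toPrefunctor := inclusionPrefunctor inv
  cell
    | .sigma00 => (dotPresentation inv).cell (.gen DotCell.sigma00)
    | .sigma20 => (dotPresentation inv).cell (.gen DotCell.sigma20)
    | .sigma21 => (dotPresentation inv).cell (.gen DotCell.sigma21)
    | .n0 => (dotPresentation inv).cell (.gen DotCell.n0)
    | .n1 => (dotPresentation inv).cell (.gen DotCell.n1)

/-- The inclusion `t : Δ_ℓ ⥤ Δ̇_ℓ` (for `inv` false), respectively `j : Δ_ℓ ⥤ Δ̇`
(for `inv` true). -/
def inclusion (inv : Prop) : DeltaL ⥤ᵖ DotDelta inv :=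
  Computad.Interp.lift (P := deltaComputad.free) (inclusionInterp inv) (fun h => h.elim)

end Delta
end BiadjointTriangle
namespace BiadjointTriangle

section Bicolimits

attribute [local instance] CategoryTheory.uliftCategory

/-- The hom-category `B(b, x)`, moved to a larger universe. -/
abbrev ULiftHomCat {B : Type u₁} [Bicategory.{w₁, v₁} B] (b x : B) :
    Cat.{max w w₁, max v v₁} :=
  Cat.of (ULiftHom.{w} (ULift.{v} (b ⟶ x)))

/-- The underlying object of an object that is moved to a larger universe. -/
def uliftDown {C : Type v₁} (X : ULiftHom.{w} (ULift.{v} C)) : C := X.objDown.down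

/-- A functor, moved to a larger universe. -/
def uliftMap {C : Type v₁} [Category.{w₁} C] {D : Type v₁} [Category.{w₁} D] (F : C ⥤ D) :
    ULiftHom.{w} (ULift.{v} C) ⥤ ULiftHom.{w} (ULift.{v} D) where
  obj X := ULiftHom.objUp (ULift.up (F.obj X.objDown.down))
  map f := ULift.up (F.map f.down)
  map_id _ := congrArg ULift.up (F.map_id _)
  map_comp _ _ := congrArg ULift.up (F.map_comp _ _)

/-- A natural transformation, moved to a larger universe. -/
def uliftMap₂ {C : Type v₁} [Category.{w₁} C] {D : Type v₁} [Category.{w₁} D] {F G : C ⥤ D}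
    (η : F ⟶ G) : uliftMap.{w, v} F ⟶ uliftMap.{w, v} G where
  app X := ULift.up (η.app X.objDown.down)
  naturality _ _ f := congrArg ULift.up (η.naturality f.down)

/-- A natural isomorphism between functors that are moved to a larger universe. -/
def uliftIso {C : Type v₁} [Category.{w₁} C] {D : Type v₁} [Category.{w₁} D] {F G : C ⥤ D}
    (η : F ≅ G) : uliftMap.{w, v} F ≅ uliftMap.{w, v} G where
  hom := uliftMap₂ η.hom
  inv := uliftMap₂ η.inv
  hom_inv_id := by
    ext X
    exact congrArg ULift.up (η.hom_inv_id_app X.objDown.down)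
  inv_hom_id := by
    ext X
    exact congrArg ULift.up (η.inv_hom_id_app X.objDown.down)

/-- The covariant hom-pseudofunctor `B(b, -)`, with values in a larger universe. -/
def corepresentable {B : Type u₁} [Bicategory.{w₁, v₁} B] (b : B) :
    B ⥤ᵖ Cat.{max w w₁, max v v₁} where
  obj x := ULiftHomCat.{w, v} b x
  map f := (uliftMap (postcomp b f)).toCatHom
  map₂ η := NatTrans.toCatHom₂ (uliftMap₂ ((postcomposing b _ _).map η))
  mapId x := Cat.Hom.isoMk (uliftIso (F := postcomp b (𝟙 x)) (G := 𝟭 (b ⟶ x))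
    (NatIso.ofComponents (fun p => ρ_ p) (fun η => rightUnitor_naturality η)))
  mapComp f g := Cat.Hom.isoMk (uliftIso (F := postcomp b (f ≫ g))
    (G := postcomp b f ⋙ postcomp b g) (NatIso.ofComponents (fun p => (α_ p f g).symm)
      (fun η => associator_inv_naturality_left η f g)))
  map₂_id f := Cat.Hom₂.ext (NatTrans.ext (funext fun X => ULift.ext _ _ (by
    exact whiskerLeft_id _ _)))
  map₂_comp η θ := Cat.Hom₂.ext (NatTrans.ext (funext fun X => ULift.ext _ _ (by
    exact whiskerLeft_comp _ _ _)))
  map₂_whisker_left f _ _ η := Cat.Hom₂.ext (NatTrans.ext (funext fun X => ULift.ext _ _ (by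
    change uliftDown.{w, v} X ◁ f ◁ η = (α_ _ _ _).inv ≫ (uliftDown.{w, v} X ≫ f) ◁ η ≫ (α_ _ _ _).hom
    simp)))
  map₂_whisker_right η h := Cat.Hom₂.ext (NatTrans.ext (funext fun X => ULift.ext _ _ (by
    change uliftDown.{w, v} X ◁ η ▷ h = (α_ _ _ _).inv ≫ (uliftDown.{w, v} X ◁ η) ▷ h ≫ (α_ _ _ _).hom
    simp)))
  map₂_associator f g h := Cat.Hom₂.ext (NatTrans.ext (funext fun X => ULift.ext _ _ (by
    change uliftDown.{w, v} X ◁ (α_ f g h).hom = (α_ _ _ _).inv ≫ (α_ _ _ _).inv ▷ h ≫ 𝟙 _ ≫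
      (α_ _ _ _).hom ≫ (α_ _ _ _).hom
    simp)))
  map₂_left_unitor f := Cat.Hom₂.ext (NatTrans.ext (funext fun X => ULift.ext _ _ (by
    change uliftDown.{w, v} X ◁ (λ_ f).hom = (α_ _ _ _).inv ≫ (ρ_ _).hom ▷ f ≫ 𝟙 _
    simp)))
  map₂_right_unitor f := Cat.Hom₂.ext (NatTrans.ext (funext fun X => ULift.ext _ _ (by
    change uliftDown.{w, v} X ◁ (ρ_ f).hom = (α_ _ _ _).inv ≫ (ρ_ _).hom ≫ 𝟙 _
    simp)))

/-- The weight `Δ̇_ℓ(0, t-)` (for `inv` false), respectively `Δ̇(0, j-)` (for `inv` true). -/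
def descentWeight (inv : Prop) : DeltaL ⥤ᵖ Cat.{w, v} :=
  (inclusion inv).comp (corepresentable.{w, v} (B := DotDelta inv) DotObj.zero)

variable {S : Type u₁} [Bicategory.{w₁, v₁} S] {A : Type u} [Bicategory.{w, v} A]

/-- For a diagram `D : Sᵒᵖ ⥤ᵖ A`, regarded as a pseudofunctor `S ⥤ᵖ Aᵒᵖ`, and an object `X` of `A`,
the pseudofunctor `A(D -, X) : S ⥤ᵖ Cat`. -/
abbrev homTo (D : S ⥤ᵖ Aᵒᵖ) (X : A) : S ⥤ᵖ Cat.{w, v} :=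
  D.comp (Bicategory.yoneda.obj X)

theorem precomp_naturality_id {C : Type u₂} [Bicategory.{w₂, v₂} C] (D : S ⥤ᵖ A) {F G : A ⥤ᵖ C}
    (θ : F ⟶ G) (s : S) :
    (θ.naturality (D.map (𝟙 s))).hom ≫ θ.app (D.obj s) ◁ ((D.comp G).mapId s).hom =
      ((D.comp F).mapId s).hom ▷ θ.app (D.obj s) ≫ (λ_ _).hom ≫ (ρ_ _).inv := by
  change _ ≫ _ ◁ (G.map₂ (D.mapId s).hom ≫ (G.mapId _).hom) =
    (F.map₂ (D.mapId s).hom ≫ (F.mapId _).hom) ▷ _ ≫ _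
  rw [whiskerLeft_comp, ← θ.naturality_naturality_assoc, θ.naturality_id, comp_whiskerRight]
  exact (Category.assoc _ _ _).symm

theorem precomp_naturality_comp {C : Type u₂} [Bicategory.{w₂, v₂} C] (D : S ⥤ᵖ A) {F G : A ⥤ᵖ C}
    (θ : F ⟶ G) {r s t : S} (f : r ⟶ s) (g : s ⟶ t) :
    (θ.naturality (D.map (f ≫ g))).hom ≫ θ.app (D.obj r) ◁ ((D.comp G).mapComp f g).hom =
      ((D.comp F).mapComp f g).hom ▷ θ.app (D.obj t) ≫ (α_ _ _ _).hom ≫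
        F.map (D.map f) ◁ (θ.naturality (D.map g)).hom ≫ (α_ _ _ _).inv ≫
        (θ.naturality (D.map f)).hom ▷ G.map (D.map g) ≫ (α_ _ _ _).hom := by
  change _ ≫ _ ◁ (G.map₂ (D.mapComp f g).hom ≫ (G.mapComp _ _).hom) =
    (F.map₂ (D.mapComp f g).hom ≫ (F.mapComp _ _).hom) ▷ _ ≫ _
  rw [whiskerLeft_comp, ← θ.naturality_naturality_assoc, θ.naturality_comp, comp_whiskerRight]
  exact (Category.assoc _ _ _).symm

/-- The pseudonatural transformation `A(D -, h) : A(D -, X) ⟶ A(D -, Y)`. -/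
def homToMap (D : S ⥤ᵖ Aᵒᵖ) {X Y : A} (h : X ⟶ Y) : homTo D X ⟶ homTo D Y where
  app s := (Bicategory.yoneda.map h).app (D.obj s)
  naturality f := (Bicategory.yoneda.map h).naturality (D.map f)
  naturality_naturality η := (Bicategory.yoneda.map h).naturality_naturality (D.map₂ η)
  naturality_id s := precomp_naturality_id D (Bicategory.yoneda.map h) s
  naturality_comp f g := precomp_naturality_comp D (Bicategory.yoneda.map h) f g

/-- The modification `A(D -, h) ⟶ A(D -, k)` induced by a 2-cell. -/
def homToMap₂ (D : S ⥤ᵖ Aᵒᵖ) {X Y : A} {h k : X ⟶ Y} (η : h ⟶ k) : homToMap D h ⟶ homToMap D k :=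
  ⟨{ app s := (Bicategory.yoneda.map₂ η).as.app (D.obj s)
     naturality f := (Bicategory.yoneda.map₂ η).as.naturality (D.map f) }⟩

/-- The functor `A(C, X) ⥤ [S, Cat](W, A(D -, X))` induced by a `W`-weighted cocone `ω` under `D`
with vertex `C`. -/
def coconeFunctor {W : S ⥤ᵖ Cat.{w, v}} {D : S ⥤ᵖ Aᵒᵖ} {C : A} (ω : W ⟶ homTo D C) (X : A) :
    (C ⟶ X) ⥤ (W ⟶ homTo D X) where
  obj h := ω ≫ homToMap D h
  map η := ω ◁ homToMap₂ D η
  map_id h := by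
    have e : homToMap₂ D (𝟙 h) = 𝟙 (homToMap D h) :=
      Pseudofunctor.StrongTrans.homCategory.ext fun s =>
        congrArg (fun m => m.as.app (D.obj s)) (Bicategory.yoneda.map₂_id h)
    rw [e, whiskerLeft_id]
  map_comp {h k l} η θ := by
    have e : homToMap₂ D (η ≫ θ) = homToMap₂ D η ≫ homToMap₂ D θ :=
      Pseudofunctor.StrongTrans.homCategory.ext fun s =>
        congrArg (fun m => m.as.app (D.obj s)) (Bicategory.yoneda.map₂_comp η θ)
    rw [e, whiskerLeft_comp]

/-- The object `C` is the weighted bicolimit of `D` with weight `W`: there is a universal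
pseudonatural transformation `W ⟶ A(D -, C)`, i.e. one that induces equivalences
`A(C, X) ≃ [S, Cat](W, A(D -, X))`, pseudonatural in `X`. -/
def IsWeightedBicolimit (W : S ⥤ᵖ Cat.{w, v}) (D : S ⥤ᵖ Aᵒᵖ) (C : A) : Prop :=
  ∃ ω : W ⟶ homTo D C, ∀ X : A, (coconeFunctor ω X).IsEquivalence

/-- `C` is the lax codescent object of `D : Δ_ℓᵒᵖ ⥤ᵖ A`. -/
def IsLaxCodescentObject (D : DeltaL ⥤ᵖ Aᵒᵖ) (C : A) : Prop :=
  IsWeightedBicolimit (descentWeight False) D C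

/-- `C` is the codescent object of `D : Δ_ℓᵒᵖ ⥤ᵖ A`. -/
def IsCodescentObject (D : DeltaL ⥤ᵖ Aᵒᵖ) (C : A) : Prop :=
  IsWeightedBicolimit (descentWeight True) D C

end Bicolimits
end BiadjointTriangle
namespace BiadjointTriangle

section Pseudomonads

/-- The 2-cell `F f ≫ F g ⟶ F h ≫ F k` obtained by applying the pseudofunctor `F` to
`α : f ≫ g ⟶ h ≫ k` and composing with the coherence cells of `F`. -/
def hat {B : Type u₁} [Bicategory.{w₁, v₁} B] {C : Type u₂} [Bicategory.{w₂, v₂} C] (F : B ⥤ᵖ C)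
    {X Y Y' Z : B} {f : X ⟶ Y} {g : Y ⟶ Z} {h : X ⟶ Y'} {k : Y' ⟶ Z} (α : f ≫ g ⟶ h ≫ k) :
    F.map f ≫ F.map g ⟶ F.map h ≫ F.map k :=
  (F.mapComp f g).inv ≫ F.map₂ α ≫ (F.mapComp h k).hom

/-- The 2-cell `𝟙 ⟶ F f ≫ F g` obtained from `α : 𝟙 ⟶ f ≫ g`. -/
def hatFromId {B : Type u₁} [Bicategory.{w₁, v₁} B] {C : Type u₂} [Bicategory.{w₂, v₂} C]
    (F : B ⥤ᵖ C) {X Y : B} {f : X ⟶ Y} {g : Y ⟶ X} (α : 𝟙 X ⟶ f ≫ g) :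
    𝟙 (F.obj X) ⟶ F.map f ≫ F.map g :=
  (F.mapId X).inv ≫ F.map₂ α ≫ (F.mapComp f g).hom

/-- The 2-cell `F f ≫ F g ⟶ 𝟙` obtained from `α : f ≫ g ⟶ 𝟙`. -/
def hatToId {B : Type u₁} [Bicategory.{w₁, v₁} B] {C : Type u₂} [Bicategory.{w₂, v₂} C]
    (F : B ⥤ᵖ C) {X Y : B} {f : X ⟶ Y} {g : Y ⟶ X} (α : f ≫ g ⟶ 𝟙 X) :
    F.map f ≫ F.map g ⟶ 𝟙 (F.obj X) :=
  (F.mapComp f g).inv ≫ F.map₂ α ≫ (F.mapId X).hom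

/-- The functor, multiplication and unit of a pseudomonad. -/
structure PseudomonadData (B : Type u) [Bicategory.{w, v} B] where
  T : B ⥤ᵖ B
  m : T.comp T ⟶ T
  η : Pseudofunctor.id B ⟶ T

namespace PseudomonadData

variable {B : Type u} [Bicategory.{w, v} B] (M : PseudomonadData B)

/-- The component `m_X : T T X ⟶ T X`. -/
def mul (X : B) : M.T.obj (M.T.obj X) ⟶ M.T.obj X := M.m.app X

/-- The component `η_X : X ⟶ T X`. -/
def unit (X : B) : X ⟶ M.T.obj X := M.η.app X

/-- The pseudonaturality cell of `m` at `f`. -/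
def mulNat {X Y : B} (f : X ⟶ Y) :
    M.T.map (M.T.map f) ≫ M.mul Y ≅ M.mul X ≫ M.T.map f :=
  M.m.naturality f

/-- The pseudonaturality cell of `η` at `f`. -/
def unitNat {X Y : B} (f : X ⟶ Y) : f ≫ M.unit Y ≅ M.unit X ≫ M.T.map f :=
  M.η.naturality f

theorem mulNat_naturality {X Y : B} {f g : X ⟶ Y} (θ : f ⟶ g) :
    M.T.map₂ (M.T.map₂ θ) ▷ M.mul Y ≫ (M.mulNat g).hom =
      (M.mulNat f).hom ≫ M.mul X ◁ M.T.map₂ θ :=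
  M.m.naturality_naturality θ

theorem unitNat_naturality {X Y : B} {f g : X ⟶ Y} (θ : f ⟶ g) :
    θ ▷ M.unit Y ≫ (M.unitNat g).hom = (M.unitNat f).hom ≫ M.unit X ◁ M.T.map₂ θ :=
  M.η.naturality_naturality θ

theorem mulNat_id (X : B) :
    (M.mulNat (𝟙 X)).hom ≫ M.mul X ◁ (M.T.mapId X).hom =
      (M.T.map₂ (M.T.mapId X).hom ≫ (M.T.mapId (M.T.obj X)).hom) ▷ M.mul X ≫
        (λ_ (M.mul X)).hom ≫ (ρ_ (M.mul X)).inv :=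
  M.m.naturality_id X

theorem unitNat_id (X : B) :
    (M.unitNat (𝟙 X)).hom ≫ M.unit X ◁ (M.T.mapId X).hom =
      (λ_ (M.unit X)).hom ≫ (ρ_ (M.unit X)).inv := by
  have h : (M.unitNat (𝟙 X)).hom ≫ M.unit X ◁ (M.T.mapId X).hom =
      (𝟙 (𝟙 X)) ▷ M.unit X ≫ (λ_ (M.unit X)).hom ≫ (ρ_ (M.unit X)).inv := M.η.naturality_id X
  rw [h, id_whiskerRight, Category.id_comp]

theorem mulNat_comp {X Y Z : B} (f : X ⟶ Y) (g : Y ⟶ Z) :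
    (M.mulNat (f ≫ g)).hom ≫ M.mul X ◁ (M.T.mapComp f g).hom =
      (M.T.map₂ (M.T.mapComp f g).hom ≫ (M.T.mapComp (M.T.map f) (M.T.map g)).hom) ▷ M.mul Z ≫
        (α_ _ _ _).hom ≫ M.T.map (M.T.map f) ◁ (M.mulNat g).hom ≫ (α_ _ _ _).inv ≫
        (M.mulNat f).hom ▷ M.T.map g ≫ (α_ _ _ _).hom :=
  M.m.naturality_comp f g

theorem unitNat_comp {X Y Z : B} (f : X ⟶ Y) (g : Y ⟶ Z) :
    (M.unitNat (f ≫ g)).hom ≫ M.unit X ◁ (M.T.mapComp f g).hom =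
      (α_ _ _ _).hom ≫ f ◁ (M.unitNat g).hom ≫ (α_ _ _ _).inv ≫
        (M.unitNat f).hom ▷ M.T.map g ≫ (α_ _ _ _).hom := by
  have h : (M.unitNat (f ≫ g)).hom ≫ M.unit X ◁ (M.T.mapComp f g).hom =
      (𝟙 (f ≫ g)) ▷ M.unit Z ≫ (α_ _ _ _).hom ≫ f ◁ (M.unitNat g).hom ≫ (α_ _ _ _).inv ≫
        (M.unitNat f).hom ▷ M.T.map g ≫ (α_ _ _ _).hom := M.η.naturality_comp f g
  rw [h, id_whiskerRight, Category.id_comp]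

end PseudomonadData

/-- A pseudomonad on `B`. The invertible modifications `μ : m (T m) ⟹ m (m T)`,
`ι : m (η T) ⟹ 𝟙` and `τ : 𝟙 ⟹ m (T η)` are given by their components and the
modification axioms. -/
structure Pseudomonad (B : Type u) [Bicategory.{w, v} B] extends PseudomonadData B where
  μ (X : B) : T.map (toPseudomonadData.mul X) ≫ toPseudomonadData.mul X ≅
    toPseudomonadData.mul (T.obj X) ≫ toPseudomonadData.mul X
  ι (X : B) : toPseudomonadData.unit (T.obj X) ≫ toPseudomonadData.mul X ≅ 𝟙 (T.obj X)
  τ (X : B) : 𝟙 (T.obj X) ≅ T.map (toPseudomonadData.unit X) ≫ toPseudomonadData.mul X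
  μ_naturality {X Y : B} (f : X ⟶ Y) :
    T.map (T.map (T.map f)) ◁ (μ Y).hom ≫ (α_ _ _ _).inv ≫
      (toPseudomonadData.mulNat (T.map f)).hom ▷ toPseudomonadData.mul Y ≫ (α_ _ _ _).hom ≫
      toPseudomonadData.mul (T.obj X) ◁ (toPseudomonadData.mulNat f).hom ≫ (α_ _ _ _).inv =
    (α_ _ _ _).inv ≫ hat T (toPseudomonadData.mulNat f).hom ▷ toPseudomonadData.mul Y ≫
      (α_ _ _ _).hom ≫ T.map (toPseudomonadData.mul X) ◁ (toPseudomonadData.mulNat f).hom ≫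
      (α_ _ _ _).inv ≫ (μ X).hom ▷ T.map f
  ι_naturality {X Y : B} (f : X ⟶ Y) :
    T.map f ◁ (ι Y).hom ≫ (ρ_ _).hom =
    (α_ _ _ _).inv ≫ (toPseudomonadData.unitNat (T.map f)).hom ▷ toPseudomonadData.mul Y ≫
      (α_ _ _ _).hom ≫ toPseudomonadData.unit (T.obj X) ◁ (toPseudomonadData.mulNat f).hom ≫
      (α_ _ _ _).inv ≫ (ι X).hom ▷ T.map f ≫ (λ_ _).hom
  τ_naturality {X Y : B} (f : X ⟶ Y) :
    (ρ_ _).inv ≫ T.map f ◁ (τ Y).hom ≫ (α_ _ _ _).inv ≫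
      hat T (toPseudomonadData.unitNat f).hom ▷ toPseudomonadData.mul Y ≫ (α_ _ _ _).hom ≫
      T.map (toPseudomonadData.unit X) ◁ (toPseudomonadData.mulNat f).hom ≫ (α_ _ _ _).inv =
    (λ_ _).inv ≫ (τ X).hom ▷ T.map f
  associativity (X : B) :
    (α_ _ _ _).inv ≫ hat T (μ X).hom ▷ toPseudomonadData.mul X ≫ (α_ _ _ _).hom ≫
      T.map (toPseudomonadData.mul (T.obj X)) ◁ (μ X).hom ≫ (α_ _ _ _).inv ≫
      (μ (T.obj X)).hom ▷ toPseudomonadData.mul X ≫ (α_ _ _ _).hom =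
    T.map (T.map (toPseudomonadData.mul X)) ◁ (μ X).hom ≫ (α_ _ _ _).inv ≫
      (toPseudomonadData.mulNat (toPseudomonadData.mul X)).hom ▷ toPseudomonadData.mul X ≫
      (α_ _ _ _).hom ≫ toPseudomonadData.mul (T.obj (T.obj X)) ◁ (μ X).hom
  identity (X : B) :
    (α_ _ _ _).inv ≫ (hatToId T (ι X).hom ≫ (τ (T.obj X)).hom) ▷ toPseudomonadData.mul X ≫
      (α_ _ _ _).hom =
    T.map (toPseudomonadData.unit (T.obj X)) ◁ (μ X).hom

end Pseudomonads
end BiadjointTriangle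
namespace BiadjointTriangle

section LaxAlgebras

variable {B : Type u} [Bicategory.{w, v} B]

/-- A lax `T`-algebra. -/
structure LaxAlgebra (M : Pseudomonad B) where
  carrier : B
  alg : M.T.obj carrier ⟶ carrier
  assoc : M.T.map alg ≫ alg ⟶ M.mul carrier ≫ alg
  unit : 𝟙 carrier ⟶ M.unit carrier ≫ alg
  assoc_assoc :
    (α_ _ _ _).inv ≫ hat M.T assoc ▷ alg ≫ (α_ _ _ _).hom ≫ M.T.map (M.mul carrier) ◁ assoc ≫
      (α_ _ _ _).inv ≫ (M.μ carrier).hom ▷ alg ≫ (α_ _ _ _).hom =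
    M.T.map (M.T.map alg) ◁ assoc ≫ (α_ _ _ _).inv ≫ (M.mulNat alg).hom ▷ alg ≫
      (α_ _ _ _).hom ≫ M.mul (M.T.obj carrier) ◁ assoc
  unit_assoc :
    (ρ_ alg).inv ≫ alg ◁ unit ≫ (α_ _ _ _).inv ≫ (M.unitNat alg).hom ▷ alg ≫ (α_ _ _ _).hom ≫
      M.unit (M.T.obj carrier) ◁ assoc ≫ (α_ _ _ _).inv ≫ (M.ι carrier).hom ▷ alg ≫
      (λ_ alg).hom = 𝟙 alg
  map_unit_assoc :
    (λ_ alg).inv ≫ hatFromId M.T unit ▷ alg ≫ (α_ _ _ _).hom ≫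
      M.T.map (M.unit carrier) ◁ assoc ≫ (α_ _ _ _).inv ≫ (M.τ carrier).inv ▷ alg ≫
      (λ_ alg).hom = 𝟙 alg

variable {M : Pseudomonad B}

/-- A lax morphism of lax `T`-algebras. -/
structure LaxMorphism (y z : LaxAlgebra M) where
  hom : y.carrier ⟶ z.carrier
  cell : M.T.map hom ≫ z.alg ⟶ y.alg ≫ hom
  cell_assoc :
    M.T.map (M.T.map hom) ◁ z.assoc ≫ (α_ _ _ _).inv ≫ (M.mulNat hom).hom ▷ z.alg ≫
      (α_ _ _ _).hom ≫ M.mul y.carrier ◁ cell =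
    (α_ _ _ _).inv ≫ hat M.T cell ▷ z.alg ≫ (α_ _ _ _).hom ≫ M.T.map y.alg ◁ cell ≫
      (α_ _ _ _).inv ≫ y.assoc ▷ hom ≫ (α_ _ _ _).hom
  cell_unit :
    (ρ_ hom).inv ≫ hom ◁ z.unit ≫ (α_ _ _ _).inv ≫ (M.unitNat hom).hom ▷ z.alg ≫
      (α_ _ _ _).hom ≫ M.unit y.carrier ◁ cell =
    (λ_ hom).inv ≫ y.unit ▷ hom ≫ (α_ _ _ _).hom

/-- A 2-cell between lax morphisms. -/
@[ext]
structure LaxCell {y z : LaxAlgebra M} (f g : LaxMorphism y z) where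
  cell : f.hom ⟶ g.hom
  comm : M.T.map₂ cell ▷ z.alg ≫ g.cell = f.cell ≫ y.alg ◁ cell

instance {y z : LaxAlgebra M} : Category (LaxMorphism y z) where
  Hom f g := LaxCell f g
  id f := ⟨𝟙 f.hom, by simp⟩
  comp θ θ' := ⟨θ.cell ≫ θ'.cell, by
    rw [M.T.map₂_comp, comp_whiskerRight, Category.assoc, θ'.comm, ← Category.assoc, θ.comm,
      Category.assoc, ← whiskerLeft_comp]⟩
  id_comp _ := LaxCell.ext (Category.id_comp _)
  comp_id _ := LaxCell.ext (Category.comp_id _)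
  assoc _ _ _ := LaxCell.ext (Category.assoc _ _ _)

/-- The 2-cell of a composite of two lax morphisms. -/
def compCell {y z x : LaxAlgebra M} (f : LaxMorphism y z) (g : LaxMorphism z x) :
    M.T.map (f.hom ≫ g.hom) ≫ x.alg ⟶ y.alg ≫ f.hom ≫ g.hom :=
  (M.T.mapComp f.hom g.hom).hom ▷ x.alg ≫ (α_ _ _ _).hom ≫ M.T.map f.hom ◁ g.cell ≫
    (α_ _ _ _).inv ≫ f.cell ▷ g.hom ≫ (α_ _ _ _).hom

theorem map₂_associator_inv {X Y Z W : B} (F : B ⥤ᵖ B) (f : X ⟶ Y) (g : Y ⟶ Z) (h : Z ⟶ W) :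
    F.map₂ (α_ f g h).inv = (F.mapComp f (g ≫ h)).hom ≫ F.map f ◁ (F.mapComp g h).hom ≫
      (α_ _ _ _).inv ≫ (F.mapComp f g).inv ▷ F.map h ≫ (F.mapComp (f ≫ g) h).inv := by
  have e : F.map₂ (α_ f g h).inv = inv (F.map₂ (α_ f g h).hom) := by
    rw [← F.map₂_inv, IsIso.Iso.inv_hom]
  rw [e]
  apply IsIso.inv_eq_of_hom_inv_id
  rw [F.map₂_associator]
  simp

theorem map₂_rightUnitor_inv {X Y : B} (F : B ⥤ᵖ B) (f : X ⟶ Y) :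
    F.map₂ (ρ_ f).inv = (ρ_ _).inv ≫ F.map f ◁ (F.mapId Y).inv ≫ (F.mapComp f (𝟙 Y)).inv := by
  have e : F.map₂ (ρ_ f).inv = inv (F.map₂ (ρ_ f).hom) := by
    rw [← F.map₂_inv, IsIso.Iso.inv_hom]
  rw [e]
  apply IsIso.inv_eq_of_hom_inv_id
  rw [F.map₂_right_unitor]
  simp

theorem hat_compCell {y z x : LaxAlgebra M} (f : LaxMorphism y z) (g : LaxMorphism z x) :
    hat M.T (compCell f g) = (M.T.map₂ (M.T.mapComp f.hom g.hom).hom ≫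
      (M.T.mapComp (M.T.map f.hom) (M.T.map g.hom)).hom) ▷ M.T.map x.alg ≫ (α_ _ _ _).hom ≫
      M.T.map (M.T.map f.hom) ◁ hat M.T g.cell ≫ (α_ _ _ _).inv ≫ hat M.T f.cell ▷ M.T.map g.hom ≫
      (α_ _ _ _).hom ≫ M.T.map y.alg ◁ (M.T.mapComp f.hom g.hom).inv := by
  simp [hat, compCell, map₂_associator_inv]

/-- The 2-cell of an identity lax morphism. -/
def idCell (y : LaxAlgebra M) : M.T.map (𝟙 y.carrier) ≫ y.alg ⟶ y.alg ≫ 𝟙 y.carrier :=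
  (M.T.mapId y.carrier).hom ▷ y.alg ≫ (λ_ y.alg).hom ≫ (ρ_ y.alg).inv

theorem hat_idCell (y : LaxAlgebra M) :
    hat M.T (idCell y) =
      (M.T.map₂ (M.T.mapId y.carrier).hom ≫ (M.T.mapId (M.T.obj y.carrier)).hom) ▷ M.T.map y.alg ≫
      (λ_ _).hom ≫ (ρ_ _).inv ≫ M.T.map y.alg ◁ (M.T.mapId y.carrier).inv := by
  simp [hat, idCell, map₂_rightUnitor_inv]

/-- The identity lax morphism. -/
def LaxMorphism.id (y : LaxAlgebra M) : LaxMorphism y y where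
  hom := 𝟙 y.carrier
  cell := idCell y
  cell_assoc := by
    have h := M.mulNat_id y.carrier
    rw [hat_idCell]
    generalize M.T.map₂ (M.T.mapId y.carrier).hom ≫ (M.T.mapId (M.T.obj y.carrier)).hom = φ at h ⊢
    calc _ = M.T.map (M.T.map (𝟙 y.carrier)) ◁ y.assoc ≫ (α_ _ _ _).inv ≫
          ((M.mulNat (𝟙 y.carrier)).hom ≫ M.mul y.carrier ◁ (M.T.mapId y.carrier).hom) ▷ y.alg ≫
          (α_ _ _ _).hom ≫ M.mul y.carrier ◁ ((λ_ y.alg).hom ≫ (ρ_ y.alg).inv) := by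
            simp [idCell]
      _ = (M.T.map (M.T.map (𝟙 y.carrier)) ◁ y.assoc ≫ φ ▷ (M.mul y.carrier ≫ y.alg)) ≫
          (λ_ _).hom ≫ (ρ_ _).inv ≫ (α_ _ _ _).hom := by
            rw [h]; simp
      _ = φ ▷ (M.T.map y.alg ≫ y.alg) ≫ 𝟙 _ ◁ y.assoc ≫
          (λ_ _).hom ≫ (ρ_ _).inv ≫ (α_ _ _ _).hom := by
            rw [whisker_exchange, Category.assoc]
      _ = _ := by
        simp [idCell]
  cell_unit := by
    have h := M.unitNat_id y.carrier
    calc _ = (ρ_ (𝟙 y.carrier)).inv ≫ 𝟙 y.carrier ◁ y.unit ≫ (α_ _ _ _).inv ≫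
        ((M.unitNat (𝟙 y.carrier)).hom ≫ M.unit y.carrier ◁ (M.T.mapId y.carrier).hom) ▷ y.alg ≫
          (α_ _ _ _).hom ≫ M.unit y.carrier ◁ ((λ_ y.alg).hom ≫ (ρ_ y.alg).inv) := by
          simp [idCell]
      _ = _ := by
        rw [h]
        simp

/-- The composite of two lax morphisms. -/
def LaxMorphism.comp {y z x : LaxAlgebra M} (f : LaxMorphism y z) (g : LaxMorphism z x) :
    LaxMorphism y x where
  hom := f.hom ≫ g.hom
  cell := compCell f g
  cell_assoc := by
    have h := M.mulNat_comp f.hom g.hom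
    rw [hat_compCell]
    have hf := f.cell_assoc
    have hg := g.cell_assoc
    generalize M.T.map₂ (M.T.mapComp f.hom g.hom).hom ≫
      (M.T.mapComp (M.T.map f.hom) (M.T.map g.hom)).hom = φ at h ⊢
    calc _ = M.T.map (M.T.map (f.hom ≫ g.hom)) ◁ x.assoc ≫ (α_ _ _ _).inv ≫
          ((M.mulNat (f.hom ≫ g.hom)).hom ≫ M.mul y.carrier ◁ (M.T.mapComp f.hom g.hom).hom) ▷
            x.alg ≫ (α_ _ _ _).hom ≫ M.mul y.carrier ◁ ((α_ _ _ _).hom ≫ M.T.map f.hom ◁ g.cell ≫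
    (α_ _ _ _).inv ≫ f.cell ▷ g.hom ≫ (α_ _ _ _).hom) := by
            simp [compCell]
      _ = (M.T.map (M.T.map (f.hom ≫ g.hom)) ◁ x.assoc ≫ φ ▷ (M.mul x.carrier ≫ x.alg)) ⊗≫
          M.T.map (M.T.map f.hom) ◁ (M.mulNat g.hom).hom ▷ x.alg ⊗≫
          ((M.mulNat f.hom).hom ▷ (M.T.map g.hom ≫ x.alg) ≫ 
          (M.mul y.carrier ≫ M.T.map f.hom) ◁ g.cell) ⊗≫
          M.mul y.carrier ◁ f.cell ▷ g.hom ⊗≫ 𝟙 _ := by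
            rw [h]; bicategory
      _ = φ ▷ (M.T.map x.alg ≫ x.alg) ⊗≫
          M.T.map (M.T.map f.hom) ◁ (M.T.map (M.T.map g.hom) ◁ x.assoc ≫ (α_ _ _ _).inv ≫
            (M.mulNat g.hom).hom ▷ x.alg ≫ (α_ _ _ _).hom ≫ M.mul z.carrier ◁ g.cell) ⊗≫
          (M.mulNat f.hom).hom ▷ z.alg ▷ g.hom ⊗≫
          M.mul y.carrier ◁ f.cell ▷ g.hom ⊗≫ 𝟙 _ := by
            rw [whisker_exchange φ x.assoc, ← whisker_exchange (M.mulNat f.hom).hom g.cell]; bicategory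
      _ = φ ▷ (M.T.map x.alg ≫ x.alg) ⊗≫
          M.T.map (M.T.map f.hom) ◁ hat M.T g.cell ▷ x.alg ⊗≫
          M.T.map (M.T.map f.hom) ◁ M.T.map z.alg ◁ g.cell ⊗≫
          (M.T.map (M.T.map f.hom) ◁ z.assoc ≫ (α_ _ _ _).inv ≫ (M.mulNat f.hom).hom ▷ z.alg ≫
          (α_ _ _ _).hom ≫ M.mul y.carrier ◁ f.cell) ▷ g.hom ⊗≫ 𝟙 _ := by
            rw [hg]; bicategory
      _ = φ ▷ (M.T.map x.alg ≫ x.alg) ⊗≫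
          M.T.map (M.T.map f.hom) ◁ hat M.T g.cell ▷ x.alg ⊗≫
          ((M.T.map (M.T.map f.hom) ≫ M.T.map z.alg) ◁ g.cell ≫
          hat M.T f.cell ▷ (z.alg ≫ g.hom)) ⊗≫ M.T.map y.alg ◁ f.cell ▷ g.hom ⊗≫
          y.assoc ▷ (f.hom ≫ g.hom) ⊗≫ 𝟙 _ := by
            rw [hf]; bicategory
      _ = _ := by
        rw [whisker_exchange (hat M.T f.cell) g.cell]
        calc _ = φ ▷ (M.T.map x.alg ≫ x.alg) ⊗≫
              M.T.map (M.T.map f.hom) ◁ hat M.T g.cell ▷ x.alg ⊗≫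
              hat M.T f.cell ▷ (M.T.map g.hom ≫ x.alg) ⊗≫
              M.T.map y.alg ◁ ((M.T.mapComp f.hom g.hom).inv ≫
                (M.T.mapComp f.hom g.hom).hom) ▷ x.alg ⊗≫
              M.T.map y.alg ◁ M.T.map f.hom ◁ g.cell ⊗≫ M.T.map y.alg ◁ f.cell ▷ g.hom ⊗≫
              y.assoc ▷ (f.hom ≫ g.hom) ⊗≫ 𝟙 _ := by
                rw [Iso.inv_hom_id]; bicategory
          _ = _ := by rw [compCell]; bicategory
  cell_unit := by
    have h := M.unitNat_comp f.hom g.hom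
    have hf := f.cell_unit
    have hg := g.cell_unit
    calc _ = (ρ_ (f.hom ≫ g.hom)).inv ≫ (f.hom ≫ g.hom) ◁ x.unit ≫ (α_ _ _ _).inv ≫
          ((M.unitNat (f.hom ≫ g.hom)).hom ≫ M.unit y.carrier ◁ (M.T.mapComp f.hom g.hom).hom) ▷
            x.alg ≫ (α_ _ _ _).hom ≫ M.unit y.carrier ◁ ((α_ _ _ _).hom ≫ M.T.map f.hom ◁ g.cell ≫
    (α_ _ _ _).inv ≫ f.cell ▷ g.hom ≫ (α_ _ _ _).hom) := by
            simp [compCell]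
      _ = 𝟙 _ ⊗≫ f.hom ◁ ((ρ_ g.hom).inv ≫ g.hom ◁ x.unit ≫ (α_ _ _ _).inv ≫
            (M.unitNat g.hom).hom ▷ x.alg ≫ (α_ _ _ _).hom) ⊗≫
          ((M.unitNat f.hom).hom ▷ (M.T.map g.hom ≫ x.alg) ≫ 
          (M.unit y.carrier ≫ M.T.map f.hom) ◁ g.cell) ⊗≫
          M.unit y.carrier ◁ f.cell ▷ g.hom ⊗≫ 𝟙 _ := by
            rw [h]; bicategory
      _ = 𝟙 _ ⊗≫ f.hom ◁ ((ρ_ g.hom).inv ≫ g.hom ◁ x.unit ≫ (α_ _ _ _).inv ≫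
            (M.unitNat g.hom).hom ▷ x.alg ≫ (α_ _ _ _).hom ≫ M.unit z.carrier ◁ g.cell) ⊗≫
          (M.unitNat f.hom).hom ▷ z.alg ▷ g.hom ⊗≫
          M.unit y.carrier ◁ f.cell ▷ g.hom ⊗≫ 𝟙 _ := by
            rw [← whisker_exchange]; bicategory
      _ = 𝟙 _ ⊗≫ ((ρ_ f.hom).inv ≫ f.hom ◁ z.unit ≫ (α_ _ _ _).inv ≫
          (M.unitNat f.hom).hom ▷ z.alg ≫ (α_ _ _ _).hom ≫
          M.unit y.carrier ◁ f.cell) ▷ g.hom ⊗≫ 𝟙 _ := by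
            rw [hg]; bicategory
      _ = _ := by rw [hf]; bicategory

/-- Left whiskering of 2-cells between lax morphisms. -/
def LaxCell.whiskerLeft {y z x : LaxAlgebra M} (f : LaxMorphism y z) {g h : LaxMorphism z x}
    (θ : LaxCell g h) : LaxCell (f.comp g) (f.comp h) where
  cell := f.hom ◁ θ.cell
  comm := by
    change M.T.map₂ (f.hom ◁ θ.cell) ▷ x.alg ≫ compCell f h =
      compCell f g ≫ y.alg ◁ f.hom ◁ θ.cell
    calc _ = (M.T.mapComp f.hom g.hom).hom ▷ x.alg ≫ (α_ _ _ _).hom ≫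
          M.T.map f.hom ◁ (M.T.map₂ θ.cell ▷ x.alg ≫ h.cell) ≫
          (α_ _ _ _).inv ≫ f.cell ▷ h.hom ≫ (α_ _ _ _).hom := by
            simp [compCell]
      _ = (M.T.mapComp f.hom g.hom).hom ▷ x.alg ≫ (α_ _ _ _).hom ≫ M.T.map f.hom ◁ g.cell ≫
          (α_ _ _ _).inv ≫ ((M.T.map f.hom ≫ z.alg) ◁ θ.cell ≫ f.cell ▷ h.hom) ≫
          (α_ _ _ _).hom := by
            rw [θ.comm]; simp
      _ = _ := by
        rw [whisker_exchange]; simp [compCell]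

/-- Right whiskering of 2-cells between lax morphisms. -/
def LaxCell.whiskerRight {y z x : LaxAlgebra M} {f g : LaxMorphism y z} (θ : LaxCell f g)
    (h : LaxMorphism z x) : LaxCell (f.comp h) (g.comp h) where
  cell := θ.cell ▷ h.hom
  comm := by
    change M.T.map₂ (θ.cell ▷ h.hom) ▷ x.alg ≫ compCell g h =
      compCell f h ≫ y.alg ◁ θ.cell ▷ h.hom
    calc _ = (M.T.mapComp f.hom h.hom).hom ▷ x.alg ≫ (α_ _ _ _).hom ≫
          (M.T.map₂ θ.cell ▷ (M.T.map h.hom ≫ x.alg) ≫ M.T.map g.hom ◁ h.cell) ≫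
          (α_ _ _ _).inv ≫ g.cell ▷ h.hom ≫ (α_ _ _ _).hom := by
            simp [compCell]
      _ = (M.T.mapComp f.hom h.hom).hom ▷ x.alg ≫ (α_ _ _ _).hom ≫ M.T.map f.hom ◁ h.cell ≫
          (α_ _ _ _).inv ≫ (M.T.map₂ θ.cell ▷ z.alg ≫ g.cell) ▷ h.hom ≫
          (α_ _ _ _).hom := by
            rw [← whisker_exchange]; simp
      _ = _ := by
        rw [θ.comm]; simp [compCell]

/-- An invertible 2-cell between lax morphisms. -/
def LaxCell.isoMk {y z : LaxAlgebra M} {f g : LaxMorphism y z} (θ : f.hom ≅ g.hom)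
    (h : M.T.map₂ θ.hom ▷ z.alg ≫ g.cell = f.cell ≫ y.alg ◁ θ.hom) : f ≅ g where
  hom := LaxCell.mk θ.hom h
  inv := LaxCell.mk θ.inv (by
    rw [← cancel_epi (M.T.map₂ θ.hom ▷ z.alg), ← Category.assoc, ← comp_whiskerRight,
      ← M.T.map₂_comp, θ.hom_inv_id, ← Category.assoc, h, Category.assoc, ← whiskerLeft_comp,
      θ.hom_inv_id]
    simp)
  hom_inv_id := LaxCell.ext θ.hom_inv_id
  inv_hom_id := LaxCell.ext θ.inv_hom_id

theorem associator_comm {y z x t : LaxAlgebra M} (f : LaxMorphism y z) (g : LaxMorphism z x)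
    (h : LaxMorphism x t) :
    M.T.map₂ (α_ f.hom g.hom h.hom).hom ▷ t.alg ≫ (f.comp (g.comp h)).cell =
      ((f.comp g).comp h).cell ≫ y.alg ◁ (α_ f.hom g.hom h.hom).hom := by
  change M.T.map₂ (α_ f.hom g.hom h.hom).hom ▷ t.alg ≫ ((M.T.mapComp f.hom (g.hom ≫ h.hom)).hom ▷
      t.alg ≫ (α_ _ _ _).hom ≫ M.T.map f.hom ◁ (compCell g h) ≫
    (α_ _ _ _).inv ≫ f.cell ▷ (g.hom ≫ h.hom) ≫ (α_ _ _ _).hom) =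
    ((M.T.mapComp (f.hom ≫ g.hom) h.hom).hom ▷ t.alg ≫ (α_ _ _ _).hom ≫
      M.T.map (f.hom ≫ g.hom) ◁ h.cell ≫
    (α_ _ _ _).inv ≫ compCell f g ▷ h.hom ≫ (α_ _ _ _).hom) ≫ _
  simp only [compCell]
  calc _ = (M.T.mapComp (f.hom ≫ g.hom) h.hom).hom ▷ t.alg ≫
        (α_ _ _ _).hom ≫ ((M.T.mapComp f.hom g.hom).hom ▷ (M.T.map h.hom ≫ t.alg) ≫
        (M.T.map f.hom ≫ M.T.map g.hom) ◁ h.cell) ⊗≫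
        M.T.map f.hom ◁ g.cell ▷ h.hom ⊗≫ f.cell ▷ (g.hom ≫ h.hom) ⊗≫ 𝟙 _ := by
        rw [M.T.map₂_associator]
        simp only [comp_whiskerRight, whiskerLeft_comp, Category.assoc,
          inv_hom_whiskerRight_assoc]
        have e : (M.T.mapComp g.hom h.hom).inv ▷ t.alg ≫ (M.T.mapComp g.hom h.hom).hom ▷ t.alg =
          𝟙 _ := inv_hom_whiskerRight _ _
        calc _ = (M.T.mapComp (f.hom ≫ g.hom) h.hom).hom ▷ t.alg ⊗≫
              (M.T.mapComp f.hom g.hom).hom ▷ (M.T.map h.hom ≫ t.alg) ⊗≫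
              M.T.map f.hom ◁ ((M.T.mapComp g.hom h.hom).inv ▷ t.alg ≫
                (M.T.mapComp g.hom h.hom).hom ▷ t.alg) ⊗≫
              (M.T.map f.hom ≫ M.T.map g.hom) ◁ h.cell ⊗≫
              M.T.map f.hom ◁ g.cell ▷ h.hom ⊗≫ f.cell ▷ (g.hom ≫ h.hom) ⊗≫ 𝟙 _ := by bicategory
          _ = _ := by rw [e]; bicategory
    _ = _ := by
      rw [← whisker_exchange]; bicategory

theorem leftUnitor_comm {y z : LaxAlgebra M} (f : LaxMorphism y z) :
    M.T.map₂ (λ_ f.hom).hom ▷ z.alg ≫ f.cell =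
      ((LaxMorphism.id y).comp f).cell ≫ y.alg ◁ (λ_ f.hom).hom := by
  change _ = compCell (LaxMorphism.id y) f ≫ _
  change _ = ((M.T.mapComp (𝟙 _) f.hom).hom ▷ z.alg ≫ (α_ _ _ _).hom ≫
      M.T.map (𝟙 _) ◁ f.cell ≫ (α_ _ _ _).inv ≫ idCell y ▷ f.hom ≫ (α_ _ _ _).hom) ≫ _
  rw [M.T.map₂_left_unitor, idCell]
  calc _ = (M.T.mapComp (𝟙 _) f.hom).hom ▷ z.alg ≫ (α_ _ _ _).hom ≫
        ((M.T.mapId _).hom ▷ (M.T.map f.hom ≫ z.alg) ≫ 𝟙 _ ◁ f.cell) ⊗≫ 𝟙 _ := by bicategory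
    _ = _ := by rw [← whisker_exchange]; bicategory

theorem rightUnitor_comm {y z : LaxAlgebra M} (f : LaxMorphism y z) :
    M.T.map₂ (ρ_ f.hom).hom ▷ z.alg ≫ f.cell =
      (f.comp (LaxMorphism.id z)).cell ≫ y.alg ◁ (ρ_ f.hom).hom := by
  change _ = ((M.T.mapComp f.hom (𝟙 _)).hom ▷ z.alg ≫ (α_ _ _ _).hom ≫
      M.T.map f.hom ◁ idCell z ≫ (α_ _ _ _).inv ≫ f.cell ▷ (𝟙 _) ≫ (α_ _ _ _).hom) ≫ _
  rw [M.T.map₂_right_unitor, idCell]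
  bicategory

variable (M) in
/-- The 2-category `Lax-T-Alg_ℓ` of lax `T`-algebras and lax morphisms. -/
def LaxAlgL : Type max u v w := LaxAlgebra M

instance : CategoryStruct (LaxAlgL M) where
  Hom (y z : LaxAlgebra M) := LaxMorphism y z
  id (y : LaxAlgebra M) := LaxMorphism.id y
  comp {y z x : LaxAlgebra M} (f : LaxMorphism y z) (g : LaxMorphism z x) := f.comp g

instance : Bicategory (LaxAlgL M) where
  homCategory (y z : LaxAlgebra M) := inferInstanceAs (Category (LaxMorphism y z))
  whiskerLeft f _ _ θ := LaxCell.whiskerLeft f θ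
  whiskerRight θ f := LaxCell.whiskerRight θ f
  associator f g h := LaxCell.isoMk (α_ _ _ _) (associator_comm f g h)
  leftUnitor f := LaxCell.isoMk (λ_ _) (leftUnitor_comm f)
  rightUnitor f := LaxCell.isoMk (ρ_ _) (rightUnitor_comm f)
  whiskerLeft_id _ _ := LaxCell.ext (whiskerLeft_id _ _)
  whiskerLeft_comp _ _ _ _ _ _ := LaxCell.ext (whiskerLeft_comp _ _ _)
  id_whiskerLeft _ := LaxCell.ext (id_whiskerLeft _)
  comp_whiskerLeft _ _ _ _ _ := LaxCell.ext (comp_whiskerLeft _ _ _)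
  id_whiskerRight _ _ := LaxCell.ext (id_whiskerRight _ _)
  comp_whiskerRight _ _ _ := LaxCell.ext (comp_whiskerRight _ _ _)
  whiskerRight_id _ := LaxCell.ext (whiskerRight_id _)
  whiskerRight_comp _ _ _ := LaxCell.ext (whiskerRight_comp _ _ _)
  whisker_assoc _ _ _ _ _ := LaxCell.ext (whisker_assoc _ _ _)
  whisker_exchange _ _ := LaxCell.ext (whisker_exchange _ _)
  pentagon _ _ _ _ := LaxCell.ext (pentagon _ _ _ _)
  triangle _ _ := LaxCell.ext (triangle _ _)

/-- A pseudomorphism of lax `T`-algebras: a lax morphism whose 2-cell is invertible. -/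
structure PseudoMorphism (y z : LaxAlgebra M) extends LaxMorphism y z where
  isIso : IsIso cell

instance {y z : LaxAlgebra M} : Category (PseudoMorphism y z) where
  Hom f g := LaxCell f.toLaxMorphism g.toLaxMorphism
  id f := 𝟙 f.toLaxMorphism
  comp {f g h} θ θ' :=
    CategoryStruct.comp (X := f.toLaxMorphism) (Y := g.toLaxMorphism) (Z := h.toLaxMorphism) θ θ'
  id_comp _ := LaxCell.ext (Category.id_comp _)
  comp_id _ := LaxCell.ext (Category.comp_id _)
  assoc _ _ _ := LaxCell.ext (Category.assoc _ _ _)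

/-- The identity pseudomorphism. -/
def PseudoMorphism.id (y : LaxAlgebra M) : PseudoMorphism y y where
  toLaxMorphism := LaxMorphism.id y
  isIso := by
    change IsIso ((M.T.mapId y.carrier).hom ▷ y.alg ≫ (λ_ y.alg).hom ≫ (ρ_ y.alg).inv)
    infer_instance

/-- The composite of two pseudomorphisms. -/
def PseudoMorphism.comp {y z x : LaxAlgebra M} (f : PseudoMorphism y z) (g : PseudoMorphism z x) :
    PseudoMorphism y x where
  toLaxMorphism := f.toLaxMorphism.comp g.toLaxMorphism
  isIso := by
    have := f.isIso
    have := g.isIso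
    change IsIso (compCell f.toLaxMorphism g.toLaxMorphism)
    rw [compCell]
    infer_instance

/-- An invertible 2-cell between pseudomorphisms. -/
def PseudoMorphism.isoMk {y z : LaxAlgebra M} {f g : PseudoMorphism y z}
    (θ : f.toLaxMorphism ≅ g.toLaxMorphism) : f ≅ g where
  hom := θ.hom
  inv := θ.inv
  hom_inv_id := θ.hom_inv_id
  inv_hom_id := θ.inv_hom_id

variable (M) in
/-- The 2-category `Lax-T-Alg` of lax `T`-algebras and pseudomorphisms, a locally full
sub-2-category of `Lax-T-Alg_ℓ`. -/
def LaxAlg : Type max u v w := LaxAlgebra M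

instance : CategoryStruct (LaxAlg M) where
  Hom (y z : LaxAlgebra M) := PseudoMorphism y z
  id (y : LaxAlgebra M) := PseudoMorphism.id y
  comp {y z x : LaxAlgebra M} (f : PseudoMorphism y z) (g : PseudoMorphism z x) := f.comp g

instance : Bicategory (LaxAlg M) where
  homCategory (y z : LaxAlgebra M) := inferInstanceAs (Category (PseudoMorphism y z))
  whiskerLeft f _ _ θ := LaxCell.whiskerLeft f.toLaxMorphism θ
  whiskerRight θ f := LaxCell.whiskerRight θ f.toLaxMorphism
  associator f g h := PseudoMorphism.isoMk (LaxCell.isoMk (α_ _ _ _) (associator_comm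
    f.toLaxMorphism g.toLaxMorphism h.toLaxMorphism))
  leftUnitor f := PseudoMorphism.isoMk (LaxCell.isoMk (λ_ _) (leftUnitor_comm f.toLaxMorphism))
  rightUnitor f := PseudoMorphism.isoMk (LaxCell.isoMk (ρ_ _) (rightUnitor_comm f.toLaxMorphism))
  whiskerLeft_id _ _ := LaxCell.ext (whiskerLeft_id _ _)
  whiskerLeft_comp _ _ _ _ _ _ := LaxCell.ext (whiskerLeft_comp _ _ _)
  id_whiskerLeft _ := LaxCell.ext (id_whiskerLeft _)
  comp_whiskerLeft _ _ _ _ _ := LaxCell.ext (comp_whiskerLeft _ _ _)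
  id_whiskerRight _ _ := LaxCell.ext (id_whiskerRight _ _)
  comp_whiskerRight _ _ _ := LaxCell.ext (comp_whiskerRight _ _ _)
  whiskerRight_id _ := LaxCell.ext (whiskerRight_id _)
  whiskerRight_comp _ _ _ := LaxCell.ext (whiskerRight_comp _ _ _)
  whisker_assoc _ _ _ _ _ := LaxCell.ext (whisker_assoc _ _ _)
  whisker_exchange _ _ := LaxCell.ext (whisker_exchange _ _)
  pentagon _ _ _ _ := LaxCell.ext (pentagon _ _ _ _)
  triangle _ _ := LaxCell.ext (triangle _ _)

theorem associator_eq_refl {X Y Z W : B} (f : X ⟶ Y) (g : Y ⟶ Z) (h : Z ⟶ W) :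
    (α_ f g h).hom = 𝟙 _ ≫ 𝟙 (f ≫ g) ▷ h ≫ (α_ f g h).hom ≫ f ◁ 𝟙 (g ≫ h) ≫ 𝟙 _ := by
  simp

theorem leftUnitor_eq_refl {X Y : B} (f : X ⟶ Y) :
    (λ_ f).hom = 𝟙 _ ≫ 𝟙 (𝟙 X) ▷ f ≫ (λ_ f).hom := by
  simp

theorem rightUnitor_eq_refl {X Y : B} (f : X ⟶ Y) :
    (ρ_ f).hom = 𝟙 _ ≫ f ◁ 𝟙 (𝟙 Y) ≫ (ρ_ f).hom := by
  simp

variable (M) in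
/-- The inclusion `ℓ : Lax-T-Alg ⥤ Lax-T-Alg_ℓ`. -/
def inclusionL : LaxAlg M ⥤ᵖ LaxAlgL M where
  obj (y : LaxAlgebra M) := (y : LaxAlgebra M)
  map f := PseudoMorphism.toLaxMorphism f
  map₂ θ := θ
  map₂_id _ := rfl
  map₂_comp _ _ := rfl
  mapId (y : LaxAlgebra M) := Iso.refl (LaxMorphism.id y)
  mapComp {y z x : LaxAlgebra M} (f : PseudoMorphism y z) (g : PseudoMorphism z x) :=
    Iso.refl (f.toLaxMorphism.comp g.toLaxMorphism)
  map₂_whisker_left _ _ _ _ :=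
    LaxCell.ext ((Category.id_comp _).trans (Category.comp_id _)).symm
  map₂_whisker_right _ _ := LaxCell.ext ((Category.id_comp _).trans (Category.comp_id _)).symm
  map₂_associator _ _ _ := LaxCell.ext (associator_eq_refl _ _ _)
  map₂_left_unitor _ := LaxCell.ext (leftUnitor_eq_refl _)
  map₂_right_unitor _ := LaxCell.ext (rightUnitor_eq_refl _)

variable (M) in
/-- The forgetful 2-functor `U : Lax-T-Alg ⥤ B`. -/
def forget : LaxAlg M ⥤ᵖ B where
  obj y := LaxAlgebra.carrier y
  map f := LaxMorphism.hom (PseudoMorphism.toLaxMorphism f)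
  map₂ θ := LaxCell.cell θ
  map₂_id _ := rfl
  map₂_comp _ _ := rfl
  mapId y := Iso.refl (𝟙 (LaxAlgebra.carrier y))
  mapComp f g := Iso.refl (LaxMorphism.hom (PseudoMorphism.toLaxMorphism f) ≫
    LaxMorphism.hom (PseudoMorphism.toLaxMorphism g))
  map₂_whisker_left _ _ _ _ := ((Category.id_comp _).trans (Category.comp_id _)).symm
  map₂_whisker_right _ _ := ((Category.id_comp _).trans (Category.comp_id _)).symm
  map₂_associator _ _ _ := associator_eq_refl _ _ _
  map₂_left_unitor _ := leftUnitor_eq_refl _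
  map₂_right_unitor _ := rightUnitor_eq_refl _

end LaxAlgebras
end BiadjointTriangle
namespace BiadjointTriangle

section Biadjunctions

variable {A : Type u₁} [Bicategory.{w₁, v₁} A] {B : Type u₂} [Bicategory.{w₂, v₂} B]

/-- The unit and the counit of a biadjunction. -/
structure BiadjunctionData (E : B ⥤ᵖ A) (R : A ⥤ᵖ B) where
  unitTrans : Pseudofunctor.id B ⟶ E.comp R
  counitTrans : R.comp E ⟶ Pseudofunctor.id A

namespace BiadjunctionData

variable {E : B ⥤ᵖ A} {R : A ⥤ᵖ B} (D : BiadjunctionData E R)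

/-- The component `ρ_X : X ⟶ R E X`. -/
def unit (X : B) : X ⟶ R.obj (E.obj X) := D.unitTrans.app X

/-- The component `ε_X : E R X ⟶ X`. -/
def counit (X : A) : E.obj (R.obj X) ⟶ X := D.counitTrans.app X

/-- The pseudonaturality cell of `ρ` at `f`. -/
def unitNat {X Y : B} (f : X ⟶ Y) : f ≫ D.unit Y ≅ D.unit X ≫ R.map (E.map f) :=
  D.unitTrans.naturality f

/-- The pseudonaturality cell of `ε` at `g`. -/
def counitNat {X Y : A} (g : X ⟶ Y) : E.map (R.map g) ≫ D.counit Y ≅ D.counit X ≫ g :=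
  D.counitTrans.naturality g

end BiadjunctionData

/-- A biadjunction `E ⊣ R`. The invertible modifications `v : 𝟙 ⟹ (ε E) (E ρ)` and
`w : (R ε) (ρ R) ⟹ 𝟙` are given by their components and the modification axioms. -/
structure Biadjunction (E : B ⥤ᵖ A) (R : A ⥤ᵖ B) extends BiadjunctionData E R where
  v (X : B) : 𝟙 (E.obj X) ≅
    E.map (toBiadjunctionData.unit X) ≫ toBiadjunctionData.counit (E.obj X)
  w (X : A) : toBiadjunctionData.unit (R.obj X) ≫ R.map (toBiadjunctionData.counit X) ≅
    𝟙 (R.obj X)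
  v_naturality {X Y : B} (f : X ⟶ Y) :
    (ρ_ _).inv ≫ E.map f ◁ (v Y).hom ≫ (α_ _ _ _).inv ≫
      hat E (toBiadjunctionData.unitNat f).hom ▷ toBiadjunctionData.counit (E.obj Y) ≫
      (α_ _ _ _).hom ≫
      E.map (toBiadjunctionData.unit X) ◁ (toBiadjunctionData.counitNat (E.map f)).hom ≫
      (α_ _ _ _).inv =
    (λ_ _).inv ≫ (v X).hom ▷ E.map f
  w_naturality {X Y : A} (g : X ⟶ Y) :
    R.map g ◁ (w Y).hom ≫ (ρ_ _).hom =
    (α_ _ _ _).inv ≫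
      (toBiadjunctionData.unitNat (R.map g)).hom ▷ R.map (toBiadjunctionData.counit Y) ≫
      (α_ _ _ _).hom ≫
      toBiadjunctionData.unit (R.obj X) ◁ hat R (toBiadjunctionData.counitNat g).hom ≫
      (α_ _ _ _).inv ≫ (w X).hom ▷ R.map g ≫ (λ_ _).hom
  counit_triangle (X : A) :
    (λ_ _).inv ≫ (v (R.obj X)).hom ▷ toBiadjunctionData.counit X ≫ (α_ _ _ _).hom ≫
      E.map (toBiadjunctionData.unit (R.obj X)) ◁
        (toBiadjunctionData.counitNat (toBiadjunctionData.counit X)).inv ≫ (α_ _ _ _).inv ≫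
      hatToId E (w X).hom ▷ toBiadjunctionData.counit X ≫ (λ_ _).hom =
    𝟙 (toBiadjunctionData.counit X)
  unit_triangle (X : B) :
    (ρ_ _).inv ≫ toBiadjunctionData.unit X ◁ hatFromId R (v X).hom ≫ (α_ _ _ _).inv ≫
      (toBiadjunctionData.unitNat (toBiadjunctionData.unit X)).inv ▷
        R.map (toBiadjunctionData.counit (E.obj X)) ≫ (α_ _ _ _).hom ≫
      toBiadjunctionData.unit X ◁ (w (E.obj X)).hom ≫ (ρ_ _).hom =
    𝟙 (toBiadjunctionData.unit X)

/-- The pseudofunctor `R` is right biadjoint. -/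
def IsRightBiadjoint (R : A ⥤ᵖ B) : Prop :=
  ∃ E : B ⥤ᵖ A, Nonempty (Biadjunction E R)

end Biadjunctions

section Triangle

variable {A : Type u₁} [Bicategory.{w₁, v₁} A] {B : Type u₂} [Bicategory.{w₂, v₂} B]
  {M : Pseudomonad B} {E : B ⥤ᵖ A} {J : A ⥤ᵖ LaxAlg M}

/-- The lax algebra `J X`. -/
abbrev jObj (J : A ⥤ᵖ LaxAlg M) (X : A) : LaxAlgebra M := J.obj X

/-- The pseudomorphism `J g`. -/
abbrev jMap (J : A ⥤ᵖ LaxAlg M) {X Y : A} (g : X ⟶ Y) : PseudoMorphism (jObj J X) (jObj J Y) :=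
  J.map g

/-- The invertible 2-cell `⟨J g⟩`. -/
noncomputable def jCell (J : A ⥤ᵖ LaxAlg M) {X Y : A} (g : X ⟶ Y) :
    M.T.map (jMap J g).hom ≫ (jObj J Y).alg ≅ (jObj J X).alg ≫ (jMap J g).hom :=
  @asIso _ _ _ _ (jMap J g).cell (jMap J g).isIso

variable (adj : Biadjunction E (J.comp (forget M)))

/-- The unit `ρ_X : X ⟶ U J E X`. -/
def rho (X : B) : X ⟶ (jObj J (E.obj X)).carrier := adj.unit X

/-- The counit `ε_X : E U J X ⟶ X`. -/
def eps (X : A) : E.obj (jObj J X).carrier ⟶ X := adj.counit X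

/-- The pseudonaturality cell of `ρ`. -/
def rhoNat {X Y : B} (f : X ⟶ Y) :
    f ≫ rho adj Y ≅ rho adj X ≫ (jMap J (E.map f)).hom :=
  adj.unitNat f

/-- The pseudonaturality cell of `ε`. -/
def epsNat {X Y : A} (g : X ⟶ Y) :
    E.map (jMap J g).hom ≫ eps adj Y ≅ eps adj X ≫ g :=
  adj.counitNat g

/-- The invertible 2-cell `v_X : 𝟙 ⟶ ε_{EX} E(ρ_X)`. -/
def vIso (X : B) : 𝟙 (E.obj X) ≅ E.map (rho adj X) ≫ eps adj (E.obj X) := adj.v X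

/-- The invertible 2-cell `w_X : UJ(ε_X) ρ_{UJX} ⟶ 𝟙`. -/
def wIso (X : A) : rho adj (jObj J X).carrier ≫ (jMap J (eps adj X)).hom ≅ 𝟙 (jObj J X).carrier :=
  adj.w X

/-- The 1-cell `alg_{JEX} T(ρ_X) : T X ⟶ U J E X`. -/
def kHom (X : B) : M.T.obj X ⟶ (jObj J (E.obj X)).carrier :=
  M.T.map (rho adj X) ≫ (jObj J (E.obj X)).alg

/-- The 1-cell `ε_{EX} E(alg_{JEX} T(ρ_X)) : E T X ⟶ E X`. -/
def cHom (X : B) : E.obj (M.T.obj X) ⟶ E.obj X := E.map (kHom adj X) ≫ eps adj (E.obj X)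

/-- The 2-cell `(⟨JE(f)⟩ * T(ρ_X)) · (alg_{JEY} * (T ρ)_f⁻¹)` for `f : X ⟶ Y`. -/
noncomputable def kIso {X Y : B} (f : X ⟶ Y) :
    M.T.map f ≫ kHom adj Y ≅ kHom adj X ≫ (jMap J (E.map f)).hom :=
  (α_ _ _ _).symm ≪≫
    whiskerRightIso ((M.T.mapComp f (rho adj Y)).symm ≪≫ M.T.map₂Iso (rhoNat adj f) ≪≫
      M.T.mapComp (rho adj X) (jMap J (E.map f)).hom) (jObj J (E.obj Y)).alg ≪≫
    α_ _ _ _ ≪≫ whiskerLeftIso (M.T.map (rho adj X)) (jCell J (E.map f)) ≪≫ (α_ _ _ _).symm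

/-- The 2-cell expressing that `cHom` is pseudonatural at `f`. -/
noncomputable def cIso {X Y : B} (f : X ⟶ Y) :
    E.map (M.T.map f) ≫ cHom adj Y ≅ cHom adj X ≫ E.map f :=
  (α_ _ _ _).symm ≪≫
    whiskerRightIso ((E.mapComp (M.T.map f) (kHom adj Y)).symm ≪≫ E.map₂Iso (kIso adj f) ≪≫
      E.mapComp (kHom adj X) (jMap J (E.map f)).hom) (eps adj (E.obj Y)) ≪≫
    α_ _ _ _ ≪≫ whiskerLeftIso (E.map (kHom adj X)) (epsNat adj (E.map f)) ≪≫ (α_ _ _ _).symm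

/-- The 2-cell `(alg_{JX} * T(w_X)) · (⟨J(ε_X)⟩⁻¹ * T(ρ_{UJX}))`. -/
noncomputable def kCounit (X : A) :
    kHom adj (jObj J X).carrier ≫ (jMap J (eps adj X)).hom ⟶ (jObj J X).alg :=
  (α_ _ _ _).hom ≫ M.T.map (rho adj (jObj J X).carrier) ◁ (jCell J (eps adj X)).inv ≫
    (α_ _ _ _).inv ≫ hatToId M.T (wIso adj X).hom ▷ (jObj J X).alg ≫ (λ_ _).hom

/-- The 2-cell `ε_X ε_{EUJX} E(alg_{JEUJX} T(ρ_{UJX})) ⟶ ε_X E(alg_{JX})` induced by `kCounit` and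
the pseudonaturality of `ε` at `ε_X`. -/
noncomputable def cCounit (X : A) :
    cHom adj (jObj J X).carrier ≫ eps adj X ⟶ E.map (jObj J X).alg ≫ eps adj X :=
  (α_ _ _ _).hom ≫ E.map (kHom adj (jObj J X).carrier) ◁ (epsNat adj (eps adj X)).inv ≫
    (α_ _ _ _).inv ≫
    ((E.mapComp (kHom adj (jObj J X).carrier) (jMap J (eps adj X)).hom).inv ≫
      E.map₂ (kCounit adj X)) ▷ eps adj X

/-- The 2-cell `(alg_{JEX} * m_{ρ_X}⁻¹) · (JEX-associator * T²(ρ_X))`. -/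
def kMul (X : B) :
    M.T.map (kHom adj X) ≫ (jObj J (E.obj X)).alg ⟶ M.mul X ≫ kHom adj X :=
  (M.T.mapComp (M.T.map (rho adj X)) (jObj J (E.obj X)).alg).hom ▷ (jObj J (E.obj X)).alg ≫
    (α_ _ _ _).hom ≫ M.T.map (M.T.map (rho adj X)) ◁ (jObj J (E.obj X)).assoc ≫
    (α_ _ _ _).inv ≫ (M.mulNat (rho adj X)).hom ▷ (jObj J (E.obj X)).alg ≫ (α_ _ _ _).hom

/-- The value of the diagram on `σ₂₁`. -/
noncomputable def sigma21Cell (X : B) :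
    cHom adj (M.T.obj X) ≫ cHom adj X ⟶ E.map (M.mul X) ≫ cHom adj X :=
  (α_ _ _ _).inv ≫ (cIso adj (kHom adj X)).inv ▷ eps adj (E.obj X) ≫ (α_ _ _ _).hom ≫
    E.map (M.T.map (kHom adj X)) ◁ cCounit adj (E.obj X) ≫ (α_ _ _ _).inv ≫
    hat E (kMul adj X) ▷ eps adj (E.obj X) ≫ (α_ _ _ _).hom

/-- The 2-cell `(alg_{JEX} * η_{ρ_X}⁻¹) · (JEX-unit * ρ_X)`. -/
def kUnit (X : B) : rho adj X ⟶ M.unit X ≫ kHom adj X :=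
  (ρ_ _).inv ≫ rho adj X ◁ (jObj J (E.obj X)).unit ≫ (α_ _ _ _).inv ≫
    (M.unitNat (rho adj X)).hom ▷ (jObj J (E.obj X)).alg ≫ (α_ _ _ _).hom

/-- The value of the diagram on `n₁`. -/
def n1Cell (X : B) : 𝟙 (E.obj X) ⟶ E.map (M.unit X) ≫ cHom adj X :=
  (vIso adj X).hom ≫ (E.map₂ (kUnit adj X) ≫ (E.mapComp (M.unit X) (kHom adj X)).hom) ▷
    eps adj (E.obj X) ≫ (α_ _ _ _).hom

/-- The 2-cell of `Aᵒᵖ` given by a 2-cell of `A`, up to left unitors. -/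
def opCell {X Y Y' Z : A} {f : X ⟶ Y} {g : Y ⟶ Z} {f' : X ⟶ Y'} {g' : Y' ⟶ Z}
    (θ : f ≫ g ⟶ f' ≫ g') :
    (𝟙 (Opposite.op Z) ≫ g.op) ≫ f.op ⟶ (𝟙 (Opposite.op Z) ≫ g'.op) ≫ f'.op :=
  (λ_ g.op).hom ▷ f.op ≫ Bicategory.Opposite.op2 θ ≫ (λ_ g'.op).inv ▷ f'.op

/-- The 2-cell of `Aᵒᵖ` given by a 2-cell of `A` with an identity as its domain, up to a
left unitor. -/
def opCellFromId {X Y : A} {f : X ⟶ Y} {g : Y ⟶ X} (θ : 𝟙 X ⟶ f ≫ g) :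
    𝟙 (Opposite.op X) ⟶ (𝟙 (Opposite.op X) ≫ g.op) ≫ f.op :=
  Bicategory.Opposite.op2 θ ≫ (λ_ g.op).inv ▷ f.op

/-- The underlying graph morphism of the diagram `𝒜_y`, with values in `Aᵒᵖ`. -/
def diagramPrefunctor (y : LaxAlgebra M) : DeltaObj ⥤q Aᵒᵖ where
  obj
    | .one => .op (E.obj y.carrier)
    | .two => .op (E.obj (M.T.obj y.carrier))
    | .three => .op (E.obj (M.T.obj (M.T.obj y.carrier)))
  map
    | .d0 => (E.map y.alg).op
    | .d1 => (cHom adj y.carrier).op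
    | .s0 => (E.map (M.unit y.carrier)).op
    | .e0 => (E.map (M.T.map y.alg)).op
    | .e1 => (E.map (M.mul y.carrier)).op
    | .e2 => (cHom adj (M.T.obj y.carrier)).op

/-- The generating data of the diagram `𝒜_y`. -/
noncomputable def diagramInterp (y : LaxAlgebra M) : deltaComputad.Interp Aᵒᵖ where
  toPrefunctor := diagramPrefunctor adj y
  cell
    | .sigma00 => opCell (hat E y.assoc)
    | .sigma20 => opCell (cIso adj y.alg).inv
    | .sigma21 => opCell (sigma21Cell adj y.carrier)
    | .n0 => opCellFromId (hatFromId E y.unit)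
    | .n1 => opCellFromId (n1Cell adj y.carrier)

/-- The diagram `𝒜_y : Δ_ℓᵒᵖ ⥤ A`, regarded as a pseudofunctor `Δ_ℓ ⥤ᵖ Aᵒᵖ`. -/
noncomputable def diagram (y : LaxAlgebra M) : DeltaL ⥤ᵖ Aᵒᵖ :=
  Computad.Interp.lift (P := deltaComputad.free) (diagramInterp adj y) (fun h => h.elim)

end Triangle
end BiadjointTriangle

namespace BiadjointTriangle

/-! ### Biuniversal arrows, and the biadjunction that a choice of them determines -/

section Biuniversal

variable {A : Type u₁} [Bicategory.{w₁, v₁} A] {C : Type u₂} [Bicategory.{w₂, v₂} C]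

/-! The theorem is about representability, one lax algebra at a time. A pseudofunctor `U` has a left
biadjoint exactly when every object `z` of its target has a biuniversal arrow `z ⟶ U a`, one such
that `g ↦ u ≫ U g` is an equivalence from `A(a, X)` to the hom-category `(z, U X)` for every `X`;
any choice of such objects `a` is the object part of a left biadjoint. This is the content of
`Biadjunction.isBiuniversal`, `BiuniversalFamily.biadjunction` and
`isRightBiadjoint_characterization`. It remains to see that `C` is a (lax) codescent object of `𝒜_y`
if and only if there is a biuniversal arrow `y ⟶ J C`. Both conditions say that `C` represents the
same thing, and codescent data link the two.

On the side of algebras, consider a lax morphism `f : y ⟶ J X`. Since `E ⊣ R`, its 1-cell is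
isomorphic to `ρ ≫ R h` for some `h : E Y ⟶ X`. Naturality of the algebra structures along `J` makes
`T (ρ ≫ R h) ≫ alg` isomorphic to the transpose of `c ≫ h` (`algPost`), while `alg_y ≫ ρ ≫ R h` is
isomorphic to the transpose of `E alg_y ≫ h` (`precompIso`). Hence the 2-cell of `f` corresponds to
a 2-cell `ϑ : c ≫ h ⟶ E alg_y ≫ h`. The 2-cells of `𝒜_y` are precisely the ones for which the two
axioms of a lax morphism become the two axioms of a codescent datum (`assoc_transposeCell_iff`,
`unit_transposeCell_iff`); the heart of that is the pair `algPost_mul` and `algPost_unit`. So lax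
morphisms `y ⟶ J X` are equivalent to codescent data with vertex `X` (`datumToLax`), and
pseudomorphisms to those with invertible `ϑ` (`datumToPseudo`).

On the side of bicolimits, a cocone with weight `Δ̇_ℓ(0, t-)` is determined up to isomorphism by its
value at `d` and its value at `ϑ`, because `Δ̇_ℓ` is presented by generators and relations.
Evaluation there, `descentEval`, is an equivalence onto codescent data. It is fully faithful by
induction over 1-cells and pastings, and essentially surjective because a codescent datum extends
the diagram to a pseudofunctor on `Δ̇_ℓ`, whose action on the 1-cells out of `0` is the desired
cocone.

Finally the composite of `coconeFunctor ω X` with these two equivalences is isomorphic to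
transposition along the lax morphism of `ω`, so that universal cocones and biuniversal arrows
correspond. The two halves of the theorem are treated together through a proposition `inv`, which
records whether `ϑ` has to be invertible. -/

theorem map₂_associator_inv' (F : A ⥤ᵖ C) {X Y Z W : A} (f : X ⟶ Y) (g : Y ⟶ Z) (h : Z ⟶ W) :
    F.map₂ (α_ f g h).inv = (F.mapComp f (g ≫ h)).hom ≫ F.map f ◁ (F.mapComp g h).hom ≫
      (α_ _ _ _).inv ≫ (F.mapComp f g).inv ▷ F.map h ≫ (F.mapComp (f ≫ g) h).inv := by
  rw [F.mapComp_assoc_right_hom_assoc]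
  simp

theorem map₂_rightUnitor_inv' (F : A ⥤ᵖ C) {X Y : A} (f : X ⟶ Y) :
    F.map₂ (ρ_ f).inv = (ρ_ _).inv ≫ F.map f ◁ (F.mapId Y).inv ≫ (F.mapComp f (𝟙 Y)).inv := by
  rw [F.whiskerLeft_mapId_inv_assoc]
  simp

theorem map₂_leftUnitor_inv' (F : A ⥤ᵖ C) {X Y : A} (f : X ⟶ Y) :
    F.map₂ (λ_ f).inv = (λ_ _).inv ≫ (F.mapId X).inv ▷ F.map f ≫ (F.mapComp (𝟙 X) f).inv := by
  rw [F.whiskerRight_mapId_inv_assoc]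
  simp

/-- The functor `A(a, X) ⥤ C(z, U X)` induced by a 1-cell `u : z ⟶ U a`. -/
@[simps]
def transpose (U : A ⥤ᵖ C) {z : C} {a : A} (u : z ⟶ U.obj a) (X : A) :
    (a ⟶ X) ⥤ (z ⟶ U.obj X) where
  obj g := u ≫ U.map g
  map θ := u ◁ U.map₂ θ

/-- The 1-cell `u : z ⟶ U a` is a biuniversal arrow from `z` to `U`. -/
def IsBiuniversal (U : A ⥤ᵖ C) {z : C} {a : A} (u : z ⟶ U.obj a) : Prop :=
  ∀ X : A, (transpose U u X).IsEquivalence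

/-- Faithfulness of the transposition. Every coherence law of the left biadjoint is an equation of
2-cells of `A`, and this is what allows it to be checked in `C`. -/
theorem IsBiuniversal.ext {U : A ⥤ᵖ C} {z : C} {a : A} {u : z ⟶ U.obj a} (hu : IsBiuniversal U u)
    {X : A} {p q : a ⟶ X} {α β : p ⟶ q} (h : u ◁ U.map₂ α = u ◁ U.map₂ β) : α = β := by
  have := hu X
  exact (transpose U u X).map_injective h

theorem IsBiuniversal.exists_hom {U : A ⥤ᵖ C} {z : C} {a : A} {u : z ⟶ U.obj a}
    (hu : IsBiuniversal U u) {X : A} {p q : a ⟶ X} (α : u ≫ U.map p ⟶ u ≫ U.map q) :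
    ∃ β : p ⟶ q, u ◁ U.map₂ β = α := by
  have := hu X
  exact (transpose U u X).map_surjective α

theorem IsBiuniversal.exists_iso {U : A ⥤ᵖ C} {z : C} {a : A} {u : z ⟶ U.obj a}
    (hu : IsBiuniversal U u) {X : A} {p q : a ⟶ X} (α : u ≫ U.map p ≅ u ≫ U.map q) :
    ∃ β : p ≅ q, u ◁ U.map₂ β.hom = α.hom := by
  have := hu X
  exact ⟨(transpose U u X).preimageIso α, (transpose U u X).map_preimage α.hom⟩

theorem IsBiuniversal.exists_obj {U : A ⥤ᵖ C} {z : C} {a : A} {u : z ⟶ U.obj a}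
    (hu : IsBiuniversal U u) {X : A} (f : z ⟶ U.obj X) :
    ∃ g : a ⟶ X, Nonempty (f ≅ u ≫ U.map g) := by
  have := hu X
  exact ⟨(transpose U u X).objPreimage f, ⟨((transpose U u X).objObjPreimageIso f).symm⟩⟩

/-- A choice of biuniversal arrows from the objects of `C` to the pseudofunctor `U`,
together with the data which they determine. -/
structure BiuniversalFamily (U : A ⥤ᵖ C) where
  obj : C → A
  unit (y : C) : y ⟶ U.obj (obj y)
  isBiuniversal (y : C) : IsBiuniversal U (unit y)
  map {y z : C} (f : y ⟶ z) : obj y ⟶ obj z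
  unitNat {y z : C} (f : y ⟶ z) : f ≫ unit z ≅ unit y ≫ U.map (map f)
  map₂ {y z : C} {f g : y ⟶ z} (θ : f ⟶ g) : map f ⟶ map g
  unitNat_naturality {y z : C} {f g : y ⟶ z} (θ : f ⟶ g) :
    (unitNat f).hom ≫ unit y ◁ U.map₂ (map₂ θ) = θ ▷ unit z ≫ (unitNat g).hom
  mapId (y : C) : map (𝟙 y) ≅ 𝟙 (obj y)
  unitNat_id (y : C) : (unitNat (𝟙 y)).hom ≫ unit y ◁ U.map₂ (mapId y).hom =
    (λ_ _).hom ≫ (ρ_ _).inv ≫ unit y ◁ (U.mapId _).inv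
  mapComp {y z x : C} (f : y ⟶ z) (g : z ⟶ x) : map (f ≫ g) ≅ map f ≫ map g
  unitNat_comp {y z x : C} (f : y ⟶ z) (g : z ⟶ x) :
    (unitNat (f ≫ g)).hom ≫ unit y ◁ U.map₂ (mapComp f g).hom =
      (α_ _ _ _).hom ≫ f ◁ (unitNat g).hom ≫ (α_ _ _ _).inv ≫
        (unitNat f).hom ▷ U.map (map g) ≫ (α_ _ _ _).hom ≫ unit y ◁ (U.mapComp _ _).inv
  counit (X : A) : obj (U.obj X) ⟶ X
  w (X : A) : unit (U.obj X) ≫ U.map (counit X) ≅ 𝟙 (U.obj X)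
  counitNat {X Y : A} (g : X ⟶ Y) : map (U.map g) ≫ counit Y ≅ counit X ≫ g
  counitNat_spec {X Y : A} (g : X ⟶ Y) :
    unit (U.obj X) ◁ U.map₂ (counitNat g).hom =
      unit (U.obj X) ◁ (U.mapComp _ _).hom ≫ (α_ _ _ _).inv ≫
      (unitNat (U.map g)).inv ▷ U.map (counit Y) ≫ (α_ _ _ _).hom ≫
      U.map g ◁ (w Y).hom ≫ (ρ_ _).hom ≫ (λ_ _).inv ≫ (w X).inv ▷ U.map g ≫ (α_ _ _ _).hom ≫
      unit (U.obj X) ◁ (U.mapComp _ _).inv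
  v (y : C) : 𝟙 (obj y) ≅ map (unit y) ≫ counit (obj y)
  v_spec (y : C) :
    unit y ◁ U.map₂ (v y).hom =
      unit y ◁ (U.mapId _).hom ≫ unit y ◁ (w (obj y)).inv ≫ (α_ _ _ _).inv ≫
      (unitNat (unit y)).hom ▷ U.map (counit (obj y)) ≫ (α_ _ _ _).hom ≫
      unit y ◁ (U.mapComp _ _).inv

/-- On objects and 1-cells the data exist by essential surjectivity of the transposition, on 2-cells
by fullness. Each 2-cell is chosen so that its transpose is a prescribed pasting, which becomes the
equation recorded in the corresponding field. -/
theorem exists_biuniversalFamily (U : A ⥤ᵖ C) (obj : C → A) (unit : ∀ y : C, y ⟶ U.obj (obj y))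
    (hu : ∀ y, IsBiuniversal U (unit y)) : ∃ F : BiuniversalFamily U, F.obj = obj := by
  choose map e using fun (y z : C) (f : y ⟶ z) => (hu y).exists_obj (f ≫ unit z)
  -- These isomorphisms are arbitrary. Only their existence matters, so nothing is lost when `have`
  -- hides their values.
  have e' : ∀ (y z : C) (f : y ⟶ z), f ≫ unit z ≅ unit y ≫ U.map (map y z f) :=
    fun y z f => (e y z f).some
  clear e
  choose map₂ h₂ using fun (y z : C) (f g : y ⟶ z) (θ : f ⟶ g) =>
    (hu y).exists_hom ((e' y z f).inv ≫ θ ▷ unit z ≫ (e' y z g).hom)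
  choose mapId hId using fun (y : C) => (hu y).exists_iso
    ((e' y y (𝟙 y)).symm ≪≫ λ_ _ ≪≫ (ρ_ _).symm ≪≫ whiskerLeftIso (unit y) (U.mapId _).symm)
  choose mapComp hComp using fun (y z x : C) (f : y ⟶ z) (g : z ⟶ x) => (hu y).exists_iso
    ((e' y x (f ≫ g)).symm ≪≫ α_ _ _ _ ≪≫ whiskerLeftIso f (e' z x g) ≪≫ (α_ _ _ _).symm ≪≫
      whiskerRightIso (e' y z f) (U.map (map z x g)) ≪≫ α_ _ _ _ ≪≫
      whiskerLeftIso (unit y) (U.mapComp _ _).symm)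
  choose counit c using fun X : A => (hu (U.obj X)).exists_obj (𝟙 (U.obj X))
  have w : ∀ X : A, unit (U.obj X) ≫ U.map (counit X) ≅ 𝟙 (U.obj X) := fun X => (c X).some.symm
  clear c
  -- Transposed, both 1-cells are isomorphic to `U.map g`, the first by means of `w Y` and the
  -- second by means of `w X`.
  choose counitNat hNat using fun (X Y : A) (g : X ⟶ Y) => (hu (U.obj X)).exists_iso
    (p := map _ _ (U.map g) ≫ counit Y) (q := counit X ≫ g)
    (whiskerLeftIso (unit (U.obj X)) (U.mapComp _ _) ≪≫ (α_ _ _ _).symm ≪≫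
      whiskerRightIso (e' _ _ (U.map g)).symm (U.map (counit Y)) ≪≫ α_ _ _ _ ≪≫
      whiskerLeftIso (U.map g) (w Y) ≪≫ ρ_ _ ≪≫ (λ_ _).symm ≪≫
      whiskerRightIso (w X).symm (U.map g) ≪≫ α_ _ _ _ ≪≫
      whiskerLeftIso (unit (U.obj X)) (U.mapComp _ _).symm)
  -- The transpose of `v` is forced by the unit triangle: it is `w⁻¹` followed by the naturality
  -- cell of the unit at the unit.
  choose v hv using fun (y : C) => (hu y).exists_iso
    (p := 𝟙 (obj y)) (q := map _ _ (unit y) ≫ counit (obj y))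
    (whiskerLeftIso (unit y) (U.mapId _) ≪≫ whiskerLeftIso (unit y) (w (obj y)).symm ≪≫
      (α_ _ _ _).symm ≪≫ whiskerRightIso (e' _ _ (unit y)) (U.map (counit (obj y))) ≪≫
      α_ _ _ _ ≪≫ whiskerLeftIso (unit y) (U.mapComp _ _).symm)
  exact ⟨{
    obj := obj
    unit := unit
    isBiuniversal := hu
    map := map _ _
    unitNat := e' _ _
    map₂ := map₂ _ _ _ _
    unitNat_naturality := fun θ => by rw [h₂]; simp
    mapId := mapId
    unitNat_id := fun y => by rw [hId]; simp
    mapComp := mapComp _ _ _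
    unitNat_comp := fun f g => by rw [hComp]; simp
    counit := counit
    w := w
    counitNat := counitNat _ _
    counitNat_spec := fun g => by rw [hNat]; simp
    v := v
    v_spec := fun y => by rw [hv]; simp }, rfl⟩

namespace BiuniversalFamily

variable {U : A ⥤ᵖ C} (F : BiuniversalFamily U)

/-- Prefixing `unitNat f` replaces the transpose of `F.map f` by `f ≫ unit z`, the form in which the
defining equations of the family can be applied one after the other. -/
theorem hom_ext {y z : C} {f : y ⟶ z} {q : F.obj y ⟶ F.obj z} {α β : F.map f ⟶ q}
    (h : (F.unitNat f).hom ≫ F.unit y ◁ U.map₂ α = (F.unitNat f).hom ≫ F.unit y ◁ U.map₂ β) :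
    α = β :=
  (F.isBiuniversal y).ext ((cancel_epi _).1 h)

theorem map₂_comp {y z : C} {f g h : y ⟶ z} (θ : f ⟶ g) (θ' : g ⟶ h) :
    F.map₂ (θ ≫ θ') = F.map₂ θ ≫ F.map₂ θ' := by
  apply F.hom_ext
  rw [F.unitNat_naturality, U.map₂_comp, whiskerLeft_comp, reassoc_of% F.unitNat_naturality θ,
    F.unitNat_naturality, comp_whiskerRight, Category.assoc]

theorem mapComp_naturality_left {y z x : C} {f f' : y ⟶ z} (θ : f ⟶ f') (g : z ⟶ x) :
    F.map₂ (θ ▷ g) ≫ (F.mapComp f' g).hom = (F.mapComp f g).hom ≫ F.map₂ θ ▷ F.map g := by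
  apply F.hom_ext
  have h := F.unitNat_naturality θ
  rw [U.map₂_comp, whiskerLeft_comp, reassoc_of% F.unitNat_naturality (θ ▷ g), F.unitNat_comp,
    U.map₂_comp, whiskerLeft_comp, reassoc_of% F.unitNat_comp f g, U.map₂_whisker_right]
  calc _ = 𝟙 _ ⊗≫ (θ ▷ (g ≫ F.unit x) ≫ f' ◁ (F.unitNat g).hom) ⊗≫
        (F.unitNat f').hom ▷ U.map (F.map g) ⊗≫ F.unit y ◁ (U.mapComp _ _).inv := by bicategory
    _ = 𝟙 _ ⊗≫ f ◁ (F.unitNat g).hom ⊗≫ (θ ▷ F.unit z ≫ (F.unitNat f').hom) ▷ U.map (F.map g) ⊗≫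
        F.unit y ◁ (U.mapComp _ _).inv := by rw [← whisker_exchange]; bicategory
    _ = 𝟙 _ ⊗≫ f ◁ (F.unitNat g).hom ⊗≫ (F.unitNat f).hom ▷ U.map (F.map g) ⊗≫
        F.unit y ◁ ((U.mapComp (F.map f) (F.map g)).inv ≫ (U.mapComp _ _).hom) ⊗≫
        F.unit y ◁ U.map₂ (F.map₂ θ) ▷ U.map (F.map g) ⊗≫
        F.unit y ◁ (U.mapComp _ _).inv := by rw [← h, Iso.inv_hom_id]; bicategory
    _ = _ := by bicategory

theorem mapComp_naturality_right {y z x : C} (f : y ⟶ z) {g g' : z ⟶ x} (θ : g ⟶ g') :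
    F.map₂ (f ◁ θ) ≫ (F.mapComp f g').hom = (F.mapComp f g).hom ≫ F.map f ◁ F.map₂ θ := by
  apply F.hom_ext
  have h := F.unitNat_naturality θ
  rw [U.map₂_comp, whiskerLeft_comp, reassoc_of% F.unitNat_naturality (f ◁ θ), F.unitNat_comp,
    U.map₂_comp, whiskerLeft_comp, reassoc_of% F.unitNat_comp f g, U.map₂_whisker_left]
  calc _ = 𝟙 _ ⊗≫ f ◁ (θ ▷ F.unit x ≫ (F.unitNat g').hom) ⊗≫
        (F.unitNat f).hom ▷ U.map (F.map g') ⊗≫ F.unit y ◁ (U.mapComp _ _).inv := by bicategory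
    _ = 𝟙 _ ⊗≫ f ◁ (F.unitNat g).hom ⊗≫
        ((f ≫ F.unit z) ◁ U.map₂ (F.map₂ θ) ≫ (F.unitNat f).hom ▷ U.map (F.map g')) ⊗≫
        F.unit y ◁ (U.mapComp _ _).inv := by rw [← h]; bicategory
    _ = 𝟙 _ ⊗≫ f ◁ (F.unitNat g).hom ⊗≫ (F.unitNat f).hom ▷ U.map (F.map g) ⊗≫
        F.unit y ◁ ((U.mapComp (F.map f) (F.map g)).inv ≫ (U.mapComp _ _).hom) ⊗≫
        F.unit y ◁ U.map (F.map f) ◁ U.map₂ (F.map₂ θ) ⊗≫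
        F.unit y ◁ (U.mapComp _ _).inv := by rw [whisker_exchange, Iso.inv_hom_id]; bicategory
    _ = _ := by bicategory

/-- Transposed, both sides become the pasting of `unitNat h`, `unitNat g` and `unitNat f`. Whatever
else occurs is a comparison cell of `U` that meets its inverse. -/
theorem map₂_associator {y z x t : C} (f : y ⟶ z) (g : z ⟶ x) (h : x ⟶ t) :
    F.map₂ (α_ f g h).hom ≫ (F.mapComp f (g ≫ h)).hom ≫ F.map f ◁ (F.mapComp g h).hom =
      (F.mapComp (f ≫ g) h).hom ≫ (F.mapComp f g).hom ▷ F.map h ≫ (α_ _ _ _).hom := by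
  apply F.hom_ext
  simp only [U.map₂_comp, whiskerLeft_comp]
  rw [reassoc_of% F.unitNat_naturality (α_ f g h).hom, reassoc_of% F.unitNat_comp f (g ≫ h),
    reassoc_of% F.unitNat_comp (f ≫ g) h, U.map₂_whisker_left, U.map₂_whisker_right,
    U.map₂_associator]
  have h1 := F.unitNat_comp g h
  have h2 := F.unitNat_comp f g
  calc _ = 𝟙 _ ⊗≫ f ◁ (F.unitNat (g ≫ h)).hom ⊗≫ (F.unitNat f).hom ▷ U.map (F.map (g ≫ h)) ⊗≫
        F.unit y ◁ ((U.mapComp (F.map f) (F.map (g ≫ h))).inv ≫ (U.mapComp _ _).hom) ⊗≫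
        F.unit y ◁ U.map (F.map f) ◁ U.map₂ (F.mapComp g h).hom ⊗≫
        F.unit y ◁ (U.mapComp _ _).inv := by bicategory
    _ = 𝟙 _ ⊗≫ f ◁ (F.unitNat (g ≫ h)).hom ⊗≫ ((F.unitNat f).hom ▷ U.map (F.map (g ≫ h)) ≫
        (F.unit y ≫ U.map (F.map f)) ◁ U.map₂ (F.mapComp g h).hom) ⊗≫
        F.unit y ◁ (U.mapComp _ _).inv := by rw [Iso.inv_hom_id]; bicategory
    _ = 𝟙 _ ⊗≫ f ◁ ((F.unitNat (g ≫ h)).hom ≫ F.unit z ◁ U.map₂ (F.mapComp g h).hom) ⊗≫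
        (F.unitNat f).hom ▷ U.map (F.map g ≫ F.map h) ⊗≫
        F.unit y ◁ (U.mapComp _ _).inv := by rw [← whisker_exchange]; bicategory
    _ = 𝟙 _ ⊗≫ f ◁ g ◁ (F.unitNat h).hom ⊗≫ f ◁ (F.unitNat g).hom ▷ U.map (F.map h) ⊗≫
        ((f ≫ F.unit z) ◁ (U.mapComp _ _).inv ≫
        (F.unitNat f).hom ▷ U.map (F.map g ≫ F.map h)) ⊗≫
        F.unit y ◁ (U.mapComp _ _).inv := by rw [h1]; bicategory
    _ = 𝟙 _ ⊗≫ f ◁ g ◁ (F.unitNat h).hom ⊗≫ f ◁ (F.unitNat g).hom ▷ U.map (F.map h) ⊗≫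
        (F.unitNat f).hom ▷ U.map (F.map g) ▷ U.map (F.map h) ⊗≫
        F.unit y ◁ U.map (F.map f) ◁ (U.mapComp (F.map g) (F.map h)).inv ⊗≫
        F.unit y ◁ (U.mapComp _ _).inv := by rw [whisker_exchange]; bicategory
    _ = 𝟙 _ ⊗≫ f ◁ g ◁ (F.unitNat h).hom ⊗≫
        (𝟙 (f ≫ g ≫ F.unit x) ⊗≫ f ◁ (F.unitNat g).hom ⊗≫ (F.unitNat f).hom ▷ U.map (F.map g) ⊗≫
        F.unit y ◁ ((U.mapComp (F.map f) (F.map g)).inv ≫ (U.mapComp _ _).hom)) ▷ U.map (F.map h) ⊗≫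
        F.unit y ◁ U.map (F.map f) ◁ (U.mapComp (F.map g) (F.map h)).inv ⊗≫
        F.unit y ◁ (U.mapComp _ _).inv := by rw [Iso.inv_hom_id]; bicategory
    _ = 𝟙 _ ⊗≫ (f ≫ g) ◁ (F.unitNat h).hom ⊗≫
        ((F.unitNat (f ≫ g)).hom ≫ F.unit y ◁ U.map₂ (F.mapComp f g).hom) ▷ U.map (F.map h) ⊗≫
        F.unit y ◁ (U.mapComp (F.map f) (F.map g)).hom ▷ U.map (F.map h) ⊗≫
        F.unit y ◁ U.map (F.map f) ◁ (U.mapComp (F.map g) (F.map h)).inv ⊗≫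
        F.unit y ◁ (U.mapComp _ _).inv := by rw [h2]; bicategory
    _ = 𝟙 _ ⊗≫ (f ≫ g) ◁ (F.unitNat h).hom ⊗≫ (F.unitNat (f ≫ g)).hom ▷ U.map (F.map h) ⊗≫
        F.unit y ◁ ((U.mapComp (F.map (f ≫ g)) (F.map h)).inv ≫ (U.mapComp _ _).hom) ⊗≫
        F.unit y ◁ U.map₂ (F.mapComp f g).hom ▷ U.map (F.map h) ⊗≫
        F.unit y ◁ ((U.mapComp (F.map f ≫ F.map g) (F.map h)).inv ≫ (U.mapComp _ _).hom) ⊗≫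
        F.unit y ◁ (U.mapComp (F.map f) (F.map g)).hom ▷ U.map (F.map h) ⊗≫
        F.unit y ◁ U.map (F.map f) ◁ (U.mapComp (F.map g) (F.map h)).inv ⊗≫
        F.unit y ◁ (U.mapComp _ _).inv := by
          rw [Iso.inv_hom_id, Iso.inv_hom_id]; bicategory
    _ = _ := by bicategory

theorem map₂_leftUnitor {y z : C} (f : y ⟶ z) :
    F.map₂ (λ_ f).hom = (F.mapComp (𝟙 y) f).hom ≫ (F.mapId y).hom ▷ F.map f ≫ (λ_ _).hom := by
  apply F.hom_ext
  simp only [U.map₂_comp, whiskerLeft_comp]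
  rw [F.unitNat_naturality (λ_ f).hom, reassoc_of% F.unitNat_comp (𝟙 y) f,
    U.map₂_whisker_right, U.map₂_left_unitor]
  have h := F.unitNat_id y
  calc _ = 𝟙 _ ⊗≫ (𝟙 y ◁ (F.unitNat f).hom) ⊗≫
        ((λ_ _).hom ≫ (ρ_ _).inv ≫ F.unit y ◁ (U.mapId _).inv) ▷ U.map (F.map f) ⊗≫
        F.unit y ◁ (U.mapId _).hom ▷ U.map (F.map f) ⊗≫ 𝟙 _ := by
          simp [bicategoricalComp]
    _ = 𝟙 _ ⊗≫ (𝟙 y ◁ (F.unitNat f).hom) ⊗≫ (F.unitNat (𝟙 y)).hom ▷ U.map (F.map f) ⊗≫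
        F.unit y ◁ ((U.mapComp (F.map (𝟙 y)) (F.map f)).inv ≫ (U.mapComp _ _).hom) ⊗≫
        F.unit y ◁ U.map₂ (F.mapId y).hom ▷ U.map (F.map f) ⊗≫
        F.unit y ◁ ((U.mapComp (𝟙 (F.obj y)) (F.map f)).inv ≫ (U.mapComp _ _).hom) ⊗≫
        F.unit y ◁ (U.mapId _).hom ▷ U.map (F.map f) ⊗≫ 𝟙 _ := by
          rw [← h, Iso.inv_hom_id, Iso.inv_hom_id]; bicategory
    _ = _ := by bicategory

theorem map₂_rightUnitor {y z : C} (f : y ⟶ z) :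
    F.map₂ (ρ_ f).hom = (F.mapComp f (𝟙 z)).hom ≫ F.map f ◁ (F.mapId z).hom ≫ (ρ_ _).hom := by
  apply F.hom_ext
  simp only [U.map₂_comp, whiskerLeft_comp]
  rw [F.unitNat_naturality (ρ_ f).hom, reassoc_of% F.unitNat_comp f (𝟙 z),
    U.map₂_whisker_left, U.map₂_right_unitor]
  have h := F.unitNat_id z
  symm
  calc _ = 𝟙 _ ⊗≫ f ◁ (F.unitNat (𝟙 z)).hom ⊗≫ (F.unitNat f).hom ▷ U.map (F.map (𝟙 z)) ⊗≫
        F.unit y ◁ ((U.mapComp (F.map f) (F.map (𝟙 z))).inv ≫ (U.mapComp _ _).hom) ⊗≫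
        F.unit y ◁ U.map (F.map f) ◁ U.map₂ (F.mapId z).hom ⊗≫
        F.unit y ◁ ((U.mapComp (F.map f) (𝟙 (F.obj z))).inv ≫ (U.mapComp _ _).hom) ⊗≫
        F.unit y ◁ U.map (F.map f) ◁ (U.mapId _).hom ⊗≫ 𝟙 _ := by bicategory
    _ = 𝟙 _ ⊗≫ f ◁ (F.unitNat (𝟙 z)).hom ⊗≫ ((F.unitNat f).hom ▷ U.map (F.map (𝟙 z)) ≫
        (F.unit y ≫ U.map (F.map f)) ◁ (U.map₂ (F.mapId z).hom ≫ (U.mapId _).hom)) ⊗≫ 𝟙 _ := by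
          rw [Iso.inv_hom_id, Iso.inv_hom_id]; bicategory
    _ = 𝟙 _ ⊗≫ f ◁ ((F.unitNat (𝟙 z)).hom ≫ F.unit z ◁ U.map₂ (F.mapId z).hom) ⊗≫
        f ◁ F.unit z ◁ (U.mapId _).hom ⊗≫ (F.unitNat f).hom ▷ 𝟙 _ ⊗≫ 𝟙 _ := by
          rw [← whisker_exchange]; bicategory
    _ = 𝟙 _ ⊗≫ f ◁ F.unit z ◁ ((U.mapId _).inv ≫ (U.mapId _).hom) ⊗≫ (F.unitNat f).hom ⊗≫ 𝟙 _ := by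
          rw [h]; bicategory
    _ = _ := by rw [Iso.inv_hom_id]; bicategory

/-- The pseudofunctor determined by a family of biuniversal arrows. -/
def pseudofunctor : C ⥤ᵖ A where
  obj := F.obj
  map := F.map
  map₂ := F.map₂
  map₂_id f := by
    apply F.hom_ext
    rw [F.unitNat_naturality]
    simp
  map₂_comp := F.map₂_comp
  mapId := F.mapId
  mapComp := F.mapComp
  map₂_whisker_left f _ _ θ := by
    rw [← reassoc_of% F.mapComp_naturality_right, Iso.hom_inv_id, Category.comp_id]
  map₂_whisker_right θ g := by
    rw [← reassoc_of% F.mapComp_naturality_left, Iso.hom_inv_id, Category.comp_id]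
  map₂_associator f g h := by
    rw [← reassoc_of% F.map₂_associator, whiskerLeft_hom_inv_assoc, Iso.hom_inv_id,
      Category.comp_id]
  map₂_left_unitor := F.map₂_leftUnitor
  map₂_right_unitor := F.map₂_rightUnitor

/-- The unit of the biadjunction determined by a family of biuniversal arrows. -/
def unitTrans : Pseudofunctor.id C ⟶ F.pseudofunctor.comp U where
  app := F.unit
  naturality := F.unitNat
  naturality_naturality θ := (F.unitNat_naturality θ).symm
  naturality_id y := by
    change (F.unitNat (𝟙 y)).hom ≫ F.unit y ◁ (U.map₂ (F.mapId y).hom ≫ (U.mapId _).hom) =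
      𝟙 (𝟙 y) ▷ F.unit y ≫ (λ_ (F.unit y)).hom ≫ (ρ_ (F.unit y)).inv
    rw [whiskerLeft_comp, reassoc_of% F.unitNat_id]
    simp
  naturality_comp f g := by
    change (F.unitNat (f ≫ g)).hom ≫ F.unit _ ◁ (U.map₂ (F.mapComp f g).hom ≫ (U.mapComp _ _).hom) =
      𝟙 (f ≫ g) ▷ F.unit _ ≫ (α_ _ _ _).hom ≫ f ◁ (F.unitNat g).hom ≫ (α_ _ _ _).inv ≫
        (F.unitNat f).hom ▷ U.map (F.map g) ≫ (α_ _ _ _).hom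
    rw [whiskerLeft_comp, reassoc_of% F.unitNat_comp]
    simp

/-- Fixes a normal form for the transpose of a 2-cell out of `F.map f ≫ r`. The rules that follow
compute this form for whiskerings and composites, so that the laws of the counit are proved by
chaining them. -/
theorem comp_hom_ext {y z : C} {X : A} {f : y ⟶ z} {r : F.obj z ⟶ X} {q : F.obj y ⟶ X}
    {α β : F.map f ≫ r ⟶ q}
    (h : (F.unitNat f).hom ▷ U.map r ≫ (α_ _ _ _).hom ≫ F.unit y ◁ (U.mapComp _ _).inv ≫
        F.unit y ◁ U.map₂ α =
      (F.unitNat f).hom ▷ U.map r ≫ (α_ _ _ _).hom ≫ F.unit y ◁ (U.mapComp _ _).inv ≫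
        F.unit y ◁ U.map₂ β) : α = β := by
  apply (F.isBiuniversal y).ext
  simpa only [cancel_epi] using h

/-- The specification of `counitNat` in normal form; moving `w X` to the other side turns it into
the modification axiom for `w`. -/
theorem unitNat_counitNat {X Y : A} (g : X ⟶ Y) :
    (F.unitNat (U.map g)).hom ▷ U.map (F.counit Y) ≫ (α_ _ _ _).hom ≫
      F.unit (U.obj X) ◁ (U.mapComp _ _).inv ≫ F.unit (U.obj X) ◁ U.map₂ (F.counitNat g).hom =
    (α_ _ _ _).hom ≫ U.map g ◁ (F.w Y).hom ≫ (ρ_ _).hom ≫ (λ_ _).inv ≫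
      (F.w X).inv ▷ U.map g ≫ (α_ _ _ _).hom ≫ F.unit (U.obj X) ◁ (U.mapComp _ _).inv := by
  rw [F.counitNat_spec]
  simp

theorem unitNat_naturality_whiskerRight {y z : C} {X : A} {f g : y ⟶ z} (θ : f ⟶ g)
    (r : F.obj z ⟶ X) :
    (F.unitNat f).hom ▷ U.map r ≫ (α_ _ _ _).hom ≫ F.unit y ◁ (U.mapComp _ _).inv ≫
      F.unit y ◁ U.map₂ (F.map₂ θ ▷ r) =
    θ ▷ F.unit z ▷ U.map r ≫ (F.unitNat g).hom ▷ U.map r ≫ (α_ _ _ _).hom ≫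
      F.unit y ◁ (U.mapComp _ _).inv := by
  have h := congrArg (fun t => t ▷ U.map r ≫ (α_ _ _ _).hom ≫ F.unit y ◁ (U.mapComp _ _).inv)
    (F.unitNat_naturality θ)
  simpa using h

theorem counitNat_naturality {X Y : A} {g g' : X ⟶ Y} (θ : g ⟶ g') :
    F.map₂ (U.map₂ θ) ▷ F.counit Y ≫ (F.counitNat g').hom =
      (F.counitNat g).hom ≫ F.counit X ◁ θ := by
  apply F.comp_hom_ext
  rw [U.map₂_comp, whiskerLeft_comp, reassoc_of% F.unitNat_naturality_whiskerRight (U.map₂ θ),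
    F.unitNat_counitNat, U.map₂_comp, whiskerLeft_comp, reassoc_of% F.unitNat_counitNat g,
    U.map₂_whisker_left]
  calc _ = 𝟙 _ ⊗≫ (U.map₂ θ ▷ (F.unit _ ≫ U.map (F.counit Y)) ≫ U.map g' ◁ (F.w Y).hom) ⊗≫
        (F.w X).inv ▷ U.map g' ⊗≫ F.unit _ ◁ (U.mapComp _ _).inv := by bicategory
    _ = 𝟙 _ ⊗≫ U.map g ◁ (F.w Y).hom ⊗≫
        (𝟙 _ ◁ U.map₂ θ ≫ (F.w X).inv ▷ U.map g') ⊗≫ F.unit _ ◁ (U.mapComp _ _).inv := by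
          rw [← whisker_exchange]; bicategory
    _ = _ := by
      rw [whisker_exchange]; simp [bicategoricalComp]

theorem unitNat_whiskerLeft {y z : C} {X : A} (f : y ⟶ z) {r s : F.obj z ⟶ X} (β : r ⟶ s) :
    (F.unitNat f).hom ▷ U.map r ≫ (α_ _ _ _).hom ≫ F.unit y ◁ (U.mapComp _ _).inv ≫
      F.unit y ◁ U.map₂ (F.map f ◁ β) =
    (f ≫ F.unit z) ◁ U.map₂ β ≫ (F.unitNat f).hom ▷ U.map s ≫ (α_ _ _ _).hom ≫
      F.unit y ◁ (U.mapComp _ _).inv := by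
  rw [whisker_exchange_assoc]
  simp

theorem unitNat_id_whiskerRight {y : C} {X : A} (r : F.obj y ⟶ X) :
    (F.unitNat (𝟙 y)).hom ▷ U.map r ≫ (α_ _ _ _).hom ≫ F.unit y ◁ (U.mapComp _ _).inv ≫
      F.unit y ◁ U.map₂ ((F.mapId y).hom ▷ r ≫ (λ_ _).hom) =
    (λ_ (F.unit y)).hom ▷ U.map r := by
  have h := congrArg (fun t => t ▷ U.map r) (F.unitNat_id y)
  simp only [comp_whiskerRight, whisker_assoc] at h
  have h' := congrArg (fun t => t ≫ (α_ _ _ _).hom ≫ F.unit y ◁ (U.mapId _).hom ▷ U.map r ≫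
    F.unit y ◁ (λ_ _).hom) h
  simpa using h'

theorem unitNat_comp_whiskerRight {y z x : C} {X : A} (f : y ⟶ z) (g : z ⟶ x) (r : F.obj x ⟶ X) :
    (F.unitNat (f ≫ g)).hom ▷ U.map r ≫ (α_ _ _ _).hom ≫ F.unit y ◁ (U.mapComp _ _).inv ≫
      F.unit y ◁ U.map₂ ((F.mapComp f g).hom ▷ r ≫ (α_ _ _ _).hom) =
    (α_ _ _ _).hom ▷ U.map r ≫ (α_ _ _ _).hom ≫ f ◁ ((F.unitNat g).hom ▷ U.map r ≫
      (α_ _ _ _).hom ≫ F.unit z ◁ (U.mapComp _ _).inv) ≫ (α_ _ _ _).inv ≫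
      (F.unitNat f).hom ▷ U.map (F.map g ≫ r) ≫ (α_ _ _ _).hom ≫
      F.unit y ◁ (U.mapComp _ _).inv := by
  have h := F.unitNat_comp f g
  calc _ = 𝟙 _ ⊗≫ ((F.unitNat (f ≫ g)).hom ≫ F.unit y ◁ U.map₂ (F.mapComp f g).hom) ▷ U.map r ⊗≫
      F.unit y ◁ (U.mapComp (F.map f) (F.map g)).hom ▷ U.map r ⊗≫
      F.unit y ◁ U.map (F.map f) ◁ (U.mapComp (F.map g) r).inv ⊗≫
      F.unit y ◁ (U.mapComp (F.map f) (F.map g ≫ r)).inv := by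
        simp [bicategoricalComp]
    _ = 𝟙 _ ⊗≫ f ◁ (F.unitNat g).hom ▷ U.map r ⊗≫
      (F.unitNat f).hom ▷ U.map (F.map g) ▷ U.map r ⊗≫
      F.unit y ◁ ((U.mapComp (F.map f) (F.map g)).inv ≫ (U.mapComp _ _).hom) ▷ U.map r ⊗≫
      F.unit y ◁ U.map (F.map f) ◁ (U.mapComp (F.map g) r).inv ⊗≫
      F.unit y ◁ (U.mapComp (F.map f) (F.map g ≫ r)).inv := by rw [h]; bicategory
    _ = 𝟙 _ ⊗≫ f ◁ (F.unitNat g).hom ▷ U.map r ⊗≫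
      ((F.unitNat f).hom ▷ (U.map (F.map g) ≫ U.map r) ≫
      (F.unit y ≫ U.map (F.map f)) ◁ (U.mapComp (F.map g) r).inv) ⊗≫
      F.unit y ◁ (U.mapComp (F.map f) (F.map g ≫ r)).inv := by rw [Iso.inv_hom_id]; bicategory
    _ = _ := by rw [← whisker_exchange]; bicategory

theorem unitNat_comp_inv_whiskerRight {y z x : C} {X : A} (f : y ⟶ z) (g : z ⟶ x)
    (r : F.obj x ⟶ X) :
    f ◁ ((F.unitNat g).hom ▷ U.map r ≫
      (α_ _ _ _).hom ≫ F.unit z ◁ (U.mapComp _ _).inv) ≫ (α_ _ _ _).inv ≫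
      (F.unitNat f).hom ▷ U.map (F.map g ≫ r) ≫ (α_ _ _ _).hom ≫
      F.unit y ◁ (U.mapComp _ _).inv ≫
      F.unit y ◁ U.map₂ ((α_ _ _ _).inv ≫ (F.mapComp f g).inv ▷ r) =
    (α_ _ _ _).inv ≫ (α_ _ _ _).inv ▷ U.map r ≫
      (F.unitNat (f ≫ g)).hom ▷ U.map r ≫ (α_ _ _ _).hom ≫ F.unit y ◁ (U.mapComp _ _).inv := by
  have h := congrArg (fun t => (α_ _ _ _).inv ≫ (α_ _ _ _).inv ▷ U.map r ≫ t ≫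
    F.unit y ◁ U.map₂ ((α_ _ _ _).inv ≫ (F.mapComp f g).inv ▷ r))
    (F.unitNat_comp_whiskerRight f g r)
  have e : F.unit y ◁ U.map₂ ((F.mapComp f g).hom ▷ r ≫ (α_ _ _ _).hom) ≫
      F.unit y ◁ U.map₂ ((α_ _ _ _).inv ≫ (F.mapComp f g).inv ▷ r) = 𝟙 _ := by
    rw [← whiskerLeft_comp, ← U.map₂_comp]
    simp
  simp only [Category.assoc, e, Category.comp_id, inv_hom_whiskerRight_assoc,
    Iso.inv_hom_id_assoc] at h
  exact h.symm

theorem unitNat_whiskerRight {y z : C} {X Y : A} {f : y ⟶ z} {r : F.obj z ⟶ X}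
    {q : F.obj y ⟶ X} (φ : F.map f ≫ r ⟶ q) (g : X ⟶ Y) :
    (F.unitNat f).hom ▷ U.map (r ≫ g) ≫ (α_ _ _ _).hom ≫ F.unit y ◁ (U.mapComp _ _).inv ≫
      F.unit y ◁ U.map₂ ((α_ _ _ _).inv ≫ φ ▷ g) =
    (f ≫ F.unit z) ◁ (U.mapComp r g).hom ≫ (α_ _ _ _).inv ≫
      ((F.unitNat f).hom ▷ U.map r ≫ (α_ _ _ _).hom ≫ F.unit y ◁ (U.mapComp _ _).inv ≫
      F.unit y ◁ U.map₂ φ) ▷ U.map g ≫ (α_ _ _ _).hom ≫ F.unit y ◁ (U.mapComp _ _).inv := by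
  calc _ = 𝟙 _ ⊗≫ ((F.unitNat f).hom ▷ U.map (r ≫ g) ≫
        (F.unit y ≫ U.map (F.map f)) ◁ (U.mapComp r g).hom) ⊗≫
        F.unit y ◁ (U.mapComp (F.map f) r).inv ▷ U.map g ⊗≫
        F.unit y ◁ U.map₂ φ ▷ U.map g ⊗≫ F.unit y ◁ (U.mapComp q g).inv := by
          simp [bicategoricalComp, map₂_associator_inv']
    _ = _ := by rw [← whisker_exchange]; bicategory

/-- For an identity 1-cell the cells `w` and `w⁻¹` in the specification of `counitNat` belong to the
same object. They cancel once interchange has moved `U.mapId` out of their way. -/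
theorem counitNat_id (X : A) :
    (F.counitNat (𝟙 X)).hom =
      (F.map₂ (U.mapId X).hom ≫ (F.mapId _).hom) ▷ F.counit X ≫ (λ_ _).hom ≫ (ρ_ _).inv := by
  apply F.comp_hom_ext
  have h := F.unitNat_id_whiskerRight (F.counit X)
  rw [U.map₂_comp, whiskerLeft_comp] at h
  rw [F.unitNat_counitNat, comp_whiskerRight, Category.assoc, U.map₂_comp, whiskerLeft_comp,
    reassoc_of% F.unitNat_naturality_whiskerRight (U.mapId X).hom,
    U.map₂_comp, whiskerLeft_comp, U.map₂_comp, whiskerLeft_comp, reassoc_of% h,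
    U.mapComp_id_right_inv]
  calc _ = 𝟙 _ ⊗≫ U.map (𝟙 X) ◁ (F.w X).hom ⊗≫ ((F.w X).inv ▷ U.map (𝟙 X) ≫
        (F.unit _ ≫ U.map (F.counit X)) ◁ (U.mapId X).hom) ⊗≫
        F.unit _ ◁ U.map₂ (ρ_ _).inv := by bicategory
    _ = 𝟙 _ ⊗≫ (U.map (𝟙 X) ◁ (F.w X).hom ≫ (U.mapId X).hom ▷ 𝟙 _) ⊗≫ (F.w X).inv ⊗≫
        F.unit _ ◁ U.map₂ (ρ_ _).inv := by
          rw [← whisker_exchange]; bicategory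
    _ = 𝟙 _ ⊗≫ (U.mapId X).hom ▷ (F.unit _ ≫ U.map (F.counit X)) ⊗≫
        ((F.w X).hom ≫ (F.w X).inv) ⊗≫ F.unit _ ◁ U.map₂ (ρ_ _).inv := by
          rw [whisker_exchange]; bicategory
    _ = _ := by rw [Iso.hom_inv_id]; bicategory

/-- Placing the specifications for `f` and `g` side by side creates `w⁻¹` followed by `w` at the
middle object `Y`. After this cancellation the specification for `f ≫ g` remains. -/
theorem counitNat_comp {X Y Z : A} (f : X ⟶ Y) (g : Y ⟶ Z) :
    (F.counitNat (f ≫ g)).hom =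
      (F.map₂ (U.mapComp f g).hom ≫ (F.mapComp _ _).hom) ▷ F.counit Z ≫ (α_ _ _ _).hom ≫
      F.map (U.map f) ◁ (F.counitNat g).hom ≫ (α_ _ _ _).inv ≫ (F.counitNat f).hom ▷ g ≫
      (α_ _ _ _).hom := by
  apply F.comp_hom_ext
  have h1 := F.unitNat_comp_whiskerRight (U.map f) (U.map g) (F.counit Z)
  rw [U.map₂_comp, whiskerLeft_comp] at h1
  have h2 := F.unitNat_whiskerRight (F.counitNat f).hom g
  rw [U.map₂_comp, whiskerLeft_comp] at h2
  have h3 := F.unitNat_counitNat g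
  rw [F.unitNat_counitNat]
  simp only [comp_whiskerRight, Category.assoc, U.map₂_comp, whiskerLeft_comp]
  rw [reassoc_of% F.unitNat_naturality_whiskerRight (U.mapComp f g).hom, reassoc_of% h1,
    reassoc_of% F.unitNat_whiskerLeft (U.map f) (F.counitNat g).hom, reassoc_of% h2,
    F.unitNat_counitNat, U.map₂_associator]
  symm
  calc _ = (U.mapComp f g).hom ▷ F.unit _ ▷ U.map (F.counit Z) ⊗≫
        U.map f ◁ ((F.unitNat (U.map g)).hom ▷ U.map (F.counit Z) ≫ (α_ _ _ _).hom ≫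
          F.unit (U.obj Y) ◁ (U.mapComp _ _).inv ≫ F.unit (U.obj Y) ◁ U.map₂ (F.counitNat g).hom) ⊗≫
        U.map f ◁ F.unit _ ◁ (U.mapComp (F.counit Y) g).hom ⊗≫
        U.map f ◁ (F.w Y).hom ▷ U.map g ⊗≫ (F.w X).inv ▷ U.map f ▷ U.map g ⊗≫
        F.unit _ ◁ (U.mapComp (F.counit X) f).inv ▷ U.map g ⊗≫
        F.unit _ ◁ ((U.mapComp (F.counit X ≫ f) g).inv ≫ (U.mapComp (F.counit X ≫ f) g).hom) ⊗≫
        F.unit _ ◁ (U.mapComp (F.counit X) f).hom ▷ U.map g ⊗≫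
        F.unit _ ◁ U.map (F.counit X) ◁ (U.mapComp f g).inv ⊗≫
        F.unit _ ◁ (U.mapComp (F.counit X) (f ≫ g)).inv := by bicategory
    _ = (U.mapComp f g).hom ▷ F.unit _ ▷ U.map (F.counit Z) ⊗≫
        U.map f ◁ U.map g ◁ (F.w Z).hom ⊗≫ U.map f ◁ (F.w Y).inv ▷ U.map g ⊗≫
        U.map f ◁ F.unit _ ◁ ((U.mapComp (F.counit Y) g).inv ≫ (U.mapComp (F.counit Y) g).hom) ⊗≫
        U.map f ◁ (F.w Y).hom ▷ U.map g ⊗≫ (F.w X).inv ▷ U.map f ▷ U.map g ⊗≫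
        F.unit _ ◁ ((U.mapComp (F.counit X) f).inv ≫ (U.mapComp (F.counit X) f).hom) ▷ U.map g ⊗≫
        F.unit _ ◁ U.map (F.counit X) ◁ (U.mapComp f g).inv ⊗≫
        F.unit _ ◁ (U.mapComp (F.counit X) (f ≫ g)).inv := by
          rw [h3, Iso.inv_hom_id (U.mapComp (F.counit X ≫ f) g)]; bicategory
    _ = 𝟙 _ ⊗≫ ((U.mapComp f g).hom ▷ (F.unit _ ≫ U.map (F.counit Z)) ≫
        (U.map f ≫ U.map g) ◁ (F.w Z).hom) ⊗≫ U.map f ◁ ((F.w Y).inv ≫ (F.w Y).hom) ▷ U.map g ⊗≫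
        ((F.w X).inv ▷ (U.map f ≫ U.map g) ≫
        (F.unit _ ≫ U.map (F.counit X)) ◁ (U.mapComp f g).inv) ⊗≫
        F.unit _ ◁ (U.mapComp (F.counit X) (f ≫ g)).inv := by
          rw [Iso.inv_hom_id, Iso.inv_hom_id]; bicategory
    _ = 𝟙 _ ⊗≫ U.map (f ≫ g) ◁ (F.w Z).hom ⊗≫
        ((U.mapComp f g).hom ≫ (U.mapComp f g).inv) ⊗≫ (F.w X).inv ▷ U.map (f ≫ g) ⊗≫
        F.unit _ ◁ (U.mapComp (F.counit X) (f ≫ g)).inv := by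
          rw [← whisker_exchange, ← whisker_exchange, Iso.inv_hom_id]; bicategory
    _ = _ := by rw [Iso.hom_inv_id]; bicategory

/-- The counit of the biadjunction determined by a family of biuniversal arrows. -/
def counitTrans : U.comp F.pseudofunctor ⟶ Pseudofunctor.id A where
  app := F.counit
  naturality := F.counitNat
  naturality_naturality θ := F.counitNat_naturality θ
  naturality_id X := by
    change (F.counitNat (𝟙 X)).hom ≫ F.counit X ◁ 𝟙 _ =
      (F.map₂ (U.mapId X).hom ≫ (F.mapId _).hom) ▷ F.counit X ≫ (λ_ _).hom ≫ (ρ_ _).inv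
    rw [F.counitNat_id]
    simp
  naturality_comp f g := by
    change (F.counitNat (f ≫ g)).hom ≫ F.counit _ ◁ 𝟙 _ =
      (F.map₂ (U.mapComp f g).hom ≫ (F.mapComp _ _).hom) ▷ F.counit _ ≫ (α_ _ _ _).hom ≫
      F.map (U.map f) ◁ (F.counitNat g).hom ≫ (α_ _ _ _).inv ≫ (F.counitNat f).hom ▷ g ≫
      (α_ _ _ _).hom
    rw [F.counitNat_comp]
    simp

theorem unitNat_rightUnitor_inv {y z : C} (f : y ⟶ z) :
    (F.unitNat f).hom ≫ F.unit y ◁ U.map₂ (ρ_ (F.map f)).inv =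
      (ρ_ _).inv ≫ (f ≫ F.unit z) ◁ (U.mapId _).inv ≫ (F.unitNat f).hom ▷ U.map (𝟙 _) ≫
        (α_ _ _ _).hom ≫ F.unit y ◁ (U.mapComp _ _).inv := by
  rw [whisker_exchange_assoc, map₂_rightUnitor_inv']
  simp

/-- The transpose of `v z` contributes `w⁻¹` at `F.obj z` and that of `counitNat` contributes `w`
there. They cancel and leave `w⁻¹` at `F.obj y`, from which `v y` is reassembled. -/
theorem v_naturality {y z : C} (f : y ⟶ z) :
    (ρ_ _).inv ≫ F.map f ◁ (F.v z).hom ≫ (α_ _ _ _).inv ≫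
      ((F.mapComp f (F.unit z)).inv ≫ F.map₂ (F.unitNat f).hom ≫
        (F.mapComp (F.unit y) (U.map (F.map f))).hom) ▷ F.counit (F.obj z) ≫ (α_ _ _ _).hom ≫
      F.map (F.unit y) ◁ (F.counitNat (F.map f)).hom ≫ (α_ _ _ _).inv =
    (λ_ _).inv ≫ (F.v y).hom ▷ F.map f := by
  apply F.hom_ext
  have h1 := F.unitNat_comp_inv_whiskerRight f (F.unit z) (F.counit (F.obj z))
  have h2 := F.unitNat_comp_whiskerRight (F.unit y) (U.map (F.map f)) (F.counit (F.obj z))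
  rw [U.map₂_comp, whiskerLeft_comp (F.unit y) (U.map₂ (α_ _ _ _).inv)] at h1
  rw [U.map₂_comp, whiskerLeft_comp] at h2
  have h3 := F.unitNat_counitNat (F.map f)
  have h4 := F.v_spec z
  simp only [comp_whiskerRight, Category.assoc, U.map₂_comp, whiskerLeft_comp]
  rw [reassoc_of% F.unitNat_rightUnitor_inv f, reassoc_of% F.unitNat_whiskerLeft f (F.v z).hom]
  have e : (f ≫ F.unit z) ◁ U.map₂ (F.v z).hom = (α_ _ _ _).hom ≫ f ◁ F.unit z ◁ (U.mapId _).hom ≫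
      f ◁ F.unit z ◁ (F.w (F.obj z)).inv ≫ f ◁ (α_ _ _ _).inv ≫
      f ◁ ((F.unitNat (F.unit z)).hom ▷ U.map (F.counit (F.obj z)) ≫
      (α_ _ _ _).hom ≫ F.unit _ ◁ (U.mapComp _ _).inv) ≫ (α_ _ _ _).inv := by
    rw [comp_whiskerLeft, h4]
    simp
  rw [e]
  simp only [Category.assoc]
  rw [reassoc_of% h1, reassoc_of% F.unitNat_naturality_whiskerRight (F.unitNat f).hom,
    reassoc_of% h2, reassoc_of% F.unitNat_whiskerLeft (F.unit y) (F.counitNat (F.map f)).hom]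
  calc _ = 𝟙 _ ⊗≫ f ◁ F.unit z ◁ ((U.mapId _).inv ≫ (U.mapId _).hom) ⊗≫
        ((f ≫ F.unit z) ◁ (F.w (F.obj z)).inv ≫
        (F.unitNat f).hom ▷ (F.unit _ ≫ U.map (F.counit (F.obj z)))) ⊗≫
        F.unit y ◁ ((F.unitNat (U.map (F.map f))).hom ▷ U.map (F.counit (F.obj z)) ≫
          (α_ _ _ _).hom ≫ F.unit _ ◁ (U.mapComp _ _).inv ≫
          F.unit _ ◁ U.map₂ (F.counitNat (F.map f)).hom) ⊗≫
        (F.unitNat (F.unit y)).hom ▷ U.map (F.counit (F.obj y) ≫ F.map f) ⊗≫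
        F.unit y ◁ (U.mapComp (F.map (F.unit y)) (F.counit (F.obj y) ≫ F.map f)).inv ⊗≫
        F.unit y ◁ U.map₂ (α_ _ _ _).inv := by bicategory
    _ = 𝟙 _ ⊗≫ (F.unitNat f).hom ⊗≫ F.unit y ◁ U.map (F.map f) ◁ ((F.w (F.obj z)).inv ≫
        (F.w (F.obj z)).hom) ⊗≫ F.unit y ◁ (F.w (F.obj y)).inv ▷ U.map (F.map f) ⊗≫
        ((F.unit y ≫ F.unit _) ◁ (U.mapComp (F.counit (F.obj y)) (F.map f)).inv ≫
        (F.unitNat (F.unit y)).hom ▷ U.map (F.counit (F.obj y) ≫ F.map f)) ⊗≫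
        F.unit y ◁ (U.mapComp (F.map (F.unit y)) (F.counit (F.obj y) ≫ F.map f)).inv ⊗≫
        F.unit y ◁ U.map₂ (α_ _ _ _).inv := by
          rw [whisker_exchange, h3, Iso.inv_hom_id]; bicategory
    _ = 𝟙 _ ⊗≫ (F.unitNat f).hom ⊗≫ F.unit y ◁ (F.w (F.obj y)).inv ▷ U.map (F.map f) ⊗≫
        (F.unitNat (F.unit y)).hom ▷ U.map (F.counit (F.obj y)) ▷ U.map (F.map f) ⊗≫
        F.unit y ◁ U.map (F.map (F.unit y)) ◁
          ((U.mapComp (F.counit (F.obj y)) (F.map f)).inv) ⊗≫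
        F.unit y ◁ ((U.mapComp (F.map (F.unit y)) (F.counit (F.obj y) ≫ F.map f)).inv ≫
          (U.mapComp _ _).hom) ⊗≫
        F.unit y ◁ U.map (F.map (F.unit y)) ◁
          ((U.mapComp (F.counit (F.obj y)) (F.map f)).hom) ⊗≫
        F.unit y ◁ (U.mapComp (F.map (F.unit y)) (F.counit (F.obj y))).inv ▷ U.map (F.map f) ⊗≫
        F.unit y ◁ (U.mapComp _ _).inv := by
          rw [whisker_exchange, map₂_associator_inv', Iso.inv_hom_id]; bicategory
    _ = 𝟙 _ ⊗≫ (F.unitNat f).hom ⊗≫ F.unit y ◁ (F.w (F.obj y)).inv ▷ U.map (F.map f) ⊗≫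
        (F.unitNat (F.unit y)).hom ▷ U.map (F.counit (F.obj y)) ▷ U.map (F.map f) ⊗≫
        F.unit y ◁ U.map (F.map (F.unit y)) ◁
          ((U.mapComp (F.counit (F.obj y)) (F.map f)).inv ≫
          (U.mapComp (F.counit (F.obj y)) (F.map f)).hom) ⊗≫
        F.unit y ◁ (U.mapComp (F.map (F.unit y)) (F.counit (F.obj y))).inv ▷ U.map (F.map f) ⊗≫
        F.unit y ◁ (U.mapComp _ _).inv := by
          rw [Iso.inv_hom_id]; bicategory
    _ = 𝟙 _ ⊗≫ (F.unitNat f).hom ⊗≫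
        F.unit y ◁ ((U.mapId _).inv ≫ (U.mapId _).hom) ▷ U.map (F.map f) ⊗≫
        F.unit y ◁ (F.w (F.obj y)).inv ▷ U.map (F.map f) ⊗≫
        (F.unitNat (F.unit y)).hom ▷ U.map (F.counit (F.obj y)) ▷ U.map (F.map f) ⊗≫
        F.unit y ◁ (U.mapComp (F.map (F.unit y)) (F.counit (F.obj y))).inv ▷ U.map (F.map f) ⊗≫
        F.unit y ◁ (U.mapComp _ _).inv := by
          rw [Iso.inv_hom_id, Iso.inv_hom_id]; bicategory
    _ = 𝟙 _ ⊗≫ (F.unitNat f).hom ⊗≫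
        F.unit y ◁ (U.mapId _).inv ▷ U.map (F.map f) ⊗≫
        (F.unit y ◁ U.map₂ (F.v y).hom) ▷ U.map (F.map f) ⊗≫
        F.unit y ◁ (U.mapComp _ _).inv := by
          rw [F.v_spec]; bicategory
    _ = _ := by
      rw [U.map₂_whisker_right, map₂_leftUnitor_inv']; simp [bicategoricalComp]

theorem unitNat_counitNat_inv {X Y : A} (g : X ⟶ Y) :
    F.unit (U.obj X) ◁ (U.mapComp _ _).inv ≫ F.unit (U.obj X) ◁ U.map₂ (F.counitNat g).inv =
    (α_ _ _ _).inv ≫ (F.w X).hom ▷ U.map g ≫ (λ_ _).hom ≫ (ρ_ _).inv ≫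
      U.map g ◁ (F.w Y).inv ≫ (α_ _ _ _).inv ≫
      (F.unitNat (U.map g)).hom ▷ U.map (F.counit Y) ≫ (α_ _ _ _).hom ≫
      F.unit (U.obj X) ◁ (U.mapComp _ _).inv := by
  have e : F.unit (U.obj X) ◁ U.map₂ (F.counitNat g).hom ≫
      F.unit (U.obj X) ◁ U.map₂ (F.counitNat g).inv = 𝟙 _ := by
    rw [← whiskerLeft_comp, ← U.map₂_comp]
    simp
  have h := congrArg (fun t => (α_ _ _ _).inv ≫ (F.w X).hom ▷ U.map g ≫ (λ_ _).hom ≫ (ρ_ _).inv ≫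
      U.map g ◁ (F.w Y).inv ≫ (α_ _ _ _).inv ≫ t ≫
      F.unit (U.obj X) ◁ U.map₂ (F.counitNat g).inv) (F.unitNat_counitNat g)
  simp only [Category.assoc, e, Category.comp_id] at h
  rw [h]
  simp

/-- In the transposed equation two pairs of cells cancel: `w` at `F.obj (U.obj X)`, coming from `v`
and from `counitNat`, and then `w` at `X`, once interchange has made the two copies adjacent. -/
theorem counit_triangle (X : A) :
    (λ_ _).inv ≫ (F.v (U.obj X)).hom ▷ F.counit X ≫ (α_ _ _ _).hom ≫
      F.map (F.unit (U.obj X)) ◁ (F.counitNat (F.counit X)).inv ≫ (α_ _ _ _).inv ≫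
      ((F.mapComp (F.unit (U.obj X)) (U.map (F.counit X))).inv ≫
        F.map₂ (F.w X).hom ≫ (F.mapId (U.obj X)).hom) ▷ F.counit X ≫ (λ_ _).hom =
    𝟙 (F.counit X) := by
  apply (F.isBiuniversal (U.obj X)).ext
  have h1 := F.unitNat_comp_inv_whiskerRight (F.unit (U.obj X)) (U.map (F.counit X)) (F.counit X)
  have h2 := F.unitNat_id_whiskerRight (F.counit X)
  rw [U.map₂_comp, whiskerLeft_comp (F.unit _) (U.map₂ (α_ _ _ _).inv)] at h1
  rw [U.map₂_comp, whiskerLeft_comp] at h2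
  have h3 := F.unitNat_counitNat_inv (F.counit X)
  have h4 := F.v_spec (U.obj X)
  have h5 : F.unit (U.obj X) ◁ U.map₂ (λ_ (F.counit X)).inv ≫
      F.unit (U.obj X) ◁ U.map₂ ((F.v (U.obj X)).hom ▷ F.counit X) ≫
      F.unit (U.obj X) ◁ U.map₂ (α_ _ _ _).hom =
      𝟙 _ ⊗≫ F.unit (U.obj X) ◁ (F.w _).inv ▷ U.map (F.counit X) ⊗≫
        (F.unit (U.obj X) ≫ F.unit _) ◁ (U.mapComp (F.counit _) (F.counit X)).inv ≫
        (F.unitNat (F.unit (U.obj X))).hom ▷ U.map (F.counit _ ≫ F.counit X) ≫ (α_ _ _ _).hom ≫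
        F.unit (U.obj X) ◁ (U.mapComp _ _).inv := by
    rw [map₂_leftUnitor_inv', U.map₂_whisker_right, U.map₂_associator]
    calc _ = 𝟙 _ ⊗≫ F.unit (U.obj X) ◁ (U.mapId _).inv ▷ U.map (F.counit X) ⊗≫
          (F.unit (U.obj X) ◁ U.map₂ (F.v (U.obj X)).hom) ▷ U.map (F.counit X) ⊗≫
          F.unit (U.obj X) ◁ (U.mapComp (F.map (F.unit (U.obj X))) (F.counit _)).hom ▷
            U.map (F.counit X) ⊗≫
          F.unit (U.obj X) ◁ U.map (F.map (F.unit (U.obj X))) ◁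
            (U.mapComp (F.counit _) (F.counit X)).inv ⊗≫
          F.unit (U.obj X) ◁ (U.mapComp _ _).inv := by simp [bicategoricalComp]
      _ = 𝟙 _ ⊗≫ F.unit (U.obj X) ◁ ((U.mapId _).inv ≫ (U.mapId _).hom) ▷ U.map (F.counit X) ⊗≫
          F.unit (U.obj X) ◁ (F.w _).inv ▷ U.map (F.counit X) ⊗≫
          (F.unitNat (F.unit (U.obj X))).hom ▷ U.map (F.counit _) ▷ U.map (F.counit X) ⊗≫
          F.unit (U.obj X) ◁ ((U.mapComp (F.map (F.unit (U.obj X))) (F.counit _)).inv ≫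
            (U.mapComp (F.map (F.unit (U.obj X))) (F.counit _)).hom) ▷ U.map (F.counit X) ⊗≫
          F.unit (U.obj X) ◁ U.map (F.map (F.unit (U.obj X))) ◁
            (U.mapComp (F.counit _) (F.counit X)).inv ⊗≫
          F.unit (U.obj X) ◁ (U.mapComp _ _).inv := by rw [h4]; bicategory
      _ = 𝟙 _ ⊗≫ F.unit (U.obj X) ◁ (F.w _).inv ▷ U.map (F.counit X) ⊗≫
          ((F.unitNat (F.unit (U.obj X))).hom ▷ (U.map (F.counit _) ≫ U.map (F.counit X)) ≫
          (F.unit (U.obj X) ≫ U.map (F.map (F.unit (U.obj X)))) ◁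
            (U.mapComp (F.counit _) (F.counit X)).inv) ⊗≫
          F.unit (U.obj X) ◁ (U.mapComp _ _).inv := by
            rw [Iso.inv_hom_id, Iso.inv_hom_id]; bicategory
      _ = _ := by rw [← whisker_exchange]; bicategory
  simp only [comp_whiskerRight, Category.assoc, U.map₂_comp, whiskerLeft_comp]
  rw [reassoc_of% h5]
  have e : (F.unit (U.obj X) ≫ F.unit _) ◁ (U.mapComp (F.counit _) (F.counit X)).inv ≫
      (F.unit (U.obj X) ≫ F.unit _) ◁ U.map₂ (F.counitNat (F.counit X)).inv =
      (α_ _ _ _).hom ≫ F.unit (U.obj X) ◁ ((α_ _ _ _).inv ≫ (F.w _).hom ▷ U.map (F.counit X) ≫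
        (λ_ _).hom ≫ (ρ_ _).inv ≫ U.map (F.counit X) ◁ (F.w _).inv ≫ (α_ _ _ _).inv) ≫
      F.unit (U.obj X) ◁ ((F.unitNat (U.map (F.counit X))).hom ▷ U.map (F.counit X) ≫
        (α_ _ _ _).hom ≫ F.unit _ ◁ (U.mapComp _ _).inv) ≫ (α_ _ _ _).inv := by
    simp only [comp_whiskerLeft, Category.assoc, Iso.inv_hom_id_assoc]
    have := congrArg (fun t => F.unit (U.obj X) ◁ t) h3
    simp only [whiskerLeft_comp] at this ⊢
    rw [reassoc_of% this]
    simp only [Category.assoc]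
  simp only [bicategoricalComp, Category.assoc]
  rw [reassoc_of% F.unitNat_whiskerLeft (F.unit (U.obj X)), reassoc_of% e, reassoc_of% h1,
    reassoc_of% F.unitNat_naturality_whiskerRight (F.w X).hom, h2]
  calc _ = 𝟙 _ ⊗≫ F.unit (U.obj X) ◁ ((F.w _).inv ≫ (F.w _).hom) ▷ U.map (F.counit X) ⊗≫
        ((F.unit (U.obj X) ≫ U.map (F.counit X)) ◁ (F.w _).inv ≫
        (F.w X).hom ▷ (F.unit (U.obj X) ≫ U.map (F.counit X))) ⊗≫ 𝟙 _ := by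
          simp [bicategoricalComp]
    _ = 𝟙 _ ⊗≫ ((F.w X).hom ≫ (F.w X).inv) ⊗≫ 𝟙 _ := by
          rw [whisker_exchange, Iso.inv_hom_id]; bicategory
    _ = _ := by rw [Iso.hom_inv_id, U.map₂_id, whiskerLeft_id]; bicategory

/-- The biadjunction determined by a family of biuniversal arrows. -/
def biadjunction : Biadjunction F.pseudofunctor U where
  unitTrans := F.unitTrans
  counitTrans := F.counitTrans
  v := F.v
  w := F.w
  v_naturality f := F.v_naturality f
  -- No computation with universal properties is needed here: `counitNat` was chosen with this
  -- equation as its specification.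
  w_naturality {X Y} g := by
    change U.map g ◁ (F.w Y).hom ≫ (ρ_ _).hom =
      (α_ _ _ _).inv ≫ (F.unitNat (U.map g)).hom ▷ U.map (F.counit Y) ≫ (α_ _ _ _).hom ≫
      F.unit (U.obj X) ◁ hat U (F.counitNat g).hom ≫
      (α_ _ _ _).inv ≫ (F.w X).hom ▷ U.map g ≫ (λ_ _).hom
    rw [hat, whiskerLeft_comp, whiskerLeft_comp]
    simp only [Category.assoc]
    rw [reassoc_of% F.unitNat_counitNat g]
    simp
  counit_triangle := F.counit_triangle
  -- Likewise this is `v_spec`, with the cells that define the transpose of `v` moved to the other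
  -- side.
  unit_triangle y := by
    change (ρ_ _).inv ≫ F.unit y ◁ hatFromId U (F.v y).hom ≫ (α_ _ _ _).inv ≫
      (F.unitNat (F.unit y)).inv ▷ U.map (F.counit (F.obj y)) ≫ (α_ _ _ _).hom ≫
      F.unit y ◁ (F.w (F.obj y)).hom ≫ (ρ_ _).hom = 𝟙 (F.unit y)
    rw [hatFromId, whiskerLeft_comp, whiskerLeft_comp, F.v_spec]
    simp

end BiuniversalFamily
end Biuniversal
end BiadjointTriangle

namespace BiadjointTriangle

/-! ### The calculus of transposes across a biadjunction -/

section Transposition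

variable {A : Type u₁} [Bicategory.{w₁, v₁} A] {B : Type u₂} [Bicategory.{w₂, v₂} B]
  {E : B ⥤ᵖ A} {R : A ⥤ᵖ B} (adj : Biadjunction E R)

namespace Biadjunction

theorem unitNat_naturality {X Y : B} {f g : X ⟶ Y} (θ : f ⟶ g) :
    θ ▷ adj.unit Y ≫ (adj.unitNat g).hom = (adj.unitNat f).hom ≫ adj.unit X ◁ R.map₂ (E.map₂ θ) :=
  adj.unitTrans.naturality_naturality θ

theorem unitNat_id (X : B) :
    (adj.unitNat (𝟙 X)).hom ≫ adj.unit X ◁ (R.map₂ (E.mapId X).hom ≫ (R.mapId _).hom) =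
      (λ_ (adj.unit X)).hom ≫ (ρ_ (adj.unit X)).inv := by
  have h : (adj.unitNat (𝟙 X)).hom ≫ adj.unit X ◁ (R.map₂ (E.mapId X).hom ≫ (R.mapId _).hom) =
      (𝟙 (𝟙 X)) ▷ adj.unit X ≫ (λ_ (adj.unit X)).hom ≫ (ρ_ (adj.unit X)).inv :=
    adj.unitTrans.naturality_id X
  rw [h, id_whiskerRight, Category.id_comp]

theorem unitNat_comp {X Y Z : B} (f : X ⟶ Y) (g : Y ⟶ Z) :
    (adj.unitNat (f ≫ g)).hom ≫
      adj.unit X ◁ (R.map₂ (E.mapComp f g).hom ≫ (R.mapComp (E.map f) (E.map g)).hom) =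
      (α_ _ _ _).hom ≫ f ◁ (adj.unitNat g).hom ≫ (α_ _ _ _).inv ≫
        (adj.unitNat f).hom ▷ R.map (E.map g) ≫ (α_ _ _ _).hom := by
  have h : (adj.unitNat (f ≫ g)).hom ≫
      adj.unit X ◁ (R.map₂ (E.mapComp f g).hom ≫ (R.mapComp (E.map f) (E.map g)).hom) =
      (𝟙 (f ≫ g)) ▷ adj.unit Z ≫ (α_ _ _ _).hom ≫ f ◁ (adj.unitNat g).hom ≫ (α_ _ _ _).inv ≫
        (adj.unitNat f).hom ▷ R.map (E.map g) ≫ (α_ _ _ _).hom := adj.unitTrans.naturality_comp f g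
  rw [h, id_whiskerRight, Category.id_comp]

theorem counitNat_naturality {X Y : A} {f g : X ⟶ Y} (θ : f ⟶ g) :
    E.map₂ (R.map₂ θ) ▷ adj.counit Y ≫ (adj.counitNat g).hom =
      (adj.counitNat f).hom ≫ adj.counit X ◁ θ :=
  adj.counitTrans.naturality_naturality θ

/-- The isomorphism between `a ≫ ρ ≫ R h` and the transpose of `E a ≫ h`. -/
def precompIso {Z' Z : B} {X : A} (a : Z' ⟶ Z) (h : E.obj Z ⟶ X) :
    a ≫ adj.unit Z ≫ R.map h ≅ adj.unit Z' ≫ R.map (E.map a ≫ h) :=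
  (α_ _ _ _).symm ≪≫ whiskerRightIso (adj.unitNat a) (R.map h) ≪≫ α_ _ _ _ ≪≫
    whiskerLeftIso (adj.unit Z') (R.mapComp (E.map a) h).symm

theorem precompIso_naturality_right {Z' Z : B} {X : A} (a : Z' ⟶ Z) {h h' : E.obj Z ⟶ X}
    (θ : h ⟶ h') :
    a ◁ adj.unit Z ◁ R.map₂ θ ≫ (adj.precompIso a h').hom =
      (adj.precompIso a h).hom ≫ adj.unit Z' ◁ R.map₂ (E.map a ◁ θ) := by
  calc _ = 𝟙 _ ⊗≫ ((a ≫ adj.unit Z) ◁ R.map₂ θ ≫ (adj.unitNat a).hom ▷ R.map h') ⊗≫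
        adj.unit Z' ◁ (R.mapComp (E.map a) h').inv := by
          simp [precompIso, bicategoricalComp]
    _ = _ := by rw [whisker_exchange]; simp [precompIso, bicategoricalComp]

theorem precompIso_naturality_left {Z' Z : B} {X : A} {a a' : Z' ⟶ Z} (β : a ⟶ a')
    (h : E.obj Z ⟶ X) :
    β ▷ (adj.unit Z ≫ R.map h) ≫ (adj.precompIso a' h).hom =
      (adj.precompIso a h).hom ≫ adj.unit Z' ◁ R.map₂ (E.map₂ β ▷ h) := by
  have e := adj.unitNat_naturality β
  calc _ = 𝟙 _ ⊗≫ (β ▷ adj.unit Z ≫ (adj.unitNat a').hom) ▷ R.map h ⊗≫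
        adj.unit Z' ◁ (R.mapComp (E.map a') h).inv := by
          simp [precompIso, bicategoricalComp]
    _ = _ := by rw [e]; simp [precompIso, bicategoricalComp]

/-- Pseudofunctoriality of `precompIso` in the source, from the composition axiom of `ρ`. The last
factor is needed because `E` preserves composites only up to isomorphism. -/
theorem precompIso_comp {Z'' Z' Z : B} {X : A} (a : Z'' ⟶ Z') (b : Z' ⟶ Z) (h : E.obj Z ⟶ X) :
    (adj.precompIso (a ≫ b) h).hom = (α_ _ _ _).hom ≫ a ◁ (adj.precompIso b h).hom ≫
      (adj.precompIso a (E.map b ≫ h)).hom ≫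
      adj.unit Z'' ◁ R.map₂ ((α_ _ _ _).inv ≫ (E.mapComp a b).inv ▷ h) := by
  have e := adj.unitNat_comp a b
  have e' : (adj.unitNat (a ≫ b)).hom = ((α_ _ _ _).hom ≫ a ◁ (adj.unitNat b).hom ≫
      (α_ _ _ _).inv ≫ (adj.unitNat a).hom ▷ R.map (E.map b) ≫ (α_ _ _ _).hom) ≫
      adj.unit Z'' ◁ (R.mapComp (E.map a) (E.map b)).inv ≫
      adj.unit Z'' ◁ R.map₂ (E.mapComp a b).inv := by
    rw [← e]
    simp [← whiskerLeft_comp, ← R.map₂_comp]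
  symm
  calc _ = 𝟙 _ ⊗≫ a ◁ (adj.unitNat b).hom ▷ R.map h ⊗≫
        ((a ≫ adj.unit Z') ◁ (R.mapComp (E.map b) h).inv ≫
        (adj.unitNat a).hom ▷ R.map (E.map b ≫ h)) ⊗≫
        adj.unit Z'' ◁ (R.mapComp (E.map a) (E.map b ≫ h)).inv ⊗≫
        adj.unit Z'' ◁ R.map₂ ((α_ _ _ _).inv ≫ (E.mapComp a b).inv ▷ h) := by
          simp only [precompIso, Iso.trans_hom, Iso.symm_hom, whiskerRightIso_hom,
            whiskerLeftIso_hom]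
          bicategory
    _ = 𝟙 _ ⊗≫ a ◁ (adj.unitNat b).hom ▷ R.map h ⊗≫
        (adj.unitNat a).hom ▷ (R.map (E.map b) ≫ R.map h) ⊗≫
        adj.unit Z'' ◁ (R.mapComp (E.map a) (E.map b)).inv ▷ R.map h ⊗≫
        adj.unit Z'' ◁ R.map₂ (E.mapComp a b).inv ▷ R.map h ⊗≫
        adj.unit Z'' ◁ (R.mapComp _ _).inv := by
          rw [whisker_exchange]
          simp [bicategoricalComp, map₂_associator_inv']
    _ = _ := by
          simp only [precompIso, Iso.trans_hom, Iso.symm_hom, whiskerRightIso_hom,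
            whiskerLeftIso_hom, e']
          bicategory

theorem precompIso_id {Z : B} {X : A} (h : E.obj Z ⟶ X) :
    (adj.precompIso (𝟙 Z) h).hom = (λ_ _).hom ≫
      adj.unit Z ◁ R.map₂ ((λ_ _).inv ≫ (E.mapId Z).inv ▷ h) := by
  have e := adj.unitNat_id Z
  have e' : (adj.unitNat (𝟙 Z)).hom = ((λ_ _).hom ≫ (ρ_ _).inv) ≫
      adj.unit Z ◁ (R.mapId _).inv ≫ adj.unit Z ◁ R.map₂ (E.mapId Z).inv := by
    rw [← e]
    simp [← whiskerLeft_comp, ← R.map₂_comp]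
  simp only [precompIso, Iso.trans_hom, Iso.symm_hom, whiskerRightIso_hom,
            whiskerLeftIso_hom, e', R.map₂_comp, map₂_leftUnitor_inv', R.map₂_whisker_right]
  simp

theorem precompIso_postcomp {Z' Z : B} {X X' : A} (a : Z' ⟶ Z) (h : E.obj Z ⟶ X) (g : X ⟶ X') :
    a ◁ ((α_ _ _ _).hom ≫ adj.unit Z ◁ (R.mapComp h g).inv) ≫
      (adj.precompIso a (h ≫ g)).hom =
    (α_ _ _ _).inv ≫ (adj.precompIso a h).hom ▷ R.map g ≫ (α_ _ _ _).hom ≫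
      adj.unit Z' ◁ (R.mapComp _ _).inv ≫ adj.unit Z' ◁ R.map₂ (α_ _ _ _).hom := by
  calc _ = 𝟙 _ ⊗≫ ((a ≫ adj.unit Z) ◁ (R.mapComp h g).inv ≫
        (adj.unitNat a).hom ▷ R.map (h ≫ g)) ⊗≫ adj.unit Z' ◁ (R.mapComp _ _).inv := by
          simp [precompIso, bicategoricalComp]
    _ = _ := by
      rw [whisker_exchange]
      simp [precompIso, bicategoricalComp]

/-- The isomorphism between `k` and the transpose of `E k ≫ ε`. -/
def transposeIso {Z : B} {X : A} (k : Z ⟶ R.obj X) :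
    k ≅ adj.unit Z ≫ R.map (E.map k ≫ adj.counit X) :=
  (ρ_ k).symm ≪≫ whiskerLeftIso k (adj.w X).symm ≪≫ adj.precompIso k (adj.counit X)

theorem transposeIso_naturality {Z : B} {X : A} {k k' : Z ⟶ R.obj X} (β : k ⟶ k') :
    β ≫ (adj.transposeIso k').hom =
      (adj.transposeIso k).hom ≫ adj.unit Z ◁ R.map₂ (E.map₂ β ▷ adj.counit X) := by
  simp only [transposeIso, Iso.trans_hom, Iso.symm_hom, whiskerLeftIso_hom, Category.assoc]
  rw [← precompIso_naturality_left, whisker_exchange_assoc]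
  simp

theorem transposeIso_precomp {Z' Z : B} {X : A} (a : Z' ⟶ Z) (k : Z ⟶ R.obj X) :
    (adj.transposeIso (a ≫ k)).hom = a ◁ (adj.transposeIso k).hom ≫
      (adj.precompIso a (E.map k ≫ adj.counit X)).hom ≫
      adj.unit Z' ◁ R.map₂ ((α_ _ _ _).inv ≫ (E.mapComp a k).inv ▷ adj.counit X) := by
  simp only [transposeIso, Iso.trans_hom, Iso.symm_hom, whiskerLeftIso_hom, precompIso_comp]
  simp

/-- For `R.map g` alone the claim is the modification axiom of `w`. Precomposition with `k`, which
`transposeIso_precomp` controls, gives the general case. -/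
theorem transposeIso_postcomp {Z : B} {X X' : A} (k : Z ⟶ R.obj X) (g : X ⟶ X') :
    (adj.transposeIso (k ≫ R.map g)).hom = (adj.transposeIso k).hom ▷ R.map g ≫ (α_ _ _ _).hom ≫
      adj.unit Z ◁ (R.mapComp _ _).inv ≫ adj.unit Z ◁ R.map₂ ((α_ _ _ _).hom ≫
        E.map k ◁ (adj.counitNat g).inv ≫ (α_ _ _ _).inv ≫
        (E.mapComp k (R.map g)).inv ▷ adj.counit X') := by
  have hw : (adj.transposeIso (R.map g)).hom =
      (λ_ _).inv ≫ (adj.w X).inv ▷ R.map g ≫ (α_ _ _ _).hom ≫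
      adj.unit _ ◁ (R.mapComp _ _).inv ≫ adj.unit _ ◁ R.map₂ (adj.counitNat g).inv := by
    have h := adj.w_naturality g
    rw [← cancel_epi (R.map g ◁ (adj.w X').hom ≫ (ρ_ _).hom)]
    trans (adj.precompIso (R.map g) (adj.counit X')).hom
    · simp [transposeIso]
    · rw [h]
      simp only [precompIso, hat, Iso.trans_hom, Iso.symm_hom, whiskerRightIso_hom,
        whiskerLeftIso_hom, Category.assoc, whiskerLeft_comp, Iso.hom_inv_id_assoc,
        hom_inv_whiskerRight_assoc, Iso.inv_hom_id_assoc, whiskerLeft_hom_inv_assoc]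
      simp only [← whiskerLeft_comp, ← R.map₂_comp, Iso.hom_inv_id, R.map₂_id, Category.comp_id]
  rw [transposeIso_precomp, hw]
  simp only [whiskerLeft_comp, Category.assoc]
  rw [reassoc_of% adj.precompIso_naturality_right k]
  have h := adj.precompIso_postcomp k (adj.counit X) g
  simp only [whiskerLeft_comp, Category.assoc] at h
  rw [reassoc_of% h]
  simp [transposeIso]

/-- This is the swallowtail equation `unit_triangle`, rearranged: up to coherence the canonical
comparison of `ρ` with its double transpose is the image of `v`. -/
theorem transposeIso_unit (Z : B) :
    (adj.transposeIso (adj.unit Z)).hom =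
      (ρ_ _).inv ≫ adj.unit Z ◁ ((R.mapId _).inv ≫ R.map₂ (adj.v Z).hom) := by
  have h := adj.unit_triangle Z
  symm
  rw [← Iso.comp_inv_eq_id]
  simpa [transposeIso, precompIso, hatFromId] using h

/-- The isomorphism between `h` and the transpose of its transpose. -/
def transposeTransposeIso {Z : B} {X : A} (h : E.obj Z ⟶ X) :
    h ≅ E.map (adj.unit Z ≫ R.map h) ≫ adj.counit X :=
  (λ_ h).symm ≪≫ whiskerRightIso (adj.v Z) h ≪≫ α_ _ _ _ ≪≫
    whiskerLeftIso _ (adj.counitNat h).symm ≪≫ (α_ _ _ _).symm ≪≫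
    whiskerRightIso (E.mapComp (adj.unit Z) (R.map h)).symm (adj.counit X)

theorem transposeTransposeIso_naturality {Z : B} {X : A} {h h' : E.obj Z ⟶ X} (θ : h ⟶ h') :
    θ ≫ (adj.transposeTransposeIso h').hom =
      (adj.transposeTransposeIso h).hom ≫ E.map₂ (adj.unit Z ◁ R.map₂ θ) ▷ adj.counit X := by
  have e : adj.counit _ ◁ θ ≫ (adj.counitNat h').inv =
      (adj.counitNat h).inv ≫ E.map₂ (R.map₂ θ) ▷ adj.counit X := by
    rw [Iso.eq_inv_comp, ← Category.assoc, Iso.comp_inv_eq, counitNat_naturality]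
  calc _ = 𝟙 _ ⊗≫ (𝟙 _ ◁ θ ≫ (adj.v Z).hom ▷ h') ⊗≫
        E.map (adj.unit Z) ◁ (adj.counitNat h').inv ⊗≫
        (E.mapComp (adj.unit Z) (R.map h')).inv ▷ adj.counit X := by
          simp [transposeTransposeIso, bicategoricalComp]
    _ = 𝟙 _ ⊗≫ (adj.v Z).hom ▷ h ⊗≫
        E.map (adj.unit Z) ◁ (adj.counit _ ◁ θ ≫ (adj.counitNat h').inv) ⊗≫
        (E.mapComp (adj.unit Z) (R.map h')).inv ▷ adj.counit X := by
          rw [whisker_exchange]; bicategory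
    _ = _ := by
          rw [e]; simp [transposeTransposeIso, bicategoricalComp]

/-- The two comparisons, on the two sides of the biadjunction, agree on 1-cells of the form `ρ ≫ R
h`. Fullness of the transposition depends on this equation. -/
theorem transposeIso_transpose {Z : B} {X : A} (h : E.obj Z ⟶ X) :
    (adj.transposeIso (adj.unit Z ≫ R.map h)).hom =
      adj.unit Z ◁ R.map₂ (adj.transposeTransposeIso h).hom := by
  rw [transposeIso_postcomp, transposeIso_unit]
  simp only [transposeTransposeIso, Iso.trans_hom, Iso.symm_hom, whiskerLeftIso_hom,
    whiskerRightIso_hom, R.map₂_comp, R.map₂_whisker_right, map₂_leftUnitor_inv']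
  simp

theorem exists_map₂_eq {Z : B} {X : A} {h h' : E.obj Z ⟶ X}
    (β : adj.unit Z ≫ R.map h ⟶ adj.unit Z ≫ R.map h') :
    ∃ θ : h ⟶ h', adj.unit Z ◁ R.map₂ θ = β := by
  -- The only candidate: transpose `β` back to `A` and conjugate with the comparisons of `h` and
  -- `h'` with their double transposes.
  refine ⟨(adj.transposeTransposeIso h).hom ≫ E.map₂ β ▷ adj.counit X ≫
    (adj.transposeTransposeIso h').inv, ?_⟩
  have e := adj.transposeIso_naturality β
  rw [transposeIso_transpose, transposeIso_transpose] at e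
  rw [R.map₂_comp, R.map₂_comp, whiskerLeft_comp, whiskerLeft_comp, ← reassoc_of% e,
    ← whiskerLeft_comp, ← R.map₂_comp, Iso.hom_inv_id, R.map₂_id, whiskerLeft_id,
    Category.comp_id]

/-- The quasi-inverse sends `k` to `E k ≫ ε`. Faithfulness comes from `transposeTransposeIso`,
essential surjectivity from `transposeIso`, and fullness from their compatibility. -/
theorem isBiuniversal (Z : B) : IsBiuniversal R (adj.unit Z) := by
  intro X
  have hf : (transpose R (adj.unit Z) X).Faithful := ⟨fun {h h'} θ θ' e => by
    have e' : adj.unit Z ◁ R.map₂ θ = adj.unit Z ◁ R.map₂ θ' := e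
    rw [← cancel_mono (adj.transposeTransposeIso h').hom, transposeTransposeIso_naturality,
      transposeTransposeIso_naturality, e']⟩
  have hF : (transpose R (adj.unit Z) X).Full := ⟨fun {_ _} => adj.exists_map₂_eq⟩
  have hE : (transpose R (adj.unit Z) X).EssSurj :=
    ⟨fun k => ⟨E.map k ≫ adj.counit X, ⟨(adj.transposeIso k).symm⟩⟩⟩
  exact { }

/-- The mate of a 2-cell. -/
def mate {Z' Z : B} {X X' : A} {a : Z' ⟶ Z} {k : Z ⟶ R.obj X} {k' : Z' ⟶ R.obj X'} {g : X' ⟶ X}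
    (ψ : a ≫ k ⟶ k' ≫ R.map g) :
    E.map a ≫ E.map k ≫ adj.counit X ⟶ (E.map k' ≫ adj.counit X') ≫ g :=
  (α_ _ _ _).inv ≫ hat E ψ ▷ adj.counit X ≫ (α_ _ _ _).hom ≫
    E.map k' ◁ (adj.counitNat g).hom ≫ (α_ _ _ _).inv

/-- Naturality of `transposeIso` at `ψ`, with the transposes of its source and target expanded by
`transposeIso_precomp` and `transposeIso_postcomp`. The lemmas on `matePost`, `matePre` and
`mateUnit` are the same argument for the other shapes of `ψ`; the four shapes are those of `γ`, `δ`,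
`κ` and `n₁`. -/
theorem transposeIso_mate {Z' Z : B} {X X' : A} {a : Z' ⟶ Z} {k : Z ⟶ R.obj X}
    {k' : Z' ⟶ R.obj X'} {g : X' ⟶ X} (ψ : a ≫ k ⟶ k' ≫ R.map g) :
    a ◁ (adj.transposeIso k).hom ≫ (adj.precompIso a _).hom ≫ adj.unit Z' ◁ R.map₂ (adj.mate ψ) =
      ψ ≫ (adj.transposeIso k').hom ▷ R.map g ≫ (α_ _ _ _).hom ≫
        adj.unit Z' ◁ (R.mapComp _ _).inv := by
  have h1 := adj.transposeIso_naturality ψ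
  rw [transposeIso_precomp adj a k, transposeIso_postcomp adj k' g] at h1
  -- The outer factors are the coherence cells by which the two expansions of `transposeIso` differ
  -- from composites, so that only `E.map₂ ψ` is left between them.
  have e : adj.mate ψ = ((α_ _ _ _).inv ≫ (E.mapComp a k).inv ▷ adj.counit X) ≫
      E.map₂ ψ ▷ adj.counit X ≫ inv ((α_ _ _ _).hom ≫
        E.map k' ◁ (adj.counitNat g).inv ≫ (α_ _ _ _).inv ≫
        (E.mapComp k' (R.map g)).inv ▷ adj.counit X) := by
    simp [mate, hat]
  rw [e]
  generalize (α_ (E.map a) (E.map k) (adj.counit X)).inv ≫ _ = φ at h1 ⊢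
  rw [R.map₂_comp, R.map₂_comp, whiskerLeft_comp, whiskerLeft_comp]
  simp only [Category.assoc] at h1
  rw [← reassoc_of% h1, ← whiskerLeft_comp, ← R.map₂_comp, IsIso.hom_inv_id]
  simp

/-- The 2-cell corresponding to `ψ : k ≫ R g ⟶ k'`. -/
def matePost {Z : B} {X X' : A} {k : Z ⟶ R.obj X} {g : X ⟶ X'} {k' : Z ⟶ R.obj X'}
    (ψ : k ≫ R.map g ⟶ k') :
    (E.map k ≫ adj.counit X) ≫ g ⟶ E.map k' ≫ adj.counit X' :=
  (α_ _ _ _).hom ≫ E.map k ◁ (adj.counitNat g).inv ≫ (α_ _ _ _).inv ≫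
    ((E.mapComp k (R.map g)).inv ≫ E.map₂ ψ) ▷ adj.counit X'

theorem transposeIso_matePost {Z : B} {X X' : A} {k : Z ⟶ R.obj X} {g : X ⟶ X'}
    {k' : Z ⟶ R.obj X'} (ψ : k ≫ R.map g ⟶ k') :
    (adj.transposeIso k).hom ▷ R.map g ≫ (α_ _ _ _).hom ≫ adj.unit Z ◁ (R.mapComp _ _).inv ≫
      adj.unit Z ◁ R.map₂ (adj.matePost ψ) = ψ ≫ (adj.transposeIso k').hom := by
  have e : adj.matePost ψ = ((α_ _ _ _).hom ≫ E.map k ◁ (adj.counitNat g).inv ≫ (α_ _ _ _).inv ≫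
    (E.mapComp k (R.map g)).inv ▷ adj.counit X') ≫ E.map₂ ψ ▷ adj.counit X' := by
    simp [matePost]
  have h := adj.transposeIso_naturality ψ
  rw [transposeIso_postcomp] at h
  rw [h, e, R.map₂_comp, whiskerLeft_comp]
  simp only [Category.assoc]

/-- The 2-cell corresponding to `ψ : a ≫ k ⟶ b ≫ k'`. -/
def matePre {Z Y Y' : B} {X : A} {a : Z ⟶ Y} {k : Y ⟶ R.obj X} {b : Z ⟶ Y'} {k' : Y' ⟶ R.obj X}
    (ψ : a ≫ k ⟶ b ≫ k') :
    E.map a ≫ E.map k ≫ adj.counit X ⟶ E.map b ≫ E.map k' ≫ adj.counit X :=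
  (α_ _ _ _).inv ≫ hat E ψ ▷ adj.counit X ≫ (α_ _ _ _).hom

theorem transposeIso_matePre {Z Y Y' : B} {X : A} {a : Z ⟶ Y} {k : Y ⟶ R.obj X} {b : Z ⟶ Y'}
    {k' : Y' ⟶ R.obj X} (ψ : a ≫ k ⟶ b ≫ k') :
    a ◁ (adj.transposeIso k).hom ≫ (adj.precompIso a _).hom ≫
      adj.unit Z ◁ R.map₂ (adj.matePre ψ) =
    ψ ≫ b ◁ (adj.transposeIso k').hom ≫ (adj.precompIso b _).hom := by
  have e : adj.matePre ψ = ((α_ _ _ _).inv ≫ (E.mapComp a k).inv ▷ adj.counit X) ≫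
      E.map₂ ψ ▷ adj.counit X ≫
        inv ((α_ _ _ _).inv ≫ (E.mapComp b k').inv ▷ adj.counit X) := by
    simp [matePre, hat]
  have h := adj.transposeIso_naturality ψ
  rw [transposeIso_precomp adj a k, transposeIso_precomp adj b k'] at h
  rw [e]
  generalize (α_ (E.map a) (E.map k) (adj.counit X)).inv ≫ _ = φ at h ⊢
  rw [R.map₂_comp, R.map₂_comp, whiskerLeft_comp, whiskerLeft_comp]
  simp only [Category.assoc] at h
  rw [← reassoc_of% h, ← whiskerLeft_comp, ← R.map₂_comp, IsIso.hom_inv_id]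
  simp

/-- The 2-cell corresponding to `ψ : ρ ⟶ b ≫ k`. -/
def mateUnit {Z Y : B} {b : Z ⟶ Y} {k : Y ⟶ R.obj (E.obj Z)} (ψ : adj.unit Z ⟶ b ≫ k) :
    𝟙 (E.obj Z) ⟶ E.map b ≫ E.map k ≫ adj.counit (E.obj Z) :=
  (adj.v Z).hom ≫ (E.map₂ ψ ≫ (E.mapComp b k).hom) ▷ adj.counit (E.obj Z) ≫ (α_ _ _ _).hom

theorem transposeIso_mateUnit {Z Y : B} {b : Z ⟶ Y} {k : Y ⟶ R.obj (E.obj Z)}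
    (ψ : adj.unit Z ⟶ b ≫ k) :
    ψ ≫ b ◁ (adj.transposeIso k).hom ≫ (adj.precompIso b _).hom =
      (ρ_ _).inv ≫ adj.unit Z ◁ ((R.mapId _).inv ≫ R.map₂ (adj.mateUnit ψ)) := by
  have e : adj.mateUnit ψ = (adj.v Z).hom ≫ E.map₂ ψ ▷ adj.counit _ ≫
        inv ((α_ _ _ _).inv ≫ (E.mapComp b k).inv ▷ adj.counit _) := by
    simp [mateUnit]
  have h := adj.transposeIso_naturality ψ
  rw [transposeIso_precomp adj b k, transposeIso_unit] at h
  rw [e]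
  rw [R.map₂_comp, R.map₂_comp]
  simp only [Category.assoc, whiskerLeft_comp] at h ⊢
  rw [← reassoc_of% h, ← whiskerLeft_comp, ← R.map₂_comp, IsIso.hom_inv_id]
  simp

end Biadjunction
end Transposition
end BiadjointTriangle

namespace BiadjointTriangle

/-! ### Algebra structures along `R`, and their transposes -/

section Lifting

variable {A : Type u₁} [Bicategory.{w₁, v₁} A] {B : Type u₂} [Bicategory.{w₂, v₂} B]

/-- The part of a lifting of `R` to lax algebras and pseudomorphisms that lives in `B`. -/
structure AlgebraLift (M : Pseudomonad B) (R : A ⥤ᵖ B) where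
  alg (X : A) : M.T.obj (R.obj X) ⟶ R.obj X
  assoc (X : A) : M.T.map (alg X) ≫ alg X ⟶ M.mul (R.obj X) ≫ alg X
  unit (X : A) : 𝟙 (R.obj X) ⟶ M.unit (R.obj X) ≫ alg X
  cell {X Y : A} (g : X ⟶ Y) : M.T.map (R.map g) ≫ alg Y ≅ alg X ≫ R.map g
  cell_naturality {X Y : A} {g g' : X ⟶ Y} (θ : g ⟶ g') :
    M.T.map₂ (R.map₂ θ) ▷ alg Y ≫ (cell g').hom = (cell g).hom ≫ alg X ◁ R.map₂ θ
  cell_comp {X Y Z : A} (g : X ⟶ Y) (h : Y ⟶ Z) :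
    M.T.map₂ (R.mapComp g h).hom ▷ alg Z ≫ (M.T.mapComp (R.map g) (R.map h)).hom ▷ alg Z ≫
      (α_ _ _ _).hom ≫ M.T.map (R.map g) ◁ (cell h).hom ≫ (α_ _ _ _).inv ≫
      (cell g).hom ▷ R.map h ≫ (α_ _ _ _).hom =
    (cell (g ≫ h)).hom ≫ alg X ◁ (R.mapComp g h).hom
  cell_assoc {X Y : A} (g : X ⟶ Y) :
    M.T.map (M.T.map (R.map g)) ◁ assoc Y ≫ (α_ _ _ _).inv ≫ (M.mulNat (R.map g)).hom ▷ alg Y ≫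
      (α_ _ _ _).hom ≫ M.mul (R.obj X) ◁ (cell g).hom =
    (α_ _ _ _).inv ≫ hat M.T (cell g).hom ▷ alg Y ≫ (α_ _ _ _).hom ≫
      M.T.map (alg X) ◁ (cell g).hom ≫ (α_ _ _ _).inv ≫ assoc X ▷ R.map g ≫ (α_ _ _ _).hom
  cell_unit {X Y : A} (g : X ⟶ Y) :
    (ρ_ _).inv ≫ R.map g ◁ unit Y ≫ (α_ _ _ _).inv ≫ (M.unitNat (R.map g)).hom ▷ alg Y ≫
      (α_ _ _ _).hom ≫ M.unit (R.obj X) ◁ (cell g).hom =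
    (λ_ _).inv ≫ unit X ▷ R.map g ≫ (α_ _ _ _).hom

namespace AlgebraLift

variable {M : Pseudomonad B} {E : B ⥤ᵖ A} {R : A ⥤ᵖ B} (L : AlgebraLift M R)
  (adj : Biadjunction E R)

/-- The 1-cell `T ρ ≫ alg : T Z ⟶ R E Z`. -/
abbrev k (Z : B) : M.T.obj Z ⟶ R.obj (E.obj Z) := M.T.map (adj.unit Z) ≫ L.alg (E.obj Z)

/-- The 1-cell `E k ≫ ε : E T Z ⟶ E Z`. -/
def c (Z : B) : E.obj (M.T.obj Z) ⟶ E.obj Z := E.map (L.k adj Z) ≫ adj.counit (E.obj Z)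

/-- The pseudonaturality cell of `k`. -/
def kIso {Z' Z : B} (a : Z' ⟶ Z) :
    M.T.map a ≫ L.k adj Z ≅ L.k adj Z' ≫ R.map (E.map a) :=
  (α_ _ _ _).symm ≪≫
    whiskerRightIso ((M.T.mapComp a (adj.unit Z)).symm ≪≫ M.T.map₂Iso (adj.unitNat a) ≪≫
      M.T.mapComp (adj.unit Z') (R.map (E.map a))) (L.alg (E.obj Z)) ≪≫
    α_ _ _ _ ≪≫ whiskerLeftIso (M.T.map (adj.unit Z')) (L.cell (E.map a)) ≪≫ (α_ _ _ _).symm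

/-- The pseudonaturality cell of `c`. -/
def cIso {Z' Z : B} (a : Z' ⟶ Z) :
    E.map (M.T.map a) ≫ L.c adj Z ≅ L.c adj Z' ≫ E.map a :=
  (α_ _ _ _).symm ≪≫
    whiskerRightIso ((E.mapComp (M.T.map a) (L.k adj Z)).symm ≪≫ E.map₂Iso (L.kIso adj a) ≪≫
      E.mapComp (L.k adj Z') (R.map (E.map a))) (adj.counit (E.obj Z)) ≪≫
    α_ _ _ _ ≪≫ whiskerLeftIso (E.map (L.k adj Z')) (adj.counitNat (E.map a)) ≪≫ (α_ _ _ _).symm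

/-- Recognises `γ` as the mate of the naturality cell of `k`, which makes the calculus of mates
applicable to `σ₂₀`. -/
theorem cIso_hom {Z' Z : B} (a : Z' ⟶ Z) :
    (L.cIso adj a).hom = adj.mate (L.kIso adj a).hom := by
  simp [cIso, Biadjunction.mate, hat, c]

/-- The comparison of `k` at `R X` with the algebra structure of `R X`. -/
def kCounit (X : A) : L.k adj (R.obj X) ≫ R.map (adj.counit X) ⟶ L.alg X :=
  (α_ _ _ _).hom ≫ M.T.map (adj.unit (R.obj X)) ◁ (L.cell (adj.counit X)).inv ≫
    (α_ _ _ _).inv ≫ hatToId M.T (adj.w X).hom ▷ L.alg X ≫ (λ_ _).hom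

/-- The comparison of `c` at `R X` with the algebra structure of `R X`. -/
def cCounit (X : A) :
    L.c adj (R.obj X) ≫ adj.counit X ⟶ E.map (L.alg X) ≫ adj.counit X :=
  adj.matePost (L.kCounit adj X)

/-- The compatibility of `k` with the multiplication. -/
def kMul (Z : B) : M.T.map (L.k adj Z) ≫ L.alg (E.obj Z) ⟶ M.mul Z ≫ L.k adj Z :=
  (M.T.mapComp (M.T.map (adj.unit Z)) (L.alg (E.obj Z))).hom ▷ L.alg (E.obj Z) ≫
    (α_ _ _ _).hom ≫ M.T.map (M.T.map (adj.unit Z)) ◁ L.assoc (E.obj Z) ≫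
    (α_ _ _ _).inv ≫ (M.mulNat (adj.unit Z)).hom ▷ L.alg (E.obj Z) ≫ (α_ _ _ _).hom

/-- The pseudonaturality cell of `c`, followed by a 1-cell. -/
def cIsoPost {Z' Z : B} {X : A} (a : Z' ⟶ Z) (h : E.obj Z ⟶ X) :
    E.map (M.T.map a) ≫ L.c adj Z ≫ h ≅ L.c adj Z' ≫ E.map a ≫ h :=
  (α_ _ _ _).symm ≪≫ whiskerRightIso (L.cIso adj a) h ≪≫ α_ _ _ _

/-- The pseudonaturality cell of `c` at `k`, followed by `ε`. -/
def cIsoCounit (Z : B) : E.map (M.T.map (L.k adj Z)) ≫ L.c adj _ ≫ adj.counit _ ≅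
    L.c adj _ ≫ L.c adj Z :=
  L.cIsoPost adj (L.k adj Z) (adj.counit _)

/-- The 2-cell corresponding to `kMul`. -/
def kMulMate (Z : B) : E.map (M.T.map (L.k adj Z)) ≫ E.map (L.alg _) ≫ adj.counit _ ⟶
    E.map (M.mul Z) ≫ L.c adj Z :=
  adj.matePre (L.kMul adj Z)

/-- The compatibility of `c` with the multiplication. -/
def cMul (Z : B) :
    L.c adj (M.T.obj Z) ≫ L.c adj Z ⟶ E.map (M.mul Z) ≫ L.c adj Z :=
  (L.cIsoCounit adj Z).inv ≫ E.map (M.T.map (L.k adj Z)) ◁ L.cCounit adj (E.obj Z) ≫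
    L.kMulMate adj Z

/-- The compatibility of `k` with the unit. -/
def kUnit (Z : B) : adj.unit Z ⟶ M.unit Z ≫ L.k adj Z :=
  (ρ_ _).inv ≫ adj.unit Z ◁ L.unit (E.obj Z) ≫ (α_ _ _ _).inv ≫
    (M.unitNat (adj.unit Z)).hom ▷ L.alg (E.obj Z) ≫ (α_ _ _ _).hom

/-- The compatibility of `c` with the unit. -/
def cUnit (Z : B) : 𝟙 (E.obj Z) ⟶ E.map (M.unit Z) ≫ L.c adj Z :=
  adj.mateUnit (L.kUnit adj Z)

/-- The isomorphism `T (ρ ≫ R h) ≫ alg ≅ k ≫ R h`. -/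
def kPost {Z : B} {X : A} (h : E.obj Z ⟶ X) :
    M.T.map (adj.unit Z ≫ R.map h) ≫ L.alg X ≅ L.k adj Z ≫ R.map h :=
  whiskerRightIso (M.T.mapComp (adj.unit Z) (R.map h)) (L.alg X) ≪≫ α_ _ _ _ ≪≫
    whiskerLeftIso (M.T.map (adj.unit Z)) (L.cell h) ≪≫ (α_ _ _ _).symm

theorem kPost_hom {Z : B} {X : A} (h : E.obj Z ⟶ X) :
    (L.kPost adj h).hom = (M.T.mapComp (adj.unit Z) (R.map h)).hom ▷ L.alg X ≫ (α_ _ _ _).hom ≫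
      M.T.map (adj.unit Z) ◁ (L.cell h).hom ≫
      (α_ (M.T.map (adj.unit Z)) (L.alg (E.obj Z)) (R.map h)).inv :=
  rfl

/-- Splits the naturality cell of `k` into that of `ρ` and an instance of `kPost`, so that the rules
for `kPost` apply to it. -/
theorem kIso_hom {Z' Z : B} (a : Z' ⟶ Z) :
    (L.kIso adj a).hom = (α_ (M.T.map a) (M.T.map (adj.unit Z)) (L.alg _)).inv ≫
      ((M.T.mapComp a (adj.unit Z)).inv ≫
        M.T.map₂ (adj.unitNat a).hom) ▷ L.alg _ ≫ (L.kPost adj (E.map a)).hom := by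
  change (α_ (M.T.map a) (M.T.map (adj.unit Z)) (L.alg _)).inv ≫
      ((M.T.mapComp a (adj.unit Z)).inv ≫ M.T.map₂ (adj.unitNat a).hom ≫
      (M.T.mapComp (adj.unit Z') (R.map (E.map a))).hom) ▷ L.alg (E.obj Z) ≫
    (α_ _ _ _).hom ≫ M.T.map (adj.unit Z') ◁ (L.cell (E.map a)).hom ≫
    (α_ (M.T.map (adj.unit Z')) (L.alg (E.obj Z')) (R.map (E.map a))).inv = _
  simp [kPost_hom]

theorem kPost_naturality {Z : B} {X : A} {h h' : E.obj Z ⟶ X} (θ : h ⟶ h') :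
    M.T.map₂ (adj.unit Z ◁ R.map₂ θ) ▷ L.alg X ≫ (L.kPost adj h').hom =
      (L.kPost adj h).hom ≫ L.k adj Z ◁ R.map₂ θ := by
  have e := congrArg (fun t => M.T.map (adj.unit Z) ◁ t) (L.cell_naturality θ)
  simp only [whiskerLeft_comp] at e
  simp [kPost_hom, reassoc_of% e]

theorem kPost_comp {Z : B} {X X' : A} (h : E.obj Z ⟶ X) (g : X ⟶ X') :
    M.T.map₂ ((α_ _ _ _).hom ≫ adj.unit Z ◁ (R.mapComp h g).inv) ▷ L.alg X' ≫
      (L.kPost adj (h ≫ g)).hom =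
    (M.T.mapComp (adj.unit Z ≫ R.map h) (R.map g)).hom ▷ L.alg X' ≫ (α_ _ _ _).hom ≫
      M.T.map (adj.unit Z ≫ R.map h) ◁ (L.cell g).hom ≫ (α_ _ _ _).inv ≫
      (L.kPost adj h).hom ▷ R.map g ≫ (α_ _ _ _).hom ≫ L.k adj Z ◁ (R.mapComp h g).inv := by
  have e : M.T.map₂ (R.mapComp h g).inv ▷ L.alg X' ≫ (L.cell (h ≫ g)).hom =
      (M.T.mapComp (R.map h) (R.map g)).hom ▷ L.alg X' ≫
      (α_ _ _ _).hom ≫ M.T.map (R.map h) ◁ (L.cell g).hom ≫ (α_ _ _ _).inv ≫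
      (L.cell h).hom ▷ R.map g ≫ (α_ _ _ _).hom ≫ L.alg _ ◁ (R.mapComp h g).inv := by
    have e0 := L.cell_comp h g
    rw [← cancel_mono (L.alg _ ◁ (R.mapComp h g).hom),
      ← cancel_epi (M.T.map₂ (R.mapComp h g).hom ▷ L.alg X')]
    simp only [Category.assoc, ← e0]
    rw [← comp_whiskerRight_assoc, ← M.T.map₂_comp]
    simp
  symm
  calc _ = 𝟙 _ ⊗≫ ((M.T.mapComp (adj.unit Z ≫ R.map h) (R.map g)).hom ▷ L.alg X') ⊗≫
      (M.T.map (adj.unit Z ≫ R.map h) ◁ (L.cell g).hom ≫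
      (M.T.mapComp (adj.unit Z) (R.map h)).hom ▷ (L.alg X ≫ R.map g)) ⊗≫
      M.T.map (adj.unit Z) ◁ (L.cell h).hom ▷ R.map g ⊗≫
      L.k adj Z ◁ (R.mapComp h g).inv := by
        simp [kPost_hom, bicategoricalComp]
    _ = _ := by
      rw [whisker_exchange]
      have e' := congrArg (fun t => M.T.map (adj.unit Z) ◁ t) e
      simp only [whiskerLeft_comp] at e'
      simp [kPost_hom, bicategoricalComp, reassoc_of% e']

/-- `precompIso a h` is the naturality cell of `ρ` at `a` followed by a comparison cell of `R`. The
rule `kPost_comp` for `E a ≫ h` absorbs the latter, and the former is the ingredient of `kIso` that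
`kPost` lacks. -/
theorem kPost_precomp {Z' Z : B} {X : A} (a : Z' ⟶ Z) (h : E.obj Z ⟶ X) :
    M.T.map a ◁ (L.kPost adj h).hom ≫ (α_ _ _ _).inv ≫ (L.kIso adj a).hom ▷ R.map h ≫
      (α_ _ _ _).hom ≫ L.k adj Z' ◁ (R.mapComp (E.map a) h).inv =
    (α_ _ _ _).inv ≫ (M.T.mapComp a (adj.unit Z ≫ R.map h)).inv ▷ L.alg X ≫
      M.T.map₂ (adj.precompIso a h).hom ▷ L.alg X ≫ (L.kPost adj (E.map a ≫ h)).hom := by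
  have e := L.kPost_comp adj (E.map a) h
  have e1 : (adj.precompIso a h).hom = ((α_ _ _ _).inv ≫ (adj.unitNat a).hom ▷ R.map h) ≫
      ((α_ _ _ _).hom ≫ adj.unit Z' ◁ (R.mapComp (E.map a) h).inv) := by
    simp [Biadjunction.precompIso]
  rw [e1, M.T.map₂_comp, comp_whiskerRight, Category.assoc, e, kIso_hom]
  calc _ = 𝟙 _ ⊗≫ M.T.map a ◁ (M.T.mapComp (adj.unit Z) (R.map h)).hom ▷ L.alg X ⊗≫
      ((M.T.map a ≫ M.T.map (adj.unit Z)) ◁ (L.cell h).hom ≫ ((M.T.mapComp a (adj.unit Z)).inv ≫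
      M.T.map₂ (adj.unitNat a).hom) ▷ (L.alg _ ≫ R.map h)) ⊗≫
      (L.kPost adj (E.map a)).hom ▷ R.map h ⊗≫
      L.k adj Z' ◁ (R.mapComp (E.map a) h).inv := by
        simp [kPost_hom, bicategoricalComp]
    _ = _ := by
      rw [whisker_exchange]
      simp [bicategoricalComp, kPost_hom, map₂_associator_inv']

/-- The isomorphism between `k` and the transpose of `c`. -/
def kTranspose (Z : B) : L.k adj Z ≅ adj.unit (M.T.obj Z) ≫ R.map (L.c adj Z) :=
  adj.transposeIso (L.k adj Z)

theorem kTranspose_cIso {Z' Z : B} (a : Z' ⟶ Z) :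
    M.T.map a ◁ (L.kTranspose adj Z).hom ≫ (adj.precompIso (M.T.map a) _).hom ≫
        adj.unit _ ◁ R.map₂ (L.cIso adj a).hom =
      (L.kIso adj a).hom ≫ (L.kTranspose adj Z').hom ▷ R.map (E.map a) ≫ (α_ _ _ _).hom ≫
        adj.unit _ ◁ (R.mapComp _ _).inv := by
  rw [cIso_hom]
  exact adj.transposeIso_mate (L.kIso adj a).hom

/-- The isomorphism between `T (ρ ≫ R h) ≫ alg` and the transpose of `c ≫ h`. -/
def algPost {Z : B} {X : A} (h : E.obj Z ⟶ X) :
    M.T.map (adj.unit Z ≫ R.map h) ≫ L.alg X ≅ adj.unit (M.T.obj Z) ≫ R.map (L.c adj Z ≫ h) :=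
  L.kPost adj h ≪≫ whiskerRightIso (L.kTranspose adj Z) (R.map h) ≪≫ α_ _ _ _ ≪≫
    whiskerLeftIso _ (R.mapComp (L.c adj Z) h).symm

theorem algPost_naturality {Z : B} {X : A} {h h' : E.obj Z ⟶ X} (θ : h ⟶ h') :
    M.T.map₂ (adj.unit Z ◁ R.map₂ θ) ▷ L.alg X ≫ (L.algPost adj h').hom =
      (L.algPost adj h).hom ≫ adj.unit _ ◁ R.map₂ (L.c adj Z ◁ θ) := by
  have e := L.kPost_naturality adj θ
  simp only [algPost, Iso.trans_hom, whiskerRightIso_hom, whiskerLeftIso_hom, Iso.symm_hom]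
  rw [reassoc_of% e, whisker_exchange_assoc]
  simp

theorem algPost_comp {Z : B} {X X' : A} (h : E.obj Z ⟶ X) (g : X ⟶ X') :
    M.T.map₂ ((α_ _ _ _).hom ≫ adj.unit Z ◁ (R.mapComp h g).inv) ▷ L.alg X' ≫
      (L.algPost adj (h ≫ g)).hom =
    (M.T.mapComp (adj.unit Z ≫ R.map h) (R.map g)).hom ▷ L.alg X' ≫ (α_ _ _ _).hom ≫
      M.T.map (adj.unit Z ≫ R.map h) ◁ (L.cell g).hom ≫ (α_ _ _ _).inv ≫
      (L.algPost adj h).hom ▷ R.map g ≫ (α_ _ _ _).hom ≫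
      adj.unit _ ◁ ((R.mapComp _ _).inv ≫ R.map₂ (α_ _ _ _).hom) := by
  have e := L.kPost_comp adj h g
  simp only [algPost, Iso.trans_hom, whiskerRightIso_hom, whiskerLeftIso_hom, Iso.symm_hom]
  rw [reassoc_of% e, whisker_exchange_assoc]
  simp

/-- This is why `γ⁻¹` is the right value for `σ₂₀`: separating `T a` from `T (a ≫ ρ ≫ R h)` on the
side of algebras corresponds to `γ_a` followed by `h` on the side of `A`. The part that precedes
transposition is `kPost_precomp`, the transposition itself is `kTranspose_cIso`. -/
theorem algPost_precomp {Z' Z : B} {X : A} (a : Z' ⟶ Z) (h : E.obj Z ⟶ X) :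
    M.T.map a ◁ (L.algPost adj h).hom ≫ (adj.precompIso (M.T.map a) _).hom ≫
      adj.unit _ ◁ R.map₂ (L.cIsoPost adj a h).hom =
    (α_ _ _ _).inv ≫ (M.T.mapComp a (adj.unit Z ≫ R.map h)).inv ▷ L.alg X ≫
      M.T.map₂ (adj.precompIso a h).hom ▷ L.alg X ≫ (L.algPost adj (E.map a ≫ h)).hom := by
  have e := L.kPost_precomp adj a h
  have e1 := adj.precompIso_postcomp (M.T.map a) (L.c adj Z) h
  have e2 := congrArg (fun t => t ▷ R.map h) (L.kTranspose_cIso adj a)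
  simp only [algPost, cIsoPost, Iso.trans_hom, whiskerRightIso_hom, whiskerLeftIso_hom,
    Iso.symm_hom]
  simp only [whiskerLeft_comp, comp_whiskerRight, Category.assoc] at e1 e2 ⊢
  rw [reassoc_of% e1, ← reassoc_of% e]
  simp only [R.map₂_comp, R.map₂_whisker_right, whiskerLeft_comp]
  have e4 : adj.unit (M.T.obj Z') ◁ R.map₂ (α_ (E.map (M.T.map a)) (L.c adj Z) h).hom ≫
    adj.unit (M.T.obj Z') ◁ R.map₂ (α_ (E.map (M.T.map a)) (L.c adj Z) h).inv = 𝟙 _ := by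
    rw [← whiskerLeft_comp, ← R.map₂_comp]; simp
  rw [reassoc_of% e4]
  calc _ = 𝟙 _ ⊗≫ M.T.map a ◁ (L.kPost adj h).hom ⊗≫
      (M.T.map a ◁ (L.kTranspose adj Z).hom ▷ R.map h ⊗≫
      (adj.precompIso (M.T.map a) (L.c adj Z)).hom ▷ R.map h ⊗≫
      (adj.unit _ ◁ R.map₂ (L.cIso adj a).hom) ▷ R.map h) ⊗≫
      adj.unit (M.T.obj Z') ◁ (R.mapComp (L.c adj Z' ≫ E.map a) h).inv ⊗≫
      adj.unit (M.T.obj Z') ◁ R.map₂ (α_ (L.c adj Z') (E.map a) h).hom := by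
        simp [bicategoricalComp]
    _ = 𝟙 _ ⊗≫ M.T.map a ◁ (L.kPost adj h).hom ⊗≫ (L.kIso adj a).hom ▷ R.map h ⊗≫
      (L.kTranspose adj Z').hom ▷ (R.map (E.map a) ≫ R.map h) ⊗≫
      adj.unit (M.T.obj Z') ◁ (R.mapComp (L.c adj Z') (E.map a)).inv ▷ R.map h ⊗≫
      adj.unit (M.T.obj Z') ◁ (R.mapComp (L.c adj Z' ≫ E.map a) h).inv ⊗≫
      adj.unit (M.T.obj Z') ◁ R.map₂ (α_ (L.c adj Z') (E.map a) h).hom := by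
        have e3 : M.T.map a ◁ (L.kTranspose adj Z).hom ▷ R.map h ⊗≫
      (adj.precompIso (M.T.map a) (L.c adj Z)).hom ▷ R.map h ⊗≫
      (adj.unit _ ◁ R.map₂ (L.cIso adj a).hom) ▷ R.map h = 𝟙 _ ⊗≫ (L.kIso adj a).hom ▷ R.map h ⊗≫
      (L.kTranspose adj Z').hom ▷ (R.map (E.map a) ≫ R.map h) ⊗≫
      adj.unit (M.T.obj Z') ◁ (R.mapComp (L.c adj Z') (E.map a)).inv ▷ R.map h ⊗≫ 𝟙 _ := by
          rw [← cancel_epi (α_ _ _ _).hom]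
          simpa [bicategoricalComp] using e2
        rw [e3]; bicategory
    _ = _ := by
      rw [whisker_exchange_assoc]
      simp [bicategoricalComp]

/-- The proof is that of associativity for a composite of lax morphisms, with `ρ` as the first
factor. The object `Z` has no algebra structure, so the axiom is available for the second factor
only, and `kMul` collects what the first leaves behind. -/
theorem kPost_mul {Z : B} {X : A} (h : E.obj Z ⟶ X) :
    M.T.map (M.T.map (adj.unit Z ≫ R.map h)) ◁ L.assoc X ≫ (α_ _ _ _).inv ≫
      (M.mulNat (adj.unit Z ≫ R.map h)).hom ▷ L.alg X ≫ (α_ _ _ _).hom ≫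
      M.mul Z ◁ (L.kPost adj h).hom =
    (α_ _ _ _).inv ≫ hat M.T (L.kPost adj h).hom ▷ L.alg X ≫ (α_ _ _ _).hom ≫
      M.T.map (L.k adj Z) ◁ (L.cell h).hom ≫ (α_ _ _ _).inv ≫ L.kMul adj Z ▷ R.map h ≫
      (α_ _ _ _).hom := by
  have e := M.mulNat_comp (adj.unit Z) (R.map h)
  have e' := L.cell_assoc h
  have eh : hat M.T (L.kPost adj h).hom =
      (M.T.map₂ (M.T.mapComp (adj.unit Z) (R.map h)).hom ≫
      (M.T.mapComp (M.T.map (adj.unit Z)) (M.T.map (R.map h))).hom) ▷ M.T.map (L.alg X) ≫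
      (α_ _ _ _).hom ≫
      M.T.map (M.T.map (adj.unit Z)) ◁ hat M.T (L.cell h).hom ≫ (α_ _ _ _).inv ≫
      (M.T.mapComp (M.T.map (adj.unit Z)) (L.alg _)).inv ▷ M.T.map (R.map h) := by
    simp [hat, kPost_hom, map₂_associator_inv']
  rw [eh]
  generalize M.T.map₂ (M.T.mapComp (adj.unit Z) (R.map h)).hom ≫
      (M.T.mapComp (M.T.map (adj.unit Z)) (M.T.map (R.map h))).hom = φ at e ⊢
  calc _ = M.T.map (M.T.map (adj.unit Z ≫ R.map h)) ◁ L.assoc X ≫ (α_ _ _ _).inv ≫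
      ((M.mulNat (adj.unit Z ≫ R.map h)).hom ≫
      M.mul Z ◁ (M.T.mapComp (adj.unit Z) (R.map h)).hom) ▷ L.alg X ⊗≫
      M.mul Z ◁ M.T.map (adj.unit Z) ◁ (L.cell h).hom ⊗≫ 𝟙 _ := by
        simp [kPost_hom, bicategoricalComp]
    _ = (M.T.map (M.T.map (adj.unit Z ≫ R.map h)) ◁ L.assoc X ≫ φ ▷ (M.mul _ ≫ L.alg X)) ⊗≫
      M.T.map (M.T.map (adj.unit Z)) ◁ (M.mulNat (R.map h)).hom ▷ L.alg X ⊗≫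
      ((M.mulNat (adj.unit Z)).hom ▷ (M.T.map (R.map h) ≫ L.alg X) ≫
      (M.mul Z ≫ M.T.map (adj.unit Z)) ◁ (L.cell h).hom) ⊗≫ 𝟙 _ := by
        rw [e]; bicategory
    _ = φ ▷ (M.T.map (L.alg X) ≫ L.alg X) ⊗≫
      M.T.map (M.T.map (adj.unit Z)) ◁ (M.T.map (M.T.map (R.map h)) ◁ L.assoc X ≫
        (α_ _ _ _).inv ≫ (M.mulNat (R.map h)).hom ▷ L.alg X ≫ (α_ _ _ _).hom ≫
        M.mul _ ◁ (L.cell h).hom) ⊗≫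
      (M.mulNat (adj.unit Z)).hom ▷ (L.alg _ ≫ R.map h) ⊗≫ 𝟙 _ := by
        rw [whisker_exchange φ (L.assoc X), ← whisker_exchange (M.mulNat (adj.unit Z)).hom]
        bicategory
    -- A comparison cell of `T` and its inverse are inserted between the parts: `hat` of `kPost`
    -- ends with the inverse, and `kMul` begins with the cell itself.
    _ = φ ▷ (M.T.map (L.alg X) ≫ L.alg X) ⊗≫
      M.T.map (M.T.map (adj.unit Z)) ◁ hat M.T (L.cell h).hom ▷ L.alg X ⊗≫
      (((M.T.map (M.T.map (adj.unit Z)) ≫ M.T.map (L.alg _)) ◁ (L.cell h).hom) ≫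
        ((M.T.mapComp (M.T.map (adj.unit Z)) (L.alg _)).inv ≫
        (M.T.mapComp (M.T.map (adj.unit Z)) (L.alg _)).hom) ▷ (L.alg _ ≫ R.map h)) ⊗≫
      M.T.map (M.T.map (adj.unit Z)) ◁ L.assoc _ ▷ R.map h ⊗≫
      (M.mulNat (adj.unit Z)).hom ▷ (L.alg _ ≫ R.map h) ⊗≫ 𝟙 _ := by
        rw [e', Iso.inv_hom_id]; bicategory
    _ = φ ▷ (M.T.map (L.alg X) ≫ L.alg X) ⊗≫
      M.T.map (M.T.map (adj.unit Z)) ◁ hat M.T (L.cell h).hom ▷ L.alg X ⊗≫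
      ((M.T.map (M.T.map (adj.unit Z)) ≫ M.T.map (L.alg _)) ◁ (L.cell h).hom ≫
        (M.T.mapComp (M.T.map (adj.unit Z)) (L.alg _)).inv ▷ (L.alg _ ≫ R.map h)) ⊗≫
        (M.T.mapComp (M.T.map (adj.unit Z)) (L.alg _)).hom ▷ (L.alg _ ≫ R.map h) ⊗≫
      M.T.map (M.T.map (adj.unit Z)) ◁ L.assoc _ ▷ R.map h ⊗≫
      (M.mulNat (adj.unit Z)).hom ▷ (L.alg _ ≫ R.map h) ⊗≫ 𝟙 _ := by
        bicategory
    _ = _ := by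
      rw [whisker_exchange, kMul]; bicategory

theorem kPost_unit {Z : B} {X : A} (h : E.obj Z ⟶ X) :
    (ρ_ _).inv ≫ (adj.unit Z ≫ R.map h) ◁ L.unit X ≫ (α_ _ _ _).inv ≫
      (M.unitNat (adj.unit Z ≫ R.map h)).hom ▷ L.alg X ≫ (α_ _ _ _).hom ≫
      M.unit Z ◁ (L.kPost adj h).hom =
    L.kUnit adj Z ▷ R.map h ≫ (α_ _ _ _).hom := by
  have e := M.unitNat_comp (adj.unit Z) (R.map h)
  have e' := L.cell_unit h
  calc _ = (ρ_ _).inv ≫ (adj.unit Z ≫ R.map h) ◁ L.unit X ≫ (α_ _ _ _).inv ≫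
      ((M.unitNat (adj.unit Z ≫ R.map h)).hom ≫
      M.unit Z ◁ (M.T.mapComp (adj.unit Z) (R.map h)).hom) ▷ L.alg X ⊗≫
      M.unit Z ◁ M.T.map (adj.unit Z) ◁ (L.cell h).hom ⊗≫ 𝟙 _ := by
        simp [kPost_hom, bicategoricalComp]
    _ = 𝟙 _ ⊗≫ adj.unit Z ◁ R.map h ◁ L.unit X ⊗≫
      adj.unit Z ◁ (M.unitNat (R.map h)).hom ▷ L.alg X ⊗≫
      ((M.unitNat (adj.unit Z)).hom ▷ (M.T.map (R.map h) ≫ L.alg X) ≫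
      (M.unit Z ≫ M.T.map (adj.unit Z)) ◁ (L.cell h).hom) ⊗≫ 𝟙 _ := by
        rw [e]; bicategory
    _ = 𝟙 _ ⊗≫ adj.unit Z ◁ ((ρ_ _).inv ≫ R.map h ◁ L.unit X ≫
        (α_ _ _ _).inv ≫ (M.unitNat (R.map h)).hom ▷ L.alg X ≫ (α_ _ _ _).hom ≫
        M.unit _ ◁ (L.cell h).hom) ⊗≫
      (M.unitNat (adj.unit Z)).hom ▷ (L.alg _ ≫ R.map h) ⊗≫ 𝟙 _ := by
        rw [← whisker_exchange (M.unitNat (adj.unit Z)).hom]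
        bicategory
    _ = _ := by
      rw [e', kUnit]; bicategory

/-- The inverse of the cell at `ε` in `kCounit` cancels the one in `kPost`, so that `T w` is all
that is left. -/
theorem kPost_kCounit (X : A) :
    (L.kPost adj (adj.counit X)).hom ≫ L.kCounit adj X =
      M.T.map₂ (adj.w X).hom ▷ L.alg X ≫ (M.T.mapId _).hom ▷ L.alg X ≫ (λ_ _).hom := by
  simp [kPost_hom, kCounit, hatToId]

theorem algPost_cCounit (X : A) :
    (L.algPost adj (adj.counit X)).hom ≫ adj.unit _ ◁ R.map₂ (L.cCounit adj X) =
      M.T.map₂ (adj.w X).hom ▷ L.alg X ≫ (M.T.mapId _).hom ▷ L.alg X ≫ (λ_ _).hom ≫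
        (adj.transposeIso (L.alg X)).hom := by
  have e1 : (L.kTranspose adj (R.obj X)).hom ▷ R.map (adj.counit X) ≫ (α_ _ _ _).hom ≫
      adj.unit _ ◁ (R.mapComp _ _).inv ≫ adj.unit _ ◁ R.map₂ (L.cCounit adj X) =
      L.kCounit adj X ≫ (adj.transposeIso (L.alg X)).hom :=
    adj.transposeIso_matePost (L.kCounit adj X)
  have e2 := L.kPost_kCounit adj X
  rw [← reassoc_of% e2, ← e1]
  simp [algPost]

/-- Explains the three factors of `σ₂₁`. The comparison of `k` with its double transpose consists of
`w⁻¹` and `precompIso`. Passing `precompIso` through the algebra structure produces `γ_k`, which the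
factor `γ_k⁻¹` removes; then `δ` turns `algPost` at `ε` into `T w`, which cancels the remaining `T
w⁻¹`; what is left is `κ`, whose transpose is the last factor. -/
theorem kTranspose_mul (Z : B) :
    M.T.map₂ (L.kTranspose adj Z).hom ▷ L.alg (E.obj Z) ≫ (L.algPost adj (L.c adj Z)).hom ≫
      adj.unit _ ◁ R.map₂ (L.cMul adj Z) =
    L.kMul adj Z ≫ M.mul Z ◁ (L.kTranspose adj Z).hom ≫ (adj.precompIso (M.mul Z) _).hom := by
  have a1 : M.T.map (L.k adj Z) ◁ (L.algPost adj (adj.counit _)).hom ≫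
      (adj.precompIso (M.T.map (L.k adj Z)) _).hom ≫
      adj.unit _ ◁ R.map₂ (L.cIsoCounit adj Z).hom =
      (α_ _ _ _).inv ≫ (M.T.mapComp (L.k adj Z) _).inv ▷ L.alg _ ≫
      M.T.map₂ (adj.precompIso (L.k adj Z) (adj.counit _)).hom ▷ L.alg _ ≫
      (L.algPost adj (L.c adj Z)).hom :=
    L.algPost_precomp adj (L.k adj Z) (adj.counit (E.obj Z))
  have a2 : M.T.map₂ (adj.precompIso (L.k adj Z) (adj.counit _)).hom ▷ L.alg _ ≫
      (L.algPost adj (L.c adj Z)).hom = (M.T.mapComp (L.k adj Z) _).hom ▷ L.alg _ ≫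
      (α_ _ _ _).hom ≫ M.T.map (L.k adj Z) ◁ (L.algPost adj (adj.counit _)).hom ≫
      (adj.precompIso (M.T.map (L.k adj Z)) _).hom ≫
      adj.unit _ ◁ R.map₂ (L.cIsoCounit adj Z).hom := by
    rw [a1]
    simp only [Iso.hom_inv_id_assoc, hom_inv_whiskerRight_assoc]
  -- Splits `transposeIso` into its `w⁻¹` part, kept for the final cancellation, and `precompIso`,
  -- which `a2` rewrites.
  have a3 : M.T.map₂ (L.kTranspose adj Z).hom ▷ L.alg (E.obj Z) ≫
      (L.algPost adj (L.c adj Z)).hom = M.T.map₂ ((ρ_ _).inv ≫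
      L.k adj Z ◁ (adj.w _).inv) ▷ L.alg (E.obj Z) ≫
      M.T.map₂ (adj.precompIso (L.k adj Z) (adj.counit _)).hom ▷ L.alg (E.obj Z) ≫
      (L.algPost adj (L.c adj Z)).hom := by
    have e : (adj.transposeIso (L.k adj Z)).hom = ((ρ_ _).inv ≫ L.k adj Z ◁ (adj.w _).inv) ≫
       (adj.precompIso (L.k adj Z) (adj.counit _)).hom := (Category.assoc _ _ _).symm
    generalize (ρ_ (L.k adj Z)).inv ≫ _ = p at e ⊢
    have e' : M.T.map₂ (adj.transposeIso (L.k adj Z)).hom ▷ L.alg (E.obj Z) =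
        M.T.map₂ p ▷ L.alg _ ≫ M.T.map₂ (adj.precompIso _ _).hom ▷ L.alg _ := by
      rw [e, M.T.map₂_comp, comp_whiskerRight]
    exact (congrArg (· ≫ (L.algPost adj (L.c adj Z)).hom) e').trans (Category.assoc _ _ _)
  have a4 := L.algPost_cCounit adj (E.obj Z)
  have a5 := adj.precompIso_naturality_right (M.T.map (L.k adj Z)) (L.cCounit adj (E.obj Z))
  have a6 : M.T.map (L.k adj Z) ◁ (adj.transposeIso (L.alg _)).hom ≫
      (adj.precompIso (M.T.map (L.k adj Z)) _).hom ≫ adj.unit _ ◁ R.map₂ (L.kMulMate adj Z) =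
      L.kMul adj Z ≫ M.mul Z ◁ (L.kTranspose adj Z).hom ≫ (adj.precompIso (M.mul Z) _).hom :=
    adj.transposeIso_matePre (L.kMul adj Z)
  rw [← a6, reassoc_of% a3, reassoc_of% a2, cMul]
  have a7 : adj.unit (M.T.obj (M.T.obj Z)) ◁ R.map₂ (L.cIsoCounit adj Z).hom ≫
      adj.unit (M.T.obj (M.T.obj Z)) ◁ R.map₂ (L.cIsoCounit adj Z).inv = 𝟙 _ := by
    rw [← whiskerLeft_comp, ← R.map₂_comp]; simp
  rw [R.map₂_comp, R.map₂_comp, whiskerLeft_comp, whiskerLeft_comp, reassoc_of% a7,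
    ← reassoc_of% a5, ← whiskerLeft_comp_assoc, a4]
  generalize (adj.precompIso (M.T.map (L.k adj Z)) (E.map (L.alg (E.obj Z)) ≫ _)).hom ≫ _ = q
  have a8 : M.T.map₂ (adj.w (E.obj Z)).inv ▷ L.alg (E.obj Z) ≫
      M.T.map₂ (adj.w (E.obj Z)).hom ▷ L.alg (E.obj Z) = 𝟙 _ := by
    rw [← comp_whiskerRight, ← M.T.map₂_comp]; simp
  clear a1 a2 a3 a5 a6 a7
  revert q
  -- From here on `k` is an arbitrary 1-cell. Its being a composite would only make `simp` break up
  -- the whiskerings by it.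
  generalize L.k adj Z = k
  intro q
  have a9 := congrArg (fun t => M.T.map k ◁ t) a8
  simp only [whiskerLeft_comp] at a9
  simp [map₂_rightUnitor_inv', reassoc_of% a9]

/-- The multiplication of `J X` transposes to `σ₂₁`: `kPost_mul` reduces it to `kMul`,
`kTranspose_mul` replaces that by `cMul`, and `algPost_comp` carries the 1-cell `h` that comes after
`c`. -/
theorem algPost_mul {Z : B} {X : A} (h : E.obj Z ⟶ X) :
    M.T.map (M.T.map (adj.unit Z ≫ R.map h)) ◁ L.assoc X ≫ (α_ _ _ _).inv ≫
      (M.mulNat (adj.unit Z ≫ R.map h)).hom ▷ L.alg X ≫ (α_ _ _ _).hom ≫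
      M.mul Z ◁ (L.algPost adj h).hom ≫ (adj.precompIso (M.mul Z) _).hom =
    (α_ _ _ _).inv ≫ ((M.T.mapComp _ _).inv ≫ M.T.map₂ (L.algPost adj h).hom) ▷ L.alg X ≫
      (L.algPost adj (L.c adj Z ≫ h)).hom ≫
      adj.unit _ ◁ R.map₂ ((α_ _ _ _).inv ≫ L.cMul adj Z ▷ h ≫ (α_ _ _ _).hom) := by
  have e1 := adj.precompIso_postcomp (M.mul Z) (L.c adj Z) h
  have e2 := L.kPost_mul adj h
  have e3 := congrArg (fun t => t ▷ R.map h) (L.kTranspose_mul adj Z)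
  have e4 := L.algPost_comp adj (L.c adj Z) h
  have e5 : adj.unit (M.T.obj (M.T.obj Z)) ◁ R.map₂ (α_ (L.c adj _) (L.c adj Z) h).hom ≫
      adj.unit (M.T.obj (M.T.obj Z)) ◁ R.map₂ (α_ (L.c adj _) (L.c adj Z) h).inv = 𝟙 _ := by
    rw [← whiskerLeft_comp, ← R.map₂_comp]; simp
  have e6 : M.mul Z ◁ (L.algPost adj h).hom ≫ (adj.precompIso (M.mul Z) _).hom =
      M.mul Z ◁ (L.kPost adj h).hom ≫ M.mul Z ◁ (L.kTranspose adj Z).hom ▷ R.map h ≫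
      (α_ _ _ _).inv ≫ (adj.precompIso (M.mul Z) (L.c adj Z)).hom ▷ R.map h ≫ (α_ _ _ _).hom ≫
      adj.unit _ ◁ (R.mapComp _ _).inv ≫ adj.unit _ ◁ R.map₂ (α_ _ _ _).hom := by
    rw [← e1]
    simp [algPost]
  have e7 : M.T.map₂ (L.algPost adj h).hom ▷ L.alg X = M.T.map₂ (L.kPost adj h).hom ▷ L.alg X ≫
      M.T.map₂ ((L.kTranspose adj Z).hom ▷ R.map h) ▷ L.alg X ≫
      M.T.map₂ ((α_ _ _ _).hom ≫ adj.unit _ ◁ (R.mapComp (L.c adj Z) h).inv) ▷ L.alg X := by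
    simp only [← comp_whiskerRight, ← M.T.map₂_comp]
    rfl
  rw [e6, reassoc_of% e2]
  have e8 : L.kMul adj Z ▷ R.map h ≫ (α_ _ _ _).hom ≫
      M.mul Z ◁ (L.kTranspose adj Z).hom ▷ R.map h ≫
      (α_ _ _ _).inv ≫ (adj.precompIso (M.mul Z) (L.c adj Z)).hom ▷ R.map h =
      M.T.map₂ (L.kTranspose adj Z).hom ▷ L.alg (E.obj Z) ▷ R.map h ≫
      (L.algPost adj (L.c adj Z)).hom ▷ R.map h ≫
      (adj.unit _ ◁ R.map₂ (L.cMul adj Z)) ▷ R.map h := by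
    simp only [comp_whiskerRight] at e3
    rw [e3]; simp
  rw [reassoc_of% e8, comp_whiskerRight, Category.assoc, e7]
  simp only [Category.assoc]
  rw [reassoc_of% e4]
  simp only [R.map₂_comp, whiskerLeft_comp, Category.assoc]
  rw [reassoc_of% e5]
  calc _ = 𝟙 _ ⊗≫ hat M.T (L.kPost adj h).hom ▷ L.alg X ⊗≫
      (M.T.map (L.k adj Z) ◁ (L.cell h).hom ≫
      M.T.map₂ (L.kTranspose adj Z).hom ▷ (L.alg (E.obj Z) ≫ R.map h)) ⊗≫
      (L.algPost adj (L.c adj Z)).hom ▷ R.map h ⊗≫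
      adj.unit _ ◁ R.map₂ (L.cMul adj Z) ▷ R.map h ⊗≫
      adj.unit _ ◁ (R.mapComp _ _).inv ≫ adj.unit _ ◁ R.map₂ (α_ _ _ _).hom := by
        simp [bicategoricalComp]
    _ = _ := by
      rw [whisker_exchange]
      simp [bicategoricalComp, hat]

/-- The counterpart for the unit, which transposes to `n₁`. Here a single use of
`transposeIso_mateUnit` takes the place of `kTranspose_mul`. -/
theorem algPost_unit {Z : B} {X : A} (h : E.obj Z ⟶ X) :
    (ρ_ _).inv ≫ (adj.unit Z ≫ R.map h) ◁ L.unit X ≫ (α_ _ _ _).inv ≫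
      (M.unitNat (adj.unit Z ≫ R.map h)).hom ▷ L.alg X ≫ (α_ _ _ _).hom ≫
      M.unit Z ◁ (L.algPost adj h).hom ≫ (adj.precompIso (M.unit Z) _).hom =
    adj.unit Z ◁ R.map₂ ((λ_ _).inv ≫ L.cUnit adj Z ▷ h ≫ (α_ _ _ _).hom) := by
  have e1 := adj.precompIso_postcomp (M.unit Z) (L.c adj Z) h
  have e2 := L.kPost_unit adj h
  have e3 : L.kUnit adj Z ≫ M.unit Z ◁ (L.kTranspose adj Z).hom ≫
      (adj.precompIso (M.unit Z) (L.c adj Z)).hom = (ρ_ _).inv ≫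
      adj.unit Z ◁ ((R.mapId _).inv ≫ R.map₂ (L.cUnit adj Z)) :=
    adj.transposeIso_mateUnit (L.kUnit adj Z)
  have e3 := congrArg (fun t => t ▷ R.map h) e3
  have e6 : M.unit Z ◁ (L.algPost adj h).hom ≫ (adj.precompIso (M.unit Z) _).hom =
      M.unit Z ◁ (L.kPost adj h).hom ≫ M.unit Z ◁ (L.kTranspose adj Z).hom ▷ R.map h ≫
      (α_ _ _ _).inv ≫ (adj.precompIso (M.unit Z) (L.c adj Z)).hom ▷ R.map h ≫ (α_ _ _ _).hom ≫
      adj.unit _ ◁ (R.mapComp _ _).inv ≫ adj.unit _ ◁ R.map₂ (α_ _ _ _).hom := by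
    rw [← e1]
    simp [algPost]
  rw [e6, reassoc_of% e2]
  have e8 : L.kUnit adj Z ▷ R.map h ≫ (α_ _ _ _).hom ≫
      M.unit Z ◁ (L.kTranspose adj Z).hom ▷ R.map h ≫
      (α_ _ _ _).inv ≫ (adj.precompIso (M.unit Z) (L.c adj Z)).hom ▷ R.map h =
      ((ρ_ _).inv ≫ adj.unit Z ◁ ((R.mapId _).inv ≫ R.map₂ (L.cUnit adj Z))) ▷ R.map h := by
    rw [← e3]; simp
  rw [reassoc_of% e8]
  simp [map₂_leftUnitor_inv']

end AlgebraLift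
end Lifting
end BiadjointTriangle

namespace BiadjointTriangle

/-! ### Codescent data and their morphisms -/

section CodescentData

variable {A : Type u₁} [Bicategory.{w₁, v₁} A]

/-- The generating data of a diagram of shape `Δ_ℓᵒᵖ`. -/
structure CodescentDiagram (A : Type u₁) [Bicategory.{w₁, v₁} A] where
  (one two three : A)
  (d0 d1 : two ⟶ one)
  s0 : one ⟶ two
  (e0 e1 e2 : three ⟶ two)
  sigma00 : e0 ≫ d0 ⟶ e1 ≫ d0
  sigma20 : e2 ≫ d0 ⟶ e0 ≫ d1
  sigma21 : e2 ≫ d1 ⟶ e1 ≫ d1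
  n0 : 𝟙 one ⟶ s0 ≫ d0
  n1 : 𝟙 one ⟶ s0 ≫ d1

/-- The 2-cell `θ` between composites, followed by a 1-cell. -/
def postWhisker {X Y Y' Z W : A} {f : X ⟶ Y} {g : Y ⟶ Z} {f' : X ⟶ Y'} {g' : Y' ⟶ Z}
    (θ : f ≫ g ⟶ f' ≫ g') (h : Z ⟶ W) : f ≫ g ≫ h ⟶ f' ≫ g' ≫ h :=
  (α_ _ _ _).inv ≫ θ ▷ h ≫ (α_ _ _ _).hom

/-- The 2-cell `θ` out of an identity, followed by a 1-cell. -/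
def postWhiskerFromId {X Y W : A} {f : X ⟶ Y} {g : Y ⟶ X}
    (θ : 𝟙 X ⟶ f ≫ g) (h : X ⟶ W) : h ⟶ f ≫ g ≫ h :=
  (λ_ _).inv ≫ θ ▷ h ≫ (α_ _ _ _).hom

/-- A codescent datum with vertex `X`; the 2-cell is required to be invertible if `inv` holds. -/
structure CodescentDatum (D : CodescentDiagram A) (inv : Prop) (X : A) where
  hom : D.one ⟶ X
  cell : D.d1 ≫ hom ⟶ D.d0 ≫ hom
  isIso : inv → IsIso cell
  associativity : D.e2 ◁ cell ≫ postWhisker D.sigma20 hom ≫ D.e0 ◁ cell ≫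
      postWhisker D.sigma00 hom = postWhisker D.sigma21 hom ≫ D.e1 ◁ cell
  identity : postWhiskerFromId D.n1 hom ≫ D.s0 ◁ cell = postWhiskerFromId D.n0 hom

/-- A morphism of codescent data. -/
@[ext]
structure CodescentDatum.Hom {D : CodescentDiagram A} {inv : Prop} {X : A}
    (a b : CodescentDatum D inv X) where
  hom : a.hom ⟶ b.hom
  comm : D.d1 ◁ hom ≫ b.cell = a.cell ≫ D.d0 ◁ hom

instance {D : CodescentDiagram A} {inv : Prop} {X : A} : Category (CodescentDatum D inv X) where
  Hom a b := CodescentDatum.Hom a b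
  id a := ⟨𝟙 a.hom, by simp⟩
  comp f g := ⟨f.hom ≫ g.hom, by
    rw [whiskerLeft_comp, Category.assoc, g.comm, ← Category.assoc, f.comm, Category.assoc,
      ← whiskerLeft_comp]⟩
  id_comp _ := CodescentDatum.Hom.ext (Category.id_comp _)
  comp_id _ := CodescentDatum.Hom.ext (Category.comp_id _)
  assoc _ _ _ := CodescentDatum.Hom.ext (Category.assoc _ _ _)

end CodescentData

section Transposition

variable {A : Type u₁} [Bicategory.{w₁, v₁} A] {B : Type u₂} [Bicategory.{w₂, v₂} B]
  {E : B ⥤ᵖ A} {R : A ⥤ᵖ B} (adj : Biadjunction E R)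

/-- A 2-cell of `B` in front of a transpose acts through its image under `E`. With `β` the
multiplication of `y` this accounts for `σ₀₀`, and the following variant for `n₀`. -/
theorem Biadjunction.precompIso_square {Z Y Y' W : B} {X : A} {a : Z ⟶ Y} {b : Y ⟶ W} {a' : Z ⟶ Y'}
    {b' : Y' ⟶ W} (β : a ≫ b ⟶ a' ≫ b') (h : E.obj W ⟶ X) :
    (α_ _ _ _).inv ≫ β ▷ (adj.unit W ≫ R.map h) ≫ (α_ _ _ _).hom ≫
      a' ◁ (adj.precompIso b' h).hom ≫ (adj.precompIso a' _).hom =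
    a ◁ (adj.precompIso b h).hom ≫ (adj.precompIso a _).hom ≫
      adj.unit Z ◁ R.map₂ (postWhisker (hat E β) h) := by
  have e := adj.precompIso_naturality_left β h
  have e' : ∀ {Y' : B} (a' : Z ⟶ Y') (b' : Y' ⟶ W), a' ◁ (adj.precompIso b' h).hom ≫
      (adj.precompIso a' _).hom = (α_ _ _ _).inv ≫ (adj.precompIso (a' ≫ b') h).hom ≫
      adj.unit Z ◁ R.map₂ ((E.mapComp a' b').hom ▷ h ≫ (α_ _ _ _).hom) := by
    intro Y' a' b'
    rw [adj.precompIso_comp a' b' h]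
    simp only [Category.assoc, Iso.inv_hom_id_assoc, ← whiskerLeft_comp, ← R.map₂_comp]
    simp
  rw [reassoc_of% (e' a b), e' a' b', Iso.hom_inv_id_assoc, reassoc_of% e]
  simp only [← whiskerLeft_comp, ← R.map₂_comp]
  congr 4
  simp [postWhisker, hat]

theorem Biadjunction.precompIso_fromId {Z Y : B} {X : A} {a : Z ⟶ Y} {b : Y ⟶ Z}
    (β : 𝟙 Z ⟶ a ≫ b) (h : E.obj Z ⟶ X) :
    (λ_ _).inv ≫ β ▷ (adj.unit Z ≫ R.map h) ≫ (α_ _ _ _).hom ≫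
      a ◁ (adj.precompIso b h).hom ≫ (adj.precompIso a _).hom =
      adj.unit Z ◁ R.map₂ (postWhiskerFromId (hatFromId E β) h) := by
  have e := adj.precompIso_naturality_left β h
  have e' : a ◁ (adj.precompIso b h).hom ≫
      (adj.precompIso a _).hom = (α_ _ _ _).inv ≫ (adj.precompIso (a ≫ b) h).hom ≫
      adj.unit Z ◁ R.map₂ ((E.mapComp a b).hom ▷ h ≫ (α_ _ _ _).hom) := by
    rw [adj.precompIso_comp a b h]
    simp only [Category.assoc, Iso.inv_hom_id_assoc, ← whiskerLeft_comp, ← R.map₂_comp]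
    simp
  rw [e', Iso.hom_inv_id_assoc, reassoc_of% e, precompIso_id]
  simp only [Category.assoc, Iso.inv_hom_id_assoc, ← whiskerLeft_comp, ← R.map₂_comp]
  simp [postWhiskerFromId, hatFromId]

end Transposition

/-! ### The axioms of lax morphisms against the axioms of codescent data -/

section Cells

variable {A : Type u₁} [Bicategory.{w₁, v₁} A] {B : Type u₂} [Bicategory.{w₂, v₂} B]
  {M : Pseudomonad B} {E : B ⥤ᵖ A} {R : A ⥤ᵖ B} (L : AlgebraLift M R)
  (adj : Biadjunction E R)

namespace AlgebraLift

/-- The diagram associated with a lax algebra. -/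
def codescentDiagram (y : LaxAlgebra M) : CodescentDiagram A where
  one := E.obj y.carrier
  two := E.obj (M.T.obj y.carrier)
  three := E.obj (M.T.obj (M.T.obj y.carrier))
  d0 := E.map y.alg
  d1 := L.c adj y.carrier
  s0 := E.map (M.unit y.carrier)
  e0 := E.map (M.T.map y.alg)
  e1 := E.map (M.mul y.carrier)
  e2 := L.c adj (M.T.obj y.carrier)
  sigma00 := hat E y.assoc
  sigma20 := (L.cIso adj y.alg).inv
  sigma21 := L.cMul adj y.carrier
  n0 := hatFromId E y.unit
  n1 := L.cUnit adj y.carrier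

variable {y : LaxAlgebra M} {X : A}

/-- The 2-cell of the transpose of a 1-cell equipped with a 2-cell. -/
def transposeCell (h : E.obj y.carrier ⟶ X) (ϑ : L.c adj y.carrier ≫ h ⟶ E.map y.alg ≫ h) :
    M.T.map (adj.unit y.carrier ≫ R.map h) ≫ L.alg X ⟶
      y.alg ≫ adj.unit y.carrier ≫ R.map h :=
  (L.algPost adj h).hom ≫ adj.unit _ ◁ R.map₂ ϑ ≫ (adj.precompIso y.alg h).inv

theorem transposeCell_precompIso (h : E.obj y.carrier ⟶ X)
    (ϑ : L.c adj y.carrier ≫ h ⟶ E.map y.alg ≫ h) :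
    L.transposeCell adj h ϑ ≫ (adj.precompIso y.alg h).hom =
      (L.algPost adj h).hom ≫ adj.unit _ ◁ R.map₂ ϑ := by
  simp [transposeCell]

/-- This side of the axiom for lax morphisms becomes `σ₂₁` followed by `∂¹ϑ`: the multiplication of
`J X` gives `σ₂₁` by `algPost_mul`, and whiskering `ϑ` with `m` gives `∂¹ϑ`. -/
theorem assoc_transposeCell_left (h : E.obj y.carrier ⟶ X)
    (ϑ : L.c adj y.carrier ≫ h ⟶ E.map y.alg ≫ h) :
    (M.T.map (M.T.map (adj.unit y.carrier ≫ R.map h)) ◁ L.assoc X ≫ (α_ _ _ _).inv ≫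
      (M.mulNat (adj.unit y.carrier ≫ R.map h)).hom ▷ L.alg X ≫ (α_ _ _ _).hom ≫
      M.mul y.carrier ◁ L.transposeCell adj h ϑ) ≫
      M.mul y.carrier ◁ (adj.precompIso y.alg h).hom ≫ (adj.precompIso _ _).hom =
    ((α_ _ _ _).inv ≫ ((M.T.mapComp _ _).inv ≫ M.T.map₂ (L.algPost adj h).hom) ▷ L.alg X ≫
      (L.algPost adj _).hom) ≫
      adj.unit _ ◁ R.map₂ (postWhisker (L.cMul adj y.carrier) h ≫ E.map (M.mul _) ◁ ϑ) := by
  have e1 := L.algPost_mul adj h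
  have e2 := adj.precompIso_naturality_right (M.mul y.carrier) ϑ
  simp only [Category.assoc]
  rw [← whiskerLeft_comp_assoc, transposeCell_precompIso, whiskerLeft_comp_assoc, e2,
    reassoc_of% e1]
  simp only [postWhisker, R.map₂_comp, whiskerLeft_comp, Category.assoc]

/-- The other side becomes the four-term composite. The cell under `T` gives `∂²ϑ`, the cell after
`T alg` gives `∂⁰ϑ`, the passage between them gives `σ₂₀` by `algPost_precomp`, and the
multiplication of `y` gives `σ₀₀`. The invertible cells at both ends are those of
`assoc_transposeCell_left`. -/
theorem assoc_transposeCell_right (h : E.obj y.carrier ⟶ X)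
    (ϑ : L.c adj y.carrier ≫ h ⟶ E.map y.alg ≫ h) :
    ((α_ _ _ _).inv ≫ hat M.T (L.transposeCell adj h ϑ) ▷ L.alg X ≫ (α_ _ _ _).hom ≫
      M.T.map y.alg ◁ L.transposeCell adj h ϑ ≫ (α_ _ _ _).inv ≫
      y.assoc ▷ (adj.unit y.carrier ≫ R.map h) ≫ (α_ _ _ _).hom) ≫
      M.mul y.carrier ◁ (adj.precompIso y.alg h).hom ≫ (adj.precompIso _ _).hom =
    ((α_ _ _ _).inv ≫ ((M.T.mapComp _ _).inv ≫ M.T.map₂ (L.algPost adj h).hom) ▷ L.alg X ≫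
      (L.algPost adj _).hom) ≫
      adj.unit _ ◁ R.map₂ (L.c adj _ ◁ ϑ ≫ postWhisker (L.cIso adj y.alg).inv h ≫
        E.map (M.T.map y.alg) ◁ ϑ ≫ postWhisker (hat E y.assoc) h) := by
  have e1 := adj.precompIso_square y.assoc h
  have e2 := adj.precompIso_naturality_right (M.T.map y.alg) ϑ
  have e3 := L.algPost_precomp adj y.alg h
  have e4 := L.algPost_naturality adj ϑ
  have e5 : postWhisker (L.cIso adj y.alg).inv h = (L.cIsoPost adj y.alg h).inv := by
    simp [postWhisker, cIsoPost]
  have e6 : adj.unit _ ◁ R.map₂ (L.cIsoPost adj y.alg h).hom ≫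
      adj.unit _ ◁ R.map₂ (L.cIsoPost adj y.alg h).inv = 𝟙 _ := by
    rw [← whiskerLeft_comp, ← R.map₂_comp]; simp
  -- `algPost_precomp`, solved for the composite that stands between the two copies of `ϑ`; the
  -- inverse of `precompIso` under `T` is the last factor of the first `transposeCell`.
  have e7 : M.T.map₂ (adj.precompIso y.alg h).inv ▷ L.alg X ≫
      (M.T.mapComp y.alg (adj.unit _ ≫ R.map h)).hom ▷ L.alg X ≫ (α_ _ _ _).hom ≫
      M.T.map y.alg ◁ (L.algPost adj h).hom ≫ (adj.precompIso (M.T.map y.alg) _).hom =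
      (L.algPost adj _).hom ≫ adj.unit _ ◁ R.map₂ (postWhisker (L.cIso adj y.alg).inv h) := by
    rw [e5]
    have e8 := congrArg (fun t => M.T.map₂ (adj.precompIso y.alg h).inv ▷ L.alg X ≫
      (M.T.mapComp y.alg (adj.unit _ ≫ R.map h)).hom ▷ L.alg X ≫ (α_ _ _ _).hom ≫ t ≫
      adj.unit _ ◁ R.map₂ (L.cIsoPost adj y.alg h).inv) e3
    simp only [Category.assoc, e6, Category.comp_id, Iso.hom_inv_id_assoc,
      hom_inv_whiskerRight_assoc] at e8
    rw [e8, ← comp_whiskerRight_assoc, ← M.T.map₂_comp, Iso.inv_hom_id]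
    simp
  simp only [Category.assoc]
  rw [e1, ← whiskerLeft_comp_assoc, transposeCell_precompIso, whiskerLeft_comp_assoc,
    reassoc_of% e2]
  have e9 : hat M.T (L.transposeCell adj h ϑ) = ((M.T.mapComp _ _).inv ≫
      M.T.map₂ (L.algPost adj h).hom) ≫ M.T.map₂ (adj.unit _ ◁ R.map₂ ϑ) ≫
      M.T.map₂ (adj.precompIso y.alg h).inv ≫ (M.T.mapComp _ _).hom := by
    simp only [hat, transposeCell, M.T.map₂_comp, Category.assoc]
  rw [e9]
  simp only [comp_whiskerRight, Category.assoc, R.map₂_comp, whiskerLeft_comp]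
  rw [reassoc_of% e7, reassoc_of% e4]

/-- The associativity equations of lax morphisms and of codescent data are equivalent. -/
theorem assoc_transposeCell_iff (h : E.obj y.carrier ⟶ X)
    (ϑ : L.c adj y.carrier ≫ h ⟶ E.map y.alg ≫ h) :
    (M.T.map (M.T.map (adj.unit y.carrier ≫ R.map h)) ◁ L.assoc X ≫ (α_ _ _ _).inv ≫
      (M.mulNat (adj.unit y.carrier ≫ R.map h)).hom ▷ L.alg X ≫ (α_ _ _ _).hom ≫
      M.mul y.carrier ◁ L.transposeCell adj h ϑ =
    (α_ _ _ _).inv ≫ hat M.T (L.transposeCell adj h ϑ) ▷ L.alg X ≫ (α_ _ _ _).hom ≫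
      M.T.map y.alg ◁ L.transposeCell adj h ϑ ≫ (α_ _ _ _).inv ≫
      y.assoc ▷ (adj.unit y.carrier ≫ R.map h) ≫ (α_ _ _ _).hom) ↔
    L.c adj _ ◁ ϑ ≫ postWhisker (L.cIso adj y.alg).inv h ≫
        E.map (M.T.map y.alg) ◁ ϑ ≫ postWhisker (hat E y.assoc) h =
      postWhisker (L.cMul adj y.carrier) h ≫ E.map (M.mul _) ◁ ϑ := by
  -- Only the middle factors differ, and they are images under `ρ ◁ R.map₂`, which is faithful
  -- because `ρ` is biuniversal.
  rw [← cancel_mono (M.mul y.carrier ◁ (adj.precompIso y.alg h).hom ≫ (adj.precompIso _ _).hom),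
    assoc_transposeCell_left, assoc_transposeCell_right, cancel_epi]
  constructor
  · intro e
    exact ((adj.isBiuniversal _).ext e).symm
  · intro e
    rw [e]

/-- The unit of `J X` gives `n₁` by `algPost_unit`, the unit of `y` gives `n₀` by
`precompIso_fromId`, and the faithfulness of the transposition does the rest. -/
theorem unit_transposeCell_iff (h : E.obj y.carrier ⟶ X)
    (ϑ : L.c adj y.carrier ≫ h ⟶ E.map y.alg ≫ h) :
    ((ρ_ _).inv ≫ (adj.unit y.carrier ≫ R.map h) ◁ L.unit X ≫ (α_ _ _ _).inv ≫
      (M.unitNat (adj.unit y.carrier ≫ R.map h)).hom ▷ L.alg X ≫ (α_ _ _ _).hom ≫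
      M.unit y.carrier ◁ L.transposeCell adj h ϑ =
    (λ_ _).inv ≫ y.unit ▷ (adj.unit y.carrier ≫ R.map h) ≫ (α_ _ _ _).hom) ↔
    postWhiskerFromId (L.cUnit adj y.carrier) h ≫ E.map (M.unit _) ◁ ϑ =
      postWhiskerFromId (hatFromId E y.unit) h := by
  have e1 := L.algPost_unit adj h
  have e2 := adj.precompIso_naturality_right (M.unit y.carrier) ϑ
  have e3 := adj.precompIso_fromId y.unit h
  rw [← cancel_mono (M.unit y.carrier ◁ (adj.precompIso y.alg h).hom ≫ (adj.precompIso _ _).hom)]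
  simp only [Category.assoc]
  rw [← whiskerLeft_comp_assoc, transposeCell_precompIso, whiskerLeft_comp_assoc, e2,
    reassoc_of% e1, e3, ← whiskerLeft_comp, ← R.map₂_comp]
  constructor
  · intro e
    exact ((adj.isBiuniversal _).ext e)
  · intro e
    rw [← e]
    rfl

end AlgebraLift
end Cells
end BiadjointTriangle

namespace BiadjointTriangle

section Cells

variable {A : Type u₁} [Bicategory.{w₁, v₁} A] {B : Type u₂} [Bicategory.{w₂, v₂} B]
  {M : Pseudomonad B} {E : B ⥤ᵖ A} {R : A ⥤ᵖ B} (L : AlgebraLift M R)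
  (adj : Biadjunction E R) {y : LaxAlgebra M} {X : A}

namespace AlgebraLift

theorem transposeCell_comm_iff {h h' : E.obj y.carrier ⟶ X}
    (ϑ : L.c adj y.carrier ≫ h ⟶ E.map y.alg ≫ h)
    (ϑ' : L.c adj y.carrier ≫ h' ⟶ E.map y.alg ≫ h') (δ : h ⟶ h') :
    (M.T.map₂ (adj.unit _ ◁ R.map₂ δ) ▷ L.alg X ≫ L.transposeCell adj h' ϑ' =
      L.transposeCell adj h ϑ ≫ y.alg ◁ adj.unit _ ◁ R.map₂ δ) ↔
    L.c adj y.carrier ◁ δ ≫ ϑ' = ϑ ≫ E.map y.alg ◁ δ := by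
  have e1 := L.algPost_naturality adj δ
  have e2 := adj.precompIso_naturality_right y.alg δ
  rw [← cancel_mono (adj.precompIso y.alg h').hom]
  simp only [Category.assoc]
  rw [transposeCell_precompIso, e2, reassoc_of% e1,
    reassoc_of% (L.transposeCell_precompIso adj h ϑ), cancel_epi, ← whiskerLeft_comp,
    ← whiskerLeft_comp, ← R.map₂_comp, ← R.map₂_comp]
  exact ⟨fun e => (adj.isBiuniversal _).ext e, fun e => by rw [e]⟩

/-- Naturality in the vertex: composing a codescent datum with `g` corresponds to composing its lax
morphism with `J g`. The comparison of cocones with transposes along a lax morphism depends on it.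
-/
theorem transposeCell_postcomp {X' : A} (h : E.obj y.carrier ⟶ X)
    (ϑ : L.c adj y.carrier ≫ h ⟶ E.map y.alg ≫ h) (g : X ⟶ X') :
    M.T.map₂ ((α_ _ _ _).hom ≫ adj.unit _ ◁ (R.mapComp h g).inv) ▷ L.alg X' ≫
      L.transposeCell adj (h ≫ g) (postWhisker ϑ g) =
    ((M.T.mapComp (adj.unit _ ≫ R.map h) (R.map g)).hom ▷ L.alg X' ≫ (α_ _ _ _).hom ≫
      M.T.map (adj.unit _ ≫ R.map h) ◁ (L.cell g).hom ≫ (α_ _ _ _).inv ≫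
      L.transposeCell adj h ϑ ▷ R.map g ≫ (α_ _ _ _).hom) ≫
      y.alg ◁ ((α_ _ _ _).hom ≫ adj.unit _ ◁ (R.mapComp h g).inv) := by
  have e1 := L.algPost_comp adj h g
  have e2 := adj.precompIso_postcomp y.alg h g
  rw [← cancel_mono (adj.precompIso y.alg (h ≫ g)).hom]
  simp only [Category.assoc]
  rw [transposeCell_precompIso, e2, reassoc_of% e1]
  have e3 := congrArg (fun t => t ▷ R.map g) (L.transposeCell_precompIso adj h ϑ)
  simp only [comp_whiskerRight] at e3
  simp only [Iso.hom_inv_id_assoc]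
  rw [reassoc_of% e3, ← whiskerLeft_comp, Category.assoc, ← R.map₂_comp]
  simp [postWhisker]

theorem exists_transposeCell_eq (h : E.obj y.carrier ⟶ X)
    (φ : M.T.map (adj.unit y.carrier ≫ R.map h) ≫ L.alg X ⟶
      y.alg ≫ adj.unit y.carrier ≫ R.map h) :
    ∃ ϑ : L.c adj y.carrier ≫ h ⟶ E.map y.alg ≫ h, L.transposeCell adj h ϑ = φ := by
  obtain ⟨ϑ, hϑ⟩ := adj.exists_map₂_eq
    ((L.algPost adj h).inv ≫ φ ≫ (adj.precompIso y.alg h).hom)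
  exact ⟨ϑ, by simp [transposeCell, hϑ]⟩

/-- Up to isomorphisms at both ends `transposeCell` is the image of `ϑ` under a fully faithful
functor. Through this equivalence pseudomorphisms match invertible `ϑ`. -/
theorem isIso_transposeCell_iff (h : E.obj y.carrier ⟶ X)
    (ϑ : L.c adj y.carrier ≫ h ⟶ E.map y.alg ≫ h) :
    IsIso (L.transposeCell adj h ϑ) ↔ IsIso ϑ := by
  constructor
  · intro hi
    have : IsIso (adj.unit _ ◁ R.map₂ ϑ) := by
      have e : adj.unit _ ◁ R.map₂ ϑ = (L.algPost adj h).inv ≫ L.transposeCell adj h ϑ ≫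
          (adj.precompIso y.alg h).hom := by simp [transposeCell]
      rw [e]
      infer_instance
    have hE := adj.isBiuniversal (M.T.obj y.carrier) X
    have : IsIso ((transpose R (adj.unit (M.T.obj y.carrier)) X).map ϑ) := this
    exact isIso_of_reflects_iso ϑ (transpose R (adj.unit (M.T.obj y.carrier)) X)
  · intro hi
    rw [transposeCell]
    infer_instance

end AlgebraLift
end Cells

/-! ### Transport of lax morphisms along isomorphisms of 1-cells -/

section Transport

variable {B : Type u} [Bicategory.{w, v} B] {M : Pseudomonad B}

/-- The transport of a lax morphism along an isomorphism of 1-cells. -/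
def LaxMorphism.ofIso {y z : LaxAlgebra M} (f : LaxMorphism y z) {g : y.carrier ⟶ z.carrier}
    (i : f.hom ≅ g) : LaxMorphism y z where
  hom := g
  cell := M.T.map₂ i.inv ▷ z.alg ≫ f.cell ≫ y.alg ◁ i.hom
  cell_assoc := by
    have e1 := M.mulNat_naturality i.inv
    have e2 := f.cell_assoc
    have e3 : hat M.T (M.T.map₂ i.inv ▷ z.alg ≫ f.cell ≫ y.alg ◁ i.hom) =
        M.T.map₂ (M.T.map₂ i.inv) ▷ M.T.map z.alg ≫ hat M.T f.cell ≫
        M.T.map y.alg ◁ M.T.map₂ i.hom := by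
      simp [hat]
    -- In the axiom the transported cell occurs twice in succession, and this is the cancellation of
    -- the transports between the two occurrences.
    have e4 : M.T.map₂ i.hom ▷ z.alg ≫ M.T.map₂ i.inv ▷ z.alg = 𝟙 _ := by
      rw [← comp_whiskerRight, ← M.T.map₂_comp]; simp
    rw [e3]
    calc _ = M.T.map (M.T.map g) ◁ z.assoc ⊗≫ ((M.mulNat g).hom ≫
          M.mul y.carrier ◁ M.T.map₂ i.inv) ▷ z.alg ⊗≫ M.mul y.carrier ◁ f.cell ⊗≫
          M.mul y.carrier ◁ y.alg ◁ i.hom := by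
            simp [bicategoricalComp]
      _ = (M.T.map (M.T.map g) ◁ z.assoc ≫ M.T.map₂ (M.T.map₂ i.inv) ▷ (M.mul _ ≫ z.alg)) ⊗≫
          (M.mulNat f.hom).hom ▷ z.alg ⊗≫ M.mul y.carrier ◁ f.cell ⊗≫
          M.mul y.carrier ◁ y.alg ◁ i.hom := by
            rw [← e1]; bicategory
      _ = M.T.map₂ (M.T.map₂ i.inv) ▷ (M.T.map z.alg ≫ z.alg) ≫
          (M.T.map (M.T.map f.hom) ◁ z.assoc ≫ (α_ _ _ _).inv ≫
          (M.mulNat f.hom).hom ▷ z.alg ≫ (α_ _ _ _).hom ≫ M.mul y.carrier ◁ f.cell) ⊗≫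
          M.mul y.carrier ◁ y.alg ◁ i.hom := by
            rw [whisker_exchange]; bicategory
      _ = M.T.map₂ (M.T.map₂ i.inv) ▷ (M.T.map z.alg ≫ z.alg) ⊗≫
          hat M.T f.cell ▷ z.alg ⊗≫ M.T.map y.alg ◁ (M.T.map₂ i.hom ▷ z.alg ≫
          M.T.map₂ i.inv ▷ z.alg) ⊗≫ M.T.map y.alg ◁ f.cell ⊗≫
          (y.assoc ▷ f.hom ≫ (M.mul y.carrier ≫ y.alg) ◁ i.hom) ⊗≫ 𝟙 _ := by
            rw [e2, e4]; bicategory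
      _ = _ := by
        rw [← whisker_exchange]; bicategory
  cell_unit := by
    have e1 := M.unitNat_naturality i.inv
    have e2 := f.cell_unit
    calc _ = 𝟙 _ ⊗≫ g ◁ z.unit ⊗≫ ((M.unitNat g).hom ≫
          M.unit y.carrier ◁ M.T.map₂ i.inv) ▷ z.alg ⊗≫ M.unit y.carrier ◁ f.cell ⊗≫
          M.unit y.carrier ◁ y.alg ◁ i.hom := by
            simp [bicategoricalComp]
      _ = 𝟙 _ ⊗≫ (g ◁ z.unit ≫ i.inv ▷ (M.unit _ ≫ z.alg)) ⊗≫
          (M.unitNat f.hom).hom ▷ z.alg ⊗≫ M.unit y.carrier ◁ f.cell ⊗≫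
          M.unit y.carrier ◁ y.alg ◁ i.hom := by
            rw [← e1]; bicategory
      _ = i.inv ≫
          ((ρ_ _).inv ≫ f.hom ◁ z.unit ≫ (α_ _ _ _).inv ≫
          (M.unitNat f.hom).hom ▷ z.alg ≫ (α_ _ _ _).hom ≫ M.unit y.carrier ◁ f.cell) ⊗≫
          M.unit y.carrier ◁ y.alg ◁ i.hom := by
            rw [whisker_exchange]; bicategory
      _ = i.inv ⊗≫ (y.unit ▷ f.hom ≫ (M.unit y.carrier ≫ y.alg) ◁ i.hom) ⊗≫ 𝟙 _ := by
            rw [e2]; bicategory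
      _ = (i.inv ≫ i.hom) ⊗≫ y.unit ▷ g ⊗≫ 𝟙 _ := by
        rw [← whisker_exchange]; bicategory
      _ = _ := by
        rw [i.inv_hom_id]; bicategory

/-- A lax morphism is isomorphic to its transports. -/
def LaxMorphism.ofIsoIso {y z : LaxAlgebra M} (f : LaxMorphism y z) {g : y.carrier ⟶ z.carrier}
    (i : f.hom ≅ g) : f ≅ f.ofIso i :=
  LaxCell.isoMk i (by
    change M.T.map₂ i.hom ▷ z.alg ≫ M.T.map₂ i.inv ▷ z.alg ≫ f.cell ≫ y.alg ◁ i.hom = _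
    rw [← comp_whiskerRight_assoc, ← M.T.map₂_comp]
    simp
    rfl)

theorem LaxMorphism.isIso_ofIso_cell {y z : LaxAlgebra M} (f : LaxMorphism y z)
    {g : y.carrier ⟶ z.carrier} (i : f.hom ≅ g) [IsIso f.cell] : IsIso (f.ofIso i).cell := by
  change IsIso (M.T.map₂ i.inv ▷ z.alg ≫ f.cell ≫ y.alg ◁ i.hom)
  infer_instance

theorem map₂_id_comm (F : B ⥤ᵖ B) {X Y : B} {a : F.obj Y ⟶ Y} {b : F.obj X ⟶ X} {f : X ⟶ Y}
    (φ : F.map f ≫ a ⟶ b ≫ f) : F.map₂ (𝟙 f) ▷ a ≫ φ = φ ≫ b ◁ 𝟙 f := by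
  simp

end Transport

/-! ### Codescent data are equivalent to lax morphisms into `J X` -/

section Comparison

variable {A : Type u₁} [Bicategory.{w₁, v₁} A] {B : Type u₂} [Bicategory.{w₂, v₂} B]
  {M : Pseudomonad B} {E : B ⥤ᵖ A} {J : A ⥤ᵖ LaxAlg M}

/-- The algebra structures along `U J`. -/
noncomputable def algebraLift (J : A ⥤ᵖ LaxAlg M) : AlgebraLift M (J.comp (forget M)) where
  alg X := (jObj J X).alg
  assoc X := (jObj J X).assoc
  unit X := (jObj J X).unit
  cell g := jCell J g
  cell_naturality θ := LaxCell.comm (J.map₂ θ)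
  cell_comp g h := by
    -- The comparison cells of the forgetful 2-functor are identities, so those of `U J` come from
    -- `J` and are morphisms of algebras.
    have e : ((J.comp (forget M)).mapComp g h).hom = LaxCell.cell (J.mapComp g h).hom :=
      Category.comp_id _
    rw [e]
    exact LaxCell.comm (J.mapComp g h).hom
  cell_assoc g := (jMap J g).cell_assoc
  cell_unit g := (jMap J g).cell_unit

variable (adj : Biadjunction E (J.comp (forget M))) (y : LaxAlgebra M) (inv : Prop) (X : A)

/-- The lax morphism corresponding to a codescent datum. -/
noncomputable def laxMorphismOfDatum {y : LaxAlgebra M} {inv : Prop} {X : A}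
    (a : CodescentDatum ((algebraLift J).codescentDiagram adj y) inv X) :
    LaxMorphism y (jObj J X) where
  hom := adj.unit y.carrier ≫ (J.comp (forget M)).map a.hom
  cell := (algebraLift J).transposeCell adj a.hom a.cell
  cell_assoc := ((algebraLift J).assoc_transposeCell_iff adj a.hom a.cell).2 a.associativity
  cell_unit := ((algebraLift J).unit_transposeCell_iff adj a.hom a.cell).2 a.identity

/-- The 2-cell corresponding to a morphism of codescent data. -/
noncomputable def laxCellOfHom {y : LaxAlgebra M} {inv : Prop} {X : A}
    {a b : CodescentDatum ((algebraLift J).codescentDiagram adj y) inv X} (δ : a ⟶ b) :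
    LaxCell (laxMorphismOfDatum adj a) (laxMorphismOfDatum adj b) where
  cell := adj.unit y.carrier ◁ (J.comp (forget M)).map₂ δ.hom
  comm := ((algebraLift J).transposeCell_comm_iff adj a.cell b.cell δ.hom).2 δ.comm

/-- The functor from codescent data to lax morphisms. -/
noncomputable def datumToLax :
    CodescentDatum ((algebraLift J).codescentDiagram adj y) inv X ⥤ LaxMorphism y (jObj J X) where
  obj a := laxMorphismOfDatum adj a
  map δ := laxCellOfHom adj δ
  map_id a := LaxCell.ext ((transpose (J.comp (forget M)) (adj.unit y.carrier) X).map_id a.hom)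
  map_comp δ δ' := LaxCell.ext
    ((transpose (J.comp (forget M)) (adj.unit y.carrier) X).map_comp δ.hom δ'.hom)

theorem laxCellOfHom_injective {y : LaxAlgebra M} {inv : Prop} {X : A}
    {a b : CodescentDatum ((algebraLift J).codescentDiagram adj y) inv X} {δ δ' : a ⟶ b}
    (h : laxCellOfHom adj δ = laxCellOfHom adj δ') : δ = δ' :=
  CodescentDatum.Hom.ext ((adj.isBiuniversal _).ext (congrArg LaxCell.cell h))

theorem laxCellOfHom_surjective {y : LaxAlgebra M} {inv : Prop} {X : A}
    {a b : CodescentDatum ((algebraLift J).codescentDiagram adj y) inv X}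
    (β : LaxCell (laxMorphismOfDatum adj a) (laxMorphismOfDatum adj b)) :
    ∃ δ : a ⟶ b, laxCellOfHom adj δ = β := by
  obtain ⟨δ, hδ⟩ := adj.exists_map₂_eq (h := a.hom) (h' := b.hom) β.cell
  refine ⟨⟨δ, ((algebraLift J).transposeCell_comm_iff adj a.cell b.cell δ).1 ?_⟩,
    LaxCell.ext hδ⟩
  rw [hδ]
  exact β.comm

/-- The 1-cell of `f` is only isomorphic to one of the form `ρ ≫ R h`, so `f` is first transported
along such an isomorphism. The new 2-cell is the transpose of a unique `ϑ`, and the equivalences of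
axioms, read backwards, show that `h` and `ϑ` form a codescent datum. -/
theorem exists_laxMorphismOfDatum_iso {y : LaxAlgebra M} {inv : Prop} {X : A}
    (f : LaxMorphism y (jObj J X)) (hf : inv → IsIso f.cell) :
    ∃ a : CodescentDatum ((algebraLift J).codescentDiagram adj y) inv X,
      Nonempty (laxMorphismOfDatum adj a ≅ f) := by
  obtain ⟨h, ⟨i⟩⟩ := (adj.isBiuniversal y.carrier).exists_obj (X := X) f.hom
  obtain ⟨ϑ, hϑ⟩ := (algebraLift J).exists_transposeCell_eq adj h (f.ofIso i).cell
  refine ⟨⟨h, ϑ, fun hi => ?_, ?_, ?_⟩, ⟨Iso.symm (f.ofIsoIso i ≪≫ LaxCell.isoMk (Iso.refl _) ?_)⟩⟩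
  · have := hf hi
    refine ((algebraLift J).isIso_transposeCell_iff adj h ϑ).1 ?_
    rw [hϑ]
    exact f.isIso_ofIso_cell i
  · refine ((algebraLift J).assoc_transposeCell_iff adj h ϑ).1 ?_
    rw [hϑ]
    exact (f.ofIso i).cell_assoc
  · refine ((algebraLift J).unit_transposeCell_iff adj h ϑ).1 ?_
    rw [hϑ]
    exact (f.ofIso i).cell_unit
  · change M.T.map₂ (𝟙 _) ▷ (jObj J X).alg ≫ (algebraLift J).transposeCell adj h ϑ =
      (f.ofIso i).cell ≫ y.alg ◁ 𝟙 _
    rw [hϑ]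
    exact map₂_id_comm M.T (f.ofIso i).cell

/-- Codescent data are equivalent to lax morphisms. -/
theorem datumToLax_isEquivalence : (datumToLax adj y False X).IsEquivalence where
  faithful := ⟨fun h => laxCellOfHom_injective adj h⟩
  full := ⟨fun β => laxCellOfHom_surjective adj β⟩
  essSurj := ⟨fun f => exists_laxMorphismOfDatum_iso adj f (fun h => h.elim)⟩

/-- The functor from codescent data with an invertible 2-cell to pseudomorphisms. -/
noncomputable def datumToPseudo :
    CodescentDatum ((algebraLift J).codescentDiagram adj y) True X ⥤
      PseudoMorphism y (jObj J X) where
  obj a := ⟨laxMorphismOfDatum adj a, by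
    have := a.isIso trivial
    exact ((algebraLift J).isIso_transposeCell_iff adj a.hom a.cell).2 this⟩
  map δ := laxCellOfHom adj δ
  map_id a := (datumToLax adj y True X).map_id a
  map_comp δ δ' := (datumToLax adj y True X).map_comp δ δ'

/-- Codescent data with an invertible 2-cell are equivalent to pseudomorphisms. -/
theorem datumToPseudo_isEquivalence : (datumToPseudo adj y X).IsEquivalence where
  faithful := ⟨fun h => laxCellOfHom_injective adj h⟩
  full := ⟨fun β => laxCellOfHom_surjective adj β⟩
  essSurj := ⟨fun f => by
    obtain ⟨a, ⟨i⟩⟩ := exists_laxMorphismOfDatum_iso adj (inv := True) f.toLaxMorphism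
      (fun _ => f.isIso)
    exact ⟨a, ⟨PseudoMorphism.isoMk i⟩⟩⟩

end Comparison
end BiadjointTriangle

namespace BiadjointTriangle

/-! ### Cocones with the weight `C(c, j-)`, expressed by 1-cells and 2-cells of `A` -/

section Legs

attribute [local instance] CategoryTheory.uliftCategory

variable {S : Type u₁} [Bicategory.{w₁, v₁} S] {C : Type u₂} [Bicategory.{0, 0} C]
  {A : Type u} [Bicategory.{w, v} A] {j : S ⥤ᵖ C} {c : C} {D : S ⥤ᵖ Aᵒᵖ} {X : A}

/-- An object, moved to a larger universe. -/
def uliftUp {C : Type v₁} (p : C) : ULiftHom.{w} (ULift.{v} C) := ULiftHom.objUp (ULift.up p)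

/-- The weight `C(c, j-)`. -/
abbrev coneWeight (j : S ⥤ᵖ C) (c : C) : S ⥤ᵖ Cat.{w, v} :=
  j.comp (corepresentable.{w, v} (B := C) c)

/-- The 1-cell that a cocone with weight `C(c, j-)` assigns to `p : c ⟶ j s`. -/
def legObj (a : coneWeight.{w, v} j c ⟶ homTo D X) (s : S) (p : c ⟶ j.obj s) :
    (D.obj s).unop ⟶ X :=
  (a.app s).toFunctor.obj (uliftUp.{w, v} p)

/-- The 2-cell that a cocone with weight `C(c, j-)` assigns to a 2-cell `p ⟶ q`. -/
def legMap (a : coneWeight.{w, v} j c ⟶ homTo D X) (s : S) {p q : c ⟶ j.obj s} (η : p ⟶ q) :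
    legObj a s p ⟶ legObj a s q :=
  (a.app s).toFunctor.map (X := uliftUp.{w, v} p) (Y := uliftUp.{w, v} q)
    (ULift.up η)

/-- The pseudonaturality cells of a cocone with weight `C(c, j-)`. -/
def legIso (a : coneWeight.{w, v} j c ⟶ homTo D X) {s t : S} (f : s ⟶ t) (p : c ⟶ j.obj s) :
    legObj a t (p ≫ j.map f) ≅ (D.map f).unop ≫ legObj a s p :=
  (Cat.Hom.toNatIso (a.naturality f)).app (uliftUp.{w, v} p)

variable (a b : coneWeight.{w, v} j c ⟶ homTo D X)

theorem legMap_id (s : S) (p : c ⟶ j.obj s) : legMap a s (𝟙 p) = 𝟙 _ :=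
  (a.app s).toFunctor.map_id _

theorem legMap_comp (s : S) {p q r : c ⟶ j.obj s} (η : p ⟶ q) (θ : q ⟶ r) :
    legMap a s (η ≫ θ) = legMap a s η ≫ legMap a s θ :=
  (a.app s).toFunctor.map_comp (X := uliftUp.{w, v} p)
    (Y := uliftUp.{w, v} q) (Z := uliftUp.{w, v} r) (ULift.up η) (ULift.up θ)

theorem legMap_eqToHom_symm (s : S) {p q : c ⟶ j.obj s} (h : p = q) :
    legMap a s (eqToHom h.symm) ≫ legMap a s (eqToHom h) = 𝟙 _ := by
  rw [← legMap_comp, eqToHom_trans, eqToHom_refl, legMap_id]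

theorem legMap_comp_eq (s : S) {p q r : c ⟶ j.obj s} {η₁ : p ⟶ q} {η₂ : q ⟶ r} {θ : p ⟶ r}
    (h : η₁ ≫ η₂ = θ) : legMap a s η₁ ≫ legMap a s η₂ = legMap a s θ := by
  rw [← legMap_comp, h]

theorem legMap_comp_eq' (s : S) {p p₁ p₂ p₃ r t : c ⟶ j.obj s} {η₁ : p ⟶ p₁} {η₂ : p₁ ⟶ p₂}
    {η₃ : p₂ ⟶ p₃} {η₄ : p₃ ⟶ r} {θ₁ : p ⟶ t} {θ₂ : t ⟶ r}
    (h : η₁ ≫ η₂ ≫ η₃ ≫ η₄ = θ₁ ≫ θ₂) :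
    legMap a s η₁ ≫ legMap a s η₂ ≫ legMap a s η₃ ≫ legMap a s η₄ =
      legMap a s θ₁ ≫ legMap a s θ₂ := by
  rw [← legMap_comp, ← legMap_comp, ← legMap_comp, h, legMap_comp]

theorem legMap_whiskerRight {s t : S} (f : s ⟶ t) {p q : c ⟶ j.obj s} (η : p ⟶ q) :
    legMap a t (η ▷ j.map f) ≫ (legIso a f q).hom =
      (legIso a f p).hom ≫ (D.map f).unop ◁ legMap a s η :=
  (a.naturality f).hom.toNatTrans.naturality (X := uliftUp.{w, v} p)
    (Y := uliftUp.{w, v} q) (ULift.up η)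

theorem legMap_whiskerLeft {s t : S} {f g : s ⟶ t} (θ : f ⟶ g) (p : c ⟶ j.obj s) :
    legMap a t (p ◁ j.map₂ θ) ≫ (legIso a g p).hom =
      (legIso a f p).hom ≫ (D.map₂ θ).unop2 ▷ legObj a s p :=
  congrArg (fun m => m.toNatTrans.app (uliftUp.{w, v} p))
    (a.naturality_naturality θ)

/-- The unit axiom of a pseudonatural transformation, evaluated at `p`. The coherence cells of `Cat`
have identity components, and the proof only has to remove these. -/
theorem legIso_id (s : S) (p : c ⟶ j.obj s) :
    (legIso a (𝟙 s) p).hom ≫ (D.mapId s).hom.unop2 ▷ legObj a s p ≫ (λ_ _).hom =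
      legMap a s (p ◁ (j.mapId s).hom ≫ (ρ_ p).hom) := by
  have h := congrArg (fun m => m.toNatTrans.app (uliftUp.{w, v} p))
    (a.naturality_id s)
  refine h.trans ?_
  refine (congrArg (_ ≫ ·) (Category.id_comp _)).trans (Category.comp_id _)

theorem legIso_comp {r s t : S} (f : r ⟶ s) (g : s ⟶ t) (p : c ⟶ j.obj r) :
    (legIso a (f ≫ g) p).hom ≫ (D.mapComp f g).hom.unop2 ▷ legObj a r p ≫ (α_ _ _ _).hom =
      legMap a t (p ◁ (j.mapComp f g).hom ≫ (α_ _ _ _).inv) ≫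
        (legIso a g (p ≫ j.map f)).hom ≫ (D.map g).unop ◁ (legIso a f p).hom := by
  have h := congrArg (fun m => m.toNatTrans.app (uliftUp.{w, v} p))
    (a.naturality_comp f g)
  refine h.trans ?_
  refine congrArg (_ ≫ ·) ?_
  refine (Category.id_comp _).trans ?_
  refine congrArg (_ ≫ ·) ?_
  refine (Category.id_comp _).trans ?_
  exact Category.comp_id _

variable {a b}

/-- The components of a modification between cocones with weight `C(c, j-)`. -/
def legHom (Γ : a ⟶ b) (s : S) (p : c ⟶ j.obj s) : legObj a s p ⟶ legObj b s p :=
  (Γ.as.app s).toNatTrans.app (uliftUp.{w, v} p)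

theorem legHom_naturality (Γ : a ⟶ b) (s : S) {p q : c ⟶ j.obj s} (η : p ⟶ q) :
    legMap a s η ≫ legHom Γ s q = legHom Γ s p ≫ legMap b s η :=
  (Γ.as.app s).toNatTrans.naturality (X := uliftUp.{w, v} p)
    (Y := uliftUp.{w, v} q) (ULift.up η)

theorem legHom_legIso (Γ : a ⟶ b) {s t : S} (f : s ⟶ t) (p : c ⟶ j.obj s) :
    legHom Γ t (p ≫ j.map f) ≫ (legIso b f p).hom =
      (legIso a f p).hom ≫ (D.map f).unop ◁ legHom Γ s p :=
  congrArg (fun m => m.toNatTrans.app (uliftUp.{w, v} p))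
    (Γ.as.naturality f)

theorem legHom_ext {Γ Θ : a ⟶ b} (h : ∀ s p, legHom Γ s p = legHom Θ s p) : Γ = Θ :=
  Pseudofunctor.StrongTrans.homCategory.ext fun s =>
    Cat.Hom₂.ext (NatTrans.ext (funext fun p => h s (uliftDown.{w, v} p)))

/-- A modification given by its components. -/
def legHomMk (φ : ∀ s (p : c ⟶ j.obj s), legObj a s p ⟶ legObj b s p)
    (hφ : ∀ s {p q : c ⟶ j.obj s} (η : p ⟶ q),
      legMap a s η ≫ φ s q = φ s p ≫ legMap b s η)
    (hφ' : ∀ {s t : S} (f : s ⟶ t) (p : c ⟶ j.obj s),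
      φ t (p ≫ j.map f) ≫ (legIso b f p).hom =
        (legIso a f p).hom ≫ (D.map f).unop ◁ φ s p) : a ⟶ b :=
  ⟨{ app s := NatTrans.toCatHom₂
      { app p := φ s (uliftDown.{w, v} p)
        naturality _ _ η := hφ s η.down }
     naturality f := Cat.Hom₂.ext (NatTrans.ext (funext fun p => hφ' f (uliftDown.{w, v} p))) }⟩

theorem legIso_cocone {Y : A} (h : X ⟶ Y) {s t : S} (f : s ⟶ t) (p : c ⟶ j.obj s) :
    (legIso (a ≫ homToMap D h) f p).hom =
      (legIso a f p).hom ▷ h ≫ (α_ (D.map f).unop (legObj a s p) h).hom := by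
  refine (congrArg (fun m => m.toNatTrans.app (uliftUp.{w, v} p))
    (Pseudofunctor.StrongTrans.categoryStruct_comp_naturality_hom a (homToMap D h) f)).trans ?_
  refine (Category.id_comp _).trans (congrArg (_ ≫ ·) ?_)
  refine (Category.id_comp _).trans ?_
  exact Category.comp_id _

variable (a b) in
/-- A 2-cell between legs of cocones is compatible with a 2-cell of the weight. -/
def LegNat (φ : ∀ s (p : c ⟶ j.obj s),
      legObj a s p ⟶ legObj b s p)
    (s : S) {p q : c ⟶ j.obj s} (η : p ⟶ q) : Prop :=
  legMap a s η ≫ φ s q = φ s p ≫ legMap b s η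

variable {φ : ∀ s (p : c ⟶ j.obj s),
      legObj a s p ⟶ legObj b s p}

variable (a b φ) in
/-- A family of 2-cells between legs of cocones is compatible with a 1-cell. -/
def LegCompat {s t : S} (f : s ⟶ t) : Prop :=
  ∀ p : c ⟶ j.obj s, φ t (p ≫ j.map f) ≫ (legIso b f p).hom =
    (legIso a f p).hom ≫ (D.map f).unop ◁ φ s p

/-- Also covers associators and unitors: in a presented 2-category they are all of the form
`eqToHom`. -/
theorem LegNat.of_eq {s : S} {p q : c ⟶ j.obj s}
    (h : p = q) : LegNat a b φ s (eqToHom h) := by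
  subst h
  simp [LegNat, legMap_id]

theorem LegNat.comp {s : S} {p q r : c ⟶ j.obj s}
    {η : p ⟶ q} {θ : q ⟶ r} (h : LegNat a b φ s η) (h' : LegNat a b φ s θ) :
    LegNat a b φ s (η ≫ θ) := by
  unfold LegNat at *
  rw [legMap_comp, legMap_comp, Category.assoc, h', reassoc_of% h]

theorem LegNat.whiskerRight {s t : S} {f : s ⟶ t}
    (hφ : LegCompat a b φ f)
    {p q : c ⟶ j.obj s} {η : p ⟶ q}
    (h : LegNat a b φ s η) :
    LegNat a b φ t (η ▷ j.map f) := by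
  unfold LegNat LegCompat at *
  rw [← cancel_mono (legIso b f q).hom, Category.assoc, Category.assoc, hφ, legMap_whiskerRight,
    reassoc_of% (hφ p), reassoc_of% (legMap_whiskerRight a f η), ← whiskerLeft_comp, ← whiskerLeft_comp, h]

theorem LegNat.whiskerLeft {s t : S} {f g : s ⟶ t}
    (hf : LegCompat a b φ f) (hg : LegCompat a b φ g)
    (θ : f ⟶ g) (p : c ⟶ j.obj s) :
    LegNat a b φ t (p ◁ j.map₂ θ) := by
  unfold LegNat LegCompat at *
  rw [← cancel_mono (legIso b g p).hom, Category.assoc, Category.assoc, hg,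
    legMap_whiskerLeft, reassoc_of% (hf p), reassoc_of% (legMap_whiskerLeft a θ p), whisker_exchange]

/-- Needed for the generator `ϑ⁻¹` of `Δ̇`, about which a morphism of codescent data says nothing
directly. -/
theorem LegNat.of_inverse {s : S} {p q : c ⟶ j.obj s}
    {η : p ⟶ q} {θ : q ⟶ p} (h : LegNat a b φ s η) (e₁ : η ≫ θ = 𝟙 p) (e₂ : θ ≫ η = 𝟙 q) :
    LegNat a b φ s θ := by
  unfold LegNat at *
  have h₁ : legMap a s θ ≫ legMap a s η = 𝟙 _ := by rw [← legMap_comp, e₂, legMap_id]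
  have h₂ : legMap b s η ≫ legMap b s θ = 𝟙 _ := by rw [← legMap_comp, e₁, legMap_id]
  calc _ = legMap a s θ ≫ (φ s p ≫ legMap b s η) ≫ legMap b s θ := by simp [h₂]
    _ = _ := by rw [← h]; simp [reassoc_of% h₁]

theorem LegNat.of_conj {s : S} {p q p' q' : c ⟶ j.obj s}
    {η : p ⟶ q} (h : LegNat a b φ s η) (hp : p' = p) (hq : q = q') :
    LegNat a b φ s (eqToHom hp ≫ η ≫ eqToHom hq) :=
  (LegNat.of_eq hp).comp (h.comp (LegNat.of_eq hq))

/-- With `LegCompat.comp` this reduces compatibility with all 1-cells to the generating ones. The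
hypotheses concern only coherence cells of `j`, which for the inclusion of `Δ_ℓ` are of the form
`eqToHom`. -/
theorem LegCompat.id {s : S}
    (h : ∀ p : c ⟶ j.obj s, LegNat a b φ s (p ◁ (j.mapId s).hom ≫ (ρ_ p).hom)) :
    LegCompat a b φ (𝟙 s) := by
  intro p
  have h := h p
  unfold LegNat at h
  rw [← legIso_id, ← legIso_id] at h
  have e : (D.map (𝟙 s)).unop ◁ φ s p ≫ (D.mapId s).hom.unop2 ▷ legObj b s p ≫ (λ_ _).hom =
      (D.mapId s).hom.unop2 ▷ legObj a s p ≫ (λ_ _).hom ≫ φ s p := by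
    rw [← leftUnitor_naturality, whisker_exchange_assoc]
    rfl
  have : IsIso (D.mapId s).hom.unop2 := (D.mapId s).unop2.isIso_hom
  rw [← cancel_mono ((D.mapId s).hom.unop2 ▷ legObj b s p ≫ (λ_ _).hom), Category.assoc,
    Category.assoc, e]
  simpa using h.symm

theorem LegCompat.comp {r s t : S} {f : r ⟶ s} {g : s ⟶ t} (hf : LegCompat a b φ f)
    (hg : LegCompat a b φ g)
    (h : ∀ p : c ⟶ j.obj r, LegNat a b φ t (p ◁ (j.mapComp f g).hom ≫ (α_ _ _ _).inv)) :
    LegCompat a b φ (f ≫ g) := by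
  intro p
  have h := h p
  unfold LegNat at h
  have ea := legIso_comp a f g p
  have eb := legIso_comp b f g p
  have e : (D.map (f ≫ g)).unop ◁ φ r p ≫ (D.mapComp f g).hom.unop2 ▷ legObj b r p ≫
      (α_ (D.map g).unop (D.map f).unop _).hom =
      (D.mapComp f g).hom.unop2 ▷ legObj a r p ≫ (α_ _ _ _).hom ≫
        (D.map g).unop ◁ (D.map f).unop ◁ φ r p := by
    rw [whisker_exchange_assoc]
    congr 1
    exact associator_naturality_right _ _ _
  have : IsIso (D.mapComp f g).hom.unop2 := (D.mapComp f g).unop2.isIso_hom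
  rw [← cancel_mono ((D.mapComp f g).hom.unop2 ▷ legObj b r p ≫ (α_ _ _ _).hom), Category.assoc,
    Category.assoc, e, eb, reassoc_of% ea, ← whiskerLeft_comp, ← hf p, whiskerLeft_comp,
    ← reassoc_of% (hg (p ≫ j.map f)), reassoc_of% h]

end Legs
end BiadjointTriangle

namespace BiadjointTriangle

/-! ### Strictness of presented 2-categories, and induction on their 1-cells -/

section Presentations

variable (P : Presentation)

/-- The comparison cells of a lifted pseudofunctor are built from associators and unitors of the
target, and in a presented 2-category these are `eqToHom`s. -/
theorem evalComp_eq_eqToHom {V : Type} [Quiver.{0} V] (F : V ⥤q P.TwoCat) {a b d : V}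
    (p : Quiver.Path a b) (q : Quiver.Path b d) :
    ∃ h, (evalComp F p q).hom = eqToHom h := by
  induction q with
  | nil => exact ⟨rfl, rfl⟩
  | cons q e ih =>
    obtain ⟨h, hh⟩ := ih
    refine ⟨(congrArg (· ≫ F.map e) h).trans
      (P.hom_comp_assoc (evalPath F p) (evalPath F q) (F.map e)), ?_⟩
    change (evalComp F p q).hom ▷ F.map e ≫ (α_ _ _ _).hom = _
    rw [hh]
    refine (congrArg (· ≫ (α_ (evalPath F p) (evalPath F q) (F.map e)).hom)
      (P.wR_eqToHom h (F.map e))).trans ?_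
    exact eqToHom_trans (congrArg (· ≫ F.map e) h)
      (P.hom_comp_assoc (evalPath F p) (evalPath F q) (F.map e))

variable {P}

/-- A generating 1-cell, as a 1-cell of the presented 2-category. -/
abbrev Presentation.edge {s t : P.TwoCat} (e : @Quiver.Hom P.V _ s t) : s ⟶ t :=
  path1 (V := P.V) e

/-- The 1-cells are paths, and composing with a single edge on the right is definitionally
`Quiver.Path.cons`. -/
theorem Presentation.hom_induction {s : P.TwoCat} {motive : ∀ {t : P.TwoCat} (_ : s ⟶ t), Prop}
    (id : motive (𝟙 s))
    (comp : ∀ {t t' : P.TwoCat} (f : s ⟶ t) (e : @Quiver.Hom P.V _ t t'), motive f →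
      motive (f ≫ P.edge e)) {t : P.TwoCat} (f : s ⟶ t) : motive f := by
  have h : ∀ {t : P.V} (f : @Quiver.Path P.V _ s t), motive (t := t) f := by
    intro t f
    induction f with
    | nil => exact id
    | cons f e ih => exact comp f e ih
  exact h f

end Presentations

/-! ### Recursion on the 1-cells out of `0` -/

section DotPaths

variable (inv : Prop)

/-- The object `0` of `Δ̇_ℓ`, respectively of `Δ̇`. -/
abbrev dotZero : DotDelta inv := DotObj.zero

/-- Recursion on the 1-cells of `Δ̇` from `0` to the objects of `Δ_ℓ`. -/
def dotPathRecAux {motive : ∀ s : DeltaL, (dotZero inv ⟶ (inclusion inv).obj s) → Sort*}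
    (base : motive DeltaObj.one (path1 (V := DotObj) DotEdge.d))
    (step : ∀ {s t : DeltaL} (e : DeltaEdge s t) (p : dotZero inv ⟶ (inclusion inv).obj s),
      motive s p → motive t (p ≫ (inclusion inv).map (deltaComputad.free.edge e))) :
    ∀ {b : DotObj} (p : Quiver.Path DotObj.zero b),
      match b, p with
      | .zero, _ => PUnit
      | .one, p => motive DeltaObj.one p
      | .two, p => motive DeltaObj.two p
      | .three, p => motive DeltaObj.three p
  | _, .nil => PUnit.unit
  -- No edge ends at `0`, so `d` is preceded by the empty path only, and every path from `0` to
  -- another object begins with `d`.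
  | _, .cons .nil .d => base
  | _, .cons p .d0 => step .d0 p (dotPathRecAux base step p)
  | _, .cons p .d1 => step .d1 p (dotPathRecAux base step p)
  | _, .cons p .s0 => step .s0 p (dotPathRecAux base step p)
  | _, .cons p .e0 => step .e0 p (dotPathRecAux base step p)
  | _, .cons p .e1 => step .e1 p (dotPathRecAux base step p)
  | _, .cons p .e2 => step .e2 p (dotPathRecAux base step p)

/-- Recursion on the 1-cells of `Δ̇` from `0` to the objects of `Δ_ℓ`. -/
def dotPathRec {motive : ∀ s : DeltaL, (dotZero inv ⟶ (inclusion inv).obj s) → Sort*}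
    (base : motive DeltaObj.one (path1 (V := DotObj) DotEdge.d))
    (step : ∀ {s t : DeltaL} (e : DeltaEdge s t) (p : dotZero inv ⟶ (inclusion inv).obj s),
      motive s p → motive t (p ≫ (inclusion inv).map (deltaComputad.free.edge e))) :
    ∀ (s : DeltaL) (p : dotZero inv ⟶ (inclusion inv).obj s), motive s p
  | DeltaObj.one, p => dotPathRecAux inv base step (b := .one) p
  | DeltaObj.two, p => dotPathRecAux inv base step (b := .two) p
  | DeltaObj.three, p => dotPathRecAux inv base step (b := .three) p

/-- The recursion inspects the last edge, so the equation reduces by computation as soon as `e` is a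
concrete edge. -/
theorem dotPathRec_step {motive : ∀ s : DeltaL, (dotZero inv ⟶ (inclusion inv).obj s) → Sort*}
    (base : motive DeltaObj.one (path1 (V := DotObj) DotEdge.d))
    (step : ∀ {s t : DeltaL} (e : DeltaEdge s t) (p : dotZero inv ⟶ (inclusion inv).obj s),
      motive s p → motive t (p ≫ (inclusion inv).map (deltaComputad.free.edge e)))
    {s t : DeltaL} (e : DeltaEdge s t) (p : dotZero inv ⟶ (inclusion inv).obj s) :
    dotPathRec inv base step t (p ≫ (inclusion inv).map (deltaComputad.free.edge e)) =
      step e p (dotPathRec inv base step s p) := by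
  cases e <;> rfl

end DotPaths

/-! ### Compatibility with `ϑ` implies compatibility with every 2-cell out of `0` -/

section Diagrams

variable {A : Type u} [Bicategory.{w, v} A]

namespace CodescentDiagram

variable (D : CodescentDiagram A)

/-- The graph morphism underlying a codescent diagram. -/
def prefunctor : DeltaObj ⥤q Aᵒᵖ where
  obj
    | .one => .op D.one
    | .two => .op D.two
    | .three => .op D.three
  map
    | .d0 => D.d0.op
    | .d1 => D.d1.op
    | .s0 => D.s0.op
    | .e0 => D.e0.op
    | .e1 => D.e1.op
    | .e2 => D.e2.op

/-- The interpretation of the computad of `Δ_ℓ` given by a codescent diagram. -/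
def interp : deltaComputad.Interp Aᵒᵖ where
  toPrefunctor := D.prefunctor
  cell
    | .sigma00 => opCell D.sigma00
    | .sigma20 => opCell D.sigma20
    | .sigma21 => opCell D.sigma21
    | .n0 => opCellFromId D.n0
    | .n1 => opCellFromId D.n1

/-- The pseudofunctor `Δ_ℓ ⥤ᵖ Aᵒᵖ` given by a codescent diagram. -/
def pseudofunctor : DeltaL ⥤ᵖ Aᵒᵖ :=
  Computad.Interp.lift (P := deltaComputad.free) D.interp (fun h => h.elim)

end CodescentDiagram

variable {D : CodescentDiagram A} {inv : Prop} {X : A}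

/-- The cocones under a codescent diagram with the weight of the (lax) codescent object. -/
abbrev DescentCocone (D : CodescentDiagram A) (inv : Prop) (X : A) :=
  coneWeight.{w, v} (inclusion inv) (dotZero inv) ⟶ homTo D.pseudofunctor X


variable {a b : DescentCocone D inv X}
  {φ : ∀ s (p : dotZero inv ⟶ (inclusion inv).obj s), legObj a s p ⟶ legObj b s p}

theorem inclusion_mapComp_eq_eqToHom {r s t : DeltaL} (f : r ⟶ s) (g : s ⟶ t)
    (p : dotZero inv ⟶ (inclusion inv).obj r) :
    ∃ h, p ◁ ((inclusion inv).mapComp f g).hom ≫ (α_ _ _ _).inv = eqToHom h := by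
  obtain ⟨h, hh⟩ := evalComp_eq_eqToHom _ (inclusionPrefunctor inv) (a := r) (b := s) (d := t) f g
  have e : p ◁ ((inclusion inv).mapComp f g).hom = eqToHom (congrArg (p ≫ ·) h) :=
    (congrArg (p ◁ ·) hh).trans ((dotPresentation inv).wL_eqToHom p h)
  rw [e]
  exact ⟨_, eqToHom_trans (congrArg (p ≫ ·) h) ((dotPresentation inv).hom_comp_assoc _ _ _).symm⟩

theorem LegNat.inclusion_mapComp {r s t : DeltaL} (f : r ⟶ s) (g : s ⟶ t)
    (p : dotZero inv ⟶ (inclusion inv).obj r) :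
    LegNat a b φ t (p ◁ ((inclusion inv).mapComp f g).hom ≫ (α_ _ _ _).inv) := by
  obtain ⟨h, e⟩ := inclusion_mapComp_eq_eqToHom f g p
  rw [e]
  exact LegNat.of_eq h

/-- Compatibility with the generating 1-cells implies compatibility with all 1-cells. -/
theorem LegCompat.of_edges
    (hφ : ∀ {s t : DeltaObj} (e : DeltaEdge s t), LegCompat a b φ (deltaComputad.free.edge e))
    {s t : DeltaL} (f : s ⟶ t) : LegCompat a b φ f := by
  induction f using Presentation.hom_induction with
  | id =>
    refine LegCompat.id fun p => ?_
    have e : p ◁ ((inclusion inv).mapId s).hom ≫ (ρ_ p).hom = 𝟙 p := by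
      refine (Category.comp_id _).trans ?_
      exact whiskerLeft_id p _
    rw [e]
    exact LegNat.of_eq rfl
  | comp f e ih => exact ih.comp (hφ e) (LegNat.inclusion_mapComp _ _)

/-- The property of a pasting in `Δ̇` that its images under two cocones are compatible. -/
def PastingNat (a b : DescentCocone D inv X)
    (φ : ∀ s (p : dotZero inv ⟶ (inclusion inv).obj s), legObj a s p ⟶ legObj b s p)
    {x : DotDelta inv} : ∀ {y : DotDelta inv} {p q : x ⟶ y}, (p ⟶ q) → Prop
  -- There are no legs at `0`, which is not an object of `Δ_ℓ`. What the induction needs there is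
  -- that every 2-cell is an identity.
  | DotObj.zero, p, q, η => ∃ h : p = q, η = @eqToHom (x ⟶ dotZero inv) _ p q h
  | DotObj.one, _, _, η => ∀ r : dotZero inv ⟶ x, LegNat a b φ DeltaObj.one (r ◁ η)
  | DotObj.two, _, _, η => ∀ r : dotZero inv ⟶ x, LegNat a b φ DeltaObj.two (r ◁ η)
  | DotObj.three, _, _, η => ∀ r : dotZero inv ⟶ x, LegNat a b φ DeltaObj.three (r ◁ η)

theorem pastingNat_zero_iff {x : DotDelta inv} {p q : x ⟶ dotZero inv} {η : p ⟶ q} :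
    PastingNat a b φ η ↔ ∃ h : p = q, η = eqToHom h := Iff.rfl

theorem pastingNat_inclusion_iff {x : DotDelta inv} {s : DeltaL} {p q : x ⟶ (inclusion inv).obj s}
    {η : p ⟶ q} :
    PastingNat a b φ η ↔ ∀ r : dotZero inv ⟶ x, LegNat a b φ s (r ◁ η) := by
  cases s <;> exact Iff.rfl

theorem eq_dotZero_or_inclusion (y : DotDelta inv) :
    y = dotZero inv ∨ ∃ s : DeltaL, y = (inclusion inv).obj s := by
  cases y
  · exact Or.inl rfl
  · exact Or.inr ⟨DeltaObj.one, rfl⟩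
  · exact Or.inr ⟨DeltaObj.two, rfl⟩
  · exact Or.inr ⟨DeltaObj.three, rfl⟩

theorem PastingNat.of_eq {x y : DotDelta inv} {p q : x ⟶ y} (h : p = q) :
    PastingNat a b φ (eqToHom h) := by
  subst h
  rcases eq_dotZero_or_inclusion y with rfl | ⟨s, rfl⟩
  · exact ⟨rfl, rfl⟩
  · rw [pastingNat_inclusion_iff]
    intro r
    rw [eqToHom_refl, whiskerLeft_id]
    exact LegNat.of_eq rfl

theorem PastingNat.comp {x y : DotDelta inv} {p q r : x ⟶ y} {η : p ⟶ q}
    {θ : q ⟶ r} (h : PastingNat a b φ η) (h' : PastingNat a b φ θ) :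
    PastingNat a b φ (η ≫ θ) := by
  rcases eq_dotZero_or_inclusion y with rfl | ⟨s, rfl⟩
  · rw [pastingNat_zero_iff] at *
    obtain ⟨h, rfl⟩ := h
    obtain ⟨h', rfl⟩ := h'
    exact ⟨h.trans h', eqToHom_trans _ _⟩
  · rw [pastingNat_inclusion_iff] at *
    intro t
    rw [whiskerLeft_comp]
    exact (h t).comp (h' t)

/-- The quantification over all `r : 0 ⟶ x` in `PastingNat` serves this closure property: `r ◁ t ◁
η` is `(r ≫ t) ◁ η` up to associators, which are `eqToHom`s. -/
theorem PastingNat.whiskerLeft {x y z : DotDelta inv} (t : x ⟶ y)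
    {p q : y ⟶ z} {η : p ⟶ q}
    (h : PastingNat a b φ η) : PastingNat a b φ (t ◁ η) := by
  rcases eq_dotZero_or_inclusion z with rfl | ⟨s, rfl⟩
  · rw [pastingNat_zero_iff] at *
    obtain ⟨rfl, rfl⟩ := h
    exact ⟨rfl, whiskerLeft_id _ _⟩
  · rw [pastingNat_inclusion_iff] at *
    intro r
    have e : r ◁ t ◁ η = (α_ r t p).inv ≫ (r ≫ t) ◁ η ≫ (α_ r t q).hom := by simp
    rw [e]
    exact LegNat.of_conj (h _) ((dotPresentation inv).hom_comp_assoc _ _ _).symm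
      ((dotPresentation inv).hom_comp_assoc _ _ _)

theorem PastingNat.whiskerRight_edge
    (hφ : ∀ {s t : DeltaL} (f : s ⟶ t), LegCompat a b φ f)
    {x y : DotDelta inv} {y' : DotObj} {p q : x ⟶ y} {η : p ⟶ q}
    (h : PastingNat a b φ η) (e : DotEdge y y') :
    PastingNat a b φ (η ▷ (dotPresentation inv).edge e) := by
  have key : ∀ {s t : DeltaL} (f : s ⟶ t) {p q : x ⟶ (inclusion inv).obj s} {η : p ⟶ q}
      (_ : PastingNat a b φ η), PastingNat a b φ (η ▷ (inclusion inv).map f) := by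
    intro s t f p q η h
    rw [pastingNat_inclusion_iff] at *
    intro r
    have e : r ◁ η ▷ (inclusion inv).map f =
      (α_ _ _ _).inv ≫ (r ◁ η) ▷ (inclusion inv).map f ≫ (α_ _ _ _).hom := by simp
    rw [e]
    exact LegNat.of_conj ((h r).whiskerRight (hφ f))
      ((dotPresentation inv).hom_comp_assoc _ _ _).symm
      ((dotPresentation inv).hom_comp_assoc _ _ _)
  cases e with
  -- A pasting with target `0` is an identity, and so is its whiskering with `d`. This is where the
  -- clause for `0` in `PastingNat` is used.
  | d =>
    obtain ⟨rfl, rfl⟩ := h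
    refine Eq.mpr (congrArg _ ?_) (PastingNat.of_eq rfl)
    exact id_whiskerRight _ _
  | d0 => exact key (deltaComputad.free.edge DeltaEdge.d0) h
  | d1 => exact key (deltaComputad.free.edge DeltaEdge.d1) h
  | s0 => exact key (deltaComputad.free.edge DeltaEdge.s0) h
  | e0 => exact key (deltaComputad.free.edge DeltaEdge.e0) h
  | e1 => exact key (deltaComputad.free.edge DeltaEdge.e1) h
  | e2 => exact key (deltaComputad.free.edge DeltaEdge.e2) h

theorem PastingNat.whiskerRight
    (hφ : ∀ {s t : DeltaL} (f : s ⟶ t), LegCompat a b φ f)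
    {x y z : DotDelta inv} {p q : x ⟶ y} {η : p ⟶ q}
    (h : PastingNat a b φ η) (r : y ⟶ z) : PastingNat a b φ (η ▷ r) := by
  induction r using Presentation.hom_induction with
  | id =>
    rw [whiskerRight_id]
    exact (PastingNat.of_eq (p := p ≫ 𝟙 _) rfl).comp (h.comp (PastingNat.of_eq (q := q ≫ 𝟙 _) rfl))
  | comp r e ih =>
    rw [whiskerRight_comp]
    exact (PastingNat.of_eq ((dotPresentation inv).hom_comp_assoc _ _ _).symm).comp
      ((PastingNat.whiskerRight_edge hφ ih e).comp
        (PastingNat.of_eq ((dotPresentation inv).hom_comp_assoc _ _ _)))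

/-- The generating 2-cell `ϑ`. -/
def dotThetaCell (inv : Prop) :
    @Quiver.Hom (dotZero inv ⟶ (inclusion inv).obj DeltaObj.two) _
      (path2 DotEdge.d DotEdge.d1) (path2 DotEdge.d DotEdge.d0) :=
  (dotPresentation inv).cell (.gen DotCell.theta)

/-- The formal inverse of the generating 2-cell `ϑ`. -/
def dotThetaInvCell {inv : Prop} (h : inv) :
    @Quiver.Hom (dotZero inv ⟶ (inclusion inv).obj DeltaObj.two) _
      (path2 DotEdge.d DotEdge.d0) (path2 DotEdge.d DotEdge.d1) :=
  (dotPresentation inv).cell (.gen (DotCell.thetaInv h))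

theorem dotThetaCell_inv (h : inv) : dotThetaCell inv ≫ dotThetaInvCell h = 𝟙 _ :=
  Quot.sound (Presentation.Rel.eqn (P := dotPresentation inv) (DotEqn.theta_thetaInv h))

theorem dotThetaInvCell_theta (h : inv) : dotThetaInvCell h ≫ dotThetaCell inv = 𝟙 _ :=
  Quot.sound (Presentation.Rel.eqn (P := dotPresentation inv) (DotEqn.thetaInv_theta h))

/-- The identity is the only 1-cell from `0` to `0`, so for a 2-cell that starts at `0`, such as
`ϑ`, left whiskering adds nothing. -/
theorem PastingNat.of_cell_zero {s : DeltaL} {p q : dotZero inv ⟶ (inclusion inv).obj s}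
    {η : p ⟶ q} (h : LegNat a b φ s η) : PastingNat a b φ η := by
  rw [pastingNat_inclusion_iff]
  intro r
  obtain rfl : r = 𝟙 _ := by
    have h : ∀ r : Quiver.Path DotObj.zero DotObj.zero, r = .nil := by
      intro r
      cases r with
      | nil => rfl
      | cons r e => nomatch e
    exact h r
  rw [id_whiskerLeft]
  exact h.of_conj ((dotPresentation inv).hom_id_comp _) ((dotPresentation inv).hom_id_comp _).symm

/-- Induction on pastings. Generators that come from `Δ_ℓ` are compatible because the cocones are
pseudonatural, `ϑ` is compatible by hypothesis, and `ϑ⁻¹` as its inverse. -/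
theorem PastingNat.of_pasting
    (hφ : ∀ {s t : DeltaL} (f : s ⟶ t), LegCompat a b φ f)
    (hϑ : LegNat a b φ DeltaObj.two (dotThetaCell inv))
    {x y : (dotComputad inv).V} {p q : Quiver.Path x y} (η : (dotComputad inv).Pasting p q) :
    PastingNat a b φ ((dotPresentation inv).cell (a := x) (b := y) η) := by
  induction η with
  | gen γ =>
    have key : ∀ {s t : DeltaL} {f g : s ⟶ t} (θ : f ⟶ g),
        PastingNat a b φ ((inclusion inv).map₂ θ) := fun θ =>
      pastingNat_inclusion_iff.2 fun r => LegNat.whiskerLeft (hφ _) (hφ _) θ r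
    cases γ with
    | sigma00 => exact key (deltaComputad.free.cell (.gen DeltaCell.sigma00))
    | sigma20 => exact key (deltaComputad.free.cell (.gen DeltaCell.sigma20))
    | sigma21 => exact key (deltaComputad.free.cell (.gen DeltaCell.sigma21))
    | n0 => exact key (deltaComputad.free.cell (.gen DeltaCell.n0))
    | n1 => exact key (deltaComputad.free.cell (.gen DeltaCell.n1))
    | theta => exact PastingNat.of_cell_zero hϑ
    | thetaInv h =>
      exact PastingNat.of_cell_zero (hϑ.of_inverse (dotThetaCell_inv h) (dotThetaInvCell_theta h))
  | refl p => exact PastingNat.of_eq rfl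
  | vcomp η θ ih ih' => exact ih.comp ih'
  | whiskerLeft p η ih => exact ih.whiskerLeft p
  | whiskerRight η r ih => exact ih.whiskerRight hφ r

/-- Hence a family of 2-cells that is compatible with 1-cells is a modification of cocones once it
respects the single 2-cell `ϑ`. -/
theorem LegNat.of_theta
    (hφ : ∀ {s t : DeltaL} (f : s ⟶ t), LegCompat a b φ f)
    (hϑ : LegNat a b φ DeltaObj.two (dotThetaCell inv))
    {s : DeltaL} {p q : dotZero inv ⟶ (inclusion inv).obj s} (η : p ⟶ q) : LegNat a b φ s η := by
  have h : PastingNat a b φ η := by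
    obtain ⟨η, rfl⟩ := Quot.exists_rep η
    exact PastingNat.of_pasting hφ hϑ η
  have h' := pastingNat_inclusion_iff.1 h (𝟙 _)
  rw [id_whiskerLeft] at h'
  have := h'.of_conj ((dotPresentation inv).hom_id_comp p).symm ((dotPresentation inv).hom_id_comp q)
  have e : eqToHom ((dotPresentation inv).hom_id_comp p).symm ≫ ((λ_ p).hom ≫ η ≫ (λ_ q).inv) ≫
      eqToHom ((dotPresentation inv).hom_id_comp q) = η := by
    change eqToHom _ ≫ (eqToHom ((dotPresentation inv).hom_id_comp p) ≫ η ≫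
      eqToHom ((dotPresentation inv).hom_id_comp q).symm) ≫ eqToHom _ = η
    simp
  rwa [e] at this

end Diagrams
end BiadjointTriangle

namespace BiadjointTriangle

/-! ### The codescent datum of a cocone; evaluation is fully faithful -/

section Evaluation

variable {A : Type u} [Bicategory.{w, v} A] {D : CodescentDiagram A} {inv : Prop} {X : A}

/-- The evaluation of a path begins with an identity, and a left unitor of `Aᵒᵖ` is a right unitor
of `A`. This is the origin of the right unitors that accompany every generator in what follows. -/
theorem unop2_opCell {X Y Y' Z : A} {f : X ⟶ Y} {g : Y ⟶ Z} {f' : X ⟶ Y'} {g' : Y' ⟶ Z}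
    (θ : f ≫ g ⟶ f' ≫ g') :
    (opCell θ).unop2 = f ◁ (ρ_ g).hom ≫ θ ≫ f' ◁ (ρ_ g').inv := rfl

theorem unop2_opCellFromId {X Y : A} {f : X ⟶ Y} {g : Y ⟶ X} (θ : 𝟙 X ⟶ f ≫ g) :
    (opCellFromId θ).unop2 = θ ≫ f ◁ (ρ_ g).inv := rfl

theorem postWhisker_rightUnitor {X Y Y' Z W : A} {f : X ⟶ Y} {g : Y ⟶ Z} {f' : X ⟶ Y'}
    {g' : Y' ⟶ Z} (θ : f ≫ g ⟶ f' ≫ g') (h : Z ⟶ W) :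
    (f ◁ (ρ_ g).hom ≫ θ ≫ f' ◁ (ρ_ g').inv) ▷ h ≫ (f' ◁ (ρ_ g').hom) ▷ h ≫ (α_ _ _ _).hom =
      ((f ◁ (ρ_ g).hom) ▷ h ≫ (α_ _ _ _).hom) ≫ postWhisker θ h := by
  have e : (f' ◁ (ρ_ g').inv) ▷ h ≫ (f' ◁ (ρ_ g').hom) ▷ h = 𝟙 _ := by
    rw [← comp_whiskerRight, whiskerLeft_inv_hom, id_whiskerRight]
  simp only [postWhisker, comp_whiskerRight, Category.assoc, Iso.hom_inv_id_assoc, reassoc_of% e]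

theorem postWhiskerFromId_rightUnitor {X Y W : A} {f : X ⟶ Y} {g : Y ⟶ X} (θ : 𝟙 X ⟶ f ≫ g)
    (h : X ⟶ W) :
    (θ ≫ f ◁ (ρ_ g).inv) ▷ h ≫ (f ◁ (ρ_ g).hom) ▷ h ≫ (α_ _ _ _).hom =
      (λ_ h).hom ≫ postWhiskerFromId θ h := by
  have e : (f ◁ (ρ_ g).inv) ▷ h ≫ (f ◁ (ρ_ g).hom) ▷ h = 𝟙 _ := by
    rw [← comp_whiskerRight, whiskerLeft_inv_hom, id_whiskerRight]
  simp only [postWhiskerFromId, comp_whiskerRight, Category.assoc, Iso.hom_inv_id_assoc,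
    reassoc_of% e]

variable (a : DescentCocone D inv X)

/-- The pseudonaturality of a cocone at a generating 1-cell. -/
def edgeIso {s t : DeltaL} (e : DeltaEdge s t) (p : dotZero inv ⟶ (inclusion inv).obj s) :
    legObj a t (p ≫ (inclusion inv).map (deltaComputad.free.edge e)) ≅
      (D.prefunctor.map e).unop ≫ legObj a s p :=
  legIso a (deltaComputad.free.edge e) p ≪≫ whiskerRightIso (ρ_ (D.prefunctor.map e).unop) _

theorem edgeIso_naturality {s t : DeltaL} (e : DeltaEdge s t)
    {p q : dotZero inv ⟶ (inclusion inv).obj s} (η : p ⟶ q) :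
    legMap a t (η ▷ (inclusion inv).map (deltaComputad.free.edge e)) ≫ (edgeIso a e q).hom =
      (edgeIso a e p).hom ≫ (D.prefunctor.map e).unop ◁ legMap a s η := by
  have h := legMap_whiskerRight a (deltaComputad.free.edge e) η
  have h' : (D.pseudofunctor.map (deltaComputad.free.edge e)).unop ◁ legMap a s η ≫
      (ρ_ (D.prefunctor.map e).unop).hom ▷ _ =
      (ρ_ (D.prefunctor.map e).unop).hom ▷ _ ≫ (D.prefunctor.map e).unop ◁ legMap a s η :=
    whisker_exchange _ _
  refine (Category.assoc _ _ _).symm.trans ((congrArg (· ≫ _) h).trans ?_)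
  exact (Category.assoc _ _ _).trans ((congrArg (_ ≫ ·) h').trans (Category.assoc _ _ _).symm)

/-- The pseudonaturality of a cocone at a composite of two generating 1-cells. -/
def edgePairIso {s t r : DeltaL} (f : DeltaEdge s t) (g : DeltaEdge t r)
    (p : dotZero inv ⟶ (inclusion inv).obj s) :
    legObj a r (p ≫ (inclusion inv).map
      (deltaComputad.free.edge f ≫ deltaComputad.free.edge g)) ≅
      (D.prefunctor.map g).unop ≫ (D.prefunctor.map f).unop ≫ legObj a s p :=
  legIso a (deltaComputad.free.edge f ≫ deltaComputad.free.edge g) p ≪≫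
    whiskerRightIso (whiskerLeftIso (D.prefunctor.map g).unop (ρ_ (D.prefunctor.map f).unop)) _ ≪≫
    α_ _ _ _

/-- The bicategorical core of `edgePairIso_hom`, stated for abstract cells so that coherence tactics
do not have to look into cocones. -/
theorem edgePairIso_aux {x y z : A} {g : x ⟶ y} {f : y ⟶ z} {h : z ⟶ X} {m : y ⟶ X} {k l : x ⟶ X}
    (L : k ⟶ (g ≫ f ≫ 𝟙 z) ≫ h) (K : k ⟶ l) (ιg : l ⟶ (g ≫ 𝟙 y) ≫ m)
    (ιf : m ⟶ (f ≫ 𝟙 z) ≫ h)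
    (e : L ≫ (g ◁ (λ_ (f ≫ 𝟙 z)).inv ≫ (α_ _ _ _).inv) ▷ h ≫ (α_ (g ≫ 𝟙 y) (f ≫ 𝟙 z) h).hom =
      K ≫ ιg ≫ (g ≫ 𝟙 y) ◁ ιf) :
    L ≫ (g ◁ (ρ_ f).hom) ▷ h ≫ (α_ _ _ _).hom =
      K ≫ (ιg ≫ (ρ_ g).hom ▷ m) ≫ g ◁ (ιf ≫ (ρ_ f).hom ▷ h) := by
  have e₁ : (g ≫ 𝟙 y) ◁ ιf ≫ (ρ_ g).hom ▷ _ = (ρ_ g).hom ▷ _ ≫ g ◁ ιf := whisker_exchange _ _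
  rw [whiskerLeft_comp, Category.assoc, ← reassoc_of% e₁, ← reassoc_of% e]
  congr 1
  simp only [comp_whiskerRight]
  bicategory

theorem edgePairIso_hom {s t r : DeltaL} (f : DeltaEdge s t) (g : DeltaEdge t r)
    (p : dotZero inv ⟶ (inclusion inv).obj s) :
    ∃ h, (edgePairIso a f g p).hom = legMap a r (eqToHom h) ≫
      (edgeIso a g (p ≫ (inclusion inv).map (deltaComputad.free.edge f))).hom ≫
        (D.prefunctor.map g).unop ◁ (edgeIso a f p).hom := by
  obtain ⟨h, e⟩ := inclusion_mapComp_eq_eqToHom (inv := inv)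
    (deltaComputad.free.edge f) (deltaComputad.free.edge g) p
  have e' := legIso_comp a (deltaComputad.free.edge f) (deltaComputad.free.edge g) p
  rw [e] at e'
  exact ⟨h, edgePairIso_aux _ _ _ _ e'⟩

/-- Under the identification of legs with composites in `A`, a generating 2-cell of `Δ_ℓ` acts by
whiskering its value in the diagram with the leg. -/
theorem edgePairIso_cell {s t r : DeltaL} {f : DeltaEdge s t} {g : DeltaEdge t r}
    {t' : DeltaL} {f' : DeltaEdge s t'} {g' : DeltaEdge t' r}
    (γ : (deltaComputad.free.edge f ≫ deltaComputad.free.edge g : s ⟶ r) ⟶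
      deltaComputad.free.edge f' ≫ deltaComputad.free.edge g')
    (θ : (D.prefunctor.map g).unop ≫ (D.prefunctor.map f).unop ⟶
      (D.prefunctor.map g').unop ≫ (D.prefunctor.map f').unop)
    (h : (D.pseudofunctor.map₂ γ).unop2 = (opCell θ).unop2)
    (p : dotZero inv ⟶ (inclusion inv).obj s) :
    legMap a r (p ◁ (inclusion inv).map₂ γ) ≫ (edgePairIso a f' g' p).hom =
      (edgePairIso a f g p).hom ≫ postWhisker θ (legObj a s p) := by
  have e := legMap_whiskerLeft a γ p
  rw [h, unop2_opCell] at e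
  refine (Category.assoc _ _ _).symm.trans ((congrArg (· ≫ _) e).trans ?_)
  refine (Category.assoc _ _ _).trans (Eq.trans (congrArg (_ ≫ ·) ?_) (Category.assoc _ _ _).symm)
  exact postWhisker_rightUnitor θ _

theorem edgePairIso_cellFromId {s t : DeltaL} {f : DeltaEdge s t} {g : DeltaEdge t s}
    (γ : 𝟙 s ⟶ deltaComputad.free.edge f ≫ deltaComputad.free.edge g)
    (θ : 𝟙 _ ⟶ (D.prefunctor.map g).unop ≫ (D.prefunctor.map f).unop)
    (h : (D.pseudofunctor.map₂ γ).unop2 = (opCellFromId θ).unop2)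
    (p : dotZero inv ⟶ (inclusion inv).obj s) :
    legMap a s (p ◁ (inclusion inv).map₂ γ) ≫ (edgePairIso a f g p).hom =
      postWhiskerFromId θ (legObj a s p) := by
  have e := legMap_whiskerLeft a γ p
  rw [h, unop2_opCellFromId] at e
  have e₀ : (legIso a (𝟙 s) p).hom ≫ (λ_ _).hom = 𝟙 _ := by
    have e₁ := legIso_id a s p
    have e₂ : p ◁ ((inclusion inv).mapId s).hom ≫ (ρ_ p).hom = 𝟙 p :=
      (Category.comp_id _).trans (whiskerLeft_id p _)
    refine Eq.trans ?_ (e₁.trans ((congrArg (legMap a s) e₂).trans (legMap_id a s p)))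
    refine congrArg (_ ≫ ·) ?_
    exact ((congrArg (· ≫ _) (id_whiskerRight _ _)).trans (Category.id_comp _)).symm
  refine (Category.assoc _ _ _).symm.trans ((congrArg (· ≫ _) e).trans ?_)
  refine Eq.trans ?_ ((congrArg (· ≫ postWhiskerFromId θ (legObj a s p)) e₀).trans
    (Category.id_comp _))
  refine (Category.assoc _ _ _).trans (Eq.trans (congrArg (_ ≫ ·) ?_) (Category.assoc _ _ _).symm)
  exact postWhiskerFromId_rightUnitor θ _

/-- The first leg of a cocone. -/
def baseLeg : D.one ⟶ X := legObj a DeltaObj.one (path1 (V := DotObj) DotEdge.d)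

/-- The 2-cell `ϑ` of a cocone. -/
def baseCell : D.d1 ≫ baseLeg a ⟶ D.d0 ≫ baseLeg a :=
  (edgeIso a (s := DeltaObj.one) (t := DeltaObj.two) DeltaEdge.d1 (path1 (V := DotObj) DotEdge.d)).inv ≫
    legMap a DeltaObj.two (dotThetaCell inv) ≫
    (edgeIso a (s := DeltaObj.one) (t := DeltaObj.two) DeltaEdge.d0 (path1 (V := DotObj) DotEdge.d)).hom

/-- The comparison of a leg of a cocone with the first leg. -/
def baseIso {r : DeltaL} (f : DeltaEdge .one .two) (g : DeltaEdge .two r) :=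
  edgePairIso a (s := DeltaObj.one) (t := DeltaObj.two) f g (path1 (V := DotObj) DotEdge.d)

theorem conj_whiskerLeft_aux {x y : A} {g : x ⟶ y} {l₁ l₁' l₀ l₀' : x ⟶ X} {u₁ u₀ v₁ v₀ : y ⟶ X}
    (m₁ : l₁ ⟶ l₁') (E₁ : l₁' ⟶ g ≫ u₁) (F₁ : u₁ ≅ v₁) (T : u₁ ⟶ u₀) (F₀ : u₀ ⟶ v₀)
    {Θ : l₁' ⟶ l₀'} {E₀ : l₀' ⟶ g ≫ u₀} {m₀ : l₀ ⟶ l₀'} {m₀' : l₀' ⟶ l₀} (hm : m₀' ≫ m₀ = 𝟙 _)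
    (nat : Θ ≫ E₀ = E₁ ≫ g ◁ T) :
    (m₁ ≫ E₁ ≫ g ◁ F₁.hom) ≫ g ◁ (F₁.inv ≫ T ≫ F₀) =
      (m₁ ≫ Θ ≫ m₀') ≫ (m₀ ≫ E₀ ≫ g ◁ F₀) := by
  simp only [Category.assoc, reassoc_of% hm, reassoc_of% nat, whiskerLeft_comp,
    whiskerLeft_hom_inv_assoc]

/-- Naturality of the edge cell at `ϑ`, with `ϑ` conjugated by `edgeIso`. The transports by
`eqToHom` come from `edgePairIso_hom`; their endpoints agree definitionally, so `eqToHom_conj_self`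
will remove them. -/
theorem baseIso_theta {r : DeltaL} (g : DeltaEdge .two r) : ∃ h h',
    (baseIso a .d1 g).hom ≫ (D.prefunctor.map g).unop ◁ baseCell a =
      legMap a r (eqToHom h ≫ dotThetaCell inv ▷ (inclusion inv).map (deltaComputad.free.edge g) ≫
        eqToHom h') ≫ (baseIso a .d0 g).hom := by
  obtain ⟨h, e⟩ := edgePairIso_hom a (s := DeltaObj.one) (t := DeltaObj.two) .d1 g
    (path1 (V := DotObj) DotEdge.d)
  obtain ⟨h', e'⟩ := edgePairIso_hom a (s := DeltaObj.one) (t := DeltaObj.two) .d0 g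
    (path1 (V := DotObj) DotEdge.d)
  refine ⟨h, h'.symm, ?_⟩
  rw [legMap_comp, legMap_comp]
  refine (congrArg (· ≫ _) e).trans (Eq.trans ?_ (congrArg (_ ≫ ·) e').symm)
  refine conj_whiskerLeft_aux _ _ _ _ _ ?_ ?_
  · exact legMap_eqToHom_symm a r h'
  · exact edgeIso_naturality a g _

theorem baseIso_cell {r : DeltaL} {f f' : DeltaEdge .one .two} {g g' : DeltaEdge .two r}
    (γ : DeltaCell (path2 f g) (path2 f' g'))
    (θ : (D.prefunctor.map g).unop ≫ (D.prefunctor.map f).unop ⟶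
      (D.prefunctor.map g').unop ≫ (D.prefunctor.map f').unop)
    (h : D.interp.cell γ = opCell θ) :
    (baseIso a f g).hom ≫ postWhisker θ (baseLeg a) =
      legMap a r (@whiskerLeft _ _ (dotZero inv) _ _ (path1 (V := DotObj) DotEdge.d) _ _
        ((inclusion inv).map₂ (deltaComputad.free.cell (.gen γ)))) ≫ (baseIso a f' g').hom :=
  (edgePairIso_cell a (s := DeltaObj.one) (t := DeltaObj.two) (t' := DeltaObj.two)
    (f := f) (g := g) (f' := f') (g' := g') (deltaComputad.free.cell (.gen γ)) θ (congrArg _ h) _).symm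

theorem baseIso_cellFromId {f : DeltaEdge .one .two} {g : DeltaEdge .two .one}
    (γ : DeltaCell .nil (path2 f g))
    (θ : 𝟙 _ ⟶ (D.prefunctor.map g).unop ≫ (D.prefunctor.map f).unop)
    (h : D.interp.cell γ = opCellFromId θ) :
    postWhiskerFromId θ (baseLeg a) =
      legMap a DeltaObj.one (@whiskerLeft _ _ (dotZero inv) _ _ (path1 (V := DotObj) DotEdge.d) _ _
        ((inclusion inv).map₂ (deltaComputad.free.cell (.gen γ)))) ≫ (baseIso a f g).hom :=
  (edgePairIso_cellFromId a (s := DeltaObj.one) (t := DeltaObj.two)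
    (f := f) (g := g) (deltaComputad.free.cell (.gen γ)) θ (congrArg _ h) _).symm

theorem eqToHom_conj_self {C : Type*} [Category C] {x y : C} (f : x ⟶ y) (h : x = x) (h' : y = y) :
    eqToHom h ≫ f ≫ eqToHom h' = f := by
  simp

/-- Transfers a hexagon along a comparison of its six vertices. Only the comparison at the initial
vertex has to be invertible. It is used in both directions, from cocones to codescent data and back.
-/
theorem associativity_aux {C : Type*} [Category C] {l₁ l₂ l₃ l₄ l₅ l₆ k₁ k₂ k₃ k₄ k₅ k₆ : C}
    (π₁ : l₁ ≅ k₁) {π₂ : l₂ ⟶ k₂} {π₃ : l₃ ⟶ k₃} {π₄ : l₄ ⟶ k₄} {π₅ : l₅ ⟶ k₅} {π₆ : l₆ ⟶ k₆}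
    {m₁₂ : l₁ ⟶ l₂} {m₂₃ : l₂ ⟶ l₃} {m₃₄ : l₃ ⟶ l₄} {m₄₅ : l₄ ⟶ l₅} {m₁₆ : l₁ ⟶ l₆} {m₆₅ : l₆ ⟶ l₅}
    {n₁₂ : k₁ ⟶ k₂} {n₂₃ : k₂ ⟶ k₃} {n₃₄ : k₃ ⟶ k₄} {n₄₅ : k₄ ⟶ k₅} {n₁₆ : k₁ ⟶ k₆} {n₆₅ : k₆ ⟶ k₅}
    (h₁₂ : π₁.hom ≫ n₁₂ = m₁₂ ≫ π₂) (h₂₃ : π₂ ≫ n₂₃ = m₂₃ ≫ π₃) (h₃₄ : π₃ ≫ n₃₄ = m₃₄ ≫ π₄)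
    (h₄₅ : π₄ ≫ n₄₅ = m₄₅ ≫ π₅) (h₁₆ : π₁.hom ≫ n₁₆ = m₁₆ ≫ π₆) (h₆₅ : π₆ ≫ n₆₅ = m₆₅ ≫ π₅)
    (h : m₁₂ ≫ m₂₃ ≫ m₃₄ ≫ m₄₅ = m₁₆ ≫ m₆₅) : n₁₂ ≫ n₂₃ ≫ n₃₄ ≫ n₄₅ = n₁₆ ≫ n₆₅ := by
  rw [← cancel_epi π₁.hom, reassoc_of% h₁₂, reassoc_of% h₂₃, reassoc_of% h₃₄, h₄₅,
    reassoc_of% h₁₆, h₆₅, reassoc_of% h]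

theorem baseCell_associativity :
    D.e2 ◁ baseCell a ≫ postWhisker D.sigma20 (baseLeg a) ≫ D.e0 ◁ baseCell a ≫
      postWhisker D.sigma00 (baseLeg a) = postWhisker D.sigma21 (baseLeg a) ≫ D.e1 ◁ baseCell a := by
  obtain ⟨h₂, h₂', e₂⟩ := baseIso_theta a (r := DeltaObj.three) .e2
  obtain ⟨h₀, h₀', e₀⟩ := baseIso_theta a (r := DeltaObj.three) .e0
  obtain ⟨h₁, h₁', e₁⟩ := baseIso_theta a (r := DeltaObj.three) .e1
  refine associativity_aux (baseIso a (r := DeltaObj.three) .d1 .e2)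
    (e₂.trans (congrArg (fun z => legMap a DeltaObj.three z ≫ _) (eqToHom_conj_self _ h₂ h₂')))
    (baseIso_cell a (r := DeltaObj.three) DeltaCell.sigma20 D.sigma20 rfl)
    (e₀.trans (congrArg (fun z => legMap a DeltaObj.three z ≫ _) (eqToHom_conj_self _ h₀ h₀')))
    (baseIso_cell a (r := DeltaObj.three) DeltaCell.sigma00 D.sigma00 rfl)
    (baseIso_cell a (r := DeltaObj.three) DeltaCell.sigma21 D.sigma21 rfl)
    (e₁.trans (congrArg (fun z => legMap a DeltaObj.three z ≫ _) (eqToHom_conj_self _ h₁ h₁')))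
    (legMap_comp_eq' a DeltaObj.three ?_)
  -- What remains is the associativity relation imposed on `ϑ` in the presentation, applied inside a
  -- cocone.
  exact Quot.sound (Presentation.Rel.eqn (P := dotPresentation inv) DotEqn.associativity)

theorem baseCell_identity :
    postWhiskerFromId D.n1 (baseLeg a) ≫ D.s0 ◁ baseCell a =
      postWhiskerFromId D.n0 (baseLeg a) := by
  obtain ⟨h, h', e⟩ := baseIso_theta a (r := DeltaObj.one) .s0
  have e' := e.trans (congrArg (fun z => legMap a DeltaObj.one z ≫ _) (eqToHom_conj_self _ h h'))
  refine (congrArg (· ≫ _) (baseIso_cellFromId a DeltaCell.n1 D.n1 rfl)).trans (Eq.trans ?_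
    (baseIso_cellFromId a DeltaCell.n0 D.n0 rfl).symm)
  refine (Category.assoc _ _ _).trans ((congrArg (_ ≫ ·) e').trans ?_)
  refine (Category.assoc _ _ _).symm.trans (congrArg (· ≫ _) ?_)
  refine legMap_comp_eq a DeltaObj.one ?_
  exact Quot.sound (Presentation.Rel.eqn (P := dotPresentation inv) DotEqn.identity)

theorem baseCell_isIso (h : inv) : IsIso (baseCell a) := by
  have : IsIso (legMap a DeltaObj.two (dotThetaCell inv)) := by
    refine ⟨legMap a DeltaObj.two (dotThetaInvCell h), ?_, ?_⟩
    · exact (legMap_comp_eq a _ (dotThetaCell_inv h)).trans (legMap_id a _ _)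
    · exact (legMap_comp_eq a _ (dotThetaInvCell_theta h)).trans (legMap_id a _ _)
  have h₁ : IsIso (legMap a DeltaObj.two (dotThetaCell inv) ≫
    (edgeIso a (s := DeltaObj.one) (t := DeltaObj.two) DeltaEdge.d0
      (path1 (V := DotObj) DotEdge.d)).hom) := IsIso.comp_isIso' this (Iso.isIso_hom _)
  exact IsIso.comp_isIso' (Iso.isIso_inv _) h₁

variable {a} {b : DescentCocone D inv X}
  {φ : ∀ s (p : dotZero inv ⟶ (inclusion inv).obj s), legObj a s p ⟶ legObj b s p}

theorem LegCompat.edgeIso {s t : DeltaL} {e : DeltaEdge s t}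
    (h : LegCompat a b φ (deltaComputad.free.edge e))
    (p : dotZero inv ⟶ (inclusion inv).obj s) :
    φ t (p ≫ (inclusion inv).map (deltaComputad.free.edge e)) ≫ (edgeIso b e p).hom =
      (edgeIso a e p).hom ≫ (D.prefunctor.map e).unop ◁ φ s p := by
  have h' : (D.pseudofunctor.map (deltaComputad.free.edge e)).unop ◁ φ s p ≫
      (ρ_ (D.prefunctor.map e).unop).hom ▷ _ =
      (ρ_ (D.prefunctor.map e).unop).hom ▷ _ ≫ (D.prefunctor.map e).unop ◁ φ s p :=
    whisker_exchange _ _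
  refine (Category.assoc _ _ _).symm.trans ((congrArg (· ≫ _) (h p)).trans ?_)
  exact (Category.assoc _ _ _).trans ((congrArg (_ ≫ ·) h').trans (Category.assoc _ _ _).symm)

theorem conj_comm_iff {C : Type*} [Category C] {u₁ u₀ v₁ v₀ u₁' u₀' v₁' v₀' : C} (F₁ : u₁ ≅ v₁)
    (F₀ : u₀ ≅ v₀) (F₁' : u₁' ≅ v₁') (F₀' : u₀' ≅ v₀') (T : u₁ ⟶ u₀) (T' : u₁' ⟶ u₀')
    {φ₁ : u₁ ⟶ u₁'} {φ₀ : u₀ ⟶ u₀'} {ψ₁ : v₁ ⟶ v₁'} {ψ₀ : v₀ ⟶ v₀'}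
    (h₁ : φ₁ ≫ F₁'.hom = F₁.hom ≫ ψ₁) (h₀ : φ₀ ≫ F₀'.hom = F₀.hom ≫ ψ₀) :
    T ≫ φ₀ = φ₁ ≫ T' ↔
      ψ₁ ≫ F₁'.inv ≫ T' ≫ F₀'.hom = (F₁.inv ≫ T ≫ F₀.hom) ≫ ψ₀ := by
  obtain rfl : ψ₁ = F₁.inv ≫ φ₁ ≫ F₁'.hom := by rw [h₁, Iso.inv_hom_id_assoc]
  obtain rfl : ψ₀ = F₀.inv ≫ φ₀ ≫ F₀'.hom := by rw [h₀, Iso.inv_hom_id_assoc]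
  simp only [Category.assoc, Iso.hom_inv_id_assoc, ← cancel_epi F₁.hom, ← cancel_mono F₀'.hom]
  exact eq_comm

/-- Conjugated with the edge cells, naturality at `ϑ` is the defining equation of a morphism of
codescent data. Read in one direction it defines `descentEval` on morphisms, in the other it gives
fullness. -/
theorem legNat_theta_iff
    (h : ∀ e : DeltaEdge .one .two, LegCompat a b φ (deltaComputad.free.edge e)) :
    LegNat a b φ DeltaObj.two (dotThetaCell inv) ↔
      D.d1 ◁ φ DeltaObj.one (path1 (V := DotObj) DotEdge.d) ≫ baseCell b =
        baseCell a ≫ D.d0 ◁ φ DeltaObj.one (path1 (V := DotObj) DotEdge.d) :=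
  conj_comm_iff _ _ _ _ _ _ ((h .d1).edgeIso _) ((h .d0).edgeIso _)

theorem baseHom_comm (Γ : a ⟶ b) :
    D.d1 ◁ legHom Γ DeltaObj.one (path1 (V := DotObj) DotEdge.d) ≫ baseCell b =
      baseCell a ≫ D.d0 ◁ legHom Γ DeltaObj.one (path1 (V := DotObj) DotEdge.d) :=
  (legNat_theta_iff (φ := legHom Γ) fun e => legHom_legIso Γ (deltaComputad.free.edge e)).1
    (legHom_naturality Γ DeltaObj.two (dotThetaCell inv))

variable (D inv X) in
/-- The codescent datum of a cocone. -/
def descentEval : DescentCocone D inv X ⥤ CodescentDatum D inv X where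
  obj a := ⟨baseLeg a, baseCell a, baseCell_isIso a, baseCell_associativity a, baseCell_identity a⟩
  map Γ := ⟨legHom Γ DeltaObj.one (path1 (V := DotObj) DotEdge.d), baseHom_comm Γ⟩
  map_id _ := rfl
  map_comp _ _ := rfl

/-- The component of a modification at `p` determines the one at `p` followed by an edge, and every
leg is reached from the first one in this way. -/
theorem descentEval_map_injective {a b : DescentCocone D inv X} {Γ Θ : a ⟶ b}
    (h : (descentEval D inv X).map Γ = (descentEval D inv X).map Θ) : Γ = Θ := by
  refine legHom_ext fun s p => ?_
  refine dotPathRec inv (motive := fun s p => legHom Γ s p = legHom Θ s p) ?_ ?_ s p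
  · exact congrArg CodescentDatum.Hom.hom h
  · intro s t e p ih
    refine (cancel_mono (legIso b (deltaComputad.free.edge e) p).hom).1 ?_
    rw [legHom_legIso, legHom_legIso, ih]

/-- The components of the modification induced by a morphism of codescent data. -/
def extendHom {a b : DescentCocone D inv X} (δ : baseLeg a ⟶ baseLeg b) (s : DeltaL)
    (p : dotZero inv ⟶ (inclusion inv).obj s) : legObj a s p ⟶ legObj b s p :=
  dotPathRec inv (motive := fun s p => legObj a s p ⟶ legObj b s p) δ
    (fun e p φ => (legIso a (deltaComputad.free.edge e) p).hom ≫
      (D.pseudofunctor.map (deltaComputad.free.edge e)).unop ◁ φ ≫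
      (legIso b (deltaComputad.free.edge e) p).inv) s p

theorem extendHom_compat_edge {a b : DescentCocone D inv X} (δ : baseLeg a ⟶ baseLeg b)
    {s t : DeltaL} (e : DeltaEdge s t) :
    LegCompat a b (extendHom δ) (deltaComputad.free.edge e) := by
  intro p
  refine (congrArg (· ≫ _) (dotPathRec_step inv _ _ e p)).trans ?_
  simp only [Category.assoc, Iso.inv_hom_id, Category.comp_id]
  rfl

/-- The recursion `extendHom` is compatible with edges by construction. Closure under composition
extends this to all 1-cells, and `LegNat.of_theta` then yields naturality for all 2-cells from the
equation that involves `ϑ`. -/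
theorem exists_descentEval_map {a b : DescentCocone D inv X}
    (δ : (descentEval D inv X).obj a ⟶ (descentEval D inv X).obj b) :
    ∃ Γ : a ⟶ b, (descentEval D inv X).map Γ = δ := by
  have h : ∀ {s t : DeltaL} (f : s ⟶ t), LegCompat a b (extendHom δ.hom) f :=
    LegCompat.of_edges (extendHom_compat_edge δ.hom)
  have hϑ : LegNat a b (extendHom δ.hom) DeltaObj.two (dotThetaCell inv) :=
    (legNat_theta_iff fun e => h (deltaComputad.free.edge e)).2 δ.comm
  exact ⟨legHomMk (extendHom δ.hom) (fun _ _ _ η => LegNat.of_theta h hϑ η) h,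
    CodescentDatum.Hom.ext rfl⟩

instance : (descentEval D inv X).Faithful := ⟨descentEval_map_injective⟩

instance : (descentEval D inv X).Full := ⟨exists_descentEval_map⟩

end Evaluation
end BiadjointTriangle

namespace BiadjointTriangle

/-! ### Closure properties of pseudonaturality cells -/

section NaturalityCells

variable {S : Type u₁} [Bicategory.{w₁, v₁} S] {K : Type u} [Bicategory.{w, v} K] {F G : S ⥤ᵖ K}
  {app : ∀ s, F.obj s ⟶ G.obj s}
  (nat : ∀ {s t : S} (f : s ⟶ t), F.map f ≫ app t ≅ app s ≫ G.map f)

/-- Compatibility of naturality cells with a 2-cell. -/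
def NatCompat {s t : S} {f g : s ⟶ t} (η : f ⟶ g) : Prop :=
  F.map₂ η ▷ app t ≫ (nat g).hom = (nat f).hom ≫ app s ◁ G.map₂ η

/-- Compatibility of naturality cells with composition. -/
def NatComp {r s t : S} (f : r ⟶ s) (g : s ⟶ t) : Prop :=
  (nat (f ≫ g)).hom ≫ app r ◁ (G.mapComp f g).hom =
    (F.mapComp f g).hom ▷ app t ≫ (α_ _ _ _).hom ≫ F.map f ◁ (nat g).hom ≫
      (α_ _ _ _).inv ≫ (nat f).hom ▷ G.map g ≫ (α_ _ _ _).hom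

variable {nat}

theorem NatCompat.of_eq {s t : S} {f g : s ⟶ t} (h : f = g) : NatCompat nat (eqToHom h) := by
  subst h
  simp [NatCompat]

theorem NatCompat.comp {s t : S} {f g h : s ⟶ t} {η : f ⟶ g} {θ : g ⟶ h} (hη : NatCompat nat η)
    (hθ : NatCompat nat θ) : NatCompat nat (η ≫ θ) := by
  unfold NatCompat at *
  rw [F.map₂_comp, G.map₂_comp, comp_whiskerRight, whiskerLeft_comp, Category.assoc, hθ,
    reassoc_of% hη]

theorem NatComp.hom_eq {r s t : S} {f : r ⟶ s} {g : s ⟶ t} (h : NatComp nat f g) :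
    (nat (f ≫ g)).hom = (F.mapComp f g).hom ▷ app t ≫ (α_ _ _ _).hom ≫ F.map f ◁ (nat g).hom ≫
      (α_ _ _ _).inv ≫ (nat f).hom ▷ G.map g ≫ (α_ _ _ _).hom ≫
        app r ◁ (G.mapComp f g).inv := by
  unfold NatComp at h
  rw [← cancel_mono (app r ◁ (G.mapComp f g).hom), h]
  simp

theorem NatCompat.whiskerLeft {r s t : S} {f : r ⟶ s} {g g' : s ⟶ t} {η : g ⟶ g'}
    (h : NatCompat nat η) (hg : NatComp nat f g) (hg' : NatComp nat f g') :
    NatCompat nat (f ◁ η) := by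
  unfold NatCompat at *
  rw [hg.hom_eq, hg'.hom_eq, F.map₂_whisker_left, G.map₂_whisker_left]
  have e := congrArg (F.map f ◁ ·) h
  simp only [whiskerLeft_comp] at e
  simp only [comp_whiskerRight, whiskerLeft_comp, Category.assoc, inv_hom_whiskerRight_assoc,
    whiskerLeft_inv_hom_assoc, whisker_assoc, Iso.inv_hom_id_assoc, reassoc_of% e]
  congr 3
  simp only [← Category.assoc]
  congr 1
  simp only [Category.assoc]
  rw [← associator_naturality_right, ← whisker_exchange_assoc]
  simp

theorem NatCompat.whiskerRight {r s t : S} {f f' : r ⟶ s} {g : s ⟶ t} {η : f ⟶ f'}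
    (h : NatCompat nat η) (hf : NatComp nat f g) (hf' : NatComp nat f' g) :
    NatCompat nat (η ▷ g) := by
  unfold NatCompat at *
  rw [hf.hom_eq, hf'.hom_eq, F.map₂_whisker_right, G.map₂_whisker_right]
  have e := congrArg (· ▷ G.map g) h
  simp only [comp_whiskerRight] at e
  simp only [comp_whiskerRight, whiskerLeft_comp, Category.assoc, inv_hom_whiskerRight_assoc,
    whiskerLeft_inv_hom_assoc]
  congr 1
  have e₁ : F.map₂ η ▷ F.map g ▷ app t ≫ (α_ _ _ _).hom ≫ F.map f' ◁ (nat g).hom ≫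
      (α_ _ _ _).inv = (α_ _ _ _).hom ≫ F.map f ◁ (nat g).hom ≫ (α_ _ _ _).inv ≫
        F.map₂ η ▷ app s ▷ G.map g := by
    rw [associator_naturality_left_assoc, ← whisker_exchange_assoc]
    simp
  rw [reassoc_of% e₁, reassoc_of% e]
  simp

/-- The inductive step for compatibility with composition. The cell at `f ≫ g ≫ h` is the one at `(f
≫ g) ≫ h` conjugated with associators, and the latter decomposes by the other hypotheses. -/
theorem NatComp.assoc {q r s t : S} {f : q ⟶ r} {g : r ⟶ s} {h : s ⟶ t}
    (hα : NatCompat nat (α_ f g h).inv) (hfg : NatComp nat f g) (hfgh : NatComp nat (f ≫ g) h)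
    (hgh : NatComp nat g h) : NatComp nat f (g ≫ h) := by
  unfold NatCompat at hα
  have e : (nat (f ≫ g ≫ h)).hom = F.map₂ (α_ f g h).inv ▷ app t ≫ (nat ((f ≫ g) ≫ h)).hom ≫
      app q ◁ G.map₂ (α_ f g h).hom := by
    rw [reassoc_of% hα, ← whiskerLeft_comp, ← G.map₂_comp]
    simp
  have eF : F.map₂ (α_ f g h).inv ≫ (F.mapComp (f ≫ g) h).hom ≫ (F.mapComp f g).hom ▷ F.map h =
      (F.mapComp f (g ≫ h)).hom ≫ F.map f ◁ (F.mapComp g h).hom ≫ (α_ _ _ _).inv := by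
    rw [map₂_associator_inv']
    simp
  have eG : (G.mapComp f g).inv ▷ G.map h ≫ (G.mapComp (f ≫ g) h).inv ≫ G.map₂ (α_ f g h).hom ≫
      (G.mapComp f (g ≫ h)).hom = (α_ _ _ _).hom ≫ G.map f ◁ (G.mapComp g h).inv := by
    rw [G.map₂_associator]
    simp
  unfold NatComp
  rw [e, hfgh.hom_eq, hfg.hom_eq, hgh.hom_eq]
  calc _ = (F.map₂ (α_ f g h).inv ≫ (F.mapComp (f ≫ g) h).hom) ▷ app t ⊗≫
        (F.map (f ≫ g) ◁ (nat h).hom ≫ (F.mapComp f g).hom ▷ (app s ≫ G.map h)) ⊗≫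
        F.map f ◁ (nat g).hom ▷ G.map h ⊗≫ (nat f).hom ▷ (G.map g ≫ G.map h) ⊗≫
        app q ◁ ((G.mapComp f g).inv ▷ G.map h ≫ (G.mapComp (f ≫ g) h).inv ≫
          G.map₂ (α_ f g h).hom ≫ (G.mapComp f (g ≫ h)).hom) ⊗≫ 𝟙 _ := by
        simp [bicategoricalComp]
    _ = (F.map₂ (α_ f g h).inv ≫ (F.mapComp (f ≫ g) h).hom ≫
          (F.mapComp f g).hom ▷ F.map h) ▷ app t ⊗≫ F.map f ◁ F.map g ◁ (nat h).hom ⊗≫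
        F.map f ◁ (nat g).hom ▷ G.map h ⊗≫ (nat f).hom ▷ (G.map g ≫ G.map h) ⊗≫
        app q ◁ ((α_ _ _ _).hom ≫ G.map f ◁ (G.mapComp g h).inv) ⊗≫ 𝟙 _ := by
        rw [whisker_exchange, eG]
        simp [bicategoricalComp]
    _ = (F.mapComp f (g ≫ h)).hom ▷ app t ⊗≫ F.map f ◁ (F.mapComp g h).hom ▷ app t ⊗≫
        F.map f ◁ F.map g ◁ (nat h).hom ⊗≫ F.map f ◁ (nat g).hom ▷ G.map h ⊗≫
        ((nat f).hom ▷ (G.map g ≫ G.map h) ≫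
        (app q ≫ G.map f) ◁ (G.mapComp g h).inv) ⊗≫ 𝟙 _ := by
        rw [eF]
        simp [bicategoricalComp]
    _ = _ := by
        rw [← whisker_exchange]
        simp [bicategoricalComp]

theorem NatComp.id {s t : S} {f : s ⟶ t} (hρ : NatCompat nat (ρ_ f).inv)
    (h : (nat (𝟙 t)).hom = (F.mapId t).hom ▷ app t ≫ (λ_ _).hom ≫ (ρ_ _).inv ≫
      app t ◁ (G.mapId t).inv) : NatComp nat f (𝟙 t) := by
  unfold NatCompat at hρ
  have e : (nat (f ≫ 𝟙 t)).hom = F.map₂ (ρ_ f).hom ▷ app t ≫ (nat f).hom ≫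
      app s ◁ G.map₂ (ρ_ f).inv := by
    rw [← hρ, ← comp_whiskerRight_assoc, ← F.map₂_comp]
    simp
  unfold NatComp
  have eG : G.map₂ (ρ_ f).inv ≫ (G.mapComp f (𝟙 t)).hom = (ρ_ _).inv ≫ G.map f ◁ (G.mapId t).inv := by
    rw [G.mapComp_id_right_hom, ← Category.assoc, ← G.map₂_comp, Iso.inv_hom_id, G.map₂_id,
      Category.id_comp]
  have eF : F.map₂ (ρ_ f).hom = (F.mapComp f (𝟙 t)).hom ≫ F.map f ◁ (F.mapId t).hom ≫ (ρ_ _).hom := by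
    rw [F.mapComp_id_right_hom]
    simp only [Category.assoc, whiskerLeft_inv_hom_assoc, Iso.inv_hom_id, Category.comp_id]
  rw [e, h, Category.assoc, Category.assoc, ← whiskerLeft_comp, eG, eF]
  calc _ = (F.mapComp f (𝟙 t)).hom ▷ app t ⊗≫ F.map f ◁ (F.mapId t).hom ▷ app t ⊗≫
        ((nat f).hom ▷ 𝟙 _ ≫ (app s ≫ G.map f) ◁ (G.mapId t).inv) ⊗≫ 𝟙 _ := by
        simp [bicategoricalComp]
    _ = _ := by
        rw [← whisker_exchange]
        simp [bicategoricalComp]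

end NaturalityCells

/-! ### Pseudonatural transformations out of a presented 2-category -/

section StrongTransOfEdges

theorem unitor_conj_eq {K : Type u} [Bicategory.{w, v} K] {x x' y y' : K} {p : x ⟶ x'} {q : y ⟶ y'}
    {a : x ⟶ y} {b : x' ⟶ y'} {i : x ⟶ x} {k : y ⟶ y} (I : i ≅ 𝟙 x) (I' : k ≅ 𝟙 y)
    (n : p ≫ b ⟶ a ≫ q) :
    ((λ_ p).inv ≫ I.inv ▷ p) ▷ b ≫ (α_ _ _ _).hom ≫ i ◁ n ≫ (α_ _ _ _).inv ≫
      (I.hom ▷ a ≫ (λ_ _).hom ≫ (ρ_ _).inv ≫ a ◁ I'.inv) ▷ q ≫ (α_ _ _ _).hom ≫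
      a ◁ (I'.hom ▷ q ≫ (λ_ q).hom) = n := by
  calc _ = 𝟙 _ ⊗≫ (I.inv ▷ (p ≫ b) ≫ i ◁ n) ⊗≫ I.hom ▷ a ▷ q ⊗≫
        a ◁ (I'.inv ≫ I'.hom) ▷ q ⊗≫ 𝟙 _ := by simp [bicategoricalComp]
    _ = 𝟙 _ ⊗≫ 𝟙 x ◁ n ⊗≫ (I.inv ≫ I.hom) ▷ a ▷ q ⊗≫ 𝟙 _ := by
        rw [← whisker_exchange, Iso.inv_hom_id]
        simp [bicategoricalComp]
    _ = _ := by
        rw [Iso.inv_hom_id]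
        simp [bicategoricalComp]

variable {P : Presentation} {K : Type u} [Bicategory.{w, v} K] {F G : P.TwoCat ⥤ᵖ K}
  (app : ∀ s, F.obj s ⟶ G.obj s)
  (nat : ∀ {s t : P.TwoCat} (e : @Quiver.Hom P.V _ s t),
    F.map (P.edge e) ≫ app t ≅ app s ≫ G.map (P.edge e))

/-- The naturality cells at paths determined by naturality cells at edges. -/
def pathNat {s : P.V} : ∀ {t : P.V} (f : Quiver.Path s t),
    (F.map (X := s) (Y := t) f ≫ app t ≅ app s ≫ G.map (X := s) (Y := t) f)
  | _, .nil => whiskerRightIso (F.mapId s) _ ≪≫ λ_ _ ≪≫ (ρ_ _).symm ≪≫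
      whiskerLeftIso _ (G.mapId s).symm
  | _, .cons (b := r) (c := t) f e =>
      whiskerRightIso (F.mapComp (a := s) (b := r) (c := t) f (P.edge e)) _ ≪≫ α_ _ _ _ ≪≫
      whiskerLeftIso _ (nat e) ≪≫ (α_ _ _ _).symm ≪≫ whiskerRightIso (pathNat f) _ ≪≫
      α_ _ _ _ ≪≫ whiskerLeftIso _ (G.mapComp (a := s) (b := r) (c := t) f (P.edge e)).symm

/-- The naturality cells at 1-cells determined by naturality cells at generating 1-cells. -/
def homNat {s t : P.TwoCat} (f : s ⟶ t) : F.map f ≫ app t ≅ app s ≫ G.map f :=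
  pathNat app nat (s := s) (t := t) f

theorem homNat_id (s : P.TwoCat) : (homNat app nat (𝟙 s)).hom =
    (F.mapId s).hom ▷ app s ≫ (λ_ _).hom ≫ (ρ_ _).inv ≫ app s ◁ (G.mapId s).inv := rfl

theorem homNat_comp_edge {s r t : P.TwoCat} (f : s ⟶ r) (e : @Quiver.Hom P.V _ r t) :
    (homNat app nat (f ≫ P.edge e)).hom = (F.mapComp f (P.edge e)).hom ▷ app t ≫ (α_ _ _ _).hom ≫
      F.map f ◁ (nat e).hom ≫ (α_ _ _ _).inv ≫ (homNat app nat f).hom ▷ G.map (P.edge e) ≫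
      (α_ _ _ _).hom ≫ app s ◁ (G.mapComp f (P.edge e)).inv := rfl

/-- The recursion gives the cell at the identity followed by `e`, surrounded by the comparison cells
for that identity; `unitor_conj_eq` cancels these. -/
theorem homNat_edge {s t : P.TwoCat} (e : @Quiver.Hom P.V _ s t) :
    homNat app nat (P.edge e) = nat e := by
  -- The left unitor of a path of length one is definitionally an identity 2-cell, so its image
  -- under `F` disappears from the unit law.
  have hF : (F.mapComp (𝟙 s) (P.edge e)).hom = (λ_ _).inv ≫ (F.mapId s).inv ▷ _ := by
    rw [F.mapComp_id_left_hom]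
    exact (congrArg (· ≫ _) (F.map₂_id (P.edge e))).trans (Category.id_comp _)
  have hG : (G.mapComp (𝟙 s) (P.edge e)).inv = (G.mapId s).hom ▷ _ ≫ (λ_ _).hom := by
    rw [G.mapComp_id_left_inv]
    exact (Category.assoc _ _ _).symm.trans
      ((congrArg (_ ≫ ·) (G.map₂_id (P.edge e))).trans (Category.comp_id _))
  have h := homNat_comp_edge app nat (𝟙 s) e
  rw [hF, hG, homNat_id] at h
  exact Iso.ext (h.trans (unitor_conj_eq _ _ _))

theorem natComp_edge {s r t : P.TwoCat} (f : s ⟶ r) (e : @Quiver.Hom P.V _ r t) :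
    NatComp (homNat app nat) f (P.edge e) := by
  unfold NatComp
  dsimp only
  rw [homNat_comp_edge, homNat_edge app nat e]
  simp

/-- Induction on `g`. The recursion that defines the cells gives compatibility when the second
factor is an edge, and `NatComp.assoc` moves edges from the first factor to the second. -/
theorem natComp_homNat {r s t : P.TwoCat} (f : r ⟶ s) (g : s ⟶ t) :
    NatComp (homNat app nat) f g := by
  induction g using Presentation.hom_induction with
  | id => exact NatComp.id (NatCompat.of_eq (f := f) (g := f ≫ 𝟙 s) rfl) (homNat_id app nat s)
  | comp g e ih =>
    exact NatComp.assoc (NatCompat.of_eq (P.hom_comp_assoc f g (P.edge e)).symm) ih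
      (natComp_edge app nat _ e) (natComp_edge app nat g e)

theorem natCompat_homNat
    (h : ∀ {s t : P.V} {p q : Quiver.Path s t} (γ : P.Cell p q),
      NatCompat (homNat app nat) (P.cell (a := s) (b := t) (.gen γ)))
    {s t : P.TwoCat} {f g : s ⟶ t} (η : f ⟶ g) : NatCompat (homNat app nat) η := by
  have key : ∀ {s t : P.V} {p q : Quiver.Path s t} (η : P.Pasting p q),
      NatCompat (homNat app nat) (P.cell (a := s) (b := t) η) := by
    intro s t p q η
    induction η with
    | gen γ => exact h γ
    | refl p => exact NatCompat.of_eq rfl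
    | vcomp η θ ih ih' => exact ih.comp ih'
    | whiskerLeft p η ih =>
      exact ih.whiskerLeft (natComp_homNat app nat _ _) (natComp_homNat app nat _ _)
    | whiskerRight η r ih =>
      exact ih.whiskerRight (natComp_homNat app nat _ _) (natComp_homNat app nat _ _)
  obtain ⟨η, rfl⟩ := Quot.exists_rep η
  exact key η

/-- The pseudonatural transformation determined by its components at the generators. -/
def strongTransOfEdges
    (h : ∀ {s t : P.V} {p q : Quiver.Path s t} (γ : P.Cell p q),
      NatCompat (homNat app nat) (P.cell (a := s) (b := t) (.gen γ))) : F ⟶ G where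
  app := app
  naturality := homNat app nat
  naturality_naturality η := natCompat_homNat app nat h η
  naturality_id s := by
    rw [homNat_id]
    simp
  naturality_comp f g := natComp_homNat app nat f g

end StrongTransOfEdges
end BiadjointTriangle

namespace BiadjointTriangle

/-! ### Extending a codescent diagram along a codescent datum -/

section Extension

variable {A : Type u} [Bicategory.{w, v} A] {D : CodescentDiagram A} {inv : Prop} {X : A}

namespace CodescentDatum

variable (x : CodescentDatum D inv X)

/-- The graph morphism that extends a codescent diagram by a codescent datum. -/
def dotPrefunctor : DotObj ⥤q Aᵒᵖ where
  obj
    | .zero => .op X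
    | .one => .op D.one
    | .two => .op D.two
    | .three => .op D.three
  map
    | .d => x.hom.op
    | .d0 => D.d0.op
    | .d1 => D.d1.op
    | .s0 => D.s0.op
    | .e0 => D.e0.op
    | .e1 => D.e1.op
    | .e2 => D.e2.op

/-- The inverse of the 2-cell of a codescent datum. -/
noncomputable def cellInv (h : inv) : D.d0 ≫ x.hom ⟶ D.d1 ≫ x.hom :=
  haveI := x.isIso h
  CategoryTheory.inv x.cell

/-- The interpretation that extends a codescent diagram by a codescent datum. -/
noncomputable def dotInterp : (dotComputad inv).Interp Aᵒᵖ where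
  toPrefunctor := x.dotPrefunctor
  cell
    | .sigma00 => opCell D.sigma00
    | .sigma20 => opCell D.sigma20
    | .sigma21 => opCell D.sigma21
    | .n0 => opCellFromId D.n0
    | .n1 => opCellFromId D.n1
    | .theta => opCell x.cell
    | .thetaInv h => opCell (x.cellInv h)

/-- The leg associated with a path. -/
def dotLeg {y : DotObj} (p : Quiver.Path DotObj.zero y) : (x.dotPrefunctor.obj y).unop ⟶ X :=
  (evalPath x.dotPrefunctor p).unop

theorem eval_whiskerLeft_aux {y₁ y₂ y₂' y₃ : A} {f : y₁ ⟶ y₂} {g : y₂ ⟶ y₃} {f' : y₁ ⟶ y₂'}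
    {g' : y₂' ⟶ y₃} (θ : f ≫ g ⟶ f' ≫ g') (h : y₃ ⟶ X) :
    (f ◁ (g ◁ (λ_ h).inv ≫ (α_ _ _ _).inv) ≫ (α_ _ _ _).inv) ≫
      (f ◁ (ρ_ g).hom ≫ θ ≫ f' ◁ (ρ_ g').inv) ▷ h ≫
      ((α_ _ _ _).hom ≫ f' ◁ ((α_ _ _ _).hom ≫ g' ◁ (λ_ h).hom)) = postWhisker θ h := by
  calc _ = 𝟙 _ ⊗≫ θ ▷ h ⊗≫ 𝟙 _ := by
        simp only [comp_whiskerRight]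
        bicategory
    _ = _ := by
        simp only [postWhisker]
        bicategory

theorem eval_whiskerLeft_cell {y₂ y₂' y₁ y₃ : DotObj} {f : DotEdge y₃ y₂} {g : DotEdge y₂ y₁}
    {f' : DotEdge y₃ y₂'} {g' : DotEdge y₂' y₁} (γ : DotCell inv (path2 f g) (path2 f' g'))
    (θ : (x.dotPrefunctor.map g).unop ≫ (x.dotPrefunctor.map f).unop ⟶
      (x.dotPrefunctor.map g').unop ≫ (x.dotPrefunctor.map f').unop)
    (h : x.dotInterp.cell γ = opCell θ) (p : Quiver.Path DotObj.zero y₃) :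
    (x.dotInterp.eval (a := DotObj.zero) (b := y₁)
      (.whiskerLeft (c := dotComputad inv) p (dotGen γ))).unop2 =
      postWhisker θ (x.dotLeg p) := by
  refine Eq.trans ?_ (eval_whiskerLeft_aux θ (x.dotLeg p))
  have h' : (x.dotInterp.cell γ).unop2 = (opCell θ).unop2 := congrArg _ h
  rw [← unop2_opCell]
  change _ ≫ (x.dotInterp.cell γ).unop2 ▷ _ ≫ _ = _
  rw [h']
  rfl

theorem eval_whiskerLeft_cellFromId {y₂ y₁ : DotObj} {f : DotEdge y₁ y₂} {g : DotEdge y₂ y₁}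
    (γ : DotCell inv .nil (path2 f g))
    (θ : 𝟙 _ ⟶ (x.dotPrefunctor.map g).unop ≫ (x.dotPrefunctor.map f).unop)
    (h : x.dotInterp.cell γ = opCellFromId θ) (p : Quiver.Path DotObj.zero y₁) :
    (x.dotInterp.eval (a := DotObj.zero) (b := y₁)
      (.whiskerLeft (c := dotComputad inv) p (dotGen γ))).unop2 =
      postWhiskerFromId θ (x.dotLeg p) := by
  have h' : (x.dotInterp.cell γ).unop2 = (opCellFromId θ).unop2 := congrArg _ h
  have e : ∀ {y₁ y₂ : A} {f : y₁ ⟶ y₂} {g : y₂ ⟶ y₁} (θ : 𝟙 _ ⟶ f ≫ g) (h : y₁ ⟶ X),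
      (λ_ h).inv ≫ (θ ≫ f ◁ (ρ_ g).inv) ▷ h ≫
      ((α_ _ _ _).hom ≫ f ◁ ((α_ _ _ _).hom ≫ g ◁ (λ_ h).hom)) = postWhiskerFromId θ h := by
    intro y₁ y₂ f g θ h
    simp only [postWhiskerFromId, comp_whiskerRight, Category.assoc]
    congr 2
    bicategory
  refine Eq.trans ?_ (e θ (x.dotLeg p))
  rw [← unop2_opCellFromId]
  change _ ≫ (x.dotInterp.cell γ).unop2 ▷ _ ≫ _ = _
  rw [h']
  rfl

theorem eval_theta {y : DotObj} (g : DotEdge DotObj.two y) :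
    (x.dotInterp.eval (dotTheta inv g)).unop2 =
      (x.dotPrefunctor.map g).unop ◁ (D.d1 ◁ (ρ_ x.hom).hom ≫ x.cell ≫ D.d0 ◁ (ρ_ x.hom).inv) := by
  have e : ∀ {y₁ y₂ : A} {f : y₁ ⟶ y₂} {g g' : y₂ ⟶ X} (θ : g ⟶ g'),
      (f ◁ (λ_ g).inv ≫ (α_ f (𝟙 _) g).inv) ≫ (f ≫ 𝟙 y₂) ◁ θ ≫ (α_ _ _ _).hom ≫ f ◁ (λ_ g').hom =
        f ◁ θ := by
    intro y₁ y₂ f g g' θ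
    simp
  exact e _

theorem postWhisker_naturality {y₁ y₂ y₂' y₃ : A} {f : y₁ ⟶ y₂} {g : y₂ ⟶ y₃} {f' : y₁ ⟶ y₂'}
    {g' : y₂' ⟶ y₃} (θ : f ≫ g ⟶ f' ≫ g') {h h' : y₃ ⟶ X} (η : h ⟶ h') :
    f ◁ g ◁ η ≫ postWhisker θ h' = postWhisker θ h ≫ f' ◁ g' ◁ η := by
  simp only [postWhisker, Category.assoc]
  rw [← associator_naturality_right, ← whisker_exchange_assoc]
  simp

theorem postWhiskerFromId_naturality {y₁ y₂ : A} {f : y₁ ⟶ y₂} {g : y₂ ⟶ y₁} (θ : 𝟙 _ ⟶ f ≫ g)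
    {h h' : y₁ ⟶ X} (η : h ⟶ h') :
    η ≫ postWhiskerFromId θ h' = postWhiskerFromId θ h ≫ f ◁ g ◁ η := by
  simp only [postWhiskerFromId, Category.assoc]
  rw [← associator_naturality_right, ← whisker_exchange_assoc]
  simp

theorem rightUnitor_theta (z : A) (g : z ⟶ D.two) :
    g ◁ D.d1 ◁ (ρ_ x.hom).inv ≫
      g ◁ (D.d1 ◁ (ρ_ x.hom).hom ≫ x.cell ≫ D.d0 ◁ (ρ_ x.hom).inv) =
    g ◁ x.cell ≫ g ◁ D.d0 ◁ (ρ_ x.hom).inv := by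
  rw [← whiskerLeft_comp, ← whiskerLeft_comp, whiskerLeft_inv_hom_assoc]

/-- The relation on `Δ̇` evaluates to the associativity axiom of `x`, except that `d` has the value
`x.hom ≫ 𝟙 X`. The comparison of the two hexagons therefore consists of whiskered right unitors. -/
theorem dotInterp_associativity :
    x.dotInterp.eval ((dotTheta inv DotEdge.e2).vcomp ((dotAfterD DotCell.sigma20).vcomp
        ((dotTheta inv DotEdge.e0).vcomp (dotAfterD DotCell.sigma00)))) =
      x.dotInterp.eval ((dotAfterD DotCell.sigma21).vcomp (dotTheta inv DotEdge.e1)) := by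
  have h : ∀ {y₁ y₂ y₂' : A} {f : y₁ ⟶ y₂} {g : y₂ ⟶ D.one} {f' : y₁ ⟶ y₂'}
      {g' : y₂' ⟶ D.one} {θ : f ≫ g ⟶ f' ≫ g'} {s : f ≫ g ≫ x.hom ≫ 𝟙 X ⟶ f' ≫ g' ≫ x.hom ≫ 𝟙 X},
      s = postWhisker θ (x.hom ≫ 𝟙 X) → f ◁ g ◁ (ρ_ x.hom).inv ≫ s =
        postWhisker θ x.hom ≫ f' ◁ g' ◁ (ρ_ x.hom).inv := by
    rintro y₁ y₂ y₂' f g f' g' θ s rfl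
    exact postWhisker_naturality θ _
  have ht : ∀ {z : A} {g : z ⟶ D.two} {t : g ≫ D.d1 ≫ x.hom ≫ 𝟙 X ⟶ g ≫ D.d0 ≫ x.hom ≫ 𝟙 X},
      t = g ◁ (D.d1 ◁ (ρ_ x.hom).hom ≫ x.cell ≫ D.d0 ◁ (ρ_ x.hom).inv) →
      g ◁ D.d1 ◁ (ρ_ x.hom).inv ≫ t = g ◁ x.cell ≫ g ◁ D.d0 ◁ (ρ_ x.hom).inv := by
    rintro z g t rfl
    exact x.rightUnitor_theta z g
  refine congrArg Bicategory.Opposite.op2 ?_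
  exact associativity_aux
    (whiskerLeftIso D.e2 (whiskerLeftIso D.d1 (ρ_ x.hom).symm))
    (ht (x.eval_theta .e2))
    (h (x.eval_whiskerLeft_cell DotCell.sigma20 D.sigma20 rfl (path1 DotEdge.d)))
    (ht (x.eval_theta .e0))
    (h (x.eval_whiskerLeft_cell DotCell.sigma00 D.sigma00 rfl (path1 DotEdge.d)))
    (h (x.eval_whiskerLeft_cell DotCell.sigma21 D.sigma21 rfl (path1 DotEdge.d)))
    (ht (x.eval_theta .e1)) x.associativity

theorem dotInterp_identity :
    x.dotInterp.eval ((dotAfterD DotCell.n1).vcomp (dotTheta inv DotEdge.s0)) =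
      x.dotInterp.eval (dotAfterD DotCell.n0) := by
  refine congrArg Bicategory.Opposite.op2 ?_
  have e₁ := x.eval_whiskerLeft_cellFromId DotCell.n1 D.n1 rfl (path1 DotEdge.d)
  have e₀ := x.eval_whiskerLeft_cellFromId DotCell.n0 D.n0 rfl (path1 DotEdge.d)
  refine Eq.trans (congrArg₂ (· ≫ ·) e₁ (x.eval_theta .s0)) (Eq.trans ?_ e₀.symm)
  refine (cancel_epi (ρ_ x.hom).inv).1 ?_
  refine Eq.trans ?_ (postWhiskerFromId_naturality D.n0 (ρ_ x.hom).inv).symm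
  refine (Category.assoc _ _ _).symm.trans ?_
  refine (congrArg (· ≫ _) (postWhiskerFromId_naturality D.n1 (ρ_ x.hom).inv)).trans ?_
  refine (Category.assoc _ _ _).trans ((congrArg (_ ≫ ·) (x.rightUnitor_theta _ D.s0)).trans ?_)
  exact (Category.assoc _ _ _).symm.trans (congrArg (· ≫ _) x.identity)

theorem opCell_comp_eq_id {y₁ y₂ y₂' y₃ : A} {f : y₁ ⟶ y₂} {g : y₂ ⟶ y₃} {f' : y₁ ⟶ y₂'}
    {g' : y₂' ⟶ y₃} {θ : f ≫ g ⟶ f' ≫ g'} {θ' : f' ≫ g' ⟶ f ≫ g} (h : θ ≫ θ' = 𝟙 _) :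
    opCell θ ≫ opCell θ' = 𝟙 _ := by
  refine congrArg Bicategory.Opposite.op2 (?_ : (opCell θ).unop2 ≫ (opCell θ').unop2 = 𝟙 _)
  rw [unop2_opCell, unop2_opCell]
  simp only [Category.assoc, whiskerLeft_inv_hom_assoc, reassoc_of% h, whiskerLeft_hom_inv]
  rfl

theorem dotInterp_isModel : x.dotInterp.IsModel (P := dotPresentation inv) := by
  intro a b p q η θ h
  change DotEqn inv η θ at h
  cases h with
  | associativity => exact x.dotInterp_associativity
  | identity => exact x.dotInterp_identity
  | theta_thetaInv h =>
    have := x.isIso h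
    exact opCell_comp_eq_id (IsIso.hom_inv_id x.cell)
  | thetaInv_theta h =>
    have := x.isIso h
    exact opCell_comp_eq_id (IsIso.inv_hom_id x.cell)

/-- The pseudofunctor that extends a codescent diagram by a codescent datum. -/
noncomputable def dotFunctor : DotDelta inv ⥤ᵖ Aᵒᵖ :=
  x.dotInterp.lift (P := dotPresentation inv) x.dotInterp_isModel

end CodescentDatum

end Extension
end BiadjointTriangle

namespace BiadjointTriangle

/-! ### The cocone of a codescent datum; evaluation is essentially surjective -/

section Realization

attribute [local instance] CategoryTheory.uliftCategory

variable {A : Type u} [Bicategory.{w, v} A] {D : CodescentDiagram A} {inv : Prop} {X : A}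

namespace CodescentDatum

variable (x : CodescentDatum D inv X)

/-- The legs of the cocone given by a codescent datum. -/
noncomputable def legFunctor (y : DotDelta inv) :
    ULiftHom.{w} (ULift.{v} (dotZero inv ⟶ y)) ⥤ ((x.dotFunctor.obj y).unop ⟶ X) where
  obj p := (x.dotFunctor.map (uliftDown.{w, v} p)).unop
  map η := (x.dotFunctor.map₂ η.down).unop2
  map_id _ := rfl
  map_comp η θ := congrArg (fun z => z.unop2) (x.dotFunctor.map₂_comp η.down θ.down)

/-- The naturality of the legs at a generating 1-cell. -/
noncomputable def legFunctorIso {y z : DotDelta inv} (g : @Quiver.Hom DotObj _ y z) :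
    uliftMap.{w, v} (postcomp (dotZero inv) ((dotPresentation inv).edge g)) ⋙ x.legFunctor z ≅
      x.legFunctor y ⋙ precomp X ((x.dotPrefunctor.map g).unop ≫ 𝟙 _) :=
  NatIso.ofComponents
    (fun p => whiskerRightIso (ρ_ (x.dotPrefunctor.map g).unop).symm ((x.legFunctor y).obj p))
    (by
      intro p q η
      have h : (x.dotFunctor.map₂ (η.down ▷ (dotPresentation inv).edge g)).unop2 =
          (x.dotPrefunctor.map g).unop ◁ (x.dotFunctor.map₂ η.down).unop2 := by
        have e : ∀ {y₁ y₂ : A} {f : y₁ ⟶ y₂} {g g' : y₂ ⟶ X} (θ : g ⟶ g'),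
            (f ◁ (λ_ g).inv ≫ (α_ f (𝟙 _) g).inv) ≫ (f ≫ 𝟙 y₂) ◁ θ ≫ (α_ _ _ _).hom ≫
              f ◁ (λ_ g').hom = f ◁ θ := by
          intro y₁ y₂ f g g' θ
          simp
        exact (congrArg (fun z => z.unop2) (x.dotFunctor.map₂_whisker_right η.down
          ((dotPresentation inv).edge g))).trans (e _)
      refine (congrArg (· ≫ _) h).trans ?_
      exact whisker_exchange (ρ_ (x.dotPrefunctor.map g).unop).inv ((x.legFunctor y).map η))

/-- The components of the cocone given by a codescent datum. -/
noncomputable def realizeApp : ∀ s : DeltaL,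
    (coneWeight.{w, v} (inclusion inv) (dotZero inv)).obj s ⟶ (homTo D.pseudofunctor X).obj s
  | DeltaObj.one => (x.legFunctor ((inclusion inv).obj DeltaObj.one)).toCatHom
  | DeltaObj.two => (x.legFunctor ((inclusion inv).obj DeltaObj.two)).toCatHom
  | DeltaObj.three => (x.legFunctor ((inclusion inv).obj DeltaObj.three)).toCatHom

/-- The naturality of the components of the cocone given by a codescent datum. -/
noncomputable def realizeNat : ∀ {s t : DeltaL} (e : @Quiver.Hom deltaComputad.free.V _ s t),
    (coneWeight.{w, v} (inclusion inv) (dotZero inv)).map (deltaComputad.free.edge e) ≫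
        x.realizeApp t ≅
      x.realizeApp s ≫ (homTo D.pseudofunctor X).map (deltaComputad.free.edge e)
  | _, _, DeltaEdge.d0 => Cat.Hom.isoMk (x.legFunctorIso DotEdge.d0)
  | _, _, DeltaEdge.d1 => Cat.Hom.isoMk (x.legFunctorIso DotEdge.d1)
  | _, _, DeltaEdge.s0 => Cat.Hom.isoMk (x.legFunctorIso DotEdge.s0)
  | _, _, DeltaEdge.e0 => Cat.Hom.isoMk (x.legFunctorIso DotEdge.e0)
  | _, _, DeltaEdge.e1 => Cat.Hom.isoMk (x.legFunctorIso DotEdge.e1)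
  | _, _, DeltaEdge.e2 => Cat.Hom.isoMk (x.legFunctorIso DotEdge.e2)

/-- The 1-cells of the cocone given by a codescent datum. -/
noncomputable def realizeObj (s : DeltaL) (p : dotZero inv ⟶ (inclusion inv).obj s) :
    (D.pseudofunctor.obj s).unop ⟶ X :=
  (x.realizeApp s).toFunctor.obj (uliftUp.{w, v} p)

/-- The 2-cells of the cocone given by a codescent datum. -/
noncomputable def realizeMap (s : DeltaL) {p q : dotZero inv ⟶ (inclusion inv).obj s} (η : p ⟶ q) :
    x.realizeObj s p ⟶ x.realizeObj s q :=
  (x.realizeApp s).toFunctor.map (X := uliftUp.{w, v} p) (Y := uliftUp.{w, v} q) (ULift.up η)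

/-- The pseudonaturality cells of the cocone given by a codescent datum. -/
noncomputable def realizeIso {s t : DeltaL} (f : s ⟶ t)
    (p : dotZero inv ⟶ (inclusion inv).obj s) :
    x.realizeObj t (p ≫ (inclusion inv).map f) ⟶
      (D.pseudofunctor.map f).unop ≫ x.realizeObj s p :=
  (homNat x.realizeApp x.realizeNat f).hom.toNatTrans.app (uliftUp.{w, v} p)

theorem realizeMap_id (s : DeltaL) (p : dotZero inv ⟶ (inclusion inv).obj s) :
    x.realizeMap s (𝟙 p) = 𝟙 _ :=
  (x.realizeApp s).toFunctor.map_id _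

/-- The analogue of `legIso_comp` at a stage where naturality for 2-cells is still missing; it uses
only the compatibility with composition provided by `natComp_homNat`. -/
theorem realizeIso_comp {r s t : DeltaL} (f : r ⟶ s) (g : s ⟶ t)
    (p : dotZero inv ⟶ (inclusion inv).obj r) :
    x.realizeIso (f ≫ g) p ≫ (D.pseudofunctor.mapComp f g).hom.unop2 ▷ x.realizeObj r p ≫
        (α_ _ _ _).hom =
      x.realizeMap t (p ◁ ((inclusion inv).mapComp f g).hom ≫ (α_ _ _ _).inv) ≫
        x.realizeIso g (p ≫ (inclusion inv).map f) ≫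
          (D.pseudofunctor.map g).unop ◁ x.realizeIso f p := by
  have h := congrArg (fun m => m.toNatTrans.app (uliftUp.{w, v} p))
    (natComp_homNat x.realizeApp x.realizeNat f g)
  refine h.trans ?_
  refine congrArg (_ ≫ ·) ?_
  refine (Category.id_comp _).trans ?_
  refine congrArg (_ ≫ ·) ?_
  refine (Category.id_comp _).trans ?_
  exact Category.comp_id _

theorem realizeIso_id (s : DeltaL) (p : dotZero inv ⟶ (inclusion inv).obj s) :
    x.realizeIso (𝟙 s) p = (λ_ (x.realizeObj s p)).inv := by
  have h := congrArg (fun m => m.toNatTrans.app (uliftUp.{w, v} p))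
    (homNat_id x.realizeApp x.realizeNat s)
  refine h.trans ?_
  have e₂ : p ◁ ((inclusion inv).mapId s).hom ≫ (ρ_ p).hom = 𝟙 p :=
    (Category.comp_id _).trans (whiskerLeft_id p _)
  have e₁ := (congrArg (x.realizeMap s) e₂).trans (x.realizeMap_id s p)
  refine (congrArg (· ≫ _) e₁).trans ((Category.id_comp _).trans ?_)
  refine (Category.id_comp _).trans ((Category.id_comp _).trans ?_)
  exact (congrArg (_ ≫ ·) (id_whiskerRight _ _)).trans (Category.comp_id _)

theorem realizeObj_edge {s t : DeltaL} (e : DeltaEdge s t)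
    (p : dotZero inv ⟶ (inclusion inv).obj s) :
    x.realizeObj t (p ≫ (inclusion inv).map (deltaComputad.free.edge e)) =
      (D.prefunctor.map e).unop ≫ x.realizeObj s p := by
  cases e <;> rfl

/-- At a generating 1-cell the naturality of the realized cocone is an inverse right unitor, so
`edgeIso` of this cocone is an identity. -/
theorem realizeIso_edge {s t : DeltaL} (e : DeltaEdge s t)
    (p : dotZero inv ⟶ (inclusion inv).obj s) :
    x.realizeIso (deltaComputad.free.edge e) p ≫
      (ρ_ (D.prefunctor.map e).unop).hom ▷ x.realizeObj s p = eqToHom (x.realizeObj_edge e p) := by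
  have h := congrArg (fun m => m.hom.toNatTrans.app (uliftUp.{w, v} p))
    (homNat_edge x.realizeApp x.realizeNat e)
  refine (congrArg (· ≫ _) h).trans ?_
  cases e <;> exact inv_hom_whiskerRight _ _

theorem realizeIso_pair {s t r : DeltaL} (f : DeltaEdge s t) (g : DeltaEdge t r)
    (p : dotZero inv ⟶ (inclusion inv).obj s) : ∃ h,
    x.realizeIso (deltaComputad.free.edge f ≫ deltaComputad.free.edge g) p ≫
      ((D.prefunctor.map g).unop ◁ (ρ_ (D.prefunctor.map f).unop).hom) ▷ x.realizeObj s p ≫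
        (α_ _ _ _).hom = x.realizeMap r (eqToHom h) ≫
          eqToHom (x.realizeObj_edge g (p ≫ (inclusion inv).map (deltaComputad.free.edge f))) ≫
            (D.prefunctor.map g).unop ◁ eqToHom (x.realizeObj_edge f p) := by
  obtain ⟨h, e⟩ := inclusion_mapComp_eq_eqToHom (inv := inv)
    (deltaComputad.free.edge f) (deltaComputad.free.edge g) p
  have e' := x.realizeIso_comp (deltaComputad.free.edge f) (deltaComputad.free.edge g) p
  rw [e] at e'
  refine ⟨h, ?_⟩
  refine (edgePairIso_aux _ _ _ _ e').trans (congrArg (_ ≫ ·) ?_)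
  exact congrArg₂ (fun i k => i ≫ (D.prefunctor.map g).unop ◁ k)
    (x.realizeIso_edge g (p ≫ (inclusion inv).map (deltaComputad.free.edge f)))
    (x.realizeIso_edge f p)

/-- The hypotheses make `c` and `c'` inverse to the standard unitor and associator, so the claim is
`postWhisker_rightUnitor` with both comparisons inverted. -/
theorem natCompat_aux {y₁ y₂ y₂' y₃ : A} {f : y₁ ⟶ y₂} {g : y₂ ⟶ y₃} {f' : y₁ ⟶ y₂'}
    {g' : y₂' ⟶ y₃} (θ : f ≫ g ⟶ f' ≫ g') {h : y₃ ⟶ X}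
    {c : f ≫ g ≫ h ⟶ (f ≫ g ≫ 𝟙 _) ≫ h} {c' : f' ≫ g' ≫ h ⟶ (f' ≫ g' ≫ 𝟙 _) ≫ h}
    (e : c ≫ (f ◁ (ρ_ g).hom) ▷ h ≫ (α_ _ _ _).hom = 𝟙 _)
    (e' : c' ≫ (f' ◁ (ρ_ g').hom) ▷ h ≫ (α_ _ _ _).hom = 𝟙 _) :
    postWhisker θ h ≫ c' = c ≫ (opCell θ).unop2 ▷ h := by
  rw [← cancel_mono ((f' ◁ (ρ_ g').hom) ▷ h ≫ (α_ _ _ _).hom), Category.assoc, e', unop2_opCell,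
    Category.assoc, postWhisker_rightUnitor, ← Category.assoc c, e, Category.comp_id,
    Category.id_comp]

theorem natCompat_fromId_aux {y₁ y₂ : A} {f : y₁ ⟶ y₂} {g : y₂ ⟶ y₁} (θ : 𝟙 _ ⟶ f ≫ g)
    {h : y₁ ⟶ X} {c : f ≫ g ≫ h ⟶ (f ≫ g ≫ 𝟙 _) ≫ h} {c₀ : h ⟶ 𝟙 _ ≫ h}
    (e : c ≫ (f ◁ (ρ_ g).hom) ▷ h ≫ (α_ _ _ _).hom = 𝟙 _) (e₀ : c₀ = (λ_ h).inv) :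
    postWhiskerFromId θ h ≫ c = c₀ ≫ (opCellFromId θ).unop2 ▷ h := by
  rw [← cancel_mono ((f ◁ (ρ_ g).hom) ▷ h ≫ (α_ _ _ _).hom), Category.assoc, e, e₀,
    unop2_opCellFromId, Category.assoc, postWhiskerFromId_rightUnitor, Iso.inv_hom_id_assoc,
    Category.comp_id]

theorem realizeIso_natCompat {s t : DeltaL} {f g : s ⟶ t} (η : f ⟶ g)
    (h : ∀ p : dotZero inv ⟶ (inclusion inv).obj s,
      x.realizeMap t (p ◁ (inclusion inv).map₂ η) ≫ x.realizeIso g p =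
        x.realizeIso f p ≫ (D.pseudofunctor.map₂ η).unop2 ▷ x.realizeObj s p) :
    NatCompat (homNat x.realizeApp x.realizeNat) η :=
  Cat.Hom₂.ext (NatTrans.ext (funext fun p => h (uliftDown.{w, v} p)))

theorem comp_whiskerLeft_eq_id {y₁ y₂ : A} {f : y₁ ⟶ y₂} {g : y₂ ⟶ X} {m k : f ≫ g ⟶ f ≫ g}
    {l : g ⟶ g} (hm : m = 𝟙 _) (hk : k = 𝟙 _) (hl : l = 𝟙 _) : m ≫ k ≫ f ◁ l = 𝟙 _ := by
  rw [hm, hk, hl, whiskerLeft_id, Category.comp_id, Category.comp_id]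

-- For each generator the extended pseudofunctor acts on a leg by whiskering the corresponding
-- 2-cell of the diagram, and the naturality cells at its source and target are coherence cells of
-- `A`. The five cases differ only in the edges involved.
set_option maxHeartbeats 1600000 in
theorem natCompat_realize {s t : DeltaObj} {p q : Quiver.Path s t} (γ : DeltaCell p q) :
    NatCompat (homNat x.realizeApp x.realizeNat)
      (deltaComputad.free.cell (a := s) (b := t) (.gen γ)) := by
  refine x.realizeIso_natCompat _ fun r => ?_
  cases γ with
  | sigma00 =>
    obtain ⟨h, e⟩ := x.realizeIso_pair (s := DeltaObj.one) (t := DeltaObj.two)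
      (r := DeltaObj.three) .d0 .e0 r
    obtain ⟨h', e'⟩ := x.realizeIso_pair (s := DeltaObj.one) (t := DeltaObj.two)
      (r := DeltaObj.three) .d0 .e1 r
    refine (congrArg (· ≫ _) (x.eval_whiskerLeft_cell DotCell.sigma00 D.sigma00 rfl r)).trans ?_
    exact natCompat_aux D.sigma00
      (e.trans (comp_whiskerLeft_eq_id (x.realizeMap_id _ _) rfl rfl))
      (e'.trans (comp_whiskerLeft_eq_id (x.realizeMap_id _ _) rfl rfl))
  | sigma20 =>
    obtain ⟨h, e⟩ := x.realizeIso_pair (s := DeltaObj.one) (t := DeltaObj.two)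
      (r := DeltaObj.three) .d0 .e2 r
    obtain ⟨h', e'⟩ := x.realizeIso_pair (s := DeltaObj.one) (t := DeltaObj.two)
      (r := DeltaObj.three) .d1 .e0 r
    refine (congrArg (· ≫ _) (x.eval_whiskerLeft_cell DotCell.sigma20 D.sigma20 rfl r)).trans ?_
    exact natCompat_aux D.sigma20
      (e.trans (comp_whiskerLeft_eq_id (x.realizeMap_id _ _) rfl rfl))
      (e'.trans (comp_whiskerLeft_eq_id (x.realizeMap_id _ _) rfl rfl))
  | sigma21 =>
    obtain ⟨h, e⟩ := x.realizeIso_pair (s := DeltaObj.one) (t := DeltaObj.two)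
      (r := DeltaObj.three) .d1 .e2 r
    obtain ⟨h', e'⟩ := x.realizeIso_pair (s := DeltaObj.one) (t := DeltaObj.two)
      (r := DeltaObj.three) .d1 .e1 r
    refine (congrArg (· ≫ _) (x.eval_whiskerLeft_cell DotCell.sigma21 D.sigma21 rfl r)).trans ?_
    exact natCompat_aux D.sigma21
      (e.trans (comp_whiskerLeft_eq_id (x.realizeMap_id _ _) rfl rfl))
      (e'.trans (comp_whiskerLeft_eq_id (x.realizeMap_id _ _) rfl rfl))
  | n0 =>
    obtain ⟨h, e⟩ := x.realizeIso_pair (s := DeltaObj.one) (t := DeltaObj.two)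
      (r := DeltaObj.one) .d0 .s0 r
    refine (congrArg (· ≫ _) (x.eval_whiskerLeft_cellFromId DotCell.n0 D.n0 rfl r)).trans ?_
    exact natCompat_fromId_aux D.n0
      (e.trans (comp_whiskerLeft_eq_id (x.realizeMap_id _ _) rfl rfl))
      (x.realizeIso_id DeltaObj.one r)
  | n1 =>
    obtain ⟨h, e⟩ := x.realizeIso_pair (s := DeltaObj.one) (t := DeltaObj.two)
      (r := DeltaObj.one) .d1 .s0 r
    refine (congrArg (· ≫ _) (x.eval_whiskerLeft_cellFromId DotCell.n1 D.n1 rfl r)).trans ?_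
    exact natCompat_fromId_aux D.n1
      (e.trans (comp_whiskerLeft_eq_id (x.realizeMap_id _ _) rfl rfl))
      (x.realizeIso_id DeltaObj.one r)

/-- The cocone given by a codescent datum. -/
noncomputable def realize : DescentCocone D inv X :=
  strongTransOfEdges x.realizeApp x.realizeNat fun γ => x.natCompat_realize γ

theorem edgeIso_realize_hom {s t : DeltaL} (e : DeltaEdge s t)
    (p : dotZero inv ⟶ (inclusion inv).obj s) :
    (edgeIso x.realize e p).hom = eqToHom (x.realizeObj_edge e p) :=
  x.realizeIso_edge e p

/-- The first leg of the realization is `x.hom ≫ 𝟙 X`, so the datum is recovered up to a right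
unitor, which is the isomorphism that gives essential surjectivity. -/
theorem baseCell_realize : baseCell x.realize =
    D.d1 ◁ (ρ_ x.hom).hom ≫ x.cell ≫ D.d0 ◁ (ρ_ x.hom).inv := by
  have h₁ := x.edgeIso_realize_hom (s := DeltaObj.one) (t := DeltaObj.two) .d1
    (path1 (V := DotObj) DotEdge.d)
  have h₀ := x.edgeIso_realize_hom (s := DeltaObj.one) (t := DeltaObj.two) .d0
    (path1 (V := DotObj) DotEdge.d)
  refine (Iso.inv_comp_eq _).2 ?_
  refine Eq.trans ?_ (congrArg (· ≫ _) h₁).symm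
  refine (congrArg (_ ≫ ·) h₀).trans ?_
  exact (Category.comp_id _).trans (Category.id_comp _).symm

theorem rightUnitor_cell_comm : D.d1 ◁ (ρ_ x.hom).hom ≫ x.cell =
    (D.d1 ◁ (ρ_ x.hom).hom ≫ x.cell ≫ D.d0 ◁ (ρ_ x.hom).inv) ≫ D.d0 ◁ (ρ_ x.hom).hom := by
  simp only [Category.assoc, whiskerLeft_inv_hom, Category.comp_id]

theorem rightUnitor_inv_cell_comm : D.d1 ◁ (ρ_ x.hom).inv ≫
    D.d1 ◁ (ρ_ x.hom).hom ≫ x.cell ≫ D.d0 ◁ (ρ_ x.hom).inv = x.cell ≫ D.d0 ◁ (ρ_ x.hom).inv := by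
  rw [whiskerLeft_inv_hom_assoc]

/-- The codescent datum of the cocone given by a codescent datum. -/
noncomputable def evalRealizeIso : (descentEval D inv X).obj x.realize ≅ x where
  hom := ⟨(ρ_ x.hom).hom, x.rightUnitor_cell_comm.trans (congrArg (· ≫ _) x.baseCell_realize).symm⟩
  inv := ⟨(ρ_ x.hom).inv, (congrArg (_ ≫ ·) x.baseCell_realize).trans x.rightUnitor_inv_cell_comm⟩
  hom_inv_id := CodescentDatum.Hom.ext (Iso.hom_inv_id _)
  inv_hom_id := CodescentDatum.Hom.ext (Iso.inv_hom_id _)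

end CodescentDatum

instance : (descentEval D inv X).EssSurj := ⟨fun x => ⟨x.realize, ⟨x.evalRealizeIso⟩⟩⟩

instance : (descentEval D inv X).IsEquivalence where

end Realization
end BiadjointTriangle

namespace BiadjointTriangle

/-! ### Identification of the diagram `𝒜_y` with the one built from transposes -/

section Diagram

variable {A : Type u₁} [Bicategory.{w₁, v₁} A] {B : Type u₂} [Bicategory.{w₂, v₂} B]
  {M : Pseudomonad B} {E : B ⥤ᵖ A} {J : A ⥤ᵖ LaxAlg M} (adj : Biadjunction E (J.comp (forget M)))

theorem comp_assoc_left {K : Type*} [Category K] {x₁ x₂ x₃ x₄ x₅ x₆ : K} (a : x₁ ⟶ x₂) (b : x₂ ⟶ x₃)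
    (c : x₃ ⟶ x₄) (d : x₄ ⟶ x₅) (e : x₅ ⟶ x₆) :
    a ≫ b ≫ c ≫ d ≫ e = ((a ≫ b) ≫ c) ≫ d ≫ e := by
  simp only [Category.assoc]

/-- The two cells consist of the same factors and differ only in bracketing. -/
theorem sigma21Cell_eq_cMul (Z : B) : sigma21Cell adj Z = (algebraLift J).cMul adj Z :=
  comp_assoc_left _ _ _ _ _

theorem diagramInterp_eq (y : LaxAlgebra M) :
    diagramInterp adj y = ((algebraLift J).codescentDiagram adj y).interp := by
  -- Once `σ₂₁` has been replaced in its field, the other generators agree definitionally and `rfl`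
  -- closes the goal.
  refine Eq.trans ?_ (congrArg (fun σ => CodescentDiagram.interp
    { (algebraLift J).codescentDiagram adj y with sigma21 := σ }) (sigma21Cell_eq_cMul adj y.carrier))
  rfl

theorem diagram_eq (y : LaxAlgebra M) :
    diagram adj y = ((algebraLift J).codescentDiagram adj y).pseudofunctor :=
  congrArg (fun I => Computad.Interp.lift (P := deltaComputad.free) I (fun h => h.elim))
    (diagramInterp_eq adj y)

end Diagram

/-! ### Cocones composed with a 1-cell -/

section Cocones

variable {A : Type u} [Bicategory.{w, v} A] {D : CodescentDiagram A} {inv : Prop} {X X' : A}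

theorem edgeIso_cocone (ω : DescentCocone D inv X) (g : X ⟶ X') {s t : DeltaL} (e : DeltaEdge s t)
    (p : dotZero inv ⟶ (inclusion inv).obj s) :
    (edgeIso (ω ≫ homToMap D.pseudofunctor g) e p).hom =
      (edgeIso ω e p).hom ▷ g ≫ (α_ _ _ _).hom := by
  have h := legIso_cocone (a := ω) g (deltaComputad.free.edge e) p
  have aux : ∀ {Y₁ Y₂ : A} {f f' : Y₁ ⟶ Y₂} {h : Y₂ ⟶ X} {k : Y₁ ⟶ X} (i : k ⟶ f ≫ h) (r : f ⟶ f'),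
      (i ▷ g ≫ (α_ f h g).hom) ≫ r ▷ (h ≫ g) = (i ≫ r ▷ h) ▷ g ≫ (α_ _ _ _).hom := by
    intro Y₁ Y₂ f f' h k i r
    simp
  exact (congrArg (· ≫ _) h).trans (aux _ _)

theorem conj_whiskerRight_aux {Y₁ Y₂ Y₂' : A} {f : Y₁ ⟶ Y₂} {f' : Y₁ ⟶ Y₂'} {h : Y₂ ⟶ X}
    {h' : Y₂' ⟶ X}
    {k k' : Y₁ ⟶ X} (i : k ≅ f ≫ h) (i' : k' ⟶ f' ≫ h') (m : k ⟶ k') (g : X ⟶ X')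
    (l : k ≫ g ≅ f ≫ h ≫ g) (l' : k' ≫ g ⟶ f' ≫ h' ≫ g)
    (e : l.hom = i.hom ▷ g ≫ (α_ _ _ _).hom) (e' : l' = i' ▷ g ≫ (α_ _ _ _).hom) :
    l.inv ≫ m ▷ g ≫ l' = postWhisker (i.inv ≫ m ≫ i') g := by
  rw [Iso.inv_comp_eq, e, e']
  simp [postWhisker]

/-- The edge cells of the composite cocone are those of `ω` followed by `g`, up to associators.
Conjugation by them therefore commutes with whiskering by `g`. -/
theorem baseCell_cocone (ω : DescentCocone D inv X) (g : X ⟶ X') :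
    baseCell (ω ≫ homToMap D.pseudofunctor g) = postWhisker (baseCell ω) g := by
  refine conj_whiskerRight_aux _ _ _ _ _ _ ?_ ?_
  · exact edgeIso_cocone ω g _ _
  · exact edgeIso_cocone ω g _ _

end Cocones

/-! ### Universal cocones correspond to biuniversal arrows -/

section Universality

variable {A : Type u₁} [Bicategory.{w₁, v₁} A] {B : Type u₂} [Bicategory.{w₂, v₂} B]
  {M : Pseudomonad B} {E : B ⥤ᵖ A} {J : A ⥤ᵖ LaxAlg M} (adj : Biadjunction E (J.comp (forget M)))
  {y : LaxAlgebra M} {inv : Prop} {C : A}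

theorem whiskerLeft_mapComp_naturality (F : A ⥤ᵖ B) {Z : B} {Y C X : A} (u : Z ⟶ F.obj Y) (h : Y ⟶ C)
    {g g' : C ⟶ X} (θ : g ⟶ g') :
    u ◁ F.map₂ (h ◁ θ) ≫ (α_ _ _ _ ≪≫ whiskerLeftIso u (F.mapComp h g').symm).inv =
      (α_ _ _ _ ≪≫ whiskerLeftIso u (F.mapComp h g).symm).inv ≫ (u ≫ F.map h) ◁ F.map₂ θ := by
  rw [F.map₂_whisker_left]
  simp

/-- The lax morphism of a cocone. -/
noncomputable def laxMorphismOfCocone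
    (ω : DescentCocone ((algebraLift J).codescentDiagram adj y) inv C) :
    LaxMorphism y (jObj J C) :=
  laxMorphismOfDatum adj ((descentEval _ inv C).obj ω)

/-- The lax morphism of a cocone that is followed by a 1-cell. -/
noncomputable def laxMorphismOfCoconeIso
    (ω : DescentCocone ((algebraLift J).codescentDiagram adj y) inv C) {X : A} (g : C ⟶ X) :
    laxMorphismOfCocone adj (ω ≫ homToMap _ g) ≅
      (laxMorphismOfCocone adj ω).comp (jMap J g).toLaxMorphism :=
  Iso.symm (LaxCell.isoMk (α_ _ _ _ ≪≫ whiskerLeftIso (adj.unit y.carrier)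
    ((J.comp (forget M)).mapComp (baseLeg ω) g).symm) (by
      have h := (algebraLift J).transposeCell_postcomp adj (baseLeg ω) (baseCell ω) g
      have h' := (congrArg ((algebraLift J).transposeCell adj (baseLeg ω ≫ g))
        (baseCell_cocone ω g))
      exact (congrArg (_ ≫ ·) h').trans h))

theorem laxMorphismOfCoconeIso_naturality
    (ω : DescentCocone ((algebraLift J).codescentDiagram adj y) inv C) {X : A} {g g' : C ⟶ X}
    (θ : g ⟶ g') :
    laxCellOfHom adj ((descentEval _ inv X).map (ω ◁ homToMap₂ _ θ)) ≫
        (laxMorphismOfCoconeIso adj ω g').hom =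
      (laxMorphismOfCoconeIso adj ω g).hom ≫
        LaxCell.whiskerLeft (laxMorphismOfCocone adj ω) (J.map₂ θ) := by
  refine LaxCell.ext ?_
  exact whiskerLeft_mapComp_naturality (J.comp (forget M)) (adj.unit y.carrier) (baseLeg ω) θ

/-- The functor from 1-cells to lax morphisms induced by a lax morphism. -/
noncomputable def transposeLax (f : LaxMorphism y (jObj J C)) (X : A) :
    (C ⟶ X) ⥤ LaxMorphism y (jObj J X) :=
  transpose (J.comp (inclusionL M)) (z := y) f X

/-- The functor from 1-cells to pseudomorphisms induced by a pseudomorphism. -/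
noncomputable def transposePseudo (f : PseudoMorphism y (jObj J C)) (X : A) :
    (C ⟶ X) ⥤ PseudoMorphism y (jObj J X) :=
  transpose J (z := y) f X

/-- The transposition functor of the lax morphism of a cocone. -/
noncomputable def coconeTransposeIso
    (ω : DescentCocone ((algebraLift J).codescentDiagram adj y) inv C) (X : A) :
    coconeFunctor ω X ⋙ descentEval _ inv X ⋙ datumToLax adj y inv X ≅
      transposeLax (laxMorphismOfCocone adj ω) X :=
  NatIso.ofComponents (fun g => laxMorphismOfCoconeIso adj ω g)
    (fun θ => laxMorphismOfCoconeIso_naturality adj ω θ)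

/-- The pseudomorphism of a cocone. -/
noncomputable def pseudoMorphismOfCocone
    (ω : DescentCocone ((algebraLift J).codescentDiagram adj y) True C) :
    PseudoMorphism y (jObj J C) :=
  (datumToPseudo adj y C).obj ((descentEval _ True C).obj ω)

/-- The transposition functor of the pseudomorphism of a cocone. -/
noncomputable def coconeTransposePseudoIso
    (ω : DescentCocone ((algebraLift J).codescentDiagram adj y) True C) (X : A) :
    coconeFunctor ω X ⋙ descentEval _ True X ⋙ datumToPseudo adj y X ≅
      transposePseudo (pseudoMorphismOfCocone adj ω) X :=
  NatIso.ofComponents (fun g => PseudoMorphism.isoMk (laxMorphismOfCoconeIso adj ω g))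
    (fun θ => laxMorphismOfCoconeIso_naturality adj ω θ)

/-- Two out of three: up to isomorphism, transposition along the lax morphism of `ω` is
`coconeFunctor ω X` followed by the equivalences `descentEval` and `datumToLax`. -/
theorem isEquivalence_coconeFunctor_iff
    (ω : DescentCocone ((algebraLift J).codescentDiagram adj y) False C) (X : A) :
    (coconeFunctor ω X).IsEquivalence ↔
      (transposeLax (laxMorphismOfCocone adj ω) X).IsEquivalence := by
  have := datumToLax_isEquivalence adj y X
  refine Iff.trans ?_ (Functor.isEquivalence_iff_of_iso (coconeTransposeIso adj ω X))
  constructor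
  · intro h
    infer_instance
  · intro h
    exact Functor.isEquivalence_of_comp_right _ (descentEval _ False X ⋙ datumToLax adj y False X)

theorem isEquivalence_coconeFunctor_iff'
    (ω : DescentCocone ((algebraLift J).codescentDiagram adj y) True C) (X : A) :
    (coconeFunctor ω X).IsEquivalence ↔
      (transposePseudo (pseudoMorphismOfCocone adj ω) X).IsEquivalence := by
  have := datumToPseudo_isEquivalence adj y X
  refine Iff.trans ?_ (Functor.isEquivalence_iff_of_iso (coconeTransposePseudoIso adj ω X))
  constructor
  · intro h
    infer_instance
  · intro h
    exact Functor.isEquivalence_of_comp_right _ (descentEval _ True X ⋙ datumToPseudo adj y X)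

/-- Biuniversality is invariant under isomorphism. -/
theorem IsBiuniversal.of_iso {K : Type u} [Bicategory.{w, v} K] {U : A ⥤ᵖ K} {z : K} {a : A}
    {f g : z ⟶ U.obj a} (i : f ≅ g) (h : IsBiuniversal U f) : IsBiuniversal U g := by
  intro X
  have := h X
  exact Functor.isEquivalence_of_iso (F := transpose U f X)
    (NatIso.ofComponents (fun p => whiskerRightIso i (U.map p))
      (fun θ => whisker_exchange i.hom (U.map₂ θ)))

/-- A universal cocone has a biuniversal lax morphism. Conversely every lax morphism `y ⟶ J C` comes
from a cocone up to isomorphism, because `descentEval` and `datumToLax` are essentially surjective.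
-/
theorem isLaxCodescentObject_iff (y : LaxAlgebra M) (C : A) :
    IsLaxCodescentObject (diagram adj y) C ↔
      ∃ f : LaxMorphism y (jObj J C), IsBiuniversal (J.comp (inclusionL M)) (z := y) f := by
  rw [diagram_eq]
  constructor
  · rintro ⟨ω, hω⟩
    exact ⟨laxMorphismOfCocone adj ω,
      fun X => (isEquivalence_coconeFunctor_iff adj ω X).1 (hω X)⟩
  · rintro ⟨f, hf⟩
    have := datumToLax_isEquivalence adj y C
    let P := descentEval ((algebraLift J).codescentDiagram adj y) False C ⋙ datumToLax adj y False C
    refine ⟨P.objPreimage f, fun X => (isEquivalence_coconeFunctor_iff adj _ X).2 ?_⟩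
    -- The lax morphism of the chosen cocone is isomorphic to `f`, not equal to it, which
    -- biuniversality tolerates.
    exact hf.of_iso (P.objObjPreimageIso f).symm X

theorem isCodescentObject_iff (y : LaxAlgebra M) (C : A) :
    IsCodescentObject (diagram adj y) C ↔
      ∃ f : PseudoMorphism y (jObj J C), IsBiuniversal J (z := y) f := by
  rw [diagram_eq]
  constructor
  · rintro ⟨ω, hω⟩
    exact ⟨pseudoMorphismOfCocone adj ω,
      fun X => (isEquivalence_coconeFunctor_iff' adj ω X).1 (hω X)⟩
  · rintro ⟨f, hf⟩
    have := datumToPseudo_isEquivalence adj y C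
    let P := descentEval ((algebraLift J).codescentDiagram adj y) True C ⋙ datumToPseudo adj y C
    refine ⟨P.objPreimage f, fun X => (isEquivalence_coconeFunctor_iff' adj _ X).2 ?_⟩
    exact hf.of_iso (P.objObjPreimageIso f).symm X

end Universality

/-! ### Right biadjoints in terms of representing objects -/

section RightBiadjoints

variable {A : Type u₁} [Bicategory.{w₁, v₁} A] {K : Type u₂} [Bicategory.{w₂, v₂} K]

/-- A criterion for right biadjoints by objects that represent biuniversal arrows. -/
theorem isRightBiadjoint_characterization (U : A ⥤ᵖ K) (P : K → A → Prop)
    (hP : ∀ y C, P y C ↔ ∃ f : y ⟶ U.obj C, IsBiuniversal U f) :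
    (IsRightBiadjoint U ↔ ∀ y, ∃ C, P y C) ∧
      (∀ G : K ⥤ᵖ A, Nonempty (Biadjunction G U) → ∀ y, P y (G.obj y)) ∧
      ∀ C : K → A, (∀ y, P y (C y)) →
        ∃ G : K ⥤ᵖ A, Nonempty (Biadjunction G U) ∧ ∀ y, G.obj y = C y := by
  have h₁ : ∀ G : K ⥤ᵖ A, Nonempty (Biadjunction G U) → ∀ y, P y (G.obj y) :=
    fun G ⟨adj⟩ y => (hP y _).2 ⟨adj.unit y, adj.isBiuniversal y⟩
  have h₂ : ∀ C : K → A, (∀ y, P y (C y)) →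
      ∃ G : K ⥤ᵖ A, Nonempty (Biadjunction G U) ∧ ∀ y, G.obj y = C y := by
    intro C hC
    choose f hf using fun y => (hP y (C y)).1 (hC y)
    -- With `C` replaced by `F.obj`, the prescribed objects are the values of the left biadjoint on
    -- the nose, as the last component demands.
    obtain ⟨F, rfl⟩ := exists_biuniversalFamily U C f hf
    exact ⟨F.pseudofunctor, ⟨F.biadjunction⟩, fun _ => rfl⟩
  refine ⟨⟨fun ⟨G, hG⟩ y => ⟨_, h₁ G hG y⟩, fun h => ?_⟩, h₁, h₂⟩
  choose C hC using h
  obtain ⟨G, hG, -⟩ := h₂ C hC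
  exact ⟨G, hG⟩

end RightBiadjoints
end BiadjointTriangle

theorem mainTheorem1
    {A : Type u₁} [Bicategory.{w₁, v₁} A] [Bicategory.Strict A]
    {B : Type u₂} [Bicategory.{w₂, v₂} B] [Bicategory.Strict B]
    (M : BiadjointTriangle.Pseudomonad B)
    (E : B ⥤ᵖ A) (R : A ⥤ᵖ B) (adj : BiadjointTriangle.Biadjunction E R)
    (J : A ⥤ᵖ BiadjointTriangle.LaxAlg M)
    (hR : R = J.comp (BiadjointTriangle.forget M)) :
    -- the inclusion into lax algebras and lax morphisms: lax codescent objects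
    ((BiadjointTriangle.IsRightBiadjoint (J.comp (BiadjointTriangle.inclusionL M)) ↔
        ∀ y : BiadjointTriangle.LaxAlgebra M, ∃ C : A,
          BiadjointTriangle.IsLaxCodescentObject (BiadjointTriangle.diagram (hR ▸ adj) y) C) ∧
      (∀ G : BiadjointTriangle.LaxAlgL M ⥤ᵖ A,
        Nonempty (BiadjointTriangle.Biadjunction G (J.comp (BiadjointTriangle.inclusionL M))) →
        ∀ y : BiadjointTriangle.LaxAlgebra M,
          BiadjointTriangle.IsLaxCodescentObject (BiadjointTriangle.diagram (hR ▸ adj) y)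
            (G.obj y)) ∧
      (∀ C : BiadjointTriangle.LaxAlgebra M → A,
        (∀ y : BiadjointTriangle.LaxAlgebra M,
          BiadjointTriangle.IsLaxCodescentObject (BiadjointTriangle.diagram (hR ▸ adj) y) (C y)) →
        ∃ G : BiadjointTriangle.LaxAlgL M ⥤ᵖ A,
          Nonempty (BiadjointTriangle.Biadjunction G
            (J.comp (BiadjointTriangle.inclusionL M))) ∧
          ∀ y : BiadjointTriangle.LaxAlgebra M, G.obj y = C y)) ∧
    -- lax algebras and pseudomorphisms: codescent objects
    ((BiadjointTriangle.IsRightBiadjoint J ↔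
        ∀ y : BiadjointTriangle.LaxAlgebra M, ∃ C : A,
          BiadjointTriangle.IsCodescentObject (BiadjointTriangle.diagram (hR ▸ adj) y) C) ∧
      (∀ G : BiadjointTriangle.LaxAlg M ⥤ᵖ A,
        Nonempty (BiadjointTriangle.Biadjunction G J) →
        ∀ y : BiadjointTriangle.LaxAlgebra M,
          BiadjointTriangle.IsCodescentObject (BiadjointTriangle.diagram (hR ▸ adj) y)
            (G.obj y)) ∧
      (∀ C : BiadjointTriangle.LaxAlgebra M → A,
        (∀ y : BiadjointTriangle.LaxAlgebra M,
          BiadjointTriangle.IsCodescentObject (BiadjointTriangle.diagram (hR ▸ adj) y) (C y)) →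
        ∃ G : BiadjointTriangle.LaxAlg M ⥤ᵖ A,
          Nonempty (BiadjointTriangle.Biadjunction G J) ∧
          ∀ y : BiadjointTriangle.LaxAlgebra M, G.obj y = C y)) := by
  -- With `R` replaced by `U J`, the transport of the biadjunction along `hR` becomes the identity,
  -- and both halves are instances of the same characterization.
  subst hR
  exact ⟨BiadjointTriangle.isRightBiadjoint_characterization
      (J.comp (BiadjointTriangle.inclusionL M))
      (fun y C => BiadjointTriangle.IsLaxCodescentObject (BiadjointTriangle.diagram adj y) C)
      (fun y C => BiadjointTriangle.isLaxCodescentObject_iff adj y C),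
    BiadjointTriangle.isRightBiadjoint_characterization J
      (fun y C => BiadjointTriangle.IsCodescentObject (BiadjointTriangle.diagram adj y) C)
      (fun y C => BiadjointTriangle.isCodescentObject_iff adj y C)⟩
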